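/- Let $d\ge 2$ and let $\Omega\subset\mathbb{R}^d$ be a polygonal domain (polyhedral if $d\ge3$), i.e. a bounded domain with Lipschitz boundary $\Gamma=\partial\Omega$ that is contained in finitely many hyperplanes; $\sigma$ is the surface measure, $\nu$ the outer unit normal, $\gamma$ the trace and $\nabla_\Gamma$ the tangential gradient on $\Gamma$. Let $\mu>0$, $\kappa>0$, $\beta\ge 0$, $T>0$. On $V=\{v\in H^1(\Omega):\sqrt\beta\,\gamma v\in H^1(\Gamma)\}$ put $$(u,v)=\int_\Omega uv\,dx+\mu\int_\Gamma(\gamma u)(\gamma v)\,d\sigma,\qquad a(u,v)=\int_\Omega\nabla u\cdot\nabla v\,dx+\kappa\int_\Gamma(\gamma u)(\gamma v)\,d\sigma+\beta\int_\Gamma\nabla_\Gamma u\cdot\nabla_\Gamma v\,d\sigma .$$ Let $u:[0,T]\to V$ be a solution of the heat equation with dynamic boundary conditions $$\partial_t u=\Delta u\ \text{ in }\Omega,\qquad \mu\,\partial_t u=-\kappa u+\beta\Delta_\Gamma u-\partial_\nu u\ \text{ on }\Gamma,$$ in the weak sense: $(\dot u(t),v)+a(u(t),v)=0$ for all $v\in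 V$ and $0<t\le T$. Assume that $u$ is regular in the following sense: for some $p\in[2,\infty]$ with $p>d/2$ ($p=2$ is allowed if $d\le 3$), $u\in C^1([0,T];X_p)$, where $X_p$ consists of the $v\in V$ with weak second derivatives in $L_p(\Omega)$ for which, if $\beta>0$, the trace $\gamma v$ has weak second tangential derivatives in $L_p$ on the flat faces of $\Gamma$; the norm of $X_p$ is the sum of the $L_2(\Omega)$ norms of $v$ and $\nabla v$, the $L_2(\Gamma)$ norm of $\gamma v$, the $L_p(\Omega)$ norm of the second derivatives and, if $\beta>0$, the $L_2(\Gamma)$ norm of $\nabla_\Gamma v$ and the $L_p(\Gamma)$ norm of the facewise second tangential derivatives. (For $p=2$: $v\in H^2(\Omega)$ and, if $\beta>0$, $\gamma v\in H^1(\Gamma)$ with $\gamma v\in H^2(F)$ for every face $F$ of $\Gamma$.) For a conforming triangulation of $\Omega$ into finitely many simplices with maximal meshwidth $h$, let $V_h\subset V$ be the space of continuous functions that are linear on each simplex, and let $u_h:[0,T]\to V_h$ be the semi-discretisation: $u_h$ is continuous on $[0,T]$, differentiable on $(0,T]$, and $$(\dot u_h(t),v_h)+a(u_h(t),v_h)=0\quad(0<t\le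 T),\qquad (u_h(0),v_h)=(u(0),v_h)\qquad\text{for all }v_h\in V_h .$$ Then for every $\rho>0$ there is a constant $C$, which may depend on $d,\Omega,\mu,\kappa,\beta,T,p,u$ and $\rho$ but neither on $t$ nor on the triangulation (in particular not on $h$), such that for every triangulation that is quasi-uniform with constant $\rho$ (every simplex contains a ball of radius $\rho h$) and for all $0<t\le T$ $$\|u_h(t)-u(t)\|_{L_2(\Omega)}^2+\mu\|\gamma(u_h(t)-u(t))\|_{L_2(\Gamma)}^2+\int_0^t\Big(\|\nabla(u_h(s)-u(s))\|_{L_2(\Omega)}^2+\beta\|\nabla_\Gamma(u_h(s)-u(s))\|_{L_2(\Gamma)}^2+\kappa\|\gamma(u_h(s)-u(s))\|_{L_2(\Gamma)}^2\Big)ds\le C h^2 .$$ -/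

import Mathlib

open MeasureTheory Set Filter Topology
open scoped ENNReal NNReal ContDiff

noncomputable section

namespace DynBC

/-- Euclidean space `ℝ^d`. -/
abbrev Pt (d : ℕ) := EuclideanSpace ℝ (Fin d)

variable {d : ℕ}

/-! ### Polygonal domains, surface measure, outer normal -/

/-- `Ω` has a Lipschitz boundary: near each boundary point `x` there are a unit vector `e` and a
Lipschitz function `f` such that `Ω` is the strict subgraph of `f` over the hyperplane `e^⊥`. -/
def HasLipschitzBoundary (Ω : Set (Pt d)) : Prop :=
  ∀ x ∈ frontier Ω, ∃ (e : Pt d) (f : Pt d → ℝ) (L : ℝ≥0) (r : ℝ),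
    ‖e‖ = 1 ∧ LipschitzWith L f ∧ 0 < r ∧
      ∀ y ∈ Metric.ball x r, (y ∈ Ω ↔ inner ℝ y e < f (y - inner ℝ y e • e))

/-- Polygonal domain (polyhedral if `d ≥ 3`): a bounded domain with Lipschitz boundary, the boundary
being contained in finitely many hyperplanes. -/
structure IsPolygonalDomain (Ω : Set (Pt d)) : Prop where
  isOpen : IsOpen Ω
  isConnected : IsConnected Ω
  isBounded : Bornology.IsBounded Ω
  lipschitz : HasLipschitzBoundary Ω
  flat : ∃ S : Finset (Pt d × ℝ), (∀ q ∈ S, q.1 ≠ 0) ∧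
    frontier Ω ⊆ ⋃ q ∈ S, {x | inner ℝ q.1 x = q.2}

/-- Lebesgue measure on the bulk `Ω`. -/
abbrev bulkMeasure (Ω : Set (Pt d)) : Measure (Pt d) := volume.restrict Ω

/-- The surface measure `σ` on `Γ = ∂Ω`: the `(d-1)`-dimensional Hausdorff measure, normalised so
that it is the `(d-1)`-dimensional Lebesgue measure on hyperplanes. -/
abbrev surfaceMeasure (Ω : Set (Pt d)) : Measure (Pt d) :=
  (Measure.euclideanHausdorffMeasure (d - 1)).restrict (frontier Ω)

/-- Near `x`, the set `Ω` is the open half space through `x` with outer unit normal `n`. -/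
def IsOuterNormal (Ω : Set (Pt d)) (x n : Pt d) : Prop :=
  ‖n‖ = 1 ∧ ∃ r : ℝ, 0 < r ∧ ∀ y ∈ Metric.ball x r, (y ∈ Ω ↔ inner ℝ (y - x) n < 0)

/-- The union of the relatively open flat faces of `Γ = ∂Ω`. -/
def openFaces (Ω : Set (Pt d)) : Set (Pt d) := {x | ∃ n, IsOuterNormal Ω x n}

open Classical in
/-- The outer unit normal `ν`, set to `0` off the open faces (for a polygonal domain they make up
almost all of `Γ`). -/
def outerNormal (Ω : Set (Pt d)) (x : Pt d) : Pt d :=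
  if h : ∃ n, IsOuterNormal Ω x n then h.choose else 0

/-! ### Weak gradients, traces, tangential gradients -/

/-- Test functions: `C_c^∞(ℝ^d)`. -/
def IsTestFunction (φ : Pt d → ℝ) : Prop := ContDiff ℝ ∞ φ ∧ HasCompactSupport φ

/-- `g` is the weak gradient of `v` in `Ω`. -/
def HasWeakGradient (Ω : Set (Pt d)) (v : Pt d → ℝ) (g : Pt d → Pt d) : Prop :=
  ∀ φ : Pt d → ℝ, IsTestFunction φ → tsupport φ ⊆ Ω →
    ∫ x in Ω, v x • gradient φ x = - ∫ x in Ω, φ x • g x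

/-- `w` is the trace on `Γ` of the function `v` with weak gradient `g`, that is, Green's formula
`∫_Ω (v ∇φ + φ ∇v) dx = ∫_Γ φ w ν dσ` holds for all `φ ∈ C_c^∞(ℝ^d)`. -/
def HasTrace (Ω : Set (Pt d)) (v : Pt d → ℝ) (g : Pt d → Pt d) (w : Pt d → ℝ) : Prop :=
  ∀ φ : Pt d → ℝ, IsTestFunction φ →
    ∫ x in Ω, (v x • gradient φ x + φ x • g x) =
      ∫ x, (φ x * w x) • outerNormal Ω x ∂(surfaceMeasure Ω)

/-- `G` is the weak tangential gradient of `w` on the part `S` of the surface `Γ`: `G` is tangential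
and `(ν_i ∂_j - ν_j ∂_i) w = ν_i G_j - ν_j G_i` in the weak sense, for all `i`, `j`. The operators
`ν_i ∂_j - ν_j ∂_i` differentiate in directions tangential to `Γ`, they determine the tangential
gradient, and `∫_Γ (ν_i ∂_j - ν_j ∂_i) ψ dσ = 0` for smooth `ψ`. -/
def HasSurfaceGradientOn (Ω S : Set (Pt d)) (w : Pt d → ℝ) (G : Pt d → Pt d) : Prop :=
  (∀ᵐ x ∂(surfaceMeasure Ω), inner ℝ (G x) (outerNormal Ω x) = 0) ∧
  ∀ φ : Pt d → ℝ, IsTestFunction φ → tsupport φ ∩ frontier Ω ⊆ S → ∀ i j : Fin d,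
    ∫ x, w x * (outerNormal Ω x i * gradient φ x j - outerNormal Ω x j * gradient φ x i)
        ∂(surfaceMeasure Ω) =
      - ∫ x, φ x * (outerNormal Ω x i * G x j - outerNormal Ω x j * G x i) ∂(surfaceMeasure Ω)

/-! ### The space `V`, the inner product of `H`, the bilinear form `a` -/

/-- Quadruples in `L₂(Ω) × L₂(Ω)^d × L₂(Γ) × L₂(Γ)^d`, meant to be `(v, ∇v, γv, ∇_Γ γv)`. -/
abbrev BulkSurface (Ω : Set (Pt d)) :=
  Lp ℝ 2 (bulkMeasure Ω) × Lp (Pt d) 2 (bulkMeasure Ω) ×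
    Lp ℝ 2 (surfaceMeasure Ω) × Lp (Pt d) 2 (surfaceMeasure Ω)

variable {Ω : Set (Pt d)}

/-- The function `v` itself. -/
abbrev val (v : BulkSurface Ω) : Lp ℝ 2 (bulkMeasure Ω) := v.1

/-- The gradient `∇v`. -/
abbrev grad (v : BulkSurface Ω) : Lp (Pt d) 2 (bulkMeasure Ω) := v.2.1

/-- The trace `γv`. -/
abbrev tr (v : BulkSurface Ω) : Lp ℝ 2 (surfaceMeasure Ω) := v.2.2.1

/-- The tangential gradient `∇_Γ (γv)`. -/
abbrev surfGrad (v : BulkSurface Ω) : Lp (Pt d) 2 (surfaceMeasure Ω) := v.2.2.2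

/-- The space `V = {v ∈ H¹(Ω) : √β γv ∈ H¹(Γ)}`; each `v` is recorded with its gradient, its trace
and its tangential gradient (the latter only if `β ≠ 0`; for `β = 0` that slot is filled by `0`). -/
def energySpace (Ω : Set (Pt d)) (β : ℝ) : Set (BulkSurface Ω) :=
  {v | HasWeakGradient Ω (val v) (grad v) ∧ HasTrace Ω (val v) (grad v) (tr v) ∧
    (β ≠ 0 → HasSurfaceGradientOn Ω univ (tr v) (surfGrad v)) ∧ (β = 0 → surfGrad v = 0)}

/-- The inner product `(u, v) = ∫_Ω u v dx + μ ∫_Γ (γu) (γv) dσ` of `H = L₂(Ω) ⊕ L₂(Γ)`. -/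
def innerH (μ : ℝ) (u v : BulkSurface Ω) : ℝ :=
  (∫ x, val u x * val v x ∂(bulkMeasure Ω)) + μ * ∫ x, tr u x * tr v x ∂(surfaceMeasure Ω)

/-- `a(u, v) = ∫_Ω ∇u · ∇v dx + κ ∫_Γ (γu) (γv) dσ + β ∫_Γ ∇_Γ u · ∇_Γ v dσ`. -/
def formA (κ β : ℝ) (u v : BulkSurface Ω) : ℝ :=
  (∫ x, inner ℝ (grad u x) (grad v x) ∂(bulkMeasure Ω)) + κ * (∫ x, tr u x * tr v x ∂(surfaceMeasure Ω)) +
    β * ∫ x, inner ℝ (surfGrad u x) (surfGrad v x) ∂(surfaceMeasure Ω)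

/-- The functions of `V` that have weak second derivatives in `L_p(Ω)` and, if `β ≠ 0`, whose trace
has weak second tangential derivatives in `L_p` on the open faces of `Γ`. Each such function is
recorded together with these second derivatives. For `p = 2` this is the space of the
`v ∈ H²(Ω)` with `√β γv ∈ H¹(Γ)` and `√β γv ∈ H²(F)` for every face `F` of `Γ`. -/
def regularSpace (Ω : Set (Pt d)) (β : ℝ) (p : ℝ≥0∞) :
    Set (BulkSurface Ω × Lp (Pt d →L[ℝ] Pt d) p (bulkMeasure Ω) ×
      Lp (Pt d →L[ℝ] Pt d) p (surfaceMeasure Ω)) :=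
  {U | U.1 ∈ energySpace Ω β ∧
    (∀ z : Pt d, HasWeakGradient Ω (fun x => inner ℝ (grad U.1 x) z) (fun x => U.2.1 x z)) ∧
    (β ≠ 0 → ∀ z : Pt d, HasSurfaceGradientOn Ω (openFaces Ω)
      (fun x => inner ℝ (surfGrad U.1 x) z) (fun x => U.2.2 x z))}

/-- The solution `u` is continuously differentiable on `[0,T]` as a function with values in the
space of functions with second derivatives in `L_p`. -/
def IsRegular (β : ℝ) (p : ℝ≥0∞) [Fact (1 ≤ p)] (T : ℝ) (u : ℝ → BulkSurface Ω) : Prop :=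
  ∃ U : ℝ → BulkSurface Ω × Lp (Pt d →L[ℝ] Pt d) p (bulkMeasure Ω) ×
      Lp (Pt d →L[ℝ] Pt d) p (surfaceMeasure Ω),
    ContDiffOn ℝ 1 U (Icc 0 T) ∧
      ∀ t ∈ Icc (0 : ℝ) T, U t ∈ regularSpace Ω β p ∧ (U t).1 = u t

/-- `u` solves `∂_t u = Δu` in `Ω`, `μ ∂_t u = -κ u + β Δ_Γ u - ∂_ν u` on `Γ` in the weak form
`(u̇(t), v) + a(u(t), v) = 0` for all `v ∈ V` and `0 < t ≤ T`. -/
structure IsWeakSolution (μ κ β T : ℝ) (u : ℝ → BulkSurface Ω) : Prop where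
  mem : ∀ t ∈ Icc 0 T, u t ∈ energySpace Ω β
  continuousOn : ContinuousOn u (Icc 0 T)
  equation : ∀ t ∈ Ioc 0 T, ∃ u' : BulkSurface Ω, HasDerivWithinAt u u' (Icc 0 T) t ∧
    ∀ v ∈ energySpace Ω β, innerH μ u' v + formA κ β (u t) v = 0

/-! ### Linear finite elements -/

/-- The (full-dimensional) elements of a simplicial complex in `ℝ^d`. -/
def elements (K : Geometry.SimplicialComplex ℝ (Pt d)) : Set (Finset (Pt d)) :=
  {s | s ∈ K.faces ∧ s.card = d + 1}

/-- The maximal meshwidth `h`, i.e. the largest diameter of an element. -/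
def meshwidth (K : Geometry.SimplicialComplex ℝ (Pt d)) : ℝ :=
  sSup ((fun s : Finset (Pt d) => Metric.diam (convexHull ℝ (s : Set (Pt d)))) '' elements K)

/-- `K` is a (conforming, finite) triangulation of `Ω`. -/
def IsTriangulation (Ω : Set (Pt d)) (K : Geometry.SimplicialComplex ℝ (Pt d)) : Prop :=
  K.faces.Finite ∧ K.space = closure Ω

/-- Quasi-uniformity with constant `ρ`: each element contains a ball of radius `ρ h`. -/
def IsQuasiUniform (ρ : ℝ) (K : Geometry.SimplicialComplex ℝ (Pt d)) : Prop :=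
  ∀ s ∈ elements K, ∃ x, Metric.closedBall x (ρ * meshwidth K) ⊆ convexHull ℝ (s : Set (Pt d))

/-- `φ` is continuous on the triangulated set and affine linear on each simplex. -/
def IsPiecewiseLinear (K : Geometry.SimplicialComplex ℝ (Pt d)) (φ : Pt d → ℝ) : Prop :=
  ContinuousOn φ K.space ∧
    ∀ s ∈ K.faces, ∃ A : Pt d →ᵃ[ℝ] ℝ, EqOn φ A (convexHull ℝ (s : Set (Pt d)))

/-- The finite element space `V_h ⊂ V` of continuous piecewise linear functions. -/
def feSpace (Ω : Set (Pt d)) (β : ℝ) (K : Geometry.SimplicialComplex ℝ (Pt d)) :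
    Set (BulkSurface Ω) :=
  {v | v ∈ energySpace Ω β ∧ ∃ φ : Pt d → ℝ, IsPiecewiseLinear K φ ∧ val v =ᵐ[bulkMeasure Ω] φ}

/-- `u_h : [0,T] → V_h` is the semi-discretisation: `(u̇_h(t), v_h) + a(u_h(t), v_h) = 0` for
`0 < t ≤ T` and `(u_h(0), v_h) = (u₀, v_h)`, for all `v_h ∈ V_h`. -/
structure IsSemidiscreteSolution (μ κ β T : ℝ) (K : Geometry.SimplicialComplex ℝ (Pt d))
    (u₀ : BulkSurface Ω) (uh : ℝ → BulkSurface Ω) : Prop where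
  mem : ∀ t ∈ Icc 0 T, uh t ∈ feSpace Ω β K
  continuousOn : ContinuousOn uh (Icc 0 T)
  equation : ∀ t ∈ Ioc 0 T, ∃ uh' : BulkSurface Ω, HasDerivWithinAt uh uh' (Icc 0 T) t ∧
    ∀ v ∈ feSpace Ω β K, innerH μ uh' v + formA κ β (uh t) v = 0
  initial : ∀ v ∈ feSpace Ω β K, innerH μ (uh 0) v = innerH μ u₀ v

end DynBC

end

/-!
The error is estimated in two steps: an energy argument in the Hilbert space `V`, and an
approximation theorem for functions in `X_p`.

*Energy argument.* Let `R` be the orthogonal projection of the ambient Hilbert space onto the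
closure of `V_h`, taken for the full norm of `V` and not for the form `a`, and put
`θ = u_h - R u`. Both equations hold for test functions in `V_h`, so `θ` satisfies
`(θ', v) + a(θ, v) = -((R u - u)', v) - a(R u - u, v)`. Testing with `v = θ` and absorbing `‖θ‖_V`
by coercivity of `a + (·, ·)` gives a bound of the energy by `sup ‖R u - u‖_V` and
`sup ‖(R u - u)'‖_V` (`energy_le`, `exists_error_le`). Both suprema are errors of best
approximation: the first one of `u(t)`, the second one of the difference quotients of `u`, which
are bounded in `X_p` because `u` is continuously differentiable with values in `X_p`. Since `R`
is used only through best approximation, no duality argument and no regularity of an elliptic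
problem is required, and first order in `V` suffices for the estimate.

*Approximation.* `exists_feSpace_approximation` provides, for every `v` in `X_p`, an element of
`V_h` at distance at most `C h ‖v‖_{X_p}` in the norm of `V`, namely the nodal interpolant. Its
ingredients are the following.

* A function with second weak derivatives in `L_q`, where `q > d / 2`, has a representative that is
  continuous on the closure of `Ω` and equal to the trace on the boundary
  (`IsPolygonalDomain.exists_continuous_representative`). The Lipschitz boundary provides a cone of
  directions pointing into `Ω`, so that `v` can be mollified up to the boundary; Taylor's formula
  in the cone shows that the mollifications converge uniformly.
* On a simplex, the error of linear interpolation is a combination of Taylor remainders with the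
  vertices as points of evaluation. As functions of the point of expansion, these are bounded in
  `L_q` by the second derivatives (`exists_eLpNorm_taylorRem_le`). Mollification on slightly smaller
  simplices extends the bound to weak derivatives (`exists_interpolation_estimate`).
* The interpolation error of the tangential gradient is the same estimate one dimension lower: in
  the coordinates of its hyperplane, a boundary facet is a simplex on which the surface gradient is
  the weak gradient (`IsFlatPiece.hasWeakGradient`, `exists_facet_estimate`). The error of the
  boundary values follows from the pointwise estimate on the adjacent elements.
* The nodal interpolant, with its elementwise gradient, its boundary values and its tangential
  gradient, belongs to `V` (`IsMeshed.exists_mem_feSpace`). This rests on the divergence theorem for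
  a bounded open set whose boundary lies in finitely many hyperplanes
  (`IsPolyhedralOpen.integral_gradient`), which is proved by integrating along the lines parallel to
  a direction transversal to all these hyperplanes. It is applied to `Ω` and to the elements, where
  the contributions of the inner facets cancel.
-/

noncomputable section

namespace DynBC

variable {d : ℕ}
variable {Ω : Set (Pt d)}

section

/-! ### Hyperplanes and their charts -/

/-- `L` is an isometric parametrisation of the linear hyperplane orthogonal to `ν`. -/
def IsChart {n : ℕ} (ν : Pt (n + 1)) (L : Pt n →ₗᵢ[ℝ] Pt (n + 1)) : Prop :=
  ∀ x, (∃ y, L y = x) ↔ inner ℝ ν x = 0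

theorem exists_isChart {n : ℕ} (ν : Pt (n + 1)) (hν : ‖ν‖ = 1) :
    ∃ L : Pt n →ₗᵢ[ℝ] Pt (n + 1), IsChart ν L := by
  have hν0 : ν ≠ 0 := by
    rintro rfl
    simp at hν
  have : Fact (Module.finrank ℝ (Pt (n + 1)) = n + 1) := ⟨by simp⟩
  let b := OrthonormalBasis.fromOrthogonalSpanSingleton (𝕜 := ℝ) n hν0
  refine ⟨(Submodule.subtypeₗᵢ _).comp b.repr.symm.toLinearIsometry, fun x => ?_⟩
  rw [← Submodule.mem_orthogonal_singleton_iff_inner_right (𝕜 := ℝ)]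
  constructor
  · rintro ⟨y, rfl⟩
    exact (b.repr.symm y).2
  · intro hx
    exact ⟨b.repr ⟨x, hx⟩, by simp⟩

namespace IsChart

variable {n : ℕ} {ν : Pt (n + 1)} {L : Pt n →ₗᵢ[ℝ] Pt (n + 1)}

theorem inner_apply (hL : IsChart ν L) (y : Pt n) : inner ℝ ν (L y) = 0 :=
  (hL _).1 ⟨y, rfl⟩

theorem exists_eq_add (hL : IsChart ν L) (hν : ‖ν‖ = 1) (x : Pt (n + 1)) :
    ∃ y, x = L y + (inner ℝ ν x : ℝ) • ν := by
  obtain ⟨y, hy⟩ := (hL (x - (inner ℝ ν x : ℝ) • ν)).2 (by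
    rw [inner_sub_right, inner_smul_right, real_inner_self_eq_norm_sq, hν]; simp)
  exact ⟨y, by rw [hy]; simp⟩

theorem measurePreserving (hL : IsChart ν L) (hν : ‖ν‖ = 1) :
    MeasurePreserving (fun p : Pt n × ℝ => L p.1 + p.2 • ν) (volume.prod volume) volume := by
  let Φ : WithLp 2 (Pt n × ℝ) →ₗ[ℝ] Pt (n + 1) :=
    { toFun := fun p => L p.fst + p.snd • ν
      map_add' := fun p q => by
        simp only [WithLp.add_fst, WithLp.add_snd, map_add, add_smul]; abel
      map_smul' := fun c p => by
        simp [smul_smul] }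
  have hΦ : ∀ p, ‖Φ p‖ = ‖p‖ := by
    intro p
    have h1 : ‖Φ p‖ ^ 2 = ‖p‖ ^ 2 := by
      have : inner ℝ (L p.fst) (p.snd • ν) = 0 := by
        rw [inner_smul_right, real_inner_comm, hL.inner_apply, mul_zero]
      change ‖L p.fst + p.snd • ν‖ ^ 2 = _
      rw [WithLp.prod_norm_sq_eq_of_L2, norm_add_sq_real, this, norm_smul, hν]
      simp
    exact (sq_eq_sq₀ (norm_nonneg _) (norm_nonneg _)).1 h1
  let Ψ : WithLp 2 (Pt n × ℝ) →ₗᵢ[ℝ] Pt (n + 1) := ⟨Φ, hΦ⟩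
  have hr : Module.finrank ℝ (WithLp 2 (Pt n × ℝ)) = Module.finrank ℝ (Pt (n + 1)) := by
    rw [(WithLp.linearEquiv 2 ℝ (Pt n × ℝ)).finrank_eq]
    simp
  have h1 := (Ψ.toLinearIsometryEquiv hr).measurePreserving
  have h2 := (WithLp.volume_preserving_ofLp (Pt n) ℝ).symm (MeasurableEquiv.toLp 2 (Pt n × ℝ)).symm
  exact h1.comp h2

theorem measurableEmbedding (hL : IsChart ν L) (hν : ‖ν‖ = 1) :
    MeasurableEmbedding (fun p : Pt n × ℝ => L p.1 + p.2 • ν) := by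
  refine Continuous.measurableEmbedding (by fun_prop) ?_
  rintro ⟨y, s⟩ ⟨y', s'⟩ h
  simp only at h
  have h1 : s = s' := by
    have := congrArg (inner ℝ ν) h
    simpa [inner_add_right, hL.inner_apply, inner_smul_right, real_inner_self_eq_norm_sq, hν]
      using this
  subst h1
  simpa using h

/-- Fubini along the normal direction. -/
theorem lintegral_eq (hL : IsChart ν L) (hν : ‖ν‖ = 1) {f : Pt (n + 1) → ℝ≥0∞}
    (hf : Measurable f) : ∫⁻ x, f x = ∫⁻ y, ∫⁻ s : ℝ, f (L y + s • ν) := by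
  rw [← (hL.measurePreserving hν).lintegral_comp hf, lintegral_prod]
  exact (hf.comp (hL.measurableEmbedding hν).measurable).aemeasurable

/-- Fubini along the normal direction, for integrable functions. -/
theorem integral_eq (hL : IsChart ν L) (hν : ‖ν‖ = 1) {f : Pt (n + 1) → ℝ}
    (hf : Integrable f) : ∫ x, f x = ∫ y, ∫ s : ℝ, f (L y + s • ν) := by
  rw [← (hL.measurePreserving hν).integral_comp (hL.measurableEmbedding hν), integral_prod]
  exact ((hL.measurePreserving hν).integrable_comp_emb (hL.measurableEmbedding hν)).2 hf

theorem ae_integrable (hL : IsChart ν L) (hν : ‖ν‖ = 1) {f : Pt (n + 1) → ℝ}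
    (hf : Integrable f) : ∀ᵐ y, Integrable (fun s : ℝ => f (L y + s • ν)) :=
  (((hL.measurePreserving hν).integrable_comp_emb (hL.measurableEmbedding hν)).2 hf).prod_right_ae

/-- Fubini along an arbitrary direction `e`: the volume of a slanted layer carries the factor
`|⟪ν, e⟫|`. -/
theorem lintegral_eq_mul (hL : IsChart ν L) (hν : ‖ν‖ = 1) {e : Pt (n + 1)}
    (he : inner ℝ ν e ≠ 0) {f : Pt (n + 1) → ℝ≥0∞} (hf : Measurable f) :
    ∫⁻ x, f x = ENNReal.ofReal |inner ℝ ν e| * ∫⁻ y, ∫⁻ s : ℝ, f (L y + s • e) := by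
  obtain ⟨b, hb⟩ := hL.exists_eq_add hν e
  set α : ℝ := inner ℝ ν e
  have h1 : ∫⁻ y, ∫⁻ s : ℝ, f (L y + s • e) = ∫⁻ s : ℝ, ∫⁻ y, f (L y + (α * s) • ν) := by
    rw [lintegral_lintegral_swap]
    · refine lintegral_congr fun s => ?_
      rw [← lintegral_add_right_eq_self (fun y => f (L y + (α * s) • ν)) (s • b)]
      refine lintegral_congr fun y => ?_
      congr 1
      rw [hb, map_add, map_smul, smul_add, smul_smul, mul_comm α s, add_assoc]
    · exact (hf.comp (by fun_prop)).aemeasurable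
  rw [h1, lintegral_lintegral_swap, hL.lintegral_eq hν hf, ← lintegral_const_mul]
  · refine lintegral_congr fun y => ?_
    have h2 : Measurable fun s : ℝ => f (L y + s • ν) := hf.comp (by fun_prop)
    conv_lhs => rw [← Real.smul_map_volume_mul_left he]
    rw [lintegral_smul_measure, lintegral_map h2 (by fun_prop), smul_eq_mul]
  · exact Measurable.lintegral_prod_right' (ν := (volume : Measure ℝ))
      (f := fun p : Pt n × ℝ => f (L p.1 + (α * p.2) • ν)) (hf.comp (by fun_prop))
  · exact (hf.comp (by fun_prop)).aemeasurable

/-- The surface measure on a hyperplane is the Lebesgue measure in the chart. -/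
theorem map_volume (hL : IsChart ν L) (hν : ‖ν‖ = 1) (c : ℝ) :
    (volume : Measure (Pt n)).map (fun y => L y + c • ν) =
      (Measure.euclideanHausdorffMeasure n).restrict {x | inner ℝ ν x = c} := by
  have hι : Isometry (fun y : Pt n => L y + c • ν) :=
    (isometry_add_right (c • ν)).comp L.isometry
  rw [← EuclideanSpace.euclideanHausdorffMeasure_eq_volume, hι.map_euclideanHausdorffMeasure]
  congr 1
  ext x
  simp only [mem_range, mem_ofPred_eq]
  constructor
  · rintro ⟨y, rfl⟩
    simp [inner_add_right, hL.inner_apply, inner_smul_right, hν]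
  · intro hx
    obtain ⟨y, hy⟩ := hL.exists_eq_add hν x
    exact ⟨y, by rw [hy, hx]⟩

/-- Projecting along `e` from the hyperplane `e^⊥` to another hyperplane multiplies the surface
measure by `|⟪ν, e⟫|⁻¹`. -/
theorem map_projection {e : Pt (n + 1)} {L₀ : Pt n →ₗᵢ[ℝ] Pt (n + 1)} (hL₀ : IsChart e L₀)
    (he1 : ‖e‖ = 1) (hL : IsChart ν L) (hν : ‖ν‖ = 1) (he : inner ℝ ν e ≠ 0) (c : ℝ) :
    (volume : Measure (Pt n)).map
        (fun z => L₀ z + ((c - inner ℝ ν (L₀ z)) / inner ℝ ν e) • e) =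
      ENNReal.ofReal |inner ℝ ν e| •
        (Measure.euclideanHausdorffMeasure n).restrict {x | inner ℝ ν x = c} := by
  have hm : Measurable fun z : Pt n => L₀ z + ((c - inner ℝ ν (L₀ z)) / inner ℝ ν e) • e := by
    fun_prop
  refine Measure.ext_of_lintegral _ fun F hF => ?_
  rw [lintegral_map hF hm, lintegral_smul_measure, ← hL.map_volume hν,
    lintegral_map hF (by fun_prop), smul_eq_mul]
  -- both sides are the integral of `F` composed with the projection, over a layer of height one
  let τ : Pt (n + 1) → ℝ := fun x => (inner ℝ ν x - c) / inner ℝ ν e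
  let f : Pt (n + 1) → ℝ≥0∞ := fun x => F (x - τ x • e) * (Icc (0 : ℝ) 1).indicator 1 (τ x)
  have hτ : Measurable τ := by fun_prop
  have hf : Measurable f := (hF.comp (by fun_prop)).mul
    ((measurable_const.indicator measurableSet_Icc).comp hτ)
  -- On a line parallel to `e`, the layer is an interval of length one, on which `F` is evaluated
  -- at the fixed point where the line meets the hyperplane.
  have key : ∀ (x : Pt (n + 1)) (s₀ : ℝ), (∀ s : ℝ, τ (x + s • e) = s - s₀) →
      ∫⁻ s : ℝ, f (x + s • e) = F (x + s₀ • e) := by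
    intro x s₀ hs
    have : ∀ s : ℝ, f (x + s • e) =
        F (x + s₀ • e) * (Icc s₀ (s₀ + 1)).indicator 1 s := by
      intro s
      have h1 : x + s • e - (s - s₀) • e = x + s₀ • e := by rw [sub_smul]; abel
      simp only [f, hs, h1]
      congr 1
      simp only [indicator, mem_Icc, sub_nonneg, tsub_le_iff_right, add_comm, Pi.one_apply]
    simp_rw [this]
    rw [lintegral_const_mul _ (measurable_one.indicator measurableSet_Icc),
      lintegral_indicator_one measurableSet_Icc]
    simp
  have e1 : ∫⁻ x, f x = ∫⁻ z, F (L₀ z + ((c - inner ℝ ν (L₀ z)) / inner ℝ ν e) • e) := by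
    rw [hL₀.lintegral_eq he1 hf]
    refine lintegral_congr fun z => key _ _ fun s => ?_
    simp only [τ, inner_add_right, inner_smul_right]
    field_simp
    ring
  have e2 : ∫⁻ x, f x = ENNReal.ofReal |inner ℝ ν e| * ∫⁻ y, F (L y + c • ν) := by
    rw [← lintegral_add_right_eq_self f (c • ν),
      hL.lintegral_eq_mul hν he (f := fun x => f (x + c • ν)) (hf.comp (by fun_prop))]
    congr 1
    refine lintegral_congr fun y => ?_
    have := key (L y + c • ν) 0 fun s => by
      simp only [τ, inner_add_right, inner_smul_right, hL.inner_apply, real_inner_self_eq_norm_sq,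
        hν]
      field_simp
      ring
    rw [zero_smul, add_zero] at this
    rw [← this]
    refine lintegral_congr fun s => ?_
    congr 1
    abel
  rw [← e1, e2]

end IsChart

/-- A hyperplane, given by a unit normal and an offset. -/
def IsHyperplane (H : Set (Pt d)) : Prop :=
  ∃ (ν : Pt d) (c : ℝ), ‖ν‖ = 1 ∧ H = {x | inner ℝ ν x = c}

theorem IsHyperplane.isClosed {H : Set (Pt d)} (h : IsHyperplane H) : IsClosed H := by
  obtain ⟨ν, c, -, rfl⟩ := h
  exact isClosed_eq (by fun_prop) continuous_const

/-- The intersection of two different hyperplanes has surface measure zero. -/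
theorem IsHyperplane.measure_inter_eq_zero {n : ℕ} {H H' : Set (Pt (n + 1))}
    (hH : IsHyperplane H) (hH' : IsHyperplane H') (hne : H ≠ H') :
    Measure.euclideanHausdorffMeasure n (H ∩ H') = 0 := by
  obtain ⟨ν, c, hν, rfl⟩ := hH
  have hcl := hH'.isClosed
  obtain ⟨ν', c', hν', rfl⟩ := hH'
  obtain ⟨L, hL⟩ := exists_isChart ν hν
  rw [inter_comm, ← Measure.restrict_apply hcl.measurableSet, ← hL.map_volume hν,
    Measure.map_apply (by fun_prop) hcl.measurableSet]
  -- In the chart of the first hyperplane the second one is an affine subspace, hence a null set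
  -- unless it is the whole space.
  let A : Pt n →ᵃ[ℝ] ℝ := ((innerₛₗ ℝ ν').comp L.toLinearMap).toAffineMap
  let s : AffineSubspace ℝ (Pt n) :=
    AffineSubspace.comap A (AffineSubspace.mk' (c' - inner ℝ ν' (c • ν)) ⊥)
  have hs : ((fun y => L y + c • ν) ⁻¹' {x | inner ℝ ν' x = c'}) = (s : Set (Pt n)) := by
    ext y
    simp [s, A, inner_add_right, AffineSubspace.mem_mk', sub_eq_zero, eq_sub_iff_add_eq]
  rw [hs]
  apply Measure.addHaar_affineSubspace
  intro htop
  apply hne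
  -- In the exceptional case `ν'` is orthogonal to the range of `L`, so it is a multiple of `ν`.
  have hall : ∀ y, inner ℝ ν' (L y + c • ν) = c' := by
    intro y
    have : y ∈ ((fun y => L y + c • ν) ⁻¹' {x | inner ℝ ν' x = c'}) := by
      rw [hs, htop]; trivial
    exact this
  have h0 : inner ℝ ν' (c • ν) = c' := by simpa using hall 0
  have h1 : ∀ y, inner ℝ ν' (L y) = 0 := by
    intro y
    have := hall y
    rw [inner_add_right, h0] at this
    linarith
  obtain ⟨y, hy⟩ := hL.exists_eq_add hν ν'
  set a : ℝ := inner ℝ ν ν'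
  have hy0 : L y = 0 := by
    have h2 := h1 y
    have h3 : inner ℝ ν' (L y) = ‖L y‖ ^ 2 := by
      conv_lhs => rw [hy]
      rw [inner_add_left, inner_smul_left, hL.inner_apply, real_inner_self_eq_norm_sq]
      simp
    rw [h3] at h2
    exact norm_eq_zero.1 (pow_eq_zero_iff two_ne_zero |>.1 h2)
  rw [hy0, zero_add] at hy
  have ha : a ≠ 0 := by
    intro h
    rw [h, zero_smul] at hy
    rw [hy] at hν'
    simp at hν'
  have hc : c' = a * c := by
    rw [← h0, hy, inner_smul_left, inner_smul_right, real_inner_self_eq_norm_sq, hν]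
    simp
  ext x
  simp only [mem_ofPred_eq]
  rw [hy, inner_smul_left, hc]
  simp [ha]

end

section

/-! ### Polyhedral open sets and the divergence theorem -/

/-- The fundamental theorem of calculus on a bounded open subset of the line with finitely many
boundary points, each of which is the endpoint of exactly one of the intervals; `ε` is the outer
normal. The function may fail to be differentiable at finitely many points. -/
theorem integral_deriv_eq_sum_boundary {O : Set ℝ} (hO : IsOpen O) (hb : Bornology.IsBounded O)
    (P : Finset ℝ) (hP : frontier O ⊆ P) (ε : ℝ → ℝ)
    (hε : ∀ s ∈ P, (s ∉ frontier O ∧ ε s = 0) ∨ (ε s = 1 ∧ ∀ᶠ t in 𝓝 s, (t ∈ O ↔ t < s)) ∨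
      (ε s = -1 ∧ ∀ᶠ t in 𝓝 s, (t ∈ O ↔ s < t)))
    {g g' : ℝ → ℝ} (hg : ContinuousOn g (closure O))
    (hd : ∀ s ∈ O, s ∉ P → HasDerivAt g (g' s) s) (hi : IntegrableOn g' O) :
    ∫ s in O, g' s = ∑ s ∈ P, ε s * g s := by
  classical
  -- adding a jump at each boundary point to `1_O g` makes it continuous
  -- `χ s` is right continuous at a right endpoint `s` of `O` and left continuous at a left
  -- endpoint, since `1_O g` vanishes at both
  let χ : ℝ → ℝ → ℝ := fun s t => if ε s = 1 then (if s ≤ t then 1 else 0)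
    else (if s < t then 1 else 0)
  let J : ℝ → ℝ := fun t => O.indicator g t + ∑ s ∈ P, ε s * g s * χ s t
  have hχ : ∀ s t, t ≠ s → ∀ᶠ t' in 𝓝 t, χ s t' = χ s t := by
    intro s t hts
    rcases lt_or_gt_of_ne hts with h | h
    · filter_upwards [eventually_lt_nhds h] with t' ht'
      simp [χ, not_le.2 h, not_le.2 ht', not_lt.2 h.le, not_lt.2 ht'.le]
    · filter_upwards [eventually_gt_nhds h] with t' ht'
      simp [χ, h.le, ht'.le, h, ht']
  have hsum : ∀ (Q : Finset ℝ) (t : ℝ), t ∉ Q →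
      ∀ᶠ t' in 𝓝 t, ∑ s ∈ Q, ε s * g s * χ s t' = ∑ s ∈ Q, ε s * g s * χ s t := by
    intro Q t htQ
    have : ∀ᶠ t' in 𝓝 t, ∀ s ∈ Q, χ s t' = χ s t :=
      (Filter.eventually_all_finset Q).2 fun s hs => hχ s t fun h => htQ (h ▸ hs)
    filter_upwards [this] with t' ht'
    exact Finset.sum_congr rfl fun s hs => by rw [ht' s hs]
  have hin : ∀ t ∈ O, O.indicator g =ᶠ[𝓝 t] g := fun t ht => by
    filter_upwards [hO.mem_nhds ht] with t' ht' using indicator_of_mem ht' g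
  have hout : ∀ t ∉ closure O, O.indicator g =ᶠ[𝓝 t] fun _ => 0 := fun t ht => by
    filter_upwards [isClosed_closure.isOpen_compl.mem_nhds ht] with t' ht'
    exact indicator_of_notMem (fun h => ht' (subset_closure h)) g
  have hfr : ∀ t, t ∉ frontier O → t ∈ O ∨ t ∉ closure O := fun t ht => by
    by_contra! h
    exact ht ⟨h.2, by rw [hO.interior_eq]; exact h.1⟩
  have hcont_ind : ∀ t, t ∉ frontier O → ContinuousAt (O.indicator g) t := by
    intro t ht
    rcases hfr t ht with h | h
    · exact ((hg.continuousAt (mem_of_superset (hO.mem_nhds h) subset_closure)).congr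
        (hin t h).symm)
    · exact continuousAt_const.congr (hout t h).symm
  have hJ : Continuous J := by
    rw [continuous_iff_continuousAt]
    intro t
    by_cases htP : t ∈ P
    · have hrest : ContinuousAt (fun t' => ∑ s ∈ P.erase t, ε s * g s * χ s t') t :=
        continuousAt_const.congr
          ((hsum (P.erase t) t (by simp)).mono fun _ h => h.symm)
      have hsplit : J = fun t' => (O.indicator g t' + ε t * g t * χ t t') +
          ∑ s ∈ P.erase t, ε s * g s * χ s t' := by
        funext t'
        simp only [J]
        rw [← Finset.add_sum_erase P _ htP]
        ring
      rw [hsplit]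
      refine ContinuousAt.add ?_ hrest
      rcases hε t htP with ⟨h1, h2⟩ | ⟨h1, h2⟩ | ⟨h1, h2⟩
      · simp only [h2, zero_mul, add_zero]
        exact hcont_ind t h1
      · have hcl : t ∈ closure O := by
          rw [mem_closure_iff_frequently]
          intro hn
          have h3 := (h2.and hn).filter_mono (nhdsWithin_le_nhds (s := Iio t))
          obtain ⟨t', h4, h5⟩ := (h3.and self_mem_nhdsWithin).exists
          exact h4.2 (h4.1.2 h5)
        have heq : (fun t' => O.indicator g t' + ε t * g t * χ t t') =ᶠ[𝓝 t]
            fun t' => if t' < t then g t' else g t := by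
          filter_upwards [h2] with t' ht'
          by_cases h : t' < t
          · simp [h, h1, χ, not_le.2 h, ht'.2 h]
          · simp [h, h1, χ, not_lt.1 h, ht']
        refine ContinuousAt.congr ?_ heq.symm
        rw [continuousAt_iff_continuous_left'_right']
        constructor
        · have h3 : ContinuousWithinAt g (Iio t) t := by
            refine (hg t hcl).mono_of_mem_nhdsWithin ?_
            filter_upwards [h2.filter_mono nhdsWithin_le_nhds, self_mem_nhdsWithin] with t' h4 h5
            exact subset_closure (h4.2 h5)
          refine ContinuousWithinAt.congr_of_eventuallyEq h3 ?_ (by simp)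
          filter_upwards [self_mem_nhdsWithin] with t' h5
          simp [mem_Iio.1 h5]
        · refine ContinuousWithinAt.congr_of_eventuallyEq
            (continuousWithinAt_const (b := g t)) ?_ (by simp)
          filter_upwards [self_mem_nhdsWithin] with t' h5
          simp [not_lt.2 (mem_Ioi.1 h5).le]
      · have hcl : t ∈ closure O := by
          rw [mem_closure_iff_frequently]
          intro hn
          have h3 := (h2.and hn).filter_mono (nhdsWithin_le_nhds (s := Ioi t))
          obtain ⟨t', h4, h5⟩ := (h3.and self_mem_nhdsWithin).exists
          exact h4.2 (h4.1.2 h5)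
        have h1' : ¬ (-1 : ℝ) = 1 := by norm_num
        have heq : (fun t' => O.indicator g t' + ε t * g t * χ t t') =ᶠ[𝓝 t]
            fun t' => if t < t' then g t' - g t else 0 := by
          filter_upwards [h2] with t' ht'
          by_cases h : t < t'
          · simp [h, h1, χ, ht'.2 h, h1', sub_eq_add_neg]
          · simp [h, h1, χ, ht', h1']
        refine ContinuousAt.congr ?_ heq.symm
        rw [continuousAt_iff_continuous_left'_right']
        constructor
        · refine ContinuousWithinAt.congr_of_eventuallyEq
            (continuousWithinAt_const (b := (0 : ℝ))) ?_ (by simp)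
          filter_upwards [self_mem_nhdsWithin] with t' h5
          simp [not_lt.2 (mem_Iio.1 h5).le]
        · have h3 : ContinuousWithinAt (fun t' => g t' - g t) (Ioi t) t := by
            refine ContinuousWithinAt.sub ?_ continuousWithinAt_const
            refine (hg t hcl).mono_of_mem_nhdsWithin ?_
            filter_upwards [h2.filter_mono nhdsWithin_le_nhds, self_mem_nhdsWithin] with t' h4 h5
            exact subset_closure (h4.2 h5)
          refine ContinuousWithinAt.congr_of_eventuallyEq h3 ?_ (by simp)
          filter_upwards [self_mem_nhdsWithin] with t' h5
          simp [mem_Ioi.1 h5]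
    · exact (hcont_ind t fun h => htP (hP h)).add
        (continuousAt_const.congr ((hsum P t htP).mono fun _ h => h.symm))
  -- The steps are locally constant off `P`, so they do not contribute to the derivative.
  have hJd : ∀ t ∉ P, HasDerivAt J (O.indicator g' t) t := by
    intro t htP
    have h2 : HasDerivAt (fun t' => ∑ s ∈ P, ε s * g s * χ s t') 0 t :=
      (hasDerivAt_const t _).congr_of_eventuallyEq (hsum P t htP)
    have h1 : HasDerivAt (O.indicator g) (O.indicator g' t) t := by
      rcases hfr t fun h => htP (hP h) with h | h
      · rw [indicator_of_mem h]
        exact (hd t h htP).congr_of_eventuallyEq (hin t h)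
      · rw [indicator_of_notMem fun h' => h (subset_closure h')]
        exact (hasDerivAt_const t _).congr_of_eventuallyEq (hout t h)
    simpa [J] using h1.fun_add h2
  -- Outside of a large interval `J` is the sum of all jumps, or zero.
  obtain ⟨R, hR⟩ := (hb.union P.finite_toSet.isBounded).subset_ball 0
  have hR' : ∀ t ∈ O ∪ P, -R < t ∧ t < R := fun t ht => by
    have := hR ht
    rw [Metric.mem_ball, dist_zero_right, Real.norm_eq_abs, abs_lt] at this
    exact this
  have hind : Integrable (O.indicator g') := hi.integrable_indicator hO.measurableSet
  have hRR : -|R| ≤ |R| := by linarith [abs_nonneg R]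
  have hftc := MeasureTheory.integral_eq_of_hasDerivAt_off_countable_of_le J (O.indicator g')
    hRR P.countable_toSet hJ.continuousOn (fun x hx => hJd x hx.2) hind.intervalIntegrable
  have hnot : ∀ t, |R| ≤ |t| → t ∉ O ∪ P := fun t h1 h2 => by
    have h3 := abs_lt.2 (hR' t h2)
    exact absurd (h3.trans_le (le_abs_self R)) (not_lt.2 h1)
  have hJR : J |R| = ∑ s ∈ P, ε s * g s := by
    have : |R| ∉ O := fun h => hnot |R| (by simp) (Or.inl h)
    simp only [J, indicator_of_notMem this, zero_add]
    refine Finset.sum_congr rfl fun s hs => ?_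
    have h1 : s < |R| := (hR' s (Or.inr hs)).2.trans_le (le_abs_self R)
    simp [χ, h1, h1.le]
  have hJR' : J (-|R|) = 0 := by
    have : -|R| ∉ O := fun h => hnot (-|R|) (by simp) (Or.inl h)
    simp only [J, indicator_of_notMem this, zero_add]
    refine Finset.sum_eq_zero fun s hs => ?_
    have h1 : -|R| < s := lt_of_le_of_lt (neg_le_neg (le_abs_self R)) (hR' s (Or.inr hs)).1
    simp [χ, not_le.2 h1, not_lt.2 h1.le]
  rw [hJR, hJR', sub_zero, intervalIntegral.integral_of_le hRR, setIntegral_indicator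
    hO.measurableSet] at hftc
  rw [← hftc]
  congr 2
  ext t
  constructor
  · intro ht
    have h3 := hR' t (Or.inl ht)
    exact ⟨⟨lt_of_le_of_lt (neg_le_neg (le_abs_self R)) h3.1, h3.2.le.trans (le_abs_self R)⟩, ht⟩
  · exact fun ht => ht.2

theorem IsOuterNormal.unique {x n n' : Pt d} (h : IsOuterNormal Ω x n)
    (h' : IsOuterNormal Ω x n') : n = n' := by
  obtain ⟨hn, r, hr, h⟩ := h
  obtain ⟨hn', r', hr', h'⟩ := h'
  by_contra hne
  have hlt : inner ℝ n n' < 1 := (inner_lt_one_iff_real_of_norm_eq_one hn hn').2 hne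
  have hc : Tendsto (fun t : ℝ => x + t • (n' - n)) (𝓝[>] 0) (𝓝 x) := by
    have : Tendsto (fun t : ℝ => x + t • (n' - n)) (𝓝 0) (𝓝 (x + (0 : ℝ) • (n' - n))) :=
      Continuous.tendsto (by fun_prop) 0
    rw [zero_smul, add_zero] at this
    exact this.mono_left nhdsWithin_le_nhds
  obtain ⟨t, ⟨h1, h2⟩, ht⟩ := (((hc.eventually (Metric.ball_mem_nhds x hr)).and
    (hc.eventually (Metric.ball_mem_nhds x hr'))).and self_mem_nhdsWithin).exists
  replace ht : 0 < t := ht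
  have h3 : x + t • (n' - n) ∈ Ω := by
    rw [h _ h1, add_sub_cancel_left, inner_smul_left, inner_sub_left, real_inner_self_eq_norm_sq,
      hn, real_inner_comm]
    simp only [conj_trivial]
    nlinarith
  rw [h' _ h2, add_sub_cancel_left, inner_smul_left, inner_sub_left, real_inner_self_eq_norm_sq,
    hn'] at h3
  simp only [conj_trivial] at h3
  nlinarith

theorem IsOuterNormal.outerNormal_eq {x n : Pt d} (h : IsOuterNormal Ω x n) :
    outerNormal Ω x = n := by
  have hex : ∃ n, IsOuterNormal Ω x n := ⟨n, h⟩
  rw [outerNormal, dif_pos hex]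
  exact hex.choose_spec.unique h

theorem norm_outerNormal_le (Ω : Set (Pt d)) (x : Pt d) : ‖outerNormal Ω x‖ ≤ 1 := by
  by_cases hex : ∃ n, IsOuterNormal Ω x n
  · rw [hex.choose_spec.outerNormal_eq, hex.choose_spec.1]
  · rw [outerNormal, dif_neg hex]
    simp

/-- `Ω` is a bounded open set without slits whose boundary lies in the hyperplanes of the finite
family `S`. -/
structure IsPolyhedralOpen (Ω : Set (Pt d)) (S : Finset (Set (Pt d))) : Prop where
  isOpen : IsOpen Ω
  isBounded : Bornology.IsBounded Ω
  regular : interior (closure Ω) = Ω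
  hyperplane : ∀ H ∈ S, IsHyperplane H
  cover : ∀ x ∈ frontier Ω, ∃ H ∈ S, x ∈ H

/-- The point `x` lies in at most one member of `S`. -/
def IsGeneric (S : Finset (Set (Pt d))) (x : Pt d) : Prop :=
  ∀ H ∈ S, ∀ H' ∈ S, x ∈ H → x ∈ H' → H = H'

theorem ae_isGeneric {n : ℕ} {S : Finset (Set (Pt (n + 1)))} (hS : ∀ H ∈ S, IsHyperplane H) :
    ∀ᵐ x ∂(Measure.euclideanHausdorffMeasure n : Measure (Pt (n + 1))), IsGeneric S x := by
  have : ∀ H ∈ S, ∀ H' ∈ S, ∀ᵐ x ∂(Measure.euclideanHausdorffMeasure n : Measure (Pt (n + 1))),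
      x ∈ H → x ∈ H' → H = H' := by
    intro H hH H' hH'
    by_cases h : H = H'
    · simp [h]
    · refine measure_mono_null ?_ ((hS H hH).measure_inter_eq_zero (hS H' hH') h)
      intro x hx
      simp only [mem_compl_iff, mem_ofPred_eq, Classical.not_imp] at hx
      exact ⟨hx.1, hx.2.1⟩
  have h2 := (ae_ball_iff S.countable_toSet).2 fun H hH =>
    (ae_ball_iff S.countable_toSet).2 fun H' hH' => this H hH H' hH'
  filter_upwards [h2] with x hx H hH H' hH' using hx H hH H' hH'

end

section

namespace IsPolyhedralOpen

variable {S : Finset (Set (Pt d))}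

theorem eventually_notMem_of_isGeneric (h : IsPolyhedralOpen Ω S) {x : Pt d}
    (hx : IsGeneric S x) {H : Set (Pt d)} (hH : H ∈ S) (hxH : x ∈ H) :
    ∀ᶠ y in 𝓝 x, y ∈ frontier Ω → y ∈ H := by
  have : ∀ᶠ y in 𝓝 x, ∀ H' ∈ S, H' ≠ H → y ∉ H' := by
    refine (Filter.eventually_all_finset S).2 fun H' hH' => ?_
    by_cases hne : H' = H
    · simp [hne]
    · have : x ∉ H' := fun hx' => hne (hx H' hH' H hH hx' hxH)
      filter_upwards [(h.hyperplane H' hH').isClosed.isOpen_compl.mem_nhds this] with y hy _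
        using hy
  filter_upwards [this] with y hy hyf
  obtain ⟨H', hH', hyH'⟩ := h.cover y hyf
  by_contra hc
  exact hy H' hH' (fun he => hc (he ▸ hyH')) hyH'

/-- At a boundary point lying on a single hyperplane, `Ω` is locally one of the two half spaces:
the absence of slits excludes that it lies on both sides. -/
theorem isOuterNormal_or (h : IsPolyhedralOpen Ω S) {x : Pt d} (hxf : x ∈ frontier Ω)
    (hx : IsGeneric S x) {ν : Pt d} {c : ℝ} (hν : ‖ν‖ = 1) (hH : {y | inner ℝ ν y = c} ∈ S)
    (hxH : inner ℝ ν x = c) : IsOuterNormal Ω x ν ∨ IsOuterNormal Ω x (-ν) := by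
  obtain ⟨r, hr, hball⟩ := Metric.eventually_nhds_iff_ball.1
    (h.eventually_notMem_of_isGeneric hx hH hxH)
  have hlin : ∀ y, inner ℝ (y - x) ν = inner ℝ ν y - c := fun y => by
    rw [inner_sub_left, real_inner_comm, real_inner_comm ν x, hxH]
  -- each open half ball is either contained in `Ω` or disjoint from its closure
  have hhalf : ∀ B ⊆ Metric.ball x r, Convex ℝ B → (∀ y ∈ B, inner ℝ ν y ≠ c) →
      B ⊆ Ω ∨ B ⊆ (closure Ω)ᶜ := by
    intro B hB hconv hne
    refine hconv.isPreconnected.subset_or_subset h.isOpen isClosed_closure.isOpen_compl ?_ ?_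
    · exact (disjoint_compl_right (a := closure Ω)).mono_left subset_closure
    · intro y hy
      by_contra hc
      simp only [mem_union, mem_compl_iff, not_or, not_not] at hc
      exact hne y hy (hball y (hB hy) ⟨hc.2, by rw [h.isOpen.interior_eq]; exact hc.1⟩)
  let Bp := Metric.ball x r ∩ {y | c < inner ℝ ν y}
  let Bm := Metric.ball x r ∩ {y | inner ℝ ν y < c}
  have hlinear : IsLinearMap ℝ (fun y : Pt d => (inner ℝ ν y : ℝ)) :=
    ⟨fun a b => inner_add_right _ _ _, fun a b => inner_smul_right _ _ _⟩
  have hBp := hhalf Bp inter_subset_left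
    ((convex_ball x r).inter (convex_halfSpace_gt hlinear c)) fun y hy => ne_of_gt hy.2
  have hBm := hhalf Bm inter_subset_left
    ((convex_ball x r).inter (convex_halfSpace_lt hlinear c)) fun y hy => ne_of_lt hy.2
  -- points of the hyperplane are limits of points of both half balls
  have happr : ∀ y ∈ Metric.ball x r, inner ℝ ν y = c → ∀ σ : ℝ, σ ≠ 0 →
      ∀ U ∈ 𝓝 y, ∃ t : ℝ, 0 < t ∧ y + (t * σ) • ν ∈ U ∩ Metric.ball x r ∧
        inner ℝ ν (y + (t * σ) • ν) = c + t * σ := by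
    intro y hy hyc σ _ U hU
    have hc : Tendsto (fun t : ℝ => y + (t * σ) • ν) (𝓝[>] 0) (𝓝 y) := by
      have : Tendsto (fun t : ℝ => y + (t * σ) • ν) (𝓝 0) (𝓝 (y + ((0 : ℝ) * σ) • ν)) :=
        Continuous.tendsto (by fun_prop) 0
      rw [zero_mul, zero_smul, add_zero] at this
      exact this.mono_left nhdsWithin_le_nhds
    obtain ⟨t, h1, ht⟩ := ((hc.eventually (inter_mem hU (Metric.isOpen_ball.mem_nhds hy))).and
      self_mem_nhdsWithin).exists
    refine ⟨t, ht, h1, ?_⟩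
    rw [inner_add_right, inner_smul_right, real_inner_self_eq_norm_sq, hν, hyc]
    ring
  have hxcl : x ∈ closure Ω := hxf.1
  have hxΩ : x ∉ Ω := by
    have := hxf.2
    rwa [h.isOpen.interior_eq] at this
  -- A point of `Ω` on the hyperplane would have points of `Ω` on both sides.
  have hflat : ∀ y ∈ Metric.ball x r, inner ℝ ν y = c → (Bp ⊆ (closure Ω)ᶜ ∨ Bm ⊆ (closure Ω)ᶜ) →
      y ∉ Ω := by
    rintro y hy hyc (hout | hout) hyΩ
    · obtain ⟨t, ht, h1, h2⟩ := happr y hy hyc 1 one_ne_zero Ω (h.isOpen.mem_nhds hyΩ)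
      exact hout ⟨h1.2, by rw [mem_ofPred_eq, h2]; linarith⟩ (subset_closure h1.1)
    · obtain ⟨t, ht, h1, h2⟩ := happr y hy hyc (-1) (by norm_num) Ω (h.isOpen.mem_nhds hyΩ)
      exact hout ⟨h1.2, by rw [mem_ofPred_eq, h2]; linarith⟩ (subset_closure h1.1)
  rcases hBp with hp | hp <;> rcases hBm with hm | hm
  · exfalso
    -- If both half balls lie in `Ω`, then `x` is interior to `closure Ω`, that is, `x ∈ Ω`.
    apply hxΩ
    rw [← h.regular, mem_interior_iff_mem_nhds]
    refine mem_of_superset (Metric.ball_mem_nhds x hr) fun y hy => ?_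
    rcases lt_trichotomy (inner ℝ ν y) c with h1 | h1 | h1
    · exact subset_closure (hm ⟨hy, h1⟩)
    · rw [mem_closure_iff_nhds]
      intro U hU
      obtain ⟨t, ht, h2, h3⟩ := happr y hy h1 1 one_ne_zero U hU
      exact ⟨_, h2.1, hp ⟨h2.2, by rw [mem_ofPred_eq, h3]; linarith⟩⟩
    · exact subset_closure (hp ⟨hy, h1⟩)
  · right
    refine ⟨by rwa [norm_neg], r, hr, fun y hy => ?_⟩
    rw [inner_neg_right, hlin]
    constructor
    · intro hyΩ
      rcases lt_trichotomy (inner ℝ ν y) c with h1 | h1 | h1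
      · exact absurd (subset_closure hyΩ) (hm ⟨hy, h1⟩)
      · exact absurd hyΩ (hflat y hy h1 (Or.inr hm))
      · linarith
    · intro h1
      exact hp ⟨hy, by rw [mem_ofPred_eq]; linarith⟩
  · left
    refine ⟨hν, r, hr, fun y hy => ?_⟩
    rw [hlin]
    constructor
    · intro hyΩ
      rcases lt_trichotomy (inner ℝ ν y) c with h1 | h1 | h1
      · linarith
      · exact absurd hyΩ (hflat y hy h1 (Or.inl hp))
      · exact absurd (subset_closure hyΩ) (hp ⟨hy, h1⟩)
    · intro h1
      exact hm ⟨hy, by rw [mem_ofPred_eq]; linarith⟩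
  · exfalso
    -- If both half balls avoid `closure Ω`, then `x` is not in `closure Ω`.
    obtain ⟨y, hy, hyΩ⟩ := mem_closure_iff_nhds.1 hxcl _ (Metric.ball_mem_nhds x hr)
    rcases lt_trichotomy (inner ℝ ν y) c with h1 | h1 | h1
    · exact hm ⟨hy, h1⟩ (subset_closure hyΩ)
    · exact hflat y hy h1 (Or.inl hp) hyΩ
    · exact hp ⟨hy, h1⟩ (subset_closure hyΩ)

theorem isCompact_closure (h : IsPolyhedralOpen Ω S) : IsCompact (closure Ω) :=
  h.isBounded.isCompact_closure

theorem isCompact_frontier (h : IsPolyhedralOpen Ω S) : IsCompact (frontier Ω) :=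
  h.isCompact_closure.of_isClosed_subset isClosed_frontier frontier_subset_closure

end IsPolyhedralOpen

/-- Bounded pieces of a hyperplane have finite surface measure. -/
theorem IsHyperplane.measure_inter_lt_top {n : ℕ} {H B : Set (Pt (n + 1))} (hH : IsHyperplane H)
    (hB : IsCompact B) : Measure.euclideanHausdorffMeasure n (B ∩ H) < ⊤ := by
  obtain ⟨ν, c, hν, rfl⟩ := hH
  obtain ⟨L, hL⟩ := exists_isChart ν hν
  rw [← Measure.restrict_apply hB.measurableSet, ← hL.map_volume hν,
    Measure.map_apply (by fun_prop) hB.measurableSet]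
  have hι : Isometry (fun y : Pt n => L y + c • ν) :=
    (isometry_add_right (c • ν)).comp L.isometry
  exact (hι.isClosedEmbedding.isCompact_preimage hB).measure_lt_top

namespace IsPolyhedralOpen

variable {n : ℕ} {Ω : Set (Pt (n + 1))} {S : Finset (Set (Pt (n + 1)))}

theorem isFiniteMeasure (h : IsPolyhedralOpen Ω S) : IsFiniteMeasure (surfaceMeasure Ω) := by
  refine ⟨?_⟩
  rw [Measure.restrict_apply_univ]
  have hsub : frontier Ω ⊆ ⋃ H ∈ S, frontier Ω ∩ H := by
    intro x hx
    obtain ⟨H, hH, hxH⟩ := h.cover x hx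
    exact mem_biUnion (Finset.mem_coe.2 hH) ⟨hx, hxH⟩
  refine (measure_mono hsub).trans_lt ?_
  refine (measure_biUnion_finset_le S _).trans_lt (ENNReal.sum_lt_top.2 fun H hH => ?_)
  exact (h.hyperplane H hH).measure_inter_lt_top h.isCompact_frontier

theorem ae_isGeneric (h : IsPolyhedralOpen Ω S) : ∀ᵐ x ∂(surfaceMeasure Ω), IsGeneric S x :=
  ae_restrict_of_ae (DynBC.ae_isGeneric h.hyperplane)

theorem ae_mem_openFaces (h : IsPolyhedralOpen Ω S) :
    ∀ᵐ x ∂(surfaceMeasure Ω), IsOuterNormal Ω x (outerNormal Ω x) := by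
  filter_upwards [h.ae_isGeneric, ae_restrict_mem isClosed_frontier.measurableSet] with x hx hxf
  obtain ⟨H, hH, hxH⟩ := h.cover x hxf
  obtain ⟨ν, c, hν, rfl⟩ := h.hyperplane H hH
  rcases h.isOuterNormal_or hxf hx hν hH hxH with h1 | h1 <;> rwa [h1.outerNormal_eq]

theorem aestronglyMeasurable_outerNormal (h : IsPolyhedralOpen Ω S) :
    AEStronglyMeasurable (outerNormal Ω) (surfaceMeasure Ω) := by
  have hcov : (Measure.euclideanHausdorffMeasure n).restrict (frontier Ω) =
      (Measure.euclideanHausdorffMeasure n).restrict (⋃ H : S, frontier Ω ∩ H.1) := by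
    congr 1
    ext x
    simp only [mem_iUnion, mem_inter_iff, Subtype.exists, exists_and_left, exists_prop]
    exact ⟨fun hx => ⟨hx, h.cover x hx⟩, fun hx => hx.1⟩
  change AEStronglyMeasurable _ ((Measure.euclideanHausdorffMeasure n).restrict (frontier Ω))
  rw [hcov, aestronglyMeasurable_iUnion_iff]
  rintro ⟨H, hH⟩
  have hHp := h.hyperplane H hH
  obtain ⟨ν, c, hν, rfl⟩ := h.hyperplane H hH
  -- Within a hyperplane, having a given vector perpendicular to it as the outer normal is an
  -- open condition.
  have hmeas : ∀ n' : Pt (n + 1), (∀ x y, inner ℝ ν x = c → inner ℝ ν y = c →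
      inner ℝ (y - x) n' = 0) → MeasurableSet {x | inner ℝ ν x = c ∧ IsOuterNormal Ω x n'} := by
    intro n' hn'
    have : ∃ U, IsOpen U ∧ {x | inner ℝ ν x = c ∧ IsOuterNormal Ω x n'} =
        {x | inner ℝ ν x = c} ∩ U := by
      refine ⟨⋃ x ∈ {x : Pt (n + 1) × ℝ | ‖n'‖ = 1 ∧ inner ℝ ν x.1 = c ∧
        ∀ y ∈ Metric.ball x.1 x.2, (y ∈ Ω ↔ inner ℝ (y - x.1) n' < 0)}, Metric.ball x.1 x.2,
        isOpen_biUnion fun _ _ => Metric.isOpen_ball, ?_⟩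
      ext x
      simp only [mem_ofPred_eq, mem_inter_iff, mem_iUnion, exists_prop, Prod.exists]
      constructor
      · rintro ⟨h1, h2, r, hr, h3⟩
        exact ⟨h1, x, r, ⟨h2, h1, h3⟩, Metric.mem_ball_self hr⟩
      · rintro ⟨h1, x', r, ⟨h2, h1', h3⟩, hx⟩
        refine ⟨h1, h2, r - dist x x', by rw [Metric.mem_ball] at hx; linarith, fun y hy => ?_⟩
        have hy' : y ∈ Metric.ball x' r := by
          rw [Metric.mem_ball] at *
          linarith [dist_triangle y x x']
        rw [h3 y hy']
        have h4 : y - x' = (y - x) + (x - x') := by abel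
        rw [h4, inner_add_left, hn' x' x h1' h1, add_zero]
    obtain ⟨U, hU, hEq⟩ := this
    rw [hEq]
    exact hHp.isClosed.measurableSet.inter hU.measurableSet
  have hperp : ∀ x y, inner ℝ ν x = c → inner ℝ ν y = c → inner ℝ (y - x) ν = 0 := by
    intro x y hx hy
    rw [real_inner_comm, inner_sub_right, hx, hy, sub_self]
  have hA := hmeas ν hperp
  have hA' := hmeas (-ν) fun x y hx hy => by rw [inner_neg_right, hperp x y hx hy, neg_zero]
  -- On the hyperplane the outer normal is almost everywhere one of `ν` and `-ν`.
  refine ((aestronglyMeasurable_const (b := ν)).indicator hA |>.add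
    ((aestronglyMeasurable_const (b := -ν)).indicator hA')).congr ?_
  have hνne : ν ≠ -ν := fun he => by
    have : ν = 0 := by
      have h2 : (2 : ℝ) • ν = 0 := by rw [two_smul]; nth_rw 2 [he]; abel
      simpa using h2
    simp [this] at hν
  filter_upwards [ae_restrict_of_ae (DynBC.ae_isGeneric h.hyperplane),
    ae_restrict_mem (isClosed_frontier.measurableSet.inter hHp.isClosed.measurableSet)]
    with x hx hxm
  rcases h.isOuterNormal_or hxm.1 hx hν hH hxm.2 with h1 | h1
  · have h2 : ¬ IsOuterNormal Ω x (-ν) := fun h2 => hνne (h1.unique h2)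
    have hm : inner ℝ ν x = c := hxm.2
    rw [h1.outerNormal_eq]
    simp [indicator, h1, h2, hm]
  · have h2 : ¬ IsOuterNormal Ω x ν := fun h2 => hνne (h2.unique h1)
    have hm : inner ℝ ν x = c := hxm.2
    rw [h1.outerNormal_eq]
    simp [indicator, h1, h2, hm]

theorem integrable_smul_outerNormal (h : IsPolyhedralOpen Ω S) {g : Pt (n + 1) → ℝ}
    (hg : ContinuousOn g (closure Ω)) :
    Integrable (fun x => g x • outerNormal Ω x) (surfaceMeasure Ω) := by
  have := h.isFiniteMeasure
  obtain ⟨M, hM⟩ := h.isCompact_closure.exists_bound_of_continuousOn hg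
  have hgm : AEStronglyMeasurable g (surfaceMeasure Ω) :=
    (hg.mono frontier_subset_closure).aestronglyMeasurable isClosed_frontier.measurableSet
  refine Integrable.of_bound (C := M) (hgm.smul h.aestronglyMeasurable_outerNormal) ?_
  filter_upwards [ae_restrict_mem isClosed_frontier.measurableSet] with x hx
  rw [norm_smul]
  have h1 := hM x (frontier_subset_closure hx)
  exact (mul_le_of_le_one_right (norm_nonneg _) (norm_outerNormal_le Ω x)).trans h1

theorem integrable_mul_inner_outerNormal (h : IsPolyhedralOpen Ω S) {g : Pt (n + 1) → ℝ}
    (hg : ContinuousOn g (closure Ω)) (e : Pt (n + 1)) :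
    Integrable (fun x => g x * inner ℝ (outerNormal Ω x) e) (surfaceMeasure Ω) := by
  refine ((h.integrable_smul_outerNormal hg).inner_const e).congr (Eventually.of_forall fun x => ?_)
  exact real_inner_smul_left _ _ _

end IsPolyhedralOpen

end

section

namespace IsPolyhedralOpen

variable {n : ℕ} {Ω : Set (Pt (n + 1))} {S : Finset (Set (Pt (n + 1)))}

/-- The divergence theorem in a direction `e` that is transversal to all boundary hyperplanes, by
integration along the lines parallel to `e`. -/
theorem integral_deriv_of_transversal (h : IsPolyhedralOpen Ω S) {e : Pt (n + 1)} (he : ‖e‖ = 1)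
    (htr : ∀ (ν : Pt (n + 1)) (c : ℝ), ‖ν‖ = 1 → {x | inner ℝ ν x = c} ∈ S → inner ℝ ν e ≠ 0)
    {g g' : Pt (n + 1) → ℝ} (hg : ContinuousOn g (closure Ω)) (hi : IntegrableOn g' Ω)
    (hd : ∀ x ∈ Ω, (∀ H ∈ S, x ∉ H) → HasDerivAt (fun s : ℝ => g (x + s • e)) (g' x) 0) :
    ∫ x in Ω, g' x = ∫ x, g x * inner ℝ (outerNormal Ω x) e ∂(surfaceMeasure Ω) := by
  classical
  obtain ⟨L₀, hL₀⟩ := exists_isChart e he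
  have hyp : ∀ H : Set (Pt (n + 1)), ∃ (ν : Pt (n + 1)) (c : ℝ), H ∈ S →
      ‖ν‖ = 1 ∧ H = {x | inner ℝ ν x = c} ∧ inner ℝ ν e ≠ 0 := by
    intro H
    by_cases hH : H ∈ S
    · obtain ⟨ν, c, hν, rfl⟩ := h.hyperplane H hH
      exact ⟨ν, c, fun _ => ⟨hν, rfl, htr ν c hν hH⟩⟩
    · exact ⟨0, 0, fun h => absurd h hH⟩
  choose ν c hνc using hyp
  -- The line through `L₀ z` parallel to `e` meets the hyperplane `H` at the parameter `sH H z`, in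
  -- the point `p H z`.
  let sH : Set (Pt (n + 1)) → Pt n → ℝ := fun H z =>
    (c H - inner ℝ (ν H) (L₀ z)) / inner ℝ (ν H) e
  let p : Set (Pt (n + 1)) → Pt n → Pt (n + 1) := fun H z => L₀ z + sH H z • e
  have hpm : ∀ H, Measurable (p H) := fun H => by fun_prop
  have hmem : ∀ H ∈ S, ∀ z (s : ℝ), L₀ z + s • e ∈ H ↔ s = sH H z := by
    intro H hH z s
    obtain ⟨h1, h2, h3⟩ := hνc H hH
    conv_lhs => rw [h2]
    simp only [mem_ofPred_eq, inner_add_right, inner_smul_right, sH]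
    rw [eq_div_iff h3]
    constructor <;> intro h <;> linarith
  have hmap : ∀ H ∈ S, (volume : Measure (Pt n)).map (p H) =
      ENNReal.ofReal |inner ℝ (ν H) e| • (Measure.euclideanHausdorffMeasure n).restrict H := by
    intro H hH
    obtain ⟨h1, h2, h3⟩ := hνc H hH
    obtain ⟨L, hL⟩ := exists_isChart (ν H) h1
    have := IsChart.map_projection hL₀ he hL h1 h3 (c H)
    rw [← h2] at this
    exact this
  let F : Pt (n + 1) → ℝ := (frontier Ω).indicator fun x => g x * inner ℝ (outerNormal Ω x) e
  have hFint : Integrable F (Measure.euclideanHausdorffMeasure n) :=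
    (integrable_indicator_iff isClosed_frontier.measurableSet).2
      (h.integrable_mul_inner_outerNormal hg e)
  have hFmap : ∀ H ∈ S, Integrable F ((volume : Measure (Pt n)).map (p H)) := fun H hH => by
    rw [hmap H hH]
    exact hFint.restrict.smul_measure ENNReal.ofReal_ne_top
  have hFcomp : ∀ H ∈ S, Integrable (fun z => F (p H z)) := fun H hH =>
    (hFmap H hH).comp_measurable (hpm H)
  -- the integral along a generic line
  have hline : ∀ᵐ z : Pt n, ∫ s : ℝ, Ω.indicator g' (L₀ z + s • e) =
      ∑ H ∈ S, |inner ℝ (ν H) e|⁻¹ * F (p H z) := by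
    -- The lines meeting an intersection of two hyperplanes project to a null set.
    have hgen : ∀ᵐ z : Pt n, ∀ H ∈ S, IsGeneric S (p H z) := by
      refine (ae_ball_iff S.countable_toSet).2 fun H hH => ?_
      have h1 : ∀ᵐ x ∂((volume : Measure (Pt n)).map (p H)), IsGeneric S x := by
        rw [hmap H hH]
        exact Measure.ae_smul_measure (ae_restrict_of_ae (DynBC.ae_isGeneric h.hyperplane)) _
      exact ae_of_ae_map (hpm H).aemeasurable h1
    filter_upwards [hgen, hL₀.ae_integrable he (hi.integrable_indicator h.isOpen.measurableSet)]
      with z hz hzi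
    have hcont : Continuous fun s : ℝ => L₀ z + s • e := by fun_prop
    let O : Set ℝ := (fun s : ℝ => L₀ z + s • e) ⁻¹' Ω
    have hO : IsOpen O := h.isOpen.preimage hcont
    have hOfr : ∀ s ∈ frontier O, L₀ z + s • e ∈ frontier Ω := fun s hs =>
      hcont.frontier_preimage_subset Ω hs
    have hOcl : ∀ s ∈ closure O, L₀ z + s • e ∈ closure Ω := fun s hs =>
      hcont.closure_preimage_subset Ω hs
    have hOb : Bornology.IsBounded O := by
      have hiso : Isometry (fun s : ℝ => L₀ z + s • e) := by
        refine Isometry.of_dist_eq fun s t => ?_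
        rw [dist_eq_norm, dist_eq_norm, add_sub_add_left_eq_sub, ← sub_smul, norm_smul, he, mul_one]
      exact hiso.antilipschitz.isBounded_preimage h.isBounded
    -- `ε` is the sign of the outer normal in the direction `e`: the one-dimensional outer normal.
    let P : Finset ℝ := S.image fun H => sH H z
    let ε : ℝ → ℝ := fun s => if L₀ z + s • e ∈ frontier Ω then
      (if 0 < inner ℝ (outerNormal Ω (L₀ z + s • e)) e then 1 else -1) else 0
    have hnormal : ∀ H ∈ S, p H z ∈ frontier Ω →
        IsOuterNormal Ω (p H z) (outerNormal Ω (p H z)) ∧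
        |inner ℝ (outerNormal Ω (p H z)) e| = |inner ℝ (ν H) e| := by
      intro H hH hfr
      obtain ⟨h1, h2, h3⟩ := hνc H hH
      have hpH : inner ℝ (ν H) (p H z) = c H := by
        have : p H z ∈ H := (hmem H hH z _).2 rfl
        exact (Set.ext_iff.1 h2 _).1 this
      rcases h.isOuterNormal_or hfr (hz H hH) h1 (h2 ▸ hH) hpH with h4 | h4
      · rw [h4.outerNormal_eq]
        exact ⟨h4, rfl⟩
      · rw [h4.outerNormal_eq]
        exact ⟨h4, by rw [inner_neg_left, abs_neg]⟩
    have hkey := integral_deriv_eq_sum_boundary hO hOb P (fun s hs => ?_) ε ?_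
      (g := fun s => g (L₀ z + s • e)) (g' := fun s => g' (L₀ z + s • e))
      (hg.comp hcont.continuousOn hOcl) ?_ ?_
    · have e1 : ∀ s, Ω.indicator g' (L₀ z + s • e) = O.indicator (fun s => g' (L₀ z + s • e)) s :=
        fun s => rfl
      simp_rw [e1]
      rw [integral_indicator hO.measurableSet, hkey, Finset.sum_image]
      · refine Finset.sum_congr rfl fun H hH => ?_
        change ε (sH H z) * g (p H z) = _
        by_cases hfr : p H z ∈ frontier Ω
        · obtain ⟨h4, h5⟩ := hnormal H hH hfr
          have h3 := (hνc H hH).2.2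
          have h6 : ε (sH H z) = if 0 < inner ℝ (outerNormal Ω (p H z)) e then 1 else -1 :=
            if_pos hfr
          simp only [F, indicator_of_mem hfr]
          rw [h6, ← h5]
          have h7 : inner ℝ (outerNormal Ω (p H z)) e ≠ 0 := fun h0 => by
            rw [h0, abs_zero, eq_comm, abs_eq_zero] at h5
            exact h3 h5
          split_ifs with h8
          · rw [abs_of_pos h8]
            field_simp
          · rw [abs_of_neg (lt_of_le_of_ne (not_lt.1 h8) h7)]
            field_simp
        · have h6 : ε (sH H z) = 0 := if_neg hfr
          simp [F, hfr, h6]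
      · intro H hH H' hH' heq
        refine hz H hH H hH H' hH' ((hmem H hH z _).2 rfl) ?_
        exact (hmem H' hH' z _).2 heq
    · obtain ⟨H, hH, hsH⟩ := h.cover _ (hOfr s hs)
      exact Finset.mem_coe.2 (Finset.mem_image.2 ⟨H, hH, ((hmem H hH z s).1 hsH).symm⟩)
    · intro s hs
      obtain ⟨H, hH, rfl⟩ := Finset.mem_image.1 hs
      by_cases hfr : p H z ∈ frontier Ω
      · right
        obtain ⟨h4, h5⟩ := hnormal H hH hfr
        have h6 : ε (sH H z) = if 0 < inner ℝ (outerNormal Ω (p H z)) e then 1 else -1 :=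
          if_pos hfr
        have h7 : inner ℝ (outerNormal Ω (p H z)) e ≠ 0 := fun h0 => by
          rw [h0, abs_zero, eq_comm, abs_eq_zero] at h5
          exact (hνc H hH).2.2 h5
        obtain ⟨-, r, hr, hball⟩ := h4
        have hev : ∀ᶠ t in 𝓝 (sH H z), (t ∈ O ↔
            (t - sH H z) * inner ℝ (outerNormal Ω (p H z)) e < 0) := by
          filter_upwards [hcont.continuousAt.eventually (Metric.ball_mem_nhds _ hr)] with t ht
          have h8 : L₀ z + t • e - p H z = (t - sH H z) • e := by
            simp only [p, add_sub_add_left_eq_sub, sub_smul]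
          change L₀ z + t • e ∈ Ω ↔ _
          rw [hball _ ht, h8, inner_smul_left, real_inner_comm]
          simp
        rw [h6]
        rcases lt_or_gt_of_ne h7 with h8 | h8
        · right
          refine ⟨by rw [if_neg (not_lt.2 h8.le)], hev.mono fun t ht => ht.trans ?_⟩
          rw [mul_neg_iff]
          constructor
          · rintro (h9 | h9) <;> linarith [h9.1, h9.2]
          · intro h9
            exact Or.inl ⟨by linarith, h8⟩
        · left
          refine ⟨by rw [if_pos h8], hev.mono fun t ht => ht.trans ?_⟩
          rw [mul_neg_iff]
          constructor
          · rintro (h9 | h9) <;> linarith [h9.1, h9.2]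
          · intro h9
            exact Or.inr ⟨by linarith, h8⟩
      · left
        exact ⟨fun hs => hfr (hOfr _ hs), if_neg hfr⟩
    · intro s hs hsP
      have h1 := hd _ hs fun H hH hx => hsP (Finset.mem_image.2
        ⟨H, hH, ((hmem H hH z s).1 hx).symm⟩)
      have h1' : HasDerivAt (fun t : ℝ => g (L₀ z + s • e + t • e)) (g' (L₀ z + s • e))
          (s - s) := by
        rwa [sub_self]
      refine (h1'.comp_sub_const s s).congr_of_eventuallyEq (Eventually.of_forall fun t => ?_)
      simp only
      congr 1
      rw [sub_smul]
      abel
    · have h1 : Integrable (O.indicator fun s => g' (L₀ z + s • e)) := hzi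
      rwa [integrable_indicator_iff hO.measurableSet] at h1
  rw [← integral_indicator h.isOpen.measurableSet,
    hL₀.integral_eq he (hi.integrable_indicator h.isOpen.measurableSet), integral_congr_ae hline,
    integral_finsetSum _ fun H hH => (hFcomp H hH).const_mul _]
  -- The weight in the line integrals is the Jacobian of the projection.
  have hterm : ∀ H ∈ S, ∫ z, |inner ℝ (ν H) e|⁻¹ * F (p H z) =
      ∫ x in H, F x ∂(Measure.euclideanHausdorffMeasure n) := by
    intro H hH
    have h3 : |inner ℝ (ν H) e| ≠ 0 := abs_ne_zero.2 (hνc H hH).2.2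
    rw [integral_const_mul, ← integral_map (hpm H).aemeasurable (hFmap H hH).aestronglyMeasurable,
      hmap H hH, integral_smul_measure, ENNReal.toReal_ofReal (abs_nonneg _), smul_eq_mul,
      inv_mul_cancel_left₀ h3]
  rw [Finset.sum_congr rfl hterm]
  have h1 : ∫ x in ⋃ H : S, H.1, F x ∂(Measure.euclideanHausdorffMeasure n) =
      ∑' H : S, ∫ x in H.1, F x ∂(Measure.euclideanHausdorffMeasure n) := by
    refine integral_iUnion_ae
      (fun H => (h.hyperplane H H.2).isClosed.measurableSet.nullMeasurableSet)
      (fun H H' hne => ?_) hFint.integrableOn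
    exact (h.hyperplane H H.2).measure_inter_eq_zero (h.hyperplane H' H'.2)
      fun he => hne (Subtype.ext he)
  rw [tsum_fintype, Finset.univ_eq_attach, Finset.sum_attach S
    (fun H => ∫ x in H, F x ∂(Measure.euclideanHausdorffMeasure n))] at h1
  have hU : MeasurableSet (⋃ H : S, H.1) :=
    MeasurableSet.iUnion fun H => (h.hyperplane H H.2).isClosed.measurableSet
  rw [← h1]
  simp only [F]
  rw [setIntegral_indicator isClosed_frontier.measurableSet]
  congr 2
  refine inter_eq_right.2 fun x hx => ?_
  obtain ⟨H, hH, hxH⟩ := h.cover x hx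
  exact mem_iUnion.2 ⟨⟨H, hH⟩, hxH⟩

/-- Directions transversal to finitely many hyperplanes are dense. -/
theorem dense_transversal (h : IsPolyhedralOpen Ω S) :
    Dense {e : Pt (n + 1) | e ≠ 0 ∧ ∀ (ν : Pt (n + 1)) (c : ℝ), ‖ν‖ = 1 →
      {x | inner ℝ ν x = c} ∈ S → inner ℝ ν e ≠ 0} := by
  classical
  have hlin : ∀ ν : Pt (n + 1), ν ≠ 0 → IsOpen {e | inner ℝ ν e ≠ 0} ∧
      Dense {e | inner ℝ ν e ≠ 0} := by
    intro ν hν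
    refine ⟨isOpen_ne_fun (by fun_prop) continuous_const, fun e => ?_⟩
    rw [mem_closure_iff_frequently]
    have hc : Tendsto (fun t : ℝ => e + t • ν) (𝓝[≠] 0) (𝓝 e) := by
      have : Tendsto (fun t : ℝ => e + t • ν) (𝓝 0) (𝓝 (e + (0 : ℝ) • ν)) :=
        Continuous.tendsto (by fun_prop) 0
      rw [zero_smul, add_zero] at this
      exact this.mono_left nhdsWithin_le_nhds
    refine hc.frequently (Eventually.frequently ?_)
    have hne : ∀ᶠ t : ℝ in 𝓝[≠] 0, t ≠ -(inner ℝ ν e) / ‖ν‖ ^ 2 := by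
      by_cases h0 : -(inner ℝ ν e) / ‖ν‖ ^ 2 = (0 : ℝ)
      · rw [h0]
        exact self_mem_nhdsWithin
      · exact mem_nhdsWithin_of_mem_nhds (isOpen_ne.mem_nhds (Ne.symm h0))
    filter_upwards [hne] with t ht h0
    apply ht
    rw [inner_add_right, inner_smul_right, real_inner_self_eq_norm_sq] at h0
    have : ‖ν‖ ^ 2 ≠ 0 := by simpa using hν
    field_simp
    linarith
  -- The unit normals of a hyperplane are all parallel, so one of them may be chosen.
  have hyp : ∀ H : Set (Pt (n + 1)), ∃ ν : Pt (n + 1), ν ≠ 0 ∧ (H ∈ S → ∀ (ν' : Pt (n + 1)) (c : ℝ),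
      ‖ν'‖ = 1 → {x | inner ℝ ν' x = c} = H → ∀ e, inner ℝ ν e ≠ 0 → inner ℝ ν' e ≠ 0) := by
    intro H
    by_cases hH : H ∈ S
    · obtain ⟨ν, c, hν, rfl⟩ := h.hyperplane H hH
      have hν0 : ν ≠ 0 := fun h0 => by simp [h0] at hν
      refine ⟨ν, hν0, fun _ ν' c' hν' hEq e he h0 => ?_⟩
      have h1 : c • ν ∈ {x : Pt (n + 1) | inner ℝ ν x = c} := by
        simp [inner_smul_right, hν]
      have h2 : c • ν ∈ {x : Pt (n + 1) | inner ℝ ν' x = c'} := hEq ▸ h1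
      have h3 : c • ν + e ∈ {x : Pt (n + 1) | inner ℝ ν' x = c'} := by
        simp only [mem_ofPred_eq] at h2 ⊢
        rw [inner_add_right, h0, h2, add_zero]
      rw [hEq] at h3
      simp only [mem_ofPred_eq] at h3 h1
      rw [inner_add_right, h1] at h3
      exact he (by linarith)
    · obtain ⟨ν, hν⟩ := exists_ne (0 : Pt (n + 1))
      exact ⟨ν, hν, fun h => absurd h hH⟩
  choose ν hν0 hν using hyp
  obtain ⟨w, hw⟩ := exists_ne (0 : Pt (n + 1))
  have hd : Dense (⋂ H ∈ (S : Set (Set (Pt (n + 1)))), {e | inner ℝ (ν H) e ≠ 0}) :=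
    dense_biInter_of_isOpen (fun H _ => (hlin _ (hν0 H)).1) S.countable_toSet
      fun H _ => (hlin _ (hν0 H)).2
  refine (hd.inter_of_isOpen_left (hlin w hw).2 ?_).mono ?_
  · exact S.finite_toSet.isOpen_biInter fun H _ => (hlin _ (hν0 H)).1
  · rintro e ⟨h1, h2⟩
    refine ⟨fun h0 => h2 (by simp [h0]), fun ν' c hν' hS => ?_⟩
    exact hν _ hS ν' c hν' rfl e (mem_iInter₂.1 h1 _ hS)

/-- The divergence theorem on a polyhedral open set, for a continuous function that is
differentiable off finitely many hyperplanes. -/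
theorem integral_gradient (h : IsPolyhedralOpen Ω S) {g : Pt (n + 1) → ℝ}
    {G : Pt (n + 1) → Pt (n + 1)} (hg : ContinuousOn g (closure Ω)) (hi : IntegrableOn G Ω)
    (hd : ∀ x ∈ Ω, (∀ H ∈ S, x ∉ H) → HasGradientAt g (G x) x) :
    ∫ x in Ω, G x = ∫ x, g x • outerNormal Ω x ∂(surfaceMeasure Ω) := by
  have hint := h.integrable_smul_outerNormal hg
  have key : ∀ e : Pt (n + 1), inner ℝ (∫ x in Ω, G x) e =
      inner ℝ (∫ x, g x • outerNormal Ω x ∂(surfaceMeasure Ω)) e := by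
    -- Both sides are continuous in `e`, so it suffices to consider transversal directions.
    refine fun e => congrFun (Continuous.ext_on h.dense_transversal (f := fun e =>
      inner ℝ (∫ x in Ω, G x) e) (g := fun e =>
      inner ℝ (∫ x, g x • outerNormal Ω x ∂(surfaceMeasure Ω)) e) (by fun_prop) (by fun_prop) ?_) e
    rintro e ⟨he0, he⟩
    have hne : ‖e‖ ≠ 0 := norm_ne_zero_iff.2 he0
    have h1 := h.integral_deriv_of_transversal (e := ‖e‖⁻¹ • e) (g := g)
      (g' := fun x => inner ℝ (‖e‖⁻¹ • e) (G x)) (by rw [norm_smul]; simp [hne])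
      (fun ν c hν hS => by
        rw [inner_smul_right]
        exact mul_ne_zero (inv_ne_zero hne) (he ν c hν hS)) hg (hi.const_inner _)
      (fun x hx hS => by
        have h2 := (hd x hx hS).hasFDerivAt
        have h3 : HasDerivAt (fun s : ℝ => x + s • (‖e‖⁻¹ • e)) (‖e‖⁻¹ • e) 0 := by
          simpa using ((hasDerivAt_id (0 : ℝ)).smul_const (‖e‖⁻¹ • e)).const_add x
        have h2' : HasFDerivAt g (InnerProductSpace.toDual ℝ (Pt (n + 1)) (G x))
            (x + (0 : ℝ) • (‖e‖⁻¹ • e)) := by simpa using h2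
        have h4 := h2'.comp_hasDerivAt (0 : ℝ) h3
        rw [InnerProductSpace.toDual_apply_apply, real_inner_comm] at h4
        exact h4)
    rw [integral_inner hi] at h1
    have h5 : ∀ x, g x * inner ℝ (outerNormal Ω x) (‖e‖⁻¹ • e) =
        inner ℝ (‖e‖⁻¹ • e) (g x • outerNormal Ω x) := fun x => by
      rw [real_inner_comm]
      exact (real_inner_smul_right _ _ _).symm
    simp_rw [h5] at h1
    rw [integral_inner hint, inner_smul_left, inner_smul_left] at h1
    have h6 := mul_left_cancel₀ (by simpa using hne) h1
    simp only
    rw [real_inner_comm, h6, real_inner_comm]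
  exact ext_inner_right ℝ key

end IsPolyhedralOpen

end

section

/-! ### Affine functions and barycentric coordinates -/

/-- The gradient of an affine function. -/
def affGrad (A : Pt d →ᵃ[ℝ] ℝ) : Pt d :=
  (InnerProductSpace.toDual ℝ (Pt d)).symm (LinearMap.toContinuousLinearMap A.linear)

theorem affine_eq (A : Pt d →ᵃ[ℝ] ℝ) (x y : Pt d) : A y = A x + inner ℝ (affGrad A) (y - x) := by
  have h1 : inner ℝ (affGrad A) (y - x) = A.linear (y - x) := by
    rw [affGrad, InnerProductSpace.toDual_symm_apply]
    rfl
  rw [h1, ← vsub_eq_sub, A.linearMap_vsub, vsub_eq_sub]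
  ring

theorem hasGradientAt_affine (A : Pt d →ᵃ[ℝ] ℝ) (x : Pt d) : HasGradientAt A (affGrad A) x := by
  rw [hasGradientAt_iff_hasFDerivAt]
  have h2 : HasFDerivAt (fun y => A x + InnerProductSpace.toDual ℝ (Pt d) (affGrad A) (y - x))
      (InnerProductSpace.toDual ℝ (Pt d) (affGrad A)) x :=
    (((InnerProductSpace.toDual ℝ (Pt d) (affGrad A)).hasFDerivAt.comp x
      ((hasFDerivAt_id x).sub_const x)).const_add (A x))
  exact h2.congr_of_eventuallyEq (Eventually.of_forall fun y => affine_eq A x y)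

theorem continuous_affine (A : Pt d →ᵃ[ℝ] ℝ) : Continuous A :=
  A.continuous_of_finiteDimensional

theorem isHyperplane_affine {A : Pt d →ᵃ[ℝ] ℝ} (hA : affGrad A ≠ 0) :
    IsHyperplane {x | A x = 0} := by
  have hn : ‖affGrad A‖ ≠ 0 := norm_ne_zero_iff.2 hA
  refine ⟨‖affGrad A‖⁻¹ • affGrad A, ‖affGrad A‖⁻¹ * (-A 0), ?_, ?_⟩
  · rw [norm_smul, norm_inv, norm_norm, inv_mul_cancel₀ hn]
  · ext x
    rw [mem_ofPred_eq, mem_ofPred_eq, affine_eq A 0 x, inner_smul_left, sub_zero]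
    simp only [conj_trivial]
    constructor
    · intro h
      congr 1
      linarith
    · intro h
      have := mul_left_cancel₀ (inv_ne_zero hn) h
      linarith

/-- The vertex set of a nondegenerate simplex. -/
def IsSimplex (s : Finset (Pt d)) : Prop :=
  AffineIndependent ℝ ((↑) : s → Pt d) ∧ s.card = d + 1

theorem IsSimplex.exists_bary {s : Finset (Pt d)} (hs : IsSimplex s) :
    ∃ l : Pt d → (Pt d →ᵃ[ℝ] ℝ), (∀ x, ∑ a ∈ s, l a x = 1) ∧ (∀ x, ∑ a ∈ s, l a x • a = x) ∧
      (∀ a ∈ s, l a a = 1) ∧ ∀ a ∈ s, ∀ b ∈ s, a ≠ b → l a b = 0 := by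
  classical
  have htop : affineSpan ℝ (Set.range ((↑) : s → Pt d)) = ⊤ := by
    rw [hs.1.affineSpan_eq_top_iff_card_eq_finrank_add_one]
    simp [hs.2]
  let b : AffineBasis s ℝ (Pt d) := ⟨(↑), hs.1, htop⟩
  have hb : ∀ i : s, b i = i := fun i => rfl
  have hl : ∀ (i : s), (if h : (i : Pt d) ∈ s then b.coord ⟨i, h⟩ else 0) = b.coord i := fun i => by
    rw [dif_pos i.2]
  refine ⟨fun a => if h : a ∈ s then b.coord ⟨a, h⟩ else 0, fun x => ?_, fun x => ?_,
    fun a ha => ?_, fun a ha c hc hne => ?_⟩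
  · rw [← Finset.sum_coe_sort]
    simp_rw [hl]
    exact b.sum_coord_apply_eq_one x
  · rw [← Finset.sum_coe_sort]
    simp_rw [hl]
    exact b.linear_combination_coord_eq_self x
  · simp only [dif_pos ha]
    exact b.coord_apply_eq ⟨a, ha⟩
  · simp only [dif_pos ha]
    exact b.coord_apply_ne (i := ⟨a, ha⟩) (j := ⟨c, hc⟩) fun h => hne (Subtype.ext_iff.1 h)

open Classical in
/-- The barycentric coordinates of a simplex, extended to affine functions on the whole space and
indexed by its vertices (with junk values elsewhere). -/
def bary (s : Finset (Pt d)) : Pt d → (Pt d →ᵃ[ℝ] ℝ) :=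
  if h : IsSimplex s then h.exists_bary.choose else fun _ => 0

namespace IsSimplex

variable {s t : Finset (Pt d)}

theorem bary_eq (hs : IsSimplex s) : bary s = hs.exists_bary.choose := by
  rw [bary, dif_pos hs]

theorem sum_bary (hs : IsSimplex s) (x : Pt d) : ∑ a ∈ s, bary s a x = 1 := by
  rw [hs.bary_eq]
  exact hs.exists_bary.choose_spec.1 x

theorem sum_bary_smul (hs : IsSimplex s) (x : Pt d) : ∑ a ∈ s, bary s a x • a = x := by
  rw [hs.bary_eq]
  exact hs.exists_bary.choose_spec.2.1 x

theorem bary_self (hs : IsSimplex s) {a : Pt d} (ha : a ∈ s) : bary s a a = 1 := by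
  rw [hs.bary_eq]
  exact hs.exists_bary.choose_spec.2.2.1 a ha

theorem bary_ne (hs : IsSimplex s) {a b : Pt d} (ha : a ∈ s) (hb : b ∈ s) (h : a ≠ b) :
    bary s a b = 0 := by
  rw [hs.bary_eq]
  exact hs.exists_bary.choose_spec.2.2.2 a ha b hb h

theorem affine_apply (hs : IsSimplex s) (A : Pt d →ᵃ[ℝ] ℝ) (x : Pt d) :
    A x = ∑ a ∈ s, bary s a x * A a := by
  have h1 : ∀ a, A a = A 0 + inner ℝ (affGrad A) a := fun a => by
    rw [affine_eq A 0 a, sub_zero]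
  rw [h1 x]
  conv_lhs => rw [← hs.sum_bary_smul x, inner_sum, ← mul_one (A 0), ← hs.sum_bary x, Finset.mul_sum,
    ← Finset.sum_add_distrib]
  refine Finset.sum_congr rfl fun a _ => ?_
  rw [h1 a, inner_smul_right]
  ring

theorem mem_convexHull_iff (hs : IsSimplex s) {x : Pt d} :
    x ∈ convexHull ℝ (s : Set (Pt d)) ↔ ∀ a ∈ s, 0 ≤ bary s a x := by
  constructor
  · intro hx a ha
    obtain ⟨w, h1, h2, h3⟩ := Finset.mem_convexHull'.1 hx
    have h4 : bary s a x = ∑ b ∈ s, w b * bary s a b := by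
      have h5 : ∀ b, bary s a b = bary s a 0 + inner ℝ (affGrad (bary s a)) b := fun b => by
        rw [affine_eq _ 0 b, sub_zero]
      rw [h5 x, ← h3, inner_sum, ← mul_one (bary s a 0), ← h2, Finset.mul_sum,
        ← Finset.sum_add_distrib]
      refine Finset.sum_congr rfl fun b _ => ?_
      rw [h5 b, inner_smul_right]
      ring
    rw [h4]
    refine Finset.sum_nonneg fun b hb => mul_nonneg (h1 b hb) ?_
    by_cases hab : a = b
    · subst hab
      rw [hs.bary_self ha]
      exact zero_le_one
    · rw [hs.bary_ne ha hb hab]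
  · intro hx
    exact Finset.mem_convexHull'.2 ⟨fun a => bary s a x, hx, hs.sum_bary x, hs.sum_bary_smul x⟩

theorem mem_interior_iff (hs : IsSimplex s) {x : Pt d} :
    x ∈ interior (convexHull ℝ (s : Set (Pt d))) ↔ ∀ a ∈ s, 0 < bary s a x := by
  constructor
  · intro hx a ha
    have hc : Tendsto (fun t : ℝ => AffineMap.lineMap a x t) (𝓝[>] 1) (𝓝 x) := by
      have h1 : Tendsto (fun t : ℝ => AffineMap.lineMap a x t) (𝓝 1)
          (𝓝 (AffineMap.lineMap a x (1 : ℝ))) :=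
        Continuous.tendsto (by fun_prop) 1
      rw [AffineMap.lineMap_apply_one] at h1
      exact h1.mono_left nhdsWithin_le_nhds
    obtain ⟨t, h1, ht⟩ := ((hc.eventually (mem_interior_iff_mem_nhds.1 hx)).and
      self_mem_nhdsWithin).exists
    have ht' : (1 : ℝ) < t := ht
    have h2 := hs.mem_convexHull_iff.1 h1 a ha
    rw [AffineMap.apply_lineMap, hs.bary_self ha, AffineMap.lineMap_apply_ring'] at h2
    by_contra hneg
    nlinarith
  · intro hx
    have ho : IsOpen {x | ∀ a ∈ s, 0 < bary s a x} := by
      have : {x | ∀ a ∈ s, 0 < bary s a x} = ⋂ a ∈ s, {x | 0 < bary s a x} := by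
        ext x
        simp
      rw [this]
      exact isOpen_biInter_finset fun a _ => isOpen_lt continuous_const (continuous_affine _)
    exact mem_interior.2 ⟨_, fun y hy => hs.mem_convexHull_iff.2 fun a ha => (hy a ha).le, ho, hx⟩

theorem affGrad_bary_ne_zero (hs : IsSimplex s) (hd : 0 < d) {a : Pt d} (ha : a ∈ s) :
    affGrad (bary s a) ≠ 0 := by
  intro h0
  obtain ⟨b, hb, hba⟩ := Finset.exists_mem_ne (s := s) (by rw [hs.2]; omega) a
  have := affine_eq (bary s a) a b
  rw [hs.bary_self ha, hs.bary_ne ha hb hba.symm, h0, inner_zero_left] at this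
  norm_num at this

end IsSimplex

theorem affGrad_sum (s : Finset (Pt d)) (c : Pt d → ℝ) (l : Pt d → (Pt d →ᵃ[ℝ] ℝ)) :
    affGrad (∑ a ∈ s, c a • l a) = ∑ a ∈ s, c a • affGrad (l a) := by
  have h1 : (∑ a ∈ s, c a • l a).linear = ∑ a ∈ s, c a • (l a).linear := by
    classical
    induction s using Finset.induction_on with
    | empty => simp
    | insert a s ha ih => rw [Finset.sum_insert ha, Finset.sum_insert ha, ← ih]; rfl
  simp only [affGrad, h1, map_sum, map_smul]

theorem affGrad_smul (c : ℝ) (A : Pt d →ᵃ[ℝ] ℝ) : affGrad (c • A) = c • affGrad A := by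
  have h1 : (c • A).linear = c • A.linear := rfl
  simp only [affGrad, h1, map_smul]

theorem affGrad_sub (A B : Pt d →ᵃ[ℝ] ℝ) : affGrad (A - B) = affGrad A - affGrad B := by
  have h1 : (A - B).linear = A.linear - B.linear := rfl
  simp only [affGrad, h1, map_sub]

end

section

/-! ### Triangulations -/

/-- The local graph representation of the boundary excludes slits. -/
theorem IsPolygonalDomain.interior_closure (hΩ : IsPolygonalDomain Ω) :
    interior (closure Ω) = Ω := by
  refine Subset.antisymm (fun x hx => ?_) (hΩ.isOpen.subset_interior_iff.2 subset_closure)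
  by_contra hxΩ
  have hxf : x ∈ frontier Ω := ⟨interior_subset hx, by rwa [hΩ.isOpen.interior_eq]⟩
  obtain ⟨e, f, L, r, he, hf, hr, hball⟩ := hΩ.lipschitz x hxf
  -- moving outwards from `x` one leaves the closure of `Ω`
  have hx0 : f (x - inner ℝ x e • e) ≤ inner ℝ x e := by
    by_contra h
    exact hxΩ ((hball x (Metric.mem_ball_self hr)).2 (not_le.1 h))
  have hc : Tendsto (fun t : ℝ => x + t • e) (𝓝[>] 0) (𝓝 x) := by
    have : Tendsto (fun t : ℝ => x + t • e) (𝓝 0) (𝓝 (x + (0 : ℝ) • e)) :=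
      Continuous.tendsto (by fun_prop) 0
    rw [zero_smul, add_zero] at this
    exact this.mono_left nhdsWithin_le_nhds
  obtain ⟨t, ⟨h1, h2⟩, ht⟩ := (((hc.eventually (mem_interior_iff_mem_nhds.1 hx)).and
    (hc.eventually (Metric.ball_mem_nhds x hr))).and self_mem_nhdsWithin).exists
  replace ht : 0 < t := ht
  have hopen : IsOpen {y : Pt d | f (y - inner ℝ y e • e) < inner ℝ y e} :=
    isOpen_lt (hf.continuous.comp (by fun_prop)) (by fun_prop)
  have hmem : x + t • e ∈ {y : Pt d | f (y - inner ℝ y e • e) < inner ℝ y e} := by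
    have h3 : inner ℝ (x + t • e) e = inner ℝ x e + t := by
      rw [inner_add_left, inner_smul_left, real_inner_self_eq_norm_sq, he]
      simp
    rw [mem_ofPred_eq, h3]
    have h4 : x + t • e - (inner ℝ x e + t) • e = x - inner ℝ x e • e := by
      rw [add_smul]; abel
    rw [h4]
    linarith
  obtain ⟨y, hy, hyΩ⟩ := mem_closure_iff_nhds.1 h1 _
    (inter_mem (hopen.mem_nhds hmem) (Metric.isOpen_ball.mem_nhds h2))
  exact absurd ((hball y hy.2).1 hyΩ) (not_lt.2 (le_of_lt hy.1))

theorem IsPolygonalDomain.exists_isPolyhedralOpen (hΩ : IsPolygonalDomain Ω) :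
    ∃ S, IsPolyhedralOpen Ω S := by
  classical
  obtain ⟨S, hS, hcov⟩ := hΩ.flat
  refine ⟨S.image fun q => {x | inner ℝ q.1 x = q.2}, hΩ.isOpen, hΩ.isBounded,
    hΩ.interior_closure, ?_, ?_⟩
  · intro H hH
    obtain ⟨q, hq, rfl⟩ := Finset.mem_image.1 hH
    have hq0 : ‖q.1‖ ≠ 0 := norm_ne_zero_iff.2 (hS q hq)
    refine ⟨‖q.1‖⁻¹ • q.1, ‖q.1‖⁻¹ * q.2, ?_, ?_⟩
    · rw [norm_smul, norm_inv, norm_norm, inv_mul_cancel₀ hq0]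
    · ext x
      rw [mem_ofPred_eq, mem_ofPred_eq, inner_smul_left]
      simp only [conj_trivial]
      exact ⟨fun h => by rw [h], fun h => mul_left_cancel₀ (inv_ne_zero hq0) h⟩
  · intro x hx
    obtain ⟨q, hq, hxq⟩ := mem_iUnion₂.1 (hcov hx)
    exact ⟨_, Finset.mem_image_of_mem _ hq, hxq⟩

theorem isSimplex_of_mem_elements {K : Geometry.SimplicialComplex ℝ (Pt d)} {s : Finset (Pt d)}
    (hs : s ∈ elements K) : IsSimplex s :=
  ⟨K.indep hs.1, hs.2⟩

/-- A triangulation of a polyhedral open set, together with a family `S` of hyperplanes that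
contains the hyperplanes spanned by the facets of the elements. -/
structure IsMeshed {n : ℕ} (Ω : Set (Pt (n + 1))) (K : Geometry.SimplicialComplex ℝ (Pt (n + 1)))
    (S : Finset (Set (Pt (n + 1)))) : Prop where
  poly : IsPolyhedralOpen Ω S
  tri : IsTriangulation Ω K
  facet_mem : ∀ s ∈ elements K, ∀ a ∈ s, {x | bary s a x = 0} ∈ S

theorem finite_elements {K : Geometry.SimplicialComplex ℝ (Pt d)} (h : IsTriangulation Ω K) :
    (elements K).Finite :=
  h.1.subset fun _ hs => hs.1

theorem IsPolyhedralOpen.exists_isMeshed {n : ℕ} {Ω : Set (Pt (n + 1))}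
    {S : Finset (Set (Pt (n + 1)))} (hΩ : IsPolyhedralOpen Ω S)
    {K : Geometry.SimplicialComplex ℝ (Pt (n + 1))} (hK : IsTriangulation Ω K) :
    ∃ S, IsMeshed Ω K S := by
  classical
  have hfin := finite_elements hK
  let S' : Finset (Set (Pt (n + 1))) :=
    hfin.toFinset.biUnion fun s => s.image fun a => {x | bary s a x = 0}
  have hS' : ∀ H, H ∈ S' ↔ ∃ s ∈ elements K, ∃ a ∈ s, {x | bary s a x = 0} = H := by
    intro H
    simp [S']
  refine ⟨S ∪ S', ⟨hΩ.isOpen, hΩ.isBounded, hΩ.regular, fun H hH => ?_, fun x hx => ?_⟩, hK,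
    fun s hs a ha => Finset.mem_union_right _ ((hS' _).2 ⟨s, hs, a, ha, rfl⟩)⟩
  · rcases Finset.mem_union.1 hH with h | h
    · exact hΩ.hyperplane H h
    · obtain ⟨s, hs, a, ha, rfl⟩ := (hS' H).1 h
      exact isHyperplane_affine
        ((isSimplex_of_mem_elements hs).affGrad_bary_ne_zero (Nat.succ_pos n) ha)
  · obtain ⟨H, hH, hxH⟩ := hΩ.cover x hx
    exact ⟨H, Finset.mem_union_left _ hH, hxH⟩

/-- The relative interior of the facet of the simplex `s` opposite to the vertex `a`. -/
def relFacet (s : Finset (Pt d)) (a : Pt d) : Set (Pt d) :=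
  {x | bary s a x = 0 ∧ ∀ b ∈ s, b ≠ a → 0 < bary s b x}

/-- The facet of the element `s` opposite to `a` belongs to no other element. -/
def IsBoundaryFacet (K : Geometry.SimplicialComplex ℝ (Pt d)) (s : Finset (Pt d)) (a : Pt d) :
    Prop :=
  ∀ t ∈ elements K, (∀ b ∈ s, b ≠ a → b ∈ t) → t = s

/-- The outer unit normal of the simplex `s` on the facet opposite to `a`. -/
def facetNormal (s : Finset (Pt d)) (a : Pt d) : Pt d :=
  -(‖affGrad (bary s a)‖⁻¹ • affGrad (bary s a))

theorem relFacet_subset {s : Finset (Pt d)} (hs : IsSimplex s) (a : Pt d) :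
    relFacet s a ⊆ convexHull ℝ (s : Set (Pt d)) := fun x hx =>
  hs.mem_convexHull_iff.2 fun b hb => by
    by_cases hba : b = a
    · rw [hba, hx.1]
    · exact (hx.2 b hb hba).le

theorem norm_facetNormal {s : Finset (Pt d)} (hs : IsSimplex s) (hd : 0 < d) {a : Pt d}
    (ha : a ∈ s) : ‖facetNormal s a‖ = 1 := by
  have h : ‖affGrad (bary s a)‖ ≠ 0 := norm_ne_zero_iff.2 (hs.affGrad_bary_ne_zero hd ha)
  rw [facetNormal, norm_neg, norm_smul, norm_inv, norm_norm, inv_mul_cancel₀ h]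

theorem inner_facetNormal_neg_iff {s : Finset (Pt d)} (hs : IsSimplex s) (hd : 0 < d) {a : Pt d}
    (ha : a ∈ s) {x : Pt d} (hx : bary s a x = 0) (y : Pt d) :
    inner ℝ (y - x) (facetNormal s a) < 0 ↔ 0 < bary s a y := by
  have h : 0 < ‖affGrad (bary s a)‖ := norm_pos_iff.2 (hs.affGrad_bary_ne_zero hd ha)
  rw [affine_eq (bary s a) x y, hx, zero_add, facetNormal, inner_neg_right, inner_smul_right,
    real_inner_comm, neg_lt_zero]
  exact mul_pos_iff_of_pos_left (inv_pos.2 h)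

namespace IsMeshed

variable {n : ℕ} {Ω : Set (Pt (n + 1))} {K : Geometry.SimplicialComplex ℝ (Pt (n + 1))}
  {S : Finset (Set (Pt (n + 1)))} {s t : Finset (Pt (n + 1))} {x : Pt (n + 1)}

theorem convexHull_subset (h : IsMeshed Ω K S) (hs : s ∈ elements K) :
    convexHull ℝ (s : Set (Pt (n + 1))) ⊆ closure Ω :=
  h.tri.2 ▸ K.convexHull_subset_space hs.1

theorem interior_subset (h : IsMeshed Ω K S) (hs : s ∈ elements K) :
    interior (convexHull ℝ (s : Set (Pt (n + 1)))) ⊆ Ω := by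
  rw [← h.poly.regular]
  exact interior_mono (h.convexHull_subset hs)

theorem isClosed_convexHull (s : Finset (Pt d)) : IsClosed (convexHull ℝ (s : Set (Pt d))) :=
  (s.finite_toSet.isCompact_convexHull ℝ).isClosed

/-- The full-dimensional elements cover: lower-dimensional faces are null sets. -/
theorem exists_element (h : IsMeshed Ω K S) (hx : x ∈ closure Ω) :
    ∃ s ∈ elements K, x ∈ convexHull ℝ (s : Set (Pt (n + 1))) := by
  have hfin := finite_elements h.tri
  have hcl : IsClosed (⋃ s ∈ elements K, convexHull ℝ (s : Set (Pt (n + 1)))) :=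
    hfin.isClosed_biUnion fun s _ => isClosed_convexHull s
  have hsub : Ω ⊆ ⋃ s ∈ elements K, convexHull ℝ (s : Set (Pt (n + 1))) := by
    rw [← sdiff_eq_empty]
    have hopen : IsOpen (Ω \ ⋃ s ∈ elements K, convexHull ℝ (s : Set (Pt (n + 1)))) :=
      h.poly.isOpen.sdiff hcl
    rw [← hopen.measure_eq_zero_iff (volume : Measure (Pt (n + 1)))]
    have hcov : (Ω \ ⋃ s ∈ elements K, convexHull ℝ (s : Set (Pt (n + 1)))) ⊆
        ⋃ s ∈ K.faces \ elements K, convexHull ℝ (s : Set (Pt (n + 1))) := by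
      rintro y ⟨hy, hyn⟩
      have hyc : y ∈ K.space := h.tri.2 ▸ subset_closure hy
      obtain ⟨s, hs, hys⟩ := Geometry.SimplicialComplex.mem_space_iff.1 hyc
      refine mem_biUnion ⟨hs, fun hse => hyn (mem_biUnion hse hys)⟩ hys
    refine measure_mono_null hcov ((measure_biUnion_null_iff
      (h.tri.1.subset sdiff_subset).countable).2 ?_)
    rintro s ⟨hs, hse⟩
    refine measure_mono_null (convexHull_subset_affineSpan _) ?_
    apply Measure.addHaar_affineSubspace
    intro htop
    have h1 := (K.indep hs).affineSpan_eq_top_iff_card_eq_finrank_add_one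
    rw [Subtype.range_coe_subtype] at h1
    have h2 := h1.1 (by simpa using htop)
    exact hse ⟨hs, by simpa using h2⟩
  have := closure_minimal hsub hcl hx
  obtain ⟨s, hs, hxs⟩ := mem_iUnion₂.1 this
  exact ⟨s, hs, hxs⟩

theorem eventually_mem_convexHull (h : IsMeshed Ω K S) (x : Pt (n + 1)) :
    ∀ᶠ y in 𝓝 x, ∀ s ∈ elements K, y ∈ convexHull ℝ (s : Set (Pt (n + 1))) →
      x ∈ convexHull ℝ (s : Set (Pt (n + 1))) := by
  refine (Filter.eventually_all_finite (finite_elements h.tri)).2 fun s _ => ?_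
  by_cases hx : x ∈ convexHull ℝ (s : Set (Pt (n + 1)))
  · exact Eventually.of_forall fun _ _ => hx
  · filter_upwards [(isClosed_convexHull s).isOpen_compl.mem_nhds hx] with y hy hy' using
      absurd hy' hy

/-- Conformity: a point of two elements only has positive coordinates at common vertices. -/
theorem mem_of_bary_pos (hs : s ∈ elements K) (ht : t ∈ elements K)
    (hxs : x ∈ convexHull ℝ (s : Set (Pt (n + 1)))) (hxt : x ∈ convexHull ℝ (t : Set (Pt (n + 1))))
    {b : Pt (n + 1)} (hb : b ∈ s) (hpos : 0 < bary s b x) : b ∈ t := by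
  by_contra hbt
  have h1 := K.inter_subset_convexHull hs.1 ht.1 ⟨hxs, hxt⟩
  have h2 : convexHull ℝ ((s : Set (Pt (n + 1))) ∩ t) ⊆ {y | bary s b y = 0} := by
    refine convexHull_min ?_ ?_
    · rintro a ⟨has, hat⟩
      exact (isSimplex_of_mem_elements hs).bary_ne hb has fun h => hbt (h ▸ hat)
    · exact (convex_singleton (0 : ℝ)).affine_preimage (bary s b)
  exact hpos.ne' (h2 h1)

theorem eq_of_mem_interior (hs : s ∈ elements K) (ht : t ∈ elements K)
    (hxs : x ∈ interior (convexHull ℝ (s : Set (Pt (n + 1)))))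
    (hxt : x ∈ convexHull ℝ (t : Set (Pt (n + 1)))) : t = s := by
  have hss := isSimplex_of_mem_elements hs
  refine (Finset.eq_of_subset_of_card_le (fun b hb => ?_) (by rw [hs.2, ht.2])).symm
  exact mem_of_bary_pos hs ht (_root_.interior_subset hxs) hxt hb (hss.mem_interior_iff.1 hxs b hb)

/-- A generic point of an element lies in its interior or in the relative interior of a facet. -/
theorem mem_interior_or (h : IsMeshed Ω K S) (hx : IsGeneric S x) (hs : s ∈ elements K)
    (hxs : x ∈ convexHull ℝ (s : Set (Pt (n + 1)))) :
    x ∈ interior (convexHull ℝ (s : Set (Pt (n + 1)))) ∨ ∃ a ∈ s, x ∈ relFacet s a := by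
  have hss := isSimplex_of_mem_elements hs
  by_cases h0 : ∃ a ∈ s, bary s a x = 0
  · right
    obtain ⟨a, ha, hax⟩ := h0
    refine ⟨a, ha, hax, fun b hb hba => lt_of_le_of_ne (hss.mem_convexHull_iff.1 hxs b hb) ?_⟩
    intro hbx
    have h1 := hx _ (h.facet_mem s hs a ha) _ (h.facet_mem s hs b hb) hax hbx.symm
    have h2 : a ∈ {y | bary s b y = 0} := hss.bary_ne hb ha hba
    rw [← h1] at h2
    have h3 : bary s a a = 0 := h2
    rw [hss.bary_self ha] at h3
    exact one_ne_zero h3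
  · left
    push Not at h0
    exact hss.mem_interior_iff.2 fun a ha =>
      lt_of_le_of_ne (hss.mem_convexHull_iff.1 hxs a ha) (h0 a ha).symm

/-- Two elements meeting in the relative interior of a facet share this facet and lie on opposite
sides of it: the barycentric coordinates that vanish on it are negative multiples of each other. -/
theorem exists_neighbour (hs : s ∈ elements K) {a : Pt (n + 1)} (ha : a ∈ s)
    (ht : t ∈ elements K) (hts : t ≠ s) (hfac : ∀ b ∈ s, b ≠ a → b ∈ t)
    (hx : x ∈ relFacet s a) :
    ∃ b ∈ t, b ∉ s ∧ bary s a b < 0 ∧ (∀ y, bary s a y = bary s a b * bary t b y) ∧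
      x ∈ relFacet t b := by
  classical
  have hss := isSimplex_of_mem_elements hs
  have htt := isSimplex_of_mem_elements ht
  have hsub : s.erase a ⊆ t := fun b hb => hfac b (Finset.mem_of_mem_erase hb)
    (Finset.ne_of_mem_erase hb)
  -- The element `t` has exactly one vertex `b` off the common facet.
  have hcard : (t \ s.erase a).card = 1 := by
    rw [Finset.card_sdiff_of_subset hsub, Finset.card_erase_of_mem ha, hs.2, ht.2]
    omega
  obtain ⟨b, hb⟩ := Finset.card_eq_one.1 hcard
  have hbt : b ∈ t ∧ b ∉ s.erase a := by
    rw [← Finset.mem_sdiff, hb]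
    exact Finset.mem_singleton_self b
  have hmem : ∀ c ∈ t, c ≠ b → c ∈ s ∧ c ≠ a := by
    intro c hc hcb
    by_contra h
    have : c ∈ t \ s.erase a := Finset.mem_sdiff.2 ⟨hc, fun h' => h
      ⟨Finset.mem_of_mem_erase h', Finset.ne_of_mem_erase h'⟩⟩
    rw [hb] at this
    exact hcb (Finset.mem_singleton.1 this)
  have hbs : b ∉ s := by
    intro hbs
    apply hts
    refine Finset.eq_of_subset_of_card_le (fun c hc => ?_) (by rw [hs.2, ht.2])
    by_cases hcb : c = b
    · rwa [hcb]
    · exact (hmem c hc hcb).1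
  -- Both coordinates are affine and vanish at the common vertices.
  have hmul : ∀ y, bary s a y = bary s a b * bary t b y := by
    intro y
    rw [htt.affine_apply (bary s a) y, Finset.sum_eq_single b]
    · ring
    · intro c hc hcb
      rw [hss.bary_ne ha (hmem c hc hcb).1 (hmem c hc hcb).2.symm, mul_zero]
    · exact fun h => absurd hbt.1 h
  have hne : bary s a b ≠ 0 := by
    intro h0
    have h1 := hmul a
    rw [hss.bary_self ha, h0, zero_mul] at h1
    exact one_ne_zero h1
  have hat : a ∉ t := by
    intro hat
    apply hts
    refine (Finset.eq_of_subset_of_card_le (fun c hc => ?_) (by rw [hs.2, ht.2])).symm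
    by_cases hca : c = a
    · rwa [hca]
    · exact hfac c hc hca
  have hxt : x ∈ relFacet t b := by
    refine ⟨?_, fun c hc hcb => ?_⟩
    · have h1 := hmul x
      rw [hx.1] at h1
      exact (mul_eq_zero.1 h1.symm).resolve_left hne
    · have h1 : bary s c x = bary t c x := by
        rw [htt.affine_apply (bary s c) x, Finset.sum_eq_single c]
        · rw [hss.bary_self (hmem c hc hcb).1, mul_one]
        · intro c' hc' hne'
          by_cases h2 : c' = b
          · have h1 := hmul x
            rw [hx.1] at h1
            rw [h2, (mul_eq_zero.1 h1.symm).resolve_left hne, zero_mul]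
          · rw [hss.bary_ne (hmem c hc hcb).1 (hmem c' hc' h2).1 hne'.symm, mul_zero]
        · exact fun h => absurd hc h
      rw [← h1]
      exact hx.2 c (hmem c hc hcb).1 (hmem c hc hcb).2
  refine ⟨b, hbt.1, hbs, lt_of_le_of_ne (not_lt.1 fun hpos => ?_) hne, hmul, hxt⟩
  -- otherwise a point slightly inside of both elements contradicts conformity
  have hc : Tendsto (fun r : ℝ => AffineMap.lineMap x b r) (𝓝[>] 0) (𝓝 x) := by
    have h1 : Tendsto (fun r : ℝ => AffineMap.lineMap x b r) (𝓝 0)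
        (𝓝 (AffineMap.lineMap x b (0 : ℝ))) :=
      Continuous.tendsto (by fun_prop) 0
    rw [AffineMap.lineMap_apply_zero] at h1
    exact h1.mono_left nhdsWithin_le_nhds
  have hev : ∀ᶠ y in 𝓝 x, ∀ c ∈ s, c ≠ a → 0 < bary s c y := by
    refine (Filter.eventually_all_finset s).2 fun c hc => ?_
    by_cases hca : c = a
    · simp [hca]
    · filter_upwards [(continuous_affine (bary s c)).continuousAt.eventually
        (lt_mem_nhds (hx.2 c hc hca))] with y hy _ using hy
  obtain ⟨r, ⟨h1, h2⟩, hr⟩ := (((hc.eventually hev).and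
    ((eventually_lt_nhds (zero_lt_one (α := ℝ))).filter_mono nhdsWithin_le_nhds)).and
    self_mem_nhdsWithin).exists
  replace hr : 0 < r := hr
  set y := AffineMap.lineMap x b r
  have hya : 0 < bary s a y := by
    simp only [y, AffineMap.apply_lineMap, hx.1, AffineMap.lineMap_apply_ring']
    nlinarith
  have hys : y ∈ convexHull ℝ (s : Set (Pt (n + 1))) := hss.mem_convexHull_iff.2 fun c hc => by
    by_cases hca : c = a
    · rw [hca]
      exact hya.le
    · exact (h1 c hc hca).le
  have hyt : y ∈ convexHull ℝ (t : Set (Pt (n + 1))) :=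
    (convex_convexHull ℝ _).lineMap_mem (relFacet_subset htt b hxt) (subset_convexHull ℝ _ hbt.1)
      ⟨hr.le, h2.le⟩
  exact hat (mem_of_bary_pos hs ht hys hyt ha hya)

theorem facet_subset_of_mem (hs : s ∈ elements K) {a : Pt (n + 1)} (ht : t ∈ elements K)
    (hx : x ∈ relFacet s a) (hxt : x ∈ convexHull ℝ (t : Set (Pt (n + 1)))) :
    ∀ b ∈ s, b ≠ a → b ∈ t := fun b hb hba =>
  mem_of_bary_pos hs ht (relFacet_subset (isSimplex_of_mem_elements hs) a hx) hxt hb (hx.2 b hb hba)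

/-- Near a point of a boundary facet, `Ω` is a half space. -/
theorem isOuterNormal_facet (h : IsMeshed Ω K S) (hs : s ∈ elements K) {a : Pt (n + 1)}
    (ha : a ∈ s) (hbd : IsBoundaryFacet K s a) (hx : x ∈ relFacet s a) :
    IsOuterNormal Ω x (facetNormal s a) := by
  have hss := isSimplex_of_mem_elements hs
  refine ⟨norm_facetNormal hss (Nat.succ_pos n) ha, ?_⟩
  have hev : ∀ᶠ y in 𝓝 x, ∀ c ∈ s, c ≠ a → 0 < bary s c y := by
    refine (Filter.eventually_all_finset s).2 fun c hc => ?_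
    by_cases hca : c = a
    · simp [hca]
    · filter_upwards [(continuous_affine (bary s c)).continuousAt.eventually
        (lt_mem_nhds (hx.2 c hc hca))] with y hy _ using hy
  obtain ⟨r, hr, hball⟩ := Metric.eventually_nhds_iff_ball.1
    (hev.and (h.eventually_mem_convexHull x))
  refine ⟨r, hr, fun y hy => ?_⟩
  rw [inner_facetNormal_neg_iff hss (Nat.succ_pos n) ha hx.1]
  have hcl : ∀ y ∈ Metric.ball x r, y ∈ closure Ω → 0 ≤ bary s a y := by
    intro y hy hyc
    obtain ⟨t, ht, hyt⟩ := h.exists_element hyc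
    have hts := hbd t ht (facet_subset_of_mem hs ht hx ((hball y hy).2 t ht hyt))
    rw [hts] at hyt
    exact hss.mem_convexHull_iff.1 hyt a ha
  constructor
  · intro hyΩ
    refine lt_of_le_of_ne (hcl y hy (subset_closure hyΩ)) fun h0 => ?_
    -- moving from `y` away from the element stays in `Ω`
    have hc : Tendsto (fun r : ℝ => AffineMap.lineMap a y r) (𝓝[>] 1) (𝓝 y) := by
      have h1 : Tendsto (fun r : ℝ => AffineMap.lineMap a y r) (𝓝 1)
          (𝓝 (AffineMap.lineMap a y (1 : ℝ))) :=
        Continuous.tendsto (by fun_prop) 1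
      rw [AffineMap.lineMap_apply_one] at h1
      exact h1.mono_left nhdsWithin_le_nhds
    obtain ⟨q, ⟨h1, h2⟩, hq⟩ := (((hc.eventually (h.poly.isOpen.mem_nhds hyΩ)).and
      (hc.eventually (Metric.isOpen_ball.mem_nhds hy))).and self_mem_nhdsWithin).exists
    replace hq : 1 < q := hq
    have h3 := hcl _ h2 (subset_closure h1)
    rw [AffineMap.apply_lineMap, hss.bary_self ha, ← h0, AffineMap.lineMap_apply_ring'] at h3
    linarith
  · intro hpos
    refine h.interior_subset hs (hss.mem_interior_iff.2 fun c hc => ?_)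
    by_cases hca : c = a
    · rwa [hca]
    · exact (hball y hy).1 c hc hca

/-- The points of an inner facet belong to `Ω`. -/
theorem mem_of_not_isBoundaryFacet (h : IsMeshed Ω K S) (hs : s ∈ elements K) {a : Pt (n + 1)}
    (ha : a ∈ s) (ht : t ∈ elements K) (hts : t ≠ s) (hfac : ∀ b ∈ s, b ≠ a → b ∈ t)
    (hx : x ∈ relFacet s a) : x ∈ Ω := by
  have hss := isSimplex_of_mem_elements hs
  have htt := isSimplex_of_mem_elements ht
  obtain ⟨b, hbt, hbs, hneg, hmul, hxt⟩ := exists_neighbour hs ha ht hts hfac hx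
  rw [← h.poly.regular, mem_interior_iff_mem_nhds]
  have hev : ∀ᶠ y in 𝓝 x, ∀ c ∈ s, c ≠ a → 0 < bary s c y := by
    refine (Filter.eventually_all_finset s).2 fun c hc => ?_
    by_cases hca : c = a
    · simp [hca]
    · filter_upwards [(continuous_affine (bary s c)).continuousAt.eventually
        (lt_mem_nhds (hx.2 c hc hca))] with y hy _ using hy
  have hev' : ∀ᶠ y in 𝓝 x, ∀ c ∈ t, c ≠ b → 0 < bary t c y := by
    refine (Filter.eventually_all_finset t).2 fun c hc => ?_
    by_cases hcb : c = b
    · simp [hcb]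
    · filter_upwards [(continuous_affine (bary t c)).continuousAt.eventually
        (lt_mem_nhds (hxt.2 c hc hcb))] with y hy _ using hy
  filter_upwards [hev, hev'] with y h1 h2
  rcases le_total 0 (bary s a y) with h3 | h3
  · refine h.convexHull_subset hs (hss.mem_convexHull_iff.2 fun c hc => ?_)
    by_cases hca : c = a
    · rwa [hca]
    · exact (h1 c hc hca).le
  · refine h.convexHull_subset ht (htt.mem_convexHull_iff.2 fun c hc => ?_)
    by_cases hcb : c = b
    · rw [hcb]
      rw [hmul y] at h3
      by_contra h4
      nlinarith
    · exact (h2 c hc hcb).le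

/-- At most two elements share a facet. -/
theorem neighbour_unique (hs : s ∈ elements K) {a : Pt (n + 1)} (ha : a ∈ s)
    (ht : t ∈ elements K) (hts : t ≠ s) (hx : x ∈ relFacet s a)
    (hxt : x ∈ convexHull ℝ (t : Set (Pt (n + 1)))) {t' : Finset (Pt (n + 1))}
    (ht' : t' ∈ elements K) (hts' : t' ≠ s) (hxt' : x ∈ convexHull ℝ (t' : Set (Pt (n + 1)))) :
    t' = t := by
  by_contra hne
  obtain ⟨b, hbt, hbs, hneg, hmul, hxb⟩ :=
    exists_neighbour hs ha ht hts (facet_subset_of_mem hs ht hx hxt) hx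
  obtain ⟨b', hbt', hbs', hneg', hmul', hxb'⟩ :=
    exists_neighbour hs ha ht' hts' (facet_subset_of_mem hs ht' hx hxt') hx
  obtain ⟨b'', hbt'', hbs'', hneg'', hmul'', hxb''⟩ :=
    exists_neighbour ht hbt ht' hne (facet_subset_of_mem ht ht' hxb hxt') hxb
  have heq : b'' = b' := by
    by_contra hbb
    exact absurd hxb''.1 (hxb'.2 b'' hbt'' hbb).ne'
  rw [heq] at hneg''
  have := hmul b'
  nlinarith

end IsMeshed

end

section

/-! ### Nodal interpolation -/

/-- The affine function with the values `c` at the vertices of `s`. -/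
def nodalAff (s : Finset (Pt d)) (c : Pt d → ℝ) : Pt d →ᵃ[ℝ] ℝ :=
  ∑ a ∈ s, c a • bary s a

theorem nodalAff_apply (s : Finset (Pt d)) (c : Pt d → ℝ) (x : Pt d) :
    nodalAff s c x = ∑ a ∈ s, c a * bary s a x := by
  classical
  rw [nodalAff]
  induction s using Finset.induction_on with
  | empty => simp
  | insert a s ha ih =>
    have : ∀ (t : Finset (Pt d)) (l : Pt d → (Pt d →ᵃ[ℝ] ℝ)),
        (∑ a ∈ t, c a • l a) x = ∑ a ∈ t, c a * l a x := by
      intro t l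
      induction t using Finset.induction_on with
      | empty => simp
      | insert b t hb ih =>
        rw [Finset.sum_insert hb, Finset.sum_insert hb, ← ih]
        rfl
    exact this _ _

theorem nodalAff_vertex {s : Finset (Pt d)} (hs : IsSimplex s) (c : Pt d → ℝ) {a : Pt d}
    (ha : a ∈ s) : nodalAff s c a = c a := by
  rw [nodalAff_apply, Finset.sum_eq_single a, hs.bary_self ha, mul_one]
  · intro b hb hba
    rw [hs.bary_ne hb ha hba, mul_zero]
  · exact fun h => absurd ha h

theorem affGrad_nodalAff (s : Finset (Pt d)) (c : Pt d → ℝ) :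
    affGrad (nodalAff s c) = ∑ a ∈ s, c a • affGrad (bary s a) :=
  affGrad_sum s c (bary s)

open Classical in
/-- The nodal interpolant: the piecewise linear function with values `c` at the vertices. -/
def nodal (K : Geometry.SimplicialComplex ℝ (Pt d)) (c : Pt d → ℝ) (x : Pt d) : ℝ :=
  if h : ∃ s ∈ elements K, x ∈ convexHull ℝ (s : Set (Pt d)) then nodalAff h.choose c x else 0

/-- The elementwise gradient of the nodal interpolant; `E` is the set of all elements. -/
def nodalGrad (E : Finset (Finset (Pt d))) (c : Pt d → ℝ) (x : Pt d) : Pt d :=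
  ∑ s ∈ E, (convexHull ℝ (s : Set (Pt d))).indicator (fun _ => affGrad (nodalAff s c)) x

theorem nodalGrad_eq {E : Finset (Finset (Pt d))} {c : Pt d → ℝ} {x : Pt d} {s : Finset (Pt d)}
    (hs : s ∈ E) (hx : x ∈ convexHull ℝ (s : Set (Pt d)))
    (hu : ∀ t ∈ E, x ∈ convexHull ℝ (t : Set (Pt d)) → t = s) :
    nodalGrad E c x = affGrad (nodalAff s c) := by
  rw [nodalGrad, Finset.sum_eq_single s, indicator_of_mem hx]
  · exact fun t ht hts => indicator_of_notMem (fun h => hts (hu t ht h)) _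
  · exact fun h => absurd hs h

theorem measurable_nodalGrad (E : Finset (Finset (Pt d))) (c : Pt d → ℝ) :
    Measurable (nodalGrad E c) := by
  unfold nodalGrad
  exact Finset.measurable_fun_sum _ fun s _ =>
    measurable_const.indicator (IsMeshed.isClosed_convexHull s).measurableSet

theorem exists_norm_nodalGrad_le (E : Finset (Finset (Pt d))) (c : Pt d → ℝ) :
    ∃ M, ∀ x, ‖nodalGrad E c x‖ ≤ M :=
  ⟨∑ s ∈ E, ‖affGrad (nodalAff s c)‖, fun _ => (norm_sum_le _ _).trans
    (Finset.sum_le_sum fun _ _ => norm_indicator_le_norm_self _ _)⟩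

theorem hasGradientAt_mul {f g : Pt d → ℝ} {f' g' x : Pt d} (hf : HasGradientAt f f' x)
    (hg : HasGradientAt g g' x) :
    HasGradientAt (fun y => f y * g y) (f x • g' + g x • f') x := by
  have h1 := hf.hasFDerivAt.mul hg.hasFDerivAt
  have h2 : InnerProductSpace.toDual ℝ (Pt d) (f x • g' + g x • f') =
      f x • InnerProductSpace.toDual ℝ (Pt d) g' + g x • InnerProductSpace.toDual ℝ (Pt d) f' := by
    ext v
    simp
  rw [hasGradientAt_iff_hasFDerivAt, h2]
  exact h1

theorem IsTestFunction.hasGradientAt {φ : Pt d → ℝ} (hφ : IsTestFunction φ) (x : Pt d) :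
    HasGradientAt φ (gradient φ x) x :=
  ((hφ.1.differentiable (by simp)) x).hasGradientAt

theorem IsTestFunction.continuous_gradient {φ : Pt d → ℝ} (hφ : IsTestFunction φ) :
    Continuous (gradient φ) :=
  (InnerProductSpace.toDual ℝ (Pt d)).symm.continuous.comp (hφ.1.continuous_fderiv (by simp))

theorem IsTestFunction.contDiff_gradient {φ : Pt d → ℝ} (hφ : IsTestFunction φ) :
    ContDiff ℝ ∞ (gradient φ) :=
  (InnerProductSpace.toDual ℝ (Pt d)).symm.contDiff.comp (hφ.1.fderiv_right (by simp))

theorem IsTestFunction.exists_bound {φ : Pt d → ℝ} (hφ : IsTestFunction φ) :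
    ∃ M, ∀ x, |φ x| ≤ M ∧ ‖gradient φ x‖ ≤ M := by
  obtain ⟨M₁, h₁⟩ := hφ.1.continuous.bounded_above_of_compact_support hφ.2
  have hc : HasCompactSupport (gradient φ) := by
    have h2 := hφ.2.fderiv (𝕜 := ℝ)
    exact h2.comp_left (g := (InnerProductSpace.toDual ℝ (Pt d)).symm) (map_zero _)
  obtain ⟨M₂, h₂⟩ := hφ.continuous_gradient.bounded_above_of_compact_support hc
  exact ⟨max M₁ M₂, fun x => ⟨(h₁ x).trans (le_max_left _ _), (h₂ x).trans (le_max_right _ _)⟩⟩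

theorem IsTestFunction.tsupport_gradient {φ : Pt d → ℝ} :
    tsupport (gradient φ) ⊆ tsupport φ := by
  refine (closure_minimal ?_ (isClosed_tsupport φ))
  intro x hx
  by_contra h
  apply hx
  have : φ =ᶠ[𝓝 x] fun _ => 0 := by
    filter_upwards [(isClosed_tsupport φ).isOpen_compl.mem_nhds h] with y hy
    exact image_eq_zero_of_notMem_tsupport hy
  rw [gradient, this.fderiv_eq]
  simp

namespace IsMeshed

variable {n : ℕ} {Ω : Set (Pt (n + 1))} {K : Geometry.SimplicialComplex ℝ (Pt (n + 1))}
  {S : Finset (Set (Pt (n + 1)))} {s t : Finset (Pt (n + 1))} {x : Pt (n + 1)}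
  {E : Finset (Finset (Pt (n + 1)))}

theorem nodalAff_eq (hs : s ∈ elements K) (ht : t ∈ elements K)
    (hxs : x ∈ convexHull ℝ (s : Set (Pt (n + 1)))) (hxt : x ∈ convexHull ℝ (t : Set (Pt (n + 1))))
    (c : Pt (n + 1) → ℝ) : nodalAff s c x = nodalAff t c x := by
  have hss := isSimplex_of_mem_elements hs
  rw [hss.affine_apply (nodalAff t c) x, nodalAff_apply]
  refine Finset.sum_congr rfl fun a ha => ?_
  rcases (hss.mem_convexHull_iff.1 hxs a ha).eq_or_lt with h0 | h0
  · rw [← h0, mul_zero, zero_mul]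
  · rw [nodalAff_vertex (isSimplex_of_mem_elements ht) c (mem_of_bary_pos hs ht hxs hxt ha h0),
      mul_comm]

theorem nodal_eq (hs : s ∈ elements K) (hxs : x ∈ convexHull ℝ (s : Set (Pt (n + 1))))
    (c : Pt (n + 1) → ℝ) : nodal K c x = nodalAff s c x := by
  have hex : ∃ s ∈ elements K, x ∈ convexHull ℝ (s : Set (Pt (n + 1))) := ⟨s, hs, hxs⟩
  rw [nodal, dif_pos hex]
  exact nodalAff_eq hex.choose_spec.1 hs hex.choose_spec.2 hxs c

theorem continuousOn_nodal (h : IsMeshed Ω K S) (c : Pt (n + 1) → ℝ) :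
    ContinuousOn (nodal K c) (closure Ω) := by
  have : Finite (elements K) := finite_elements h.tri
  have h1 : ContinuousOn (nodal K c)
      (⋃ s : elements K, convexHull ℝ (s.1 : Set (Pt (n + 1)))) := by
    refine LocallyFinite.continuousOn_iUnion (locallyFinite_of_finite _)
      (fun s => isClosed_convexHull s.1) fun s => ?_
    exact (continuous_affine (nodalAff s.1 c)).continuousOn.congr fun x hx => nodal_eq s.2 hx c
  refine h1.mono fun x hx => ?_
  obtain ⟨s, hs, hxs⟩ := h.exists_element hx
  exact mem_iUnion.2 ⟨⟨s, hs⟩, hxs⟩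

/-- Off the hyperplanes of `S`, a point of `Ω` is interior to an element. -/
theorem exists_mem_interior (h : IsMeshed Ω K S) (hx : x ∈ closure Ω) (hxS : ∀ H ∈ S, x ∉ H) :
    ∃ s ∈ elements K, x ∈ interior (convexHull ℝ (s : Set (Pt (n + 1)))) := by
  obtain ⟨s, hs, hxs⟩ := h.exists_element hx
  refine ⟨s, hs, ?_⟩
  rcases h.mem_interior_or (fun H hH _ _ hx' _ => absurd hx' (hxS H hH)) hs hxs with
    h1 | ⟨a, ha, h1⟩
  · exact h1
  · exact absurd h1.1 (hxS _ (h.facet_mem s hs a ha))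

theorem hasGradientAt_nodal (h : IsMeshed Ω K S) (hE : ∀ s, s ∈ E ↔ s ∈ elements K)
    (c : Pt (n + 1) → ℝ) (hx : x ∈ Ω) (hxS : ∀ H ∈ S, x ∉ H) :
    HasGradientAt (nodal K c) (nodalGrad E c x) x := by
  obtain ⟨s, hs, hxs⟩ := h.exists_mem_interior (subset_closure hx) hxS
  rw [nodalGrad_eq ((hE s).2 hs) (_root_.interior_subset hxs) fun t ht hxt =>
    eq_of_mem_interior hs ((hE t).1 ht) hxs hxt]
  refine (hasGradientAt_affine (nodalAff s c) x).congr_of_eventuallyEq ?_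
  filter_upwards [isOpen_interior.mem_nhds hxs] with y hy
  exact nodal_eq hs (_root_.interior_subset hy) c

theorem exists_abs_nodal_le (h : IsMeshed Ω K S) (c : Pt (n + 1) → ℝ) :
    ∃ M, ∀ x ∈ closure Ω, |nodal K c x| ≤ M :=
  h.poly.isCompact_closure.exists_bound_of_continuousOn (h.continuousOn_nodal c)

theorem isFiniteMeasure_bulk (h : IsMeshed Ω K S) : IsFiniteMeasure (bulkMeasure Ω) :=
  ⟨by
    rw [Measure.restrict_apply_univ]
    exact h.poly.isBounded.measure_lt_top⟩

theorem memLp_nodal_bulk (h : IsMeshed Ω K S) (c : Pt (n + 1) → ℝ) :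
    MemLp (nodal K c) 2 (bulkMeasure Ω) := by
  have := h.isFiniteMeasure_bulk
  obtain ⟨M, hM⟩ := h.exists_abs_nodal_le c
  refine MemLp.of_bound (((h.continuousOn_nodal c).mono subset_closure).aestronglyMeasurable
    h.poly.isOpen.measurableSet) M ?_
  filter_upwards [ae_restrict_mem h.poly.isOpen.measurableSet] with x hx
    using hM x (subset_closure hx)

theorem memLp_nodal_surface (h : IsMeshed Ω K S) (c : Pt (n + 1) → ℝ) :
    MemLp (nodal K c) 2 (surfaceMeasure Ω) := by
  have := h.poly.isFiniteMeasure
  obtain ⟨M, hM⟩ := h.exists_abs_nodal_le c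
  refine MemLp.of_bound (((h.continuousOn_nodal c).mono
    frontier_subset_closure).aestronglyMeasurable isClosed_frontier.measurableSet) M ?_
  filter_upwards [ae_restrict_mem isClosed_frontier.measurableSet] with x hx
    using hM x (frontier_subset_closure hx)

theorem memLp_nodalGrad_bulk (h : IsMeshed Ω K S) (c : Pt (n + 1) → ℝ) :
    MemLp (nodalGrad E c) 2 (bulkMeasure Ω) := by
  have := h.isFiniteMeasure_bulk
  obtain ⟨M, hM⟩ := exists_norm_nodalGrad_le E c
  exact MemLp.of_bound (measurable_nodalGrad E c).aestronglyMeasurable M (Eventually.of_forall hM)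

/-- Green's formula for the nodal interpolant. -/
theorem integral_nodal (h : IsMeshed Ω K S) (hE : ∀ s, s ∈ E ↔ s ∈ elements K)
    (c : Pt (n + 1) → ℝ) {φ : Pt (n + 1) → ℝ} (hφ : IsTestFunction φ) :
    IntegrableOn (fun x => nodal K c x • gradient φ x) Ω ∧
    IntegrableOn (fun x => φ x • nodalGrad E c x) Ω ∧
    ∫ x in Ω, (nodal K c x • gradient φ x + φ x • nodalGrad E c x) =
      ∫ x, (φ x * nodal K c x) • outerNormal Ω x ∂(surfaceMeasure Ω) := by
  have := h.isFiniteMeasure_bulk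
  obtain ⟨M, hM⟩ := hφ.exists_bound
  have i1 : IntegrableOn (fun x => nodal K c x • gradient φ x) Ω :=
    ((h.memLp_nodal_bulk c).integrable (by norm_num)).smul_bdd M
      hφ.continuous_gradient.aestronglyMeasurable (Eventually.of_forall fun x => (hM x).2)
  have i2 : IntegrableOn (fun x => φ x • nodalGrad E c x) Ω :=
    ((h.memLp_nodalGrad_bulk (E := E) c).integrable (by norm_num)).bdd_smul M
      hφ.1.continuous.aestronglyMeasurable (Eventually.of_forall fun x => (hM x).1)
  refine ⟨i1, i2, h.poly.integral_gradient (hφ.1.continuous.continuousOn.mul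
    (h.continuousOn_nodal c)) (i1.add i2) fun x hx hxS => ?_⟩
  have := hasGradientAt_mul (hφ.hasGradientAt x) (h.hasGradientAt_nodal hE c hx hxS)
  rwa [add_comm (nodal K c x • gradient φ x)]

theorem hasWeakGradient_nodal (h : IsMeshed Ω K S) (hE : ∀ s, s ∈ E ↔ s ∈ elements K)
    (c : Pt (n + 1) → ℝ) : HasWeakGradient Ω (nodal K c) (nodalGrad E c) := by
  intro φ hφ hsupp
  obtain ⟨i1, i2, h3⟩ := h.integral_nodal hE c hφ
  rw [integral_add i1 i2] at h3
  have h4 : ∫ x, (φ x * nodal K c x) • outerNormal Ω x ∂(surfaceMeasure Ω) = 0 := by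
    refine setIntegral_eq_zero_of_forall_eq_zero fun x hx => ?_
    have : x ∉ Ω := by
      have := hx.2
      rwa [h.poly.isOpen.interior_eq] at this
    rw [image_eq_zero_of_notMem_tsupport fun h => this (hsupp h)]
    simp
  rw [h4] at h3
  exact eq_neg_of_add_eq_zero_left h3

theorem isPiecewiseLinear_nodal (h : IsMeshed Ω K S) (c : Pt (n + 1) → ℝ) :
    IsPiecewiseLinear K (nodal K c) := by
  classical
  refine ⟨h.tri.2 ▸ h.continuousOn_nodal c, fun t ht => ?_⟩
  -- the barycentre of a face lies in an element, which then contains the face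
  have htne : t.Nonempty := K.nonempty_of_mem_faces ht
  obtain ⟨s, hs, hxs⟩ := h.exists_element (h.tri.2 ▸ K.convexHull_subset_space ht
    (Finset.centroid_mem_convexHull (R := ℝ) t htne))
  suffices hts : t ⊆ s from ⟨nodalAff s c, fun x hx => nodal_eq hs (convexHull_mono hts hx) c⟩
  have h1 := K.inter_subset_convexHull ht hs.1
    ⟨Finset.centroid_mem_convexHull (R := ℝ) t htne, hxs⟩
  intro v hv
  by_contra hvs
  have hsub : ((t : Set (Pt (n + 1))) ∩ s) ⊆ (t.erase v : Finset (Pt (n + 1))) := by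
    rintro a ⟨ha, has⟩
    exact Finset.mem_coe.2 (Finset.mem_erase.2 ⟨fun h => hvs (h ▸ has), ha⟩)
  obtain ⟨w, hw0, hw1, hw2⟩ := Finset.mem_convexHull'.1 (convexHull_mono hsub h1)
  have hcent : Finset.centroid ℝ t id = ∑ a ∈ t, (t.card : ℝ)⁻¹ • a := by
    rw [Finset.centroid_def, Finset.affineCombination_eq_linear_combination _ _ _
      (t.sum_centroidWeights_eq_one_of_nonempty ℝ htne)]
    simp
  have hcard : (t.card : ℝ) ≠ 0 := by
    exact_mod_cast (Finset.card_pos.2 htne).ne'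
  have hind := (affineIndependent_iff.1 (K.indep ht)) t.attach
    (fun a => (t.card : ℝ)⁻¹ - if (a : Pt (n + 1)) = v then 0 else w a) ?_ ?_ ⟨v, hv⟩
    (Finset.mem_attach _ _)
  · simp only [if_true, sub_zero] at hind
    exact hcard (inv_eq_zero.1 hind)
  · rw [Finset.sum_attach t (fun a => (t.card : ℝ)⁻¹ - if a = v then 0 else w a),
      Finset.sum_sub_distrib, ← Finset.add_sum_erase t (fun a => if a = v then 0 else w a) hv]
    have : ∑ a ∈ t.erase v, (if a = v then 0 else w a) = ∑ a ∈ t.erase v, w a :=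
      Finset.sum_congr rfl fun a ha => if_neg (Finset.ne_of_mem_erase ha)
    rw [this, hw1]
    simp [hcard]
  · rw [Finset.sum_attach t (fun a => ((t.card : ℝ)⁻¹ - if a = v then 0 else w a) • a)]
    simp_rw [sub_smul]
    rw [Finset.sum_sub_distrib, ← hcent,
      ← Finset.add_sum_erase t (fun a => (if a = v then (0 : ℝ) else w a) • a) hv]
    have : ∑ a ∈ t.erase v, (if a = v then (0 : ℝ) else w a) • a = ∑ a ∈ t.erase v, w a • a :=
      Finset.sum_congr rfl fun a ha => by rw [if_neg (Finset.ne_of_mem_erase ha)]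
    rw [this, hw2]
    simp

end IsMeshed

end

section

/-! ### The surface gradient of the nodal interpolant -/

theorem IsTestFunction.gradient_apply {φ : Pt d → ℝ} (hφ : IsTestFunction φ) (j : Fin d) :
    IsTestFunction (fun x => gradient φ x j) := by
  refine ⟨?_, ?_⟩
  · exact (EuclideanSpace.proj (𝕜 := ℝ) j).contDiff.comp hφ.contDiff_gradient
  · refine HasCompactSupport.of_support_subset_isCompact hφ.2 fun x hx => ?_
    refine IsTestFunction.tsupport_gradient (subset_tsupport _ fun h0 => hx ?_)
    simp only [h0, PiLp.zero_apply]

theorem IsTestFunction.gradient_gradient_symm {φ : Pt d → ℝ} (hφ : IsTestFunction φ) (i j : Fin d)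
    (x : Pt d) :
    gradient (fun x => gradient φ x j) x i = gradient (fun x => gradient φ x i) x j := by
  have hcoord : ∀ (f : Pt d → ℝ) (x : Pt d) (i : Fin d),
      gradient f x i = fderiv ℝ f x (EuclideanSpace.single i 1) := by
    intro f x i
    have h1 : gradient f x i = inner ℝ (gradient f x) (EuclideanSpace.single i (1 : ℝ)) := by
      rw [EuclideanSpace.inner_single_right]
      simp
    rw [h1, gradient, InnerProductSpace.toDual_symm_apply]
  have hdiff : DifferentiableAt ℝ (fderiv ℝ φ) x :=
    ((hφ.1.fderiv_right (m := ∞) (by simp)).differentiable (by simp)) x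
  have h2 : ∀ i j : Fin d, gradient (fun x => gradient φ x j) x i =
      fderiv ℝ (fderiv ℝ φ) x (EuclideanSpace.single i 1) (EuclideanSpace.single j 1) := by
    intro i j
    rw [hcoord]
    simp_rw [hcoord]
    rw [fderiv_clm_apply hdiff (differentiableAt_const _)]
    simp
  rw [h2, h2]
  have hs : IsSymmSndFDerivAt ℝ φ x :=
    (hφ.1.contDiffAt).isSymmSndFDerivAt (by
      rw [minSmoothness_of_isRCLikeNormedField]
      exact WithTop.coe_le_coe.2 le_top)
  exact hs _ _

theorem affGrad_eq_of_forall {A B : Pt d →ᵃ[ℝ] ℝ} (h : ∀ y, A y = B y) : affGrad A = affGrad B := by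
  rw [AffineMap.ext h]

namespace IsMeshed

variable {n : ℕ} {Ω : Set (Pt (n + 1))} {K : Geometry.SimplicialComplex ℝ (Pt (n + 1))}
  {S : Finset (Set (Pt (n + 1)))} {s t : Finset (Pt (n + 1))} {x : Pt (n + 1)}
  {E : Finset (Finset (Pt (n + 1)))}

/-- The interior of an element is itself a polyhedral open set. -/
theorem isPolyhedralOpen_element (h : IsMeshed Ω K S) (hs : s ∈ elements K) :
    IsPolyhedralOpen (interior (convexHull ℝ (s : Set (Pt (n + 1))))) S := by
  have hss := isSimplex_of_mem_elements hs
  have hne : (interior (convexHull ℝ (s : Set (Pt (n + 1))))).Nonempty := by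
    rw [interior_convexHull_nonempty_iff_affineSpan_eq_top]
    have h1 := hss.1.affineSpan_eq_top_iff_card_eq_finrank_add_one
    rw [Subtype.range_coe_subtype] at h1
    simpa using h1.2 (by simp [hss.2])
  have hcl : closure (interior (convexHull ℝ (s : Set (Pt (n + 1))))) =
      convexHull ℝ (s : Set (Pt (n + 1))) := by
    rw [(convex_convexHull ℝ _).closure_interior_eq_closure_of_nonempty_interior hne,
      (isClosed_convexHull s).closure_eq]
  refine ⟨isOpen_interior, ?_, by rw [hcl], h.poly.hyperplane, fun x hx => ?_⟩
  · exact (isBounded_convexHull.2 s.finite_toSet.isBounded).subset _root_.interior_subset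
  · have h1 : x ∈ convexHull ℝ (s : Set (Pt (n + 1))) := hcl ▸ hx.1
    have h2 : ¬ ∀ a ∈ s, 0 < bary s a x := fun h2 => hx.2 (by
      rw [isOpen_interior.interior_eq]
      exact hss.mem_interior_iff.2 h2)
    push Not at h2
    obtain ⟨a, ha, h3⟩ := h2
    exact ⟨_, h.facet_mem s hs a ha, le_antisymm h3 (hss.mem_convexHull_iff.1 h1 a ha)⟩

theorem frontier_element (s : Finset (Pt (n + 1))) :
    frontier (interior (convexHull ℝ (s : Set (Pt (n + 1))))) ⊆
      convexHull ℝ (s : Set (Pt (n + 1))) :=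
  fun _ hx => closure_minimal _root_.interior_subset (isClosed_convexHull s) hx.1

theorem isOuterNormal_element (hs : s ∈ elements K) {a : Pt (n + 1)} (ha : a ∈ s)
    (hx : x ∈ relFacet s a) :
    IsOuterNormal (interior (convexHull ℝ (s : Set (Pt (n + 1))))) x (facetNormal s a) := by
  have hss := isSimplex_of_mem_elements hs
  refine ⟨norm_facetNormal hss (Nat.succ_pos n) ha, ?_⟩
  have hev : ∀ᶠ y in 𝓝 x, ∀ c ∈ s, c ≠ a → 0 < bary s c y := by
    refine (Filter.eventually_all_finset s).2 fun c hc => ?_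
    by_cases hca : c = a
    · simp [hca]
    · filter_upwards [(continuous_affine (bary s c)).continuousAt.eventually
        (lt_mem_nhds (hx.2 c hc hca))] with y hy _ using hy
  obtain ⟨r, hr, hball⟩ := Metric.eventually_nhds_iff_ball.1 hev
  refine ⟨r, hr, fun y hy => ?_⟩
  rw [inner_facetNormal_neg_iff hss (Nat.succ_pos n) ha hx.1, hss.mem_interior_iff]
  refine ⟨fun h => h a ha, fun hpos c hc => ?_⟩
  by_cases hca : c = a
  · rwa [hca]
  · exact hball y hy c hc hca

theorem _root_.DynBC.IsOuterNormal.mem_frontier {Ω : Set (Pt d)} {x ν : Pt d}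
    (h : IsOuterNormal Ω x ν) : x ∈ frontier Ω := by
  obtain ⟨hν, r, hr, hball⟩ := h
  have hxΩ : x ∉ Ω := fun hx => by
    have := (hball x (Metric.mem_ball_self hr)).1 hx
    rw [sub_self, inner_zero_left] at this
    exact lt_irrefl _ this
  refine ⟨?_, fun hx => hxΩ (_root_.interior_subset hx)⟩
  rw [mem_closure_iff_nhds]
  intro U hU
  have hc : Tendsto (fun t : ℝ => x + (-t) • ν) (𝓝[>] 0) (𝓝 x) := by
    have : Tendsto (fun t : ℝ => x + (-t) • ν) (𝓝 0) (𝓝 (x + (-(0 : ℝ)) • ν)) :=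
      Continuous.tendsto (by fun_prop) 0
    rw [neg_zero, zero_smul, add_zero] at this
    exact this.mono_left nhdsWithin_le_nhds
  obtain ⟨t, ⟨h1, h2⟩, ht⟩ := (((hc.eventually hU).and
    (hc.eventually (Metric.ball_mem_nhds x hr))).and self_mem_nhdsWithin).exists
  replace ht : 0 < t := ht
  refine ⟨_, h1, (hball _ h2).2 ?_⟩
  rw [add_sub_cancel_left, inner_smul_left, real_inner_self_eq_norm_sq, hν]
  simpa using ht

/-- At a generic point of the boundary there is exactly one element, and it touches the boundary in
a boundary facet. -/
theorem exists_boundaryFacet (h : IsMeshed Ω K S) (hx : IsGeneric S x) (hxf : x ∈ frontier Ω) :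
    ∃ s ∈ elements K, ∃ a ∈ s, IsBoundaryFacet K s a ∧ x ∈ relFacet s a ∧
      ∀ t ∈ elements K, x ∈ convexHull ℝ (t : Set (Pt (n + 1))) → t = s := by
  have hxΩ : x ∉ Ω := by
    have := hxf.2
    rwa [h.poly.isOpen.interior_eq] at this
  obtain ⟨s, hs, hxs⟩ := h.exists_element hxf.1
  rcases h.mem_interior_or hx hs hxs with h1 | ⟨a, ha, h1⟩
  · exact absurd (h.interior_subset hs h1) hxΩ
  · have hbd : IsBoundaryFacet K s a := by
      intro t ht hfac
      by_contra hne
      exact hxΩ (h.mem_of_not_isBoundaryFacet hs ha ht hne hfac h1)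
    exact ⟨s, hs, a, ha, hbd, h1, fun t ht hxt => hbd t ht (facet_subset_of_mem hs ht h1 hxt)⟩

/-- The gradients of the nodal interpolant on two neighbours differ by a normal vector. -/
theorem affGrad_nodalAff_sub (hs : s ∈ elements K) {a b : Pt (n + 1)} (ha : a ∈ s)
    (ht : t ∈ elements K) (hfac : ∀ b ∈ s, b ≠ a → b ∈ t) (hneg : bary s a b < 0)
    (hmul : ∀ y, bary s a y = bary s a b * bary t b y) (c : Pt (n + 1) → ℝ) :
    facetNormal t b = -facetNormal s a ∧
    ∃ m : ℝ, affGrad (nodalAff s c) - affGrad (nodalAff t c) = m • facetNormal s a := by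
  have hss := isSimplex_of_mem_elements hs
  have hne : ‖affGrad (bary s a)‖ ≠ 0 :=
    norm_ne_zero_iff.2 (hss.affGrad_bary_ne_zero (Nat.succ_pos n) ha)
  constructor
  · have h1 : affGrad (bary s a) = bary s a b • affGrad (bary t b) := by
      rw [← affGrad_smul]
      exact affGrad_eq_of_forall fun y => hmul y
    have hne' : ‖affGrad (bary t b)‖ ≠ 0 := fun h0 => by
      rw [h1, norm_smul, h0, mul_zero] at hne
      exact hne rfl
    rw [facetNormal, facetNormal, h1, norm_smul, Real.norm_eq_abs, abs_of_neg hneg, smul_smul,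
      ← neg_smul, neg_neg]
    congr 1
    field_simp
    rw [div_self hneg.ne]
  · refine ⟨-((c a - nodalAff t c a) * ‖affGrad (bary s a)‖), ?_⟩
    have h1 : affGrad (nodalAff s c) - affGrad (nodalAff t c) =
        (c a - nodalAff t c a) • affGrad (bary s a) := by
      rw [← affGrad_sub, ← affGrad_smul]
      refine affGrad_eq_of_forall fun y => ?_
      change nodalAff s c y - nodalAff t c y = (c a - nodalAff t c a) * bary s a y
      rw [hss.affine_apply (nodalAff t c) y, nodalAff_apply, ← Finset.sum_sub_distrib,
        Finset.sum_eq_single a]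
      · ring
      · intro b' hb' hba
        rw [nodalAff_vertex (isSimplex_of_mem_elements ht) c (hfac b' hb' hba)]
        ring
      · exact fun h => absurd ha h
    rw [h1, facetNormal, neg_smul, smul_neg, neg_neg, smul_smul, mul_assoc, mul_inv_cancel₀ hne,
      mul_one]

/-- In the sum over all elements the contributions of the inner facets cancel. -/
theorem sum_indicator_frontier (h : IsMeshed Ω K S) (hE : ∀ s, s ∈ E ↔ s ∈ elements K)
    (c : Pt (n + 1) → ℝ) (hx : IsGeneric S x) (i j : Fin (n + 1)) :
    ∑ s ∈ E, (frontier (interior (convexHull ℝ (s : Set (Pt (n + 1)))))).indicator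
      (fun x => affGrad (nodalAff s c) i *
          outerNormal (interior (convexHull ℝ (s : Set (Pt (n + 1))))) x j -
        affGrad (nodalAff s c) j *
          outerNormal (interior (convexHull ℝ (s : Set (Pt (n + 1))))) x i) x =
      (frontier Ω).indicator (fun x => nodalGrad E c x i * outerNormal Ω x j -
        nodalGrad E c x j * outerNormal Ω x i) x := by
  classical
  set f : Finset (Pt (n + 1)) → ℝ := fun s =>
    (frontier (interior (convexHull ℝ (s : Set (Pt (n + 1)))))).indicator
      (fun x => affGrad (nodalAff s c) i *
          outerNormal (interior (convexHull ℝ (s : Set (Pt (n + 1))))) x j -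
        affGrad (nodalAff s c) j *
          outerNormal (interior (convexHull ℝ (s : Set (Pt (n + 1))))) x i) x with hf
  change ∑ s ∈ E, f s = _
  have hf0 : ∀ s ∈ elements K, x ∉ convexHull ℝ (s : Set (Pt (n + 1))) → f s = 0 :=
    fun s hs hxs => indicator_of_notMem (fun hx' => hxs (frontier_element s hx')) _
  have hf1 : ∀ s ∈ elements K, ∀ a ∈ s, x ∈ relFacet s a → f s =
      affGrad (nodalAff s c) i * facetNormal s a j -
        affGrad (nodalAff s c) j * facetNormal s a i := by
    intro s hs a ha hxa
    have hn := isOuterNormal_element hs ha hxa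
    simp only [hf]
    rw [indicator_of_mem hn.mem_frontier, hn.outerNormal_eq]
  by_cases hxf : x ∈ frontier Ω
  · -- At a boundary point only one element contributes.
    obtain ⟨s, hs, a, ha, hbd, hxa, hu⟩ := h.exists_boundaryFacet hx hxf
    have hss := isSimplex_of_mem_elements hs
    rw [Finset.sum_eq_single s, indicator_of_mem hxf, hf1 s hs a ha hxa,
      (h.isOuterNormal_facet hs ha hbd hxa).outerNormal_eq,
      nodalGrad_eq ((hE s).2 hs) (relFacet_subset hss a hxa) fun t ht hxt => hu t ((hE t).1 ht) hxt]
    · exact fun t ht hts => hf0 t ((hE t).1 ht) fun hxt => hts (hu t ((hE t).1 ht) hxt)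
    · exact fun hs' => absurd ((hE s).2 hs) hs'
  · rw [indicator_of_notMem hxf]
    by_cases hex : ∃ s ∈ elements K, ∃ a ∈ s, x ∈ relFacet s a
    · obtain ⟨s, hs, a, ha, hxa⟩ := hex
      have hss := isSimplex_of_mem_elements hs
      have hbd : ¬ IsBoundaryFacet K s a := fun hbd =>
        hxf (h.isOuterNormal_facet hs ha hbd hxa).mem_frontier
      unfold IsBoundaryFacet at hbd
      push Not at hbd
      obtain ⟨t, ht, hfac, hts⟩ := hbd
      obtain ⟨b, hbt, hbs, hneg, hmul, hxb⟩ := exists_neighbour hs ha ht hts hfac hxa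
      have htt := isSimplex_of_mem_elements ht
      have hxt := relFacet_subset htt b hxb
      rw [Finset.sum_eq_add_of_mem s t ((hE s).2 hs) ((hE t).2 ht) hts.symm, hf1 s hs a ha hxa,
        hf1 t ht b hbt hxb]
      · -- The normals are opposite, and a jump in the direction of the normal does not change the
        -- antisymmetric expression.
        obtain ⟨hn, m, hm⟩ := affGrad_nodalAff_sub hs ha ht hfac hneg hmul c
        rw [sub_eq_iff_eq_add] at hm
        rw [hn, hm]
        simp only [PiLp.add_apply, PiLp.smul_apply, PiLp.neg_apply, smul_eq_mul]
        ring
      · intro t' ht' hne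
        refine hf0 t' ((hE t').1 ht') fun hxt' => hne.2 ?_
        exact neighbour_unique hs ha ht hts hxa hxt ((hE t').1 ht') hne.1 hxt'
    · refine Finset.sum_eq_zero fun s hs => ?_
      have hs' := (hE s).1 hs
      by_cases hxs : x ∈ convexHull ℝ (s : Set (Pt (n + 1)))
      · rcases h.mem_interior_or hx hs' hxs with h1 | ⟨a, ha, h1⟩
        · refine indicator_of_notMem (fun hx' => hx'.2 ?_) _
          rwa [isOpen_interior.interior_eq]
        · exact absurd ⟨s, hs', a, ha, h1⟩ hex
      · exact hf0 s hs' hxs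

end IsMeshed

end

section

theorem integral_apply {α : Type*} [MeasurableSpace α] {μ : Measure α} {V : α → Pt d}
    (hV : Integrable V μ) (i : Fin d) : (∫ x, V x ∂μ) i = ∫ x, V x i ∂μ :=
  ((EuclideanSpace.proj (𝕜 := ℝ) i).integral_comp_comm hV).symm

theorem integrable_apply {α : Type*} [MeasurableSpace α] {μ : Measure α} {V : α → Pt d}
    (hV : Integrable V μ) (i : Fin d) : Integrable (fun x => V x i) μ :=
  (EuclideanSpace.proj (𝕜 := ℝ) i).integrable_comp hV

/-- The tangential part of the gradient of the nodal interpolant. -/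
def nodalSurfGrad (Ω : Set (Pt d)) (E : Finset (Finset (Pt d))) (c : Pt d → ℝ) (x : Pt d) : Pt d :=
  nodalGrad E c x - inner ℝ (nodalGrad E c x) (outerNormal Ω x) • outerNormal Ω x

namespace IsMeshed

variable {n : ℕ} {Ω : Set (Pt (n + 1))} {K : Geometry.SimplicialComplex ℝ (Pt (n + 1))}
  {S : Finset (Set (Pt (n + 1)))} {s t : Finset (Pt (n + 1))} {x : Pt (n + 1)}
  {E : Finset (Finset (Pt (n + 1)))}

theorem integral_inter_element (h : IsMeshed Ω K S) (hs : s ∈ elements K)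
    (f : Pt (n + 1) → ℝ) : ∫ x in Ω ∩ convexHull ℝ (s : Set (Pt (n + 1))), f x =
      ∫ x in interior (convexHull ℝ (s : Set (Pt (n + 1)))), f x := by
  refine setIntegral_congr_set ?_
  have h0 : (volume : Measure (Pt (n + 1))) (frontier (convexHull ℝ (s : Set (Pt (n + 1))))) = 0 :=
    (convex_convexHull ℝ _).addHaar_frontier volume
  refine (ae_eq_set).2 ⟨measure_mono_null ?_ h0, ?_⟩
  · rintro x ⟨⟨-, h1⟩, h2⟩
    exact ⟨subset_closure h1, h2⟩
  · rw [sdiff_eq_empty.2 (subset_inter (h.interior_subset hs) _root_.interior_subset),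
      measure_empty]

/-- Integration by parts on the boundary for the nodal interpolant. Green's formula turns the
boundary integral into a bulk integral, in which the second derivatives of the test function cancel;
on each element the gradient is constant and the divergence theorem applies again. -/
theorem integral_surface_nodal (h : IsMeshed Ω K S) (hE : ∀ s, s ∈ E ↔ s ∈ elements K)
    (c : Pt (n + 1) → ℝ) {φ : Pt (n + 1) → ℝ} (hφ : IsTestFunction φ) (i j : Fin (n + 1)) :
    ∫ x, nodal K c x * (outerNormal Ω x i * gradient φ x j - outerNormal Ω x j * gradient φ x i)
        ∂(surfaceMeasure Ω) =
      - ∫ x, φ x * (outerNormal Ω x i * nodalGrad E c x j - outerNormal Ω x j * nodalGrad E c x i)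
        ∂(surfaceMeasure Ω) := by
  classical
  -- Green's formula with the partial derivative `∂_j φ` as the test function.
  have green : ∀ i j : Fin (n + 1),
      IntegrableOn (fun x => gradient φ x j * nodalGrad E c x i) Ω ∧
      IntegrableOn (fun x => nodal K c x * gradient (fun y => gradient φ y j) x i) Ω ∧
      Integrable (fun x => gradient φ x j * nodal K c x * outerNormal Ω x i) (surfaceMeasure Ω) ∧
      (∫ x in Ω, nodal K c x * gradient (fun y => gradient φ y j) x i) +
        (∫ x in Ω, gradient φ x j * nodalGrad E c x i) =
      ∫ x, gradient φ x j * nodal K c x * outerNormal Ω x i ∂(surfaceMeasure Ω) := by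
    intro i j
    have hj := hφ.gradient_apply j
    obtain ⟨i1, i2, h3⟩ := h.integral_nodal hE c hj
    have i3 : Integrable (fun x => (gradient φ x j * nodal K c x) • outerNormal Ω x)
        (surfaceMeasure Ω) := h.poly.integrable_smul_outerNormal
      (hj.1.continuous.continuousOn.mul (h.continuousOn_nodal c))
    have h4 := congrArg (fun v : Pt (n + 1) => v i) h3
    simp only at h4
    rw [integral_add i1 i2, PiLp.add_apply, integral_apply i1, integral_apply i2,
      integral_apply i3] at h4
    exact ⟨integrable_apply i2 i, integrable_apply i1 i, integrable_apply i3 i, h4⟩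
  obtain ⟨a1, a2, a3, a4⟩ := green i j
  obtain ⟨b1, b2, b3, b4⟩ := green j i
  have hsymm : ∫ x in Ω, nodal K c x * gradient (fun y => gradient φ y j) x i =
      ∫ x in Ω, nodal K c x * gradient (fun y => gradient φ y i) x j := by
    simp_rw [hφ.gradient_gradient_symm i j]
  have e1 : ∫ x, nodal K c x * (outerNormal Ω x i * gradient φ x j -
      outerNormal Ω x j * gradient φ x i) ∂(surfaceMeasure Ω) =
      (∫ x in Ω, gradient φ x j * nodalGrad E c x i) -
        ∫ x in Ω, gradient φ x i * nodalGrad E c x j := by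
    have : ∫ x, nodal K c x * (outerNormal Ω x i * gradient φ x j -
        outerNormal Ω x j * gradient φ x i) ∂(surfaceMeasure Ω) =
        (∫ x, gradient φ x j * nodal K c x * outerNormal Ω x i ∂(surfaceMeasure Ω)) -
        ∫ x, gradient φ x i * nodal K c x * outerNormal Ω x j ∂(surfaceMeasure Ω) := by
      rw [← integral_sub a3 b3]
      exact integral_congr_ae (Eventually.of_forall fun x => by simp only; ring)
    rw [this, ← a4, ← b4, hsymm]
    ring
  -- the bulk integrals, element by element
  have hcomp : ∀ (i : Fin (n + 1)) (x : Pt (n + 1)), nodalGrad E c x i =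
      ∑ s ∈ E, (convexHull ℝ (s : Set (Pt (n + 1)))).indicator
        (fun _ => affGrad (nodalAff s c) i) x := by
    intro i x
    rw [nodalGrad, WithLp.ofLp_sum, Finset.sum_apply]
    refine Finset.sum_congr rfl fun s _ => ?_
    by_cases hx : x ∈ convexHull ℝ (s : Set (Pt (n + 1))) <;> simp [hx]
  have hdφ : ∀ (j : Fin (n + 1)) (s : Set (Pt (n + 1))), Bornology.IsBounded s →
      IntegrableOn (fun x => gradient φ x j) s := fun j s _ =>
    ((hφ.gradient_apply j).1.continuous.integrable_of_hasCompactSupport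
      (hφ.gradient_apply j).2).integrableOn
  have bulk : ∀ i j : Fin (n + 1), ∫ x in Ω, gradient φ x j * nodalGrad E c x i =
      ∑ s ∈ E, affGrad (nodalAff s c) i *
        ∫ x in frontier (interior (convexHull ℝ (s : Set (Pt (n + 1))))), φ x *
          outerNormal (interior (convexHull ℝ (s : Set (Pt (n + 1))))) x j
          ∂(Measure.euclideanHausdorffMeasure n) := by
    intro i j
    have hterm : ∀ (s : Finset (Pt (n + 1))) (x : Pt (n + 1)), gradient φ x j *
        (convexHull ℝ (s : Set (Pt (n + 1)))).indicator (fun _ => affGrad (nodalAff s c) i) x =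
        (convexHull ℝ (s : Set (Pt (n + 1)))).indicator
          (fun x => gradient φ x j * affGrad (nodalAff s c) i) x := by
      intro s x
      by_cases hx : x ∈ convexHull ℝ (s : Set (Pt (n + 1))) <;> simp [hx]
    simp_rw [hcomp, Finset.mul_sum, hterm]
    rw [integral_finsetSum]
    · refine Finset.sum_congr rfl fun s hs => ?_
      have hse := (hE s).1 hs
      rw [setIntegral_indicator (isClosed_convexHull s).measurableSet,
        h.integral_inter_element hse, integral_mul_const, mul_comm]
      congr 1
      have hps := h.isPolyhedralOpen_element hse
      have hgi : IntegrableOn (gradient φ) (interior (convexHull ℝ (s : Set (Pt (n + 1))))) :=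
        (hφ.continuous_gradient.continuousOn.integrableOn_compact
          hps.isCompact_closure).mono_set subset_closure
      have hd := hps.integral_gradient hφ.1.continuous.continuousOn hgi
        fun x _ _ => hφ.hasGradientAt x
      have hd' := congrArg (fun v : Pt (n + 1) => v j) hd
      simp only at hd'
      rw [integral_apply hgi, integral_apply (hps.integrable_smul_outerNormal
        hφ.1.continuous.continuousOn)] at hd'
      exact hd'
    · intro s _
      exact (((hdφ j Ω h.poly.isBounded).mul_const _).indicator
        (isClosed_convexHull s).measurableSet)
  -- collect the contributions of all facets
  let f : Finset (Pt (n + 1)) → Pt (n + 1) → ℝ := fun s =>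
    (frontier (interior (convexHull ℝ (s : Set (Pt (n + 1)))))).indicator
      (fun x => affGrad (nodalAff s c) i *
          outerNormal (interior (convexHull ℝ (s : Set (Pt (n + 1))))) x j -
        affGrad (nodalAff s c) j *
          outerNormal (interior (convexHull ℝ (s : Set (Pt (n + 1))))) x i)
  have hfint : ∀ s ∈ E, Integrable (fun x => φ x * f s x) (Measure.euclideanHausdorffMeasure n) ∧
      ∫ x, φ x * f s x ∂(Measure.euclideanHausdorffMeasure n) =
        affGrad (nodalAff s c) i * (∫ x in frontier (interior (convexHull ℝ
          (s : Set (Pt (n + 1))))), φ x * outerNormal (interior (convexHull ℝ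
            (s : Set (Pt (n + 1))))) x j ∂(Measure.euclideanHausdorffMeasure n)) -
        affGrad (nodalAff s c) j * (∫ x in frontier (interior (convexHull ℝ
          (s : Set (Pt (n + 1))))), φ x * outerNormal (interior (convexHull ℝ
            (s : Set (Pt (n + 1))))) x i ∂(Measure.euclideanHausdorffMeasure n)) := by
    intro s hs
    have hps := h.isPolyhedralOpen_element ((hE s).1 hs)
    have hint := hps.integrable_smul_outerNormal (g := φ) hφ.1.continuous.continuousOn
    have hj : IntegrableOn (fun x => φ x * outerNormal (interior (convexHull ℝ
        (s : Set (Pt (n + 1))))) x j) (frontier (interior (convexHull ℝ (s : Set (Pt (n + 1))))))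
        (Measure.euclideanHausdorffMeasure n) := integrable_apply hint j
    have hi : IntegrableOn (fun x => φ x * outerNormal (interior (convexHull ℝ
        (s : Set (Pt (n + 1))))) x i) (frontier (interior (convexHull ℝ (s : Set (Pt (n + 1))))))
        (Measure.euclideanHausdorffMeasure n) := integrable_apply hint i
    have heq : (fun x => φ x * f s x) =
        (frontier (interior (convexHull ℝ (s : Set (Pt (n + 1)))))).indicator (fun x =>
          affGrad (nodalAff s c) i * (φ x *
            outerNormal (interior (convexHull ℝ (s : Set (Pt (n + 1))))) x j) -
          affGrad (nodalAff s c) j * (φ x *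
            outerNormal (interior (convexHull ℝ (s : Set (Pt (n + 1))))) x i)) := by
      funext x
      by_cases hx : x ∈ frontier (interior (convexHull ℝ (s : Set (Pt (n + 1)))))
      · simp only [f, indicator_of_mem hx]
        ring
      · simp only [f, indicator_of_notMem hx, mul_zero]
    rw [heq]
    refine ⟨(integrable_indicator_iff isClosed_frontier.measurableSet).2
      ((hj.const_mul _).sub (hi.const_mul _)), ?_⟩
    rw [integral_indicator isClosed_frontier.measurableSet, integral_sub (hj.const_mul _)
      (hi.const_mul _), integral_const_mul, integral_const_mul]
  rw [e1, bulk i j, bulk j i, ← Finset.sum_sub_distrib,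
    ← Finset.sum_congr rfl fun s hs => (hfint s hs).2,
    ← integral_finsetSum _ fun s hs => (hfint s hs).1]
  have hae : ∀ᵐ x ∂(Measure.euclideanHausdorffMeasure n : Measure (Pt (n + 1))),
      ∑ s ∈ E, φ x * f s x = (frontier Ω).indicator (fun x => φ x * (nodalGrad E c x i *
        outerNormal Ω x j - nodalGrad E c x j * outerNormal Ω x i)) x := by
    filter_upwards [DynBC.ae_isGeneric h.poly.hyperplane] with x hx
    rw [← Finset.mul_sum, h.sum_indicator_frontier hE c hx i j]
    by_cases hxf : x ∈ frontier Ω <;> simp [hxf]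
  rw [integral_congr_ae hae, integral_indicator isClosed_frontier.measurableSet, ← integral_neg]
  exact integral_congr_ae (Eventually.of_forall fun x => by simp only; ring)

theorem hasSurfaceGradientOn_nodal (h : IsMeshed Ω K S) (hE : ∀ s, s ∈ E ↔ s ∈ elements K)
    (c : Pt (n + 1) → ℝ) :
    HasSurfaceGradientOn Ω univ (nodal K c) (nodalSurfGrad Ω E c) := by
  constructor
  · filter_upwards [h.poly.ae_mem_openFaces] with x hx
    rw [nodalSurfGrad, inner_sub_left, inner_smul_left, real_inner_self_eq_norm_sq, hx.1]
    simp
  · intro φ hφ _ i j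
    rw [h.integral_surface_nodal hE c hφ i j]
    congr 1
    refine integral_congr_ae (Eventually.of_forall fun x => ?_)
    simp only [nodalSurfGrad, PiLp.sub_apply, PiLp.smul_apply, smul_eq_mul]
    ring

theorem memLp_nodalSurfGrad (h : IsMeshed Ω K S) (c : Pt (n + 1) → ℝ) :
    MemLp (nodalSurfGrad Ω E c) 2 (surfaceMeasure Ω) := by
  have := h.poly.isFiniteMeasure
  obtain ⟨M, hM⟩ := exists_norm_nodalGrad_le E c
  have hν := h.poly.aestronglyMeasurable_outerNormal
  have hG : AEStronglyMeasurable (nodalGrad E c) (surfaceMeasure Ω) :=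
    (measurable_nodalGrad E c).aestronglyMeasurable
  have hm : AEStronglyMeasurable (nodalSurfGrad Ω E c) (surfaceMeasure Ω) :=
    hG.sub ((hG.inner (𝕜 := ℝ) hν).smul hν)
  refine MemLp.of_bound hm (M + M) (Eventually.of_forall fun x => ?_)
  refine (norm_sub_le _ _).trans (add_le_add (hM x) ?_)
  rw [norm_smul]
  have h1 := norm_outerNormal_le Ω x
  refine (mul_le_of_le_one_right (norm_nonneg _) h1).trans ((norm_inner_le_norm _ _).trans ?_)
  exact (mul_le_of_le_one_right (norm_nonneg _) h1).trans (hM x)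

/-- The nodal interpolant, with its gradient, trace and surface gradient, is a finite element
function. -/
theorem exists_mem_feSpace (h : IsMeshed Ω K S) (hE : ∀ s, s ∈ E ↔ s ∈ elements K)
    (c : Pt (n + 1) → ℝ) (β : ℝ) : ∃ W ∈ feSpace Ω β K,
      val W =ᵐ[bulkMeasure Ω] nodal K c ∧ grad W =ᵐ[bulkMeasure Ω] nodalGrad E c ∧
      tr W =ᵐ[surfaceMeasure Ω] nodal K c ∧
      (β ≠ 0 → surfGrad W =ᵐ[surfaceMeasure Ω] nodalSurfGrad Ω E c) ∧
      (β = 0 → surfGrad W = 0) := by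
  classical
  let V := (h.memLp_nodal_bulk c).toLp
  let G := (h.memLp_nodalGrad_bulk (E := E) c).toLp
  let R := (h.memLp_nodal_surface c).toLp
  let P := (h.memLp_nodalSurfGrad (E := E) c).toLp
  have hV : V =ᵐ[bulkMeasure Ω] nodal K c := MemLp.coeFn_toLp _
  have hG : G =ᵐ[bulkMeasure Ω] nodalGrad E c := MemLp.coeFn_toLp _
  have hR : R =ᵐ[surfaceMeasure Ω] nodal K c := MemLp.coeFn_toLp _
  have hP : P =ᵐ[surfaceMeasure Ω] nodalSurfGrad Ω E c := MemLp.coeFn_toLp _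
  refine ⟨(V, G, R, if β = 0 then 0 else P), ⟨⟨?_, ?_, ?_, ?_⟩, nodal K c,
    h.isPiecewiseLinear_nodal c, hV⟩, hV, hG, hR, ?_, ?_⟩
  · intro φ hφ hsupp
    have h1 := h.hasWeakGradient_nodal hE c φ hφ hsupp
    rw [integral_congr_ae (g := fun x => nodal K c x • gradient φ x)
        (by filter_upwards [hV] with x hx; rw [← hx]), h1,
      integral_congr_ae (g := fun x => φ x • G x)
        (by filter_upwards [hG] with x hx; rw [← hx])]
  · intro φ hφ
    have h1 := (h.integral_nodal hE c hφ).2.2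
    rw [integral_congr_ae (g := fun x => nodal K c x • gradient φ x + φ x • nodalGrad E c x)
        (by filter_upwards [hV, hG] with x hx hx'; rw [← hx, ← hx']), h1,
      integral_congr_ae (g := fun x => (φ x * R x) • outerNormal Ω x)
        (by filter_upwards [hR] with x hx; rw [← hx])]
  · intro hβ
    obtain ⟨h1, h2⟩ := h.hasSurfaceGradientOn_nodal hE c
    simp only [surfGrad, if_neg hβ]
    refine ⟨by filter_upwards [h1, hP] with x hx hx'; rwa [hx'], fun φ hφ hs i j => ?_⟩
    have h3 := h2 φ hφ hs i j
    rw [integral_congr_ae (g := fun x => nodal K c x *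
        (outerNormal Ω x i * gradient φ x j - outerNormal Ω x j * gradient φ x i))
        (by filter_upwards [hR] with x hx; rw [← hx]), h3]
    congr 1
    exact integral_congr_ae (by filter_upwards [hP] with x hx; rw [← hx])
  · intro hβ
    simp [hβ]
  · intro hβ
    simpa [hβ] using hP
  · intro hβ
    simp [hβ]

end IsMeshed

end

section

/-! ### Taylor's formula and its remainder in `L_q` -/

/-- `w` is twice differentiable at the points of `O`, with gradient `G` and Hessian `H`. The Hessian
is given by the gradients of the components `⟪G ·, z⟫`. -/
structure IsC2On (O : Set (Pt d)) (w : Pt d → ℝ) (G : Pt d → Pt d) (H : Pt d → Pt d →L[ℝ] Pt d) :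
    Prop where
  grad : ∀ x ∈ O, HasGradientAt w (G x) x
  hess : ∀ x ∈ O, ∀ z, HasGradientAt (fun y => inner ℝ (G y) z) (H x z) x
  cont : Continuous H

/-- The remainder of the first order Taylor expansion about `y`, evaluated at `a`. -/
def taylorRem (w : Pt d → ℝ) (G : Pt d → Pt d) (a y : Pt d) : ℝ :=
  w a - w y - inner ℝ (G y) (a - y)

theorem IsC2On.mono {O O' : Set (Pt d)} {w : Pt d → ℝ} {G : Pt d → Pt d}
    {H : Pt d → Pt d →L[ℝ] Pt d} (h : IsC2On O w G H) (hO : O' ⊆ O) : IsC2On O' w G H :=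
  ⟨fun x hx => h.grad x (hO hx), fun x hx => h.hess x (hO hx), h.cont⟩

theorem IsC2On.sub {O : Set (Pt d)} {w w' : Pt d → ℝ} {G G' : Pt d → Pt d}
    {H H' : Pt d → Pt d →L[ℝ] Pt d} (h : IsC2On O w G H) (h' : IsC2On O w' G' H') :
    IsC2On O (fun x => w x - w' x) (fun x => G x - G' x) (fun x => H x - H' x) := by
  refine ⟨fun x hx => ?_, fun x hx z => ?_, h.cont.sub h'.cont⟩
  · rw [hasGradientAt_iff_hasFDerivAt, map_sub]
    exact (h.grad x hx).hasFDerivAt.sub (h'.grad x hx).hasFDerivAt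
  · rw [hasGradientAt_iff_hasFDerivAt, _root_.sub_apply, map_sub]
    simp_rw [inner_sub_left]
    exact (h.hess x hx z).hasFDerivAt.sub (h'.hess x hx z).hasFDerivAt

/-- The integral form of the remainder, on a segment parametrised from the point of evaluation. -/
theorem IsC2On.taylorRem_eq {O : Set (Pt d)} {w : Pt d → ℝ} {G : Pt d → Pt d}
    {H : Pt d → Pt d →L[ℝ] Pt d} (h : IsC2On O w G H) {a y : Pt d}
    (hO : ∀ τ ∈ Icc (0 : ℝ) 1, a + τ • (y - a) ∈ O) :
    taylorRem w G a y =
      ∫ τ in (0 : ℝ)..1, τ * inner ℝ (H (a + τ • (y - a)) (y - a)) (y - a) := by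
  have hp : ∀ τ : ℝ, HasDerivAt (fun τ : ℝ => a + τ • (y - a)) (y - a) τ := fun τ => by
    simpa using ((hasDerivAt_id τ).smul_const (y - a)).const_add a
  have hder : ∀ τ ∈ uIcc (0 : ℝ) 1, HasDerivAt
      (fun τ : ℝ => τ * inner ℝ (G (a + τ • (y - a))) (y - a) - w (a + τ • (y - a)))
      (τ * inner ℝ (H (a + τ • (y - a)) (y - a)) (y - a)) τ := by
    intro τ hτ
    rw [uIcc_of_le zero_le_one] at hτ
    have h1 := (h.grad _ (hO τ hτ)).hasFDerivAt.comp_hasDerivAt τ (hp τ)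
    have h2 := (h.hess _ (hO τ hτ) (y - a)).hasFDerivAt.comp_hasDerivAt τ (hp τ)
    have h3 := ((hasDerivAt_id τ).mul h2).sub h1
    refine h3.congr_deriv ?_
    simp [InnerProductSpace.toDual_apply_apply, -map_sub]
  have hcont : Continuous
      (fun τ : ℝ => τ * inner ℝ (H (a + τ • (y - a)) (y - a)) (y - a)) := by
    have := h.cont
    fun_prop
  have hftc := intervalIntegral.integral_eq_sub_of_hasDerivAt hder (hcont.intervalIntegrable 0 1)
  rw [hftc, taylorRem, ← neg_sub y a, inner_neg_right]
  simp
  ring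

theorem IsC2On.enorm_taylorRem_le {O : Set (Pt d)} {w : Pt d → ℝ} {G : Pt d → Pt d}
    {H : Pt d → Pt d →L[ℝ] Pt d} (h : IsC2On O w G H) {a y : Pt d} {l : ℝ} (hl : dist a y ≤ l)
    (hO : ∀ τ ∈ Icc (0 : ℝ) 1, a + τ • (y - a) ∈ O) :
    ‖taylorRem w G a y‖ₑ ≤ ENNReal.ofReal (l ^ 2) *
      ∫⁻ τ in Ioc (0 : ℝ) 1, ENNReal.ofReal τ * ‖H (a + τ • (y - a))‖ₑ := by
  rw [h.taylorRem_eq hO, intervalIntegral.integral_of_le zero_le_one,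
    ← lintegral_const_mul' _ _ ENNReal.ofReal_ne_top]
  refine (enorm_integral_le_lintegral_enorm _).trans (setLIntegral_mono' measurableSet_Ioc ?_)
  intro τ hτ
  rw [← ofReal_norm, ← ofReal_norm, ← ENNReal.ofReal_mul hτ.1.le,
    ← ENNReal.ofReal_mul (sq_nonneg l)]
  refine ENNReal.ofReal_le_ofReal ?_
  rw [norm_mul, Real.norm_of_nonneg hτ.1.le]
  have h1 : ‖y - a‖ ≤ l := by rwa [← dist_eq_norm, dist_comm]
  have h2 : ‖inner ℝ (H (a + τ • (y - a)) (y - a)) (y - a)‖ ≤ ‖H (a + τ • (y - a))‖ * l ^ 2 := by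
    refine (norm_inner_le_norm _ _).trans ?_
    calc _ ≤ ‖H (a + τ • (y - a))‖ * ‖y - a‖ * ‖y - a‖ := by gcongr; exact (H _).le_opNorm _
      _ = ‖H (a + τ • (y - a))‖ * ‖y - a‖ ^ 2 := by ring
      _ ≤ _ := by gcongr
  nlinarith [mul_le_mul_of_nonneg_left h2 hτ.1.le]

theorem lintegral_ofReal_rpow_lt_top {r : ℝ} (hr : -1 < r) :
    ∫⁻ τ in Ioc (0 : ℝ) 1, ENNReal.ofReal (τ ^ r) < ⊤ := by
  have h := (intervalIntegral.intervalIntegrable_rpow' (a := 0) (b := 1) hr)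
  rw [intervalIntegrable_iff_integrableOn_Ioc_of_le zero_le_one] at h
  exact h.lintegral_lt_top

/-- Homotheties towards `a` with ratio `τ` contract volume by the factor `τ ^ d`. -/
theorem lintegral_homothety {ψ : Pt d → ℝ≥0∞} (hψ : Measurable ψ) (a : Pt d) {τ : ℝ} (hτ : 0 < τ) :
    ∫⁻ y, ψ (a + τ • (y - a)) = ENNReal.ofReal (τ ^ (-(d : ℝ))) * ∫⁻ y, ψ y := by
  rw [lintegral_sub_right_eq_self (fun y => ψ (a + τ • y)) a]
  have h1 : ∫⁻ y : Pt d, ψ (a + τ • y) = ∫⁻ y, ψ (a + y) ∂(volume.map (τ • · : Pt d → Pt d)) := by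
    rw [lintegral_map (by fun_prop) (by fun_prop)]
  rw [h1, Measure.map_addHaar_smul _ hτ.ne', lintegral_smul_measure,
    lintegral_add_left_eq_self (fun y => ψ y) a, smul_eq_mul, Real.rpow_neg hτ.le,
    Real.rpow_natCast, finrank_euclideanSpace, Fintype.card_fin, abs_of_pos (by positivity)]

/-- The averages `∫₀¹ τ ψ(a + τ (y - a)) dτ` are bounded in `L_q` by `ψ`, if `q > d / 2`. -/
theorem exists_lintegral_segment_le (d : ℕ) {q : ℝ} (hq : 1 < q) (hdq : (d : ℝ) < 2 * q) :
    ∃ C : ℝ≥0∞, C ≠ ⊤ ∧ ∀ (B P : Set (Pt d)) (a : Pt d) (ψ : Pt d → ℝ≥0∞), MeasurableSet B →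
      MeasurableSet P → Measurable ψ → (∀ y ∈ B, ∀ τ ∈ Ioc (0 : ℝ) 1, a + τ • (y - a) ∈ P) →
      ∫⁻ y in B, (∫⁻ τ in Ioc (0 : ℝ) 1, ENNReal.ofReal τ * ψ (a + τ • (y - a))) ^ q ≤
        C * ∫⁻ y in P, ψ y ^ q := by
  -- any exponent strictly between `d - 1` and `2 * q - 1` may serve as the weight in Hölder's
  -- inequality
  set e : ℝ := d / 2 + q - 1 with he
  have hq0 : 0 < q := by linarith
  have hc : q.HolderConjugate (q / (q - 1)) := Real.HolderConjugate.conjExponent hq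
  set q' := q / (q - 1) with hq'
  have hr : -1 < (1 - e / q) * q' := by
    have : (1 - e / q) * q' = (q - e) / (q - 1) := by
      have : q - 1 ≠ 0 := by linarith
      rw [hq']
      field_simp
    rw [this, lt_div_iff₀ (by linarith)]
    linarith
  set A := ∫⁻ τ in Ioc (0 : ℝ) 1, ENNReal.ofReal (τ ^ ((1 - e / q) * q')) with hA
  set D := ∫⁻ τ in Ioc (0 : ℝ) 1, ENNReal.ofReal (τ ^ (e - d)) with hD
  have hAt : A ≠ ⊤ := (lintegral_ofReal_rpow_lt_top hr).ne
  have hDt : D ≠ ⊤ := (lintegral_ofReal_rpow_lt_top (by linarith)).ne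
  refine ⟨A ^ (q / q') * D, ENNReal.mul_ne_top (ENNReal.rpow_ne_top_of_nonneg
    (div_nonneg hq0.le hc.symm.nonneg) hAt) hDt, ?_⟩
  intro B P a ψ hB hP hψ hseg
  -- Hölder's inequality for `τ = τ ^ (1 - e / q) * τ ^ (e / q)`.
  have hstep : ∀ y, (∫⁻ τ in Ioc (0 : ℝ) 1, ENNReal.ofReal τ * ψ (a + τ • (y - a))) ^ q ≤
      A ^ (q / q') *
        ∫⁻ τ in Ioc (0 : ℝ) 1, ENNReal.ofReal (τ ^ e) * ψ (a + τ • (y - a)) ^ q := by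
    intro y
    have h1 : ∫⁻ τ in Ioc (0 : ℝ) 1, ENNReal.ofReal τ * ψ (a + τ • (y - a)) =
        ∫⁻ τ in Ioc (0 : ℝ) 1, ((fun τ => ENNReal.ofReal (τ ^ (1 - e / q))) *
          fun τ => ENNReal.ofReal (τ ^ (e / q)) * ψ (a + τ • (y - a))) τ := by
      refine setLIntegral_congr_fun measurableSet_Ioc fun τ hτ => ?_
      simp only [Pi.mul_apply]
      rw [← mul_assoc, ← ENNReal.ofReal_mul (Real.rpow_nonneg hτ.1.le _), ← Real.rpow_add hτ.1]
      simp
    rw [h1]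
    refine (ENNReal.rpow_le_rpow (ENNReal.lintegral_mul_le_Lp_mul_Lq _ hc.symm ?_ ?_)
      hq0.le).trans (le_of_eq ?_)
    · fun_prop
    · fun_prop
    · rw [ENNReal.mul_rpow_of_nonneg _ _ hq0.le, ← ENNReal.rpow_mul, ← ENNReal.rpow_mul,
        one_div_mul_cancel hq0.ne', ENNReal.rpow_one, one_div_mul_eq_div]
      refine congrArg₂ (· * ·) (congrArg (· ^ (q / q')) ?_) ?_
      · refine setLIntegral_congr_fun measurableSet_Ioc fun τ hτ => ?_
        rw [ENNReal.ofReal_rpow_of_nonneg (Real.rpow_nonneg hτ.1.le _) hc.symm.nonneg,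
          ← Real.rpow_mul hτ.1.le]
      · refine setLIntegral_congr_fun measurableSet_Ioc fun τ hτ => ?_
        rw [ENNReal.mul_rpow_of_nonneg _ _ hq0.le,
          ENNReal.ofReal_rpow_of_nonneg (Real.rpow_nonneg hτ.1.le _) hq0.le,
          ← Real.rpow_mul hτ.1.le, div_mul_cancel₀ _ hq0.ne']
  have hψm : Measurable (Function.uncurry fun (y : Pt d) (τ : ℝ) =>
      ENNReal.ofReal (τ ^ e) * ψ (a + τ • (y - a)) ^ q) := by
    unfold Function.uncurry
    fun_prop
  -- After exchanging the integrals, the substitution `a + τ • (y - a)` costs the factor `τ ^ (-d)`,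
  -- and `τ ^ (e - d)` is integrable.
  calc _ ≤ ∫⁻ y in B, A ^ (q / q') *
        ∫⁻ τ in Ioc (0 : ℝ) 1, ENNReal.ofReal (τ ^ e) * ψ (a + τ • (y - a)) ^ q :=
        lintegral_mono fun y => hstep y
    _ = A ^ (q / q') * ∫⁻ τ in Ioc (0 : ℝ) 1, ∫⁻ y in B,
          ENNReal.ofReal (τ ^ e) * ψ (a + τ • (y - a)) ^ q := by
        rw [lintegral_const_mul' _ _ (ENNReal.rpow_ne_top_of_nonneg
          (div_nonneg hq0.le hc.symm.nonneg) hAt), lintegral_lintegral_swap hψm.aemeasurable]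
    _ ≤ A ^ (q / q') * ∫⁻ τ in Ioc (0 : ℝ) 1,
          ENNReal.ofReal (τ ^ (e - d)) * ∫⁻ y in P, ψ y ^ q := by
        refine mul_le_mul' le_rfl ?_
        refine setLIntegral_mono' measurableSet_Ioc fun τ hτ => ?_
        rw [lintegral_const_mul' _ _ ENNReal.ofReal_ne_top, sub_eq_add_neg, Real.rpow_add hτ.1,
          ENNReal.ofReal_mul (Real.rpow_nonneg hτ.1.le _), mul_assoc,
          ← lintegral_indicator hP, ← lintegral_homothety ((hψ.pow_const q).indicator hP) a hτ.1]
        refine mul_le_mul' le_rfl ?_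
        rw [← lintegral_indicator hB]
        refine lintegral_mono fun y => ?_
        by_cases hy : y ∈ B
        · rw [indicator_of_mem hy, indicator_of_mem (hseg y hy τ hτ)]
        · rw [indicator_of_notMem hy]
          exact zero_le
    _ = _ := by
        rw [lintegral_mul_const _ (by fun_prop), mul_assoc]

/-- The remainder of the first order Taylor expansion is bounded in `L_q`, as a function of the
point of expansion, by the second derivatives; `q > d / 2` makes the constant finite. -/
theorem exists_eLpNorm_taylorRem_le (d : ℕ) {q : ℝ} (hq : 1 < q) (hdq : (d : ℝ) < 2 * q) :
    ∃ C : ℝ≥0, ∀ (B P : Set (Pt d)) (a : Pt d) (w : Pt d → ℝ) (G : Pt d → Pt d)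
      (H : Pt d → Pt d →L[ℝ] Pt d) (l : ℝ), MeasurableSet B → MeasurableSet P →
      IsC2On (insert a P) w G H → (∀ y ∈ B, ∀ τ ∈ Ioc (0 : ℝ) 1, a + τ • (y - a) ∈ P) →
      (∀ y ∈ B, dist a y ≤ l) →
      eLpNorm (taylorRem w G a) (ENNReal.ofReal q) (volume.restrict B) ≤
        C * ENNReal.ofReal (l ^ 2) * eLpNorm H (ENNReal.ofReal q) (volume.restrict P) := by
  have hq0 : 0 < q := by linarith
  obtain ⟨C, hC, hle⟩ := exists_lintegral_segment_le d hq hdq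
  refine ⟨(C ^ (1 / q)).toNNReal, fun B P a w G H l hB hP hw hseg hdist => ?_⟩
  rw [ENNReal.coe_toNNReal (ENNReal.rpow_ne_top_of_nonneg (by positivity) hC)]
  have hq1 : ENNReal.ofReal q ≠ 0 := by simpa using hq0
  rw [eLpNorm_eq_lintegral_rpow_enorm_toReal hq1 ENNReal.ofReal_ne_top,
    eLpNorm_eq_lintegral_rpow_enorm_toReal hq1 ENNReal.ofReal_ne_top, ENNReal.toReal_ofReal hq0.le]
  calc _ ≤ (∫⁻ y in B, (ENNReal.ofReal (l ^ 2) * ∫⁻ τ in Ioc (0 : ℝ) 1,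
          ENNReal.ofReal τ * ‖H (a + τ • (y - a))‖ₑ) ^ q) ^ (1 / q) := by
        gcongr ?_ ^ _
        refine setLIntegral_mono' hB fun y hy => ?_
        gcongr
        refine hw.enorm_taylorRem_le (hdist y hy) fun τ hτ => ?_
        rcases hτ.1.eq_or_lt with h0 | h0
        · left
          simp [← h0]
        · exact Or.inr (hseg y hy τ ⟨h0, hτ.2⟩)
    _ = ENNReal.ofReal (l ^ 2) * (∫⁻ y in B, (∫⁻ τ in Ioc (0 : ℝ) 1,
          ENNReal.ofReal τ * ‖H (a + τ • (y - a))‖ₑ) ^ q) ^ (1 / q) := by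
        simp_rw [ENNReal.mul_rpow_of_nonneg _ _ hq0.le]
        rw [lintegral_const_mul' _ _ (ENNReal.rpow_ne_top_of_nonneg hq0.le ENNReal.ofReal_ne_top),
          ENNReal.mul_rpow_of_nonneg _ _ (by positivity), ← ENNReal.rpow_mul,
          mul_one_div_cancel hq0.ne', ENNReal.rpow_one]
    _ ≤ ENNReal.ofReal (l ^ 2) * (C * ∫⁻ y in P, ‖H y‖ₑ ^ q) ^ (1 / q) := by
        refine mul_le_mul' le_rfl (ENNReal.rpow_le_rpow ?_ (by positivity))
        exact hle B P a _ hB hP hw.cont.enorm.measurable hseg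
    _ = _ := by
        rw [ENNReal.mul_rpow_of_nonneg _ _ (by positivity)]
        ring

end

section

/-! ### Mollification -/

/-- A smooth probability density supported in the ball of radius `η` about the origin; it need not
be centred, so that functions can be averaged over points of a domain only. -/
structure IsMollifier (k : Pt d → ℝ) (η : ℝ) : Prop where
  isTestFunction : IsTestFunction k
  nonneg : ∀ x, 0 ≤ k x
  integral_eq_one : ∫ x, k x = 1
  tsupport_subset : tsupport k ⊆ Metric.closedBall 0 η

theorem exists_isMollifier (c : Pt d) {r : ℝ} (hr : 0 < r) :
    ∃ k : Pt d → ℝ, tsupport k = Metric.closedBall c r ∧ ∀ η, ‖c‖ + r ≤ η → IsMollifier k η := by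
  let f : ContDiffBump c := ⟨r / 2, r, by positivity, by linarith⟩
  refine ⟨f.normed volume, f.tsupport_normed_eq, fun η hη =>
    ⟨⟨f.contDiff_normed, f.hasCompactSupport_normed⟩, f.nonneg_normed, f.integral_normed, ?_⟩⟩
  rw [f.tsupport_normed_eq]
  refine Metric.closedBall_subset_closedBall' ?_
  rw [dist_zero_right]
  exact (add_comm _ _).trans_le hη

/-- The convolution of the kernel `k` with `f`, extended by zero from `Ω`. -/
def mollify {F : Type*} [NormedAddCommGroup F] [NormedSpace ℝ F] (Ω : Set (Pt d)) (k : Pt d → ℝ)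
    (f : Pt d → F) : Pt d → F :=
  convolution (Ω.indicator f) k (ContinuousLinearMap.lsmul ℝ ℝ).flip volume

/-- Translations are continuous in `L_q`. -/
theorem exists_eLpNorm_translate_le {F : Type*} [NormedAddCommGroup F] {q : ℝ≥0∞} (hq : 1 ≤ q)
    (hqt : q ≠ ⊤) (f : Lp F q (volume : Measure (Pt d)))
    {ε : ℝ≥0∞} (hε : 0 < ε) : ∃ η > 0, ∀ z : Pt d, ‖z‖ < η →
      eLpNorm (fun x => f (x - z) - f x) q volume ≤ ε := by
  have : Fact (1 ≤ q) := ⟨hq⟩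
  have : Fact (q ≠ ⊤) := ⟨hqt⟩
  have hcont : Continuous fun z : Pt d => DomAddAct.mk z +ᵥ f :=
    (DomAddAct.continuous_mk).vadd continuous_const
  have h0 : Tendsto (fun z : Pt d => edist (DomAddAct.mk z +ᵥ f) f) (𝓝 0) (𝓝 0) := by
    have h1 := (hcont.edist (continuous_const (y := f))).tendsto (0 : Pt d)
    simpa using h1
  obtain ⟨η, hη, hball⟩ := Metric.eventually_nhds_iff.1 (h0.eventually (ge_mem_nhds hε))
  refine ⟨η, hη, fun z hz => ?_⟩
  have h1 := hball (y := -z) (by simpa using hz)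
  rw [Lp.edist_def] at h1
  refine le_trans (le_of_eq (eLpNorm_congr_ae ?_)) h1
  filter_upwards [DomAddAct.vadd_Lp_ae_eq (DomAddAct.mk (-z)) f] with x hx
  simp only [Pi.sub_apply]
  rw [hx]
  simp [sub_eq_neg_add]

section Mollify

variable {F : Type*} [NormedAddCommGroup F] [NormedSpace ℝ F] {k : Pt d → ℝ} {f : Pt d → F}

theorem mollify_apply (hΩ : MeasurableSet Ω) (k : Pt d → ℝ) (f : Pt d → F) (x : Pt d) :
    mollify Ω k f x = ∫ y in Ω, k (x - y) • f y := by
  rw [← integral_indicator hΩ]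
  refine integral_congr_ae (Eventually.of_forall fun y => ?_)
  by_cases hy : y ∈ Ω <;> simp [hy]

theorem continuous_mollify (hk : IsTestFunction k) (hΩ : MeasurableSet Ω)
    (hf : IntegrableOn f Ω) : Continuous (mollify Ω k f) :=
  hk.2.continuous_convolution_right _ ((integrable_indicator_iff hΩ).2 hf).locallyIntegrable
    hk.1.continuous

theorem integrableOn_mollify (hk : IsTestFunction k) (hf : IntegrableOn f Ω) (x : Pt d) :
    IntegrableOn (fun y => k (x - y) • f y) Ω := by
  obtain ⟨M, hM⟩ := hk.1.continuous.bounded_above_of_compact_support hk.2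
  have h1 := hk.1.continuous
  have h2 : Continuous fun y : Pt d => k (x - y) := by fun_prop
  exact Integrable.bdd_smul hf M h2.aestronglyMeasurable (Eventually.of_forall fun y => hM _)

theorem IsTestFunction.comp_sub (hk : IsTestFunction k) (x : Pt d) :
    IsTestFunction (fun y => k (x - y)) ∧ (∀ y, gradient (fun y => k (x - y)) y =
      -gradient k (x - y)) ∧ ∀ y ∈ tsupport (fun y => k (x - y)), x - y ∈ tsupport k := by
  have hcont : Continuous fun y : Pt d => x - y := by fun_prop
  have hsup : ∀ y ∈ tsupport (fun y => k (x - y)), x - y ∈ tsupport k := fun y hy =>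
    tsupport_comp_subset_preimage k hcont hy
  refine ⟨⟨hk.1.comp (contDiff_const.sub contDiff_id), ?_⟩, fun y => ?_, hsup⟩
  · refine HasCompactSupport.of_support_subset_isCompact
      (K := (fun z => x - z) '' tsupport k) (hk.2.isCompact.image (by fun_prop)) fun y hy => ?_
    exact ⟨x - y, hsup y (subset_tsupport _ hy), by simp⟩
  · refine HasGradientAt.gradient ?_
    have h1 := (hk.hasGradientAt (x - y)).hasFDerivAt.comp y
      ((hasFDerivAt_const x y).sub (hasFDerivAt_id y))
    rw [hasGradientAt_iff_hasFDerivAt]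
    refine h1.congr_fderiv ?_
    ext z
    simp

/-- Mollification commutes with weak derivatives at points whose averaging region lies in `Ω`. -/
theorem hasGradientAt_mollify (hk : IsTestFunction k) (hΩ : MeasurableSet Ω) {v : Pt d → ℝ}
    {g : Pt d → Pt d} (hv : IntegrableOn v Ω) (h : HasWeakGradient Ω v g)
    {x : Pt d} (hx : ∀ z ∈ tsupport k, x - z ∈ Ω) :
    HasGradientAt (mollify Ω k v) (mollify Ω k g x) x := by
  have hvl : LocallyIntegrable (Ω.indicator v) volume :=
    ((integrable_indicator_iff hΩ).2 hv).locallyIntegrable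
  have h1 := hk.2.hasFDerivAt_convolution_right (ContinuousLinearMap.lsmul ℝ ℝ).flip hvl
    (hk.1.of_le (by simp)) x
  rw [hasGradientAt_iff_hasFDerivAt]
  refine h1.congr_fderiv ?_
  obtain ⟨t1, t2, t3⟩ := hk.comp_sub x
  have hw := h _ t1 fun y hy => by simpa using hx _ (t3 y hy)
  simp_rw [t2] at hw
  ext z
  rw [convolution_precompR_apply _ hvl (hk.2.fderiv ℝ) (hk.1.continuous_fderiv (by simp)),
    InnerProductSpace.toDual_apply_apply, mollify_apply hΩ]
  have hw' := neg_eq_iff_eq_neg.2 hw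
  rw [← hw', inner_neg_left, real_inner_comm, ← integral_inner, ← integral_neg,
    ← integral_indicator hΩ]
  · refine integral_congr_ae (Eventually.of_forall fun y => ?_)
    by_cases hy : y ∈ Ω
    · simp [hy, inner_smul_right, inner_neg_right, mul_comm]
    · simp [hy]
  · obtain ⟨M, hM⟩ := hk.exists_bound
    have hc := hk.continuous_gradient
    have h2 : Continuous fun y : Pt d => -gradient k (x - y) := by fun_prop
    exact Integrable.smul_bdd hv M h2.aestronglyMeasurable
      (Eventually.of_forall fun y => by rw [norm_neg]; exact (hM _).2)

/-- The mollification of a function with two weak derivatives is twice differentiable. -/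
theorem isC2On_mollify (hk : IsTestFunction k) (hΩ : MeasurableSet Ω) {v : Pt d → ℝ}
    {g : Pt d → Pt d} {H : Pt d → Pt d →L[ℝ] Pt d} (hv : IntegrableOn v Ω) (hg : IntegrableOn g Ω)
    (hH : IntegrableOn H Ω) (h : HasWeakGradient Ω v g)
    (h2 : ∀ z, HasWeakGradient Ω (fun x => inner ℝ (g x) z) (fun x => H x z)) :
    IsC2On {x | ∀ z ∈ tsupport k, x - z ∈ Ω} (mollify Ω k v) (mollify Ω k g) (mollify Ω k H) := by
  refine ⟨fun x hx => hasGradientAt_mollify hk hΩ hv h hx, fun x hx z => ?_,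
    continuous_mollify hk hΩ hH⟩
  have e1 : (fun y => inner ℝ (mollify Ω k g y) z) = mollify Ω k (fun x => inner ℝ (g x) z) := by
    funext y
    rw [mollify_apply hΩ, mollify_apply hΩ, real_inner_comm,
      ← integral_inner (integrableOn_mollify hk hg y)]
    simp only [inner_smul_right, real_inner_comm z, smul_eq_mul]
  have e2 : mollify Ω k H x z = mollify Ω k (fun x => H x z) x := by
    rw [mollify_apply hΩ, mollify_apply hΩ,
      ContinuousLinearMap.integral_apply (integrableOn_mollify hk hH x)]
    simp
  rw [e1, e2]
  exact hasGradientAt_mollify hk hΩ (hg.inner_const z) (h2 z) hx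

theorem mollify_congr {f' : Pt d → F}
    (hf : Ω.indicator f =ᵐ[volume] f') (k : Pt d → ℝ) (x : Pt d) :
    mollify Ω k f x = ∫ z, k z • f' (x - z) := by
  have h1 : mollify Ω k f x = ∫ y, k (x - y) • f' y :=
    integral_congr_ae (by filter_upwards [hf] with y hy; simp [hy])
  rw [h1, ← integral_sub_left_eq_self _ volume x]
  simp

/-- Mollifications converge in `L_q`. By Jensen's inequality, the error is at most the largest
`L_q` distance of `f` to its translates by vectors in the support of the kernel. -/
theorem exists_eLpNorm_mollify_sub_le [CompleteSpace F] {q : ℝ≥0∞} (hq : 1 ≤ q) (hqt : q ≠ ⊤)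
    (hΩ : MeasurableSet Ω) (hf : MemLp f q (volume.restrict Ω)) {ε : ℝ≥0∞} (hε : 0 < ε) :
    ∃ η > 0, ∀ k, IsMollifier k η →
      eLpNorm (fun x => mollify Ω k f x - Ω.indicator f x) q volume ≤ ε := by
  have hF : MemLp (Ω.indicator f) q volume := (memLp_indicator_iff_restrict hΩ).2 hf
  set f0 : Lp F q (volume : Measure (Pt d)) := hF.toLp with hf0
  have hae : Ω.indicator f =ᵐ[volume] f0 := hF.coeFn_toLp.symm
  obtain ⟨η, hη, htr⟩ := exists_eLpNorm_translate_le hq hqt f0 hε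
  refine ⟨η / 2, half_pos hη, fun k hk => ?_⟩
  have hq0 : q ≠ 0 := (zero_lt_one.trans_le hq).ne'
  set r := q.toReal with hr
  have hr1 : 1 ≤ r := by rw [hr, ← ENNReal.toReal_one]; exact ENNReal.toReal_mono hqt hq
  have hr0 : 0 < r := by linarith
  have hsm : StronglyMeasurable f0 := Lp.stronglyMeasurable f0
  have hkc := hk.isTestFunction.1.continuous
  -- The kernel is the density of a probability measure.
  set P : Measure (Pt d) := volume.withDensity fun z => ENNReal.ofReal (k z) with hP
  have hki : Integrable k := hkc.integrable_of_hasCompactSupport hk.isTestFunction.2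
  have : IsProbabilityMeasure P := ⟨by
    rw [hP, withDensity_apply _ MeasurableSet.univ, Measure.restrict_univ,
      ← ofReal_integral_eq_lintegral_ofReal hki (Eventually.of_forall hk.nonneg),
      hk.integral_eq_one, ENNReal.ofReal_one]⟩
  have hloc : LocallyIntegrable f0 volume := (Lp.memLp f0).locallyIntegrable hq
  have hjoint : StronglyMeasurable fun p : Pt d × Pt d => f0 (p.1 - p.2) - f0 p.1 :=
    (hsm.comp_measurable (by fun_prop)).sub (hsm.comp_measurable measurable_fst)
  have hpt : ∀ x, ‖mollify Ω k f x - f0 x‖ₑ ^ r ≤ ∫⁻ z, ‖f0 (x - z) - f0 x‖ₑ ^ r ∂P := by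
    intro x
    have hsec : StronglyMeasurable fun z => f0 (x - z) - f0 x :=
      hjoint.comp_measurable (by fun_prop : Measurable fun z : Pt d => (x, z))
    have e1 : mollify Ω k f x - f0 x = ∫ z, k z • (f0 (x - z) - f0 x) := by
      have hex : Integrable fun z => k z • f0 (x - z) :=
        hk.isTestFunction.2.convolutionExists_left (ContinuousLinearMap.lsmul ℝ ℝ) hkc hloc x
      simp_rw [smul_sub]
      rw [mollify_congr hae, integral_sub hex (hki.smul_const _), integral_smul_const,
        hk.integral_eq_one, one_smul]
    have e2 : ‖mollify Ω k f x - f0 x‖ₑ ≤ ∫⁻ z, ‖f0 (x - z) - f0 x‖ₑ ∂P := by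
      rw [e1, hP, lintegral_withDensity_eq_lintegral_mul _ (by fun_prop) hsec.enorm]
      refine (enorm_integral_le_lintegral_enorm _).trans (lintegral_mono fun z => le_of_eq ?_)
      simp only [Pi.mul_apply]
      rw [enorm_smul, Real.enorm_of_nonneg (hk.nonneg z)]
    refine (ENNReal.rpow_le_rpow e2 hr0.le).trans ?_
    -- Jensen's inequality.
    have hj := eLpNorm'_le_eLpNorm'_of_exponent_le zero_lt_one hr1 P
      hsec.aestronglyMeasurable
    simp only [eLpNorm', ENNReal.rpow_one, div_one, one_div] at hj
    refine (ENNReal.rpow_le_rpow hj hr0.le).trans (le_of_eq ?_)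
    rw [← ENNReal.rpow_mul, inv_mul_cancel₀ hr0.ne', ENNReal.rpow_one]
  rw [eLpNorm_congr_ae (g := fun x => mollify Ω k f x - f0 x)
    (by filter_upwards [hae] with x hx; rw [hx]), eLpNorm_eq_lintegral_rpow_enorm_toReal hq0 hqt,
    ← hr, one_div, ENNReal.rpow_inv_le_iff hr0]
  calc _ ≤ ∫⁻ x, ∫⁻ z, ‖f0 (x - z) - f0 x‖ₑ ^ r ∂P := lintegral_mono hpt
    _ = ∫⁻ z, (∫⁻ x, ‖f0 (x - z) - f0 x‖ₑ ^ r) ∂P :=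
        lintegral_lintegral_swap (hjoint.enorm.pow_const r).aemeasurable
    _ ≤ ∫⁻ _, ε ^ r ∂P := by
        refine lintegral_mono_ae ?_
        have hsupp : ∀ᵐ z ∂P, z ∈ tsupport k := by
          rw [hP, ae_withDensity_iff (by fun_prop)]
          refine Eventually.of_forall fun z hz => subset_tsupport _ fun h0 => hz ?_
          simp [h0]
        filter_upwards [hsupp] with z hz
        have hz' := hk.tsupport_subset hz
        rw [mem_closedBall_zero_iff] at hz'
        have h1 := htr z (by linarith)
        rwa [eLpNorm_eq_lintegral_rpow_enorm_toReal hq0 hqt, ← hr, one_div,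
          ENNReal.rpow_inv_le_iff hr0] at h1
    _ = ε ^ r := by simp

end Mollify

end

section

/-! ### Linear interpolation on a simplex -/

theorem IsMollifier.mono {k : Pt d → ℝ} {η η' : ℝ} (hk : IsMollifier k η) (h : η ≤ η') :
    IsMollifier k η' :=
  ⟨hk.1, hk.2, hk.3, hk.4.trans (Metric.closedBall_subset_closedBall h)⟩

theorem tendsto_eLpNorm_mollify_sub {F : Type*} [NormedAddCommGroup F] [NormedSpace ℝ F]
    [CompleteSpace F] {f : Pt d → F} {q : ℝ≥0∞} (hq : 1 ≤ q) (hqt : q ≠ ⊤)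
    (hΩ : MeasurableSet Ω) (hf : MemLp f q (volume.restrict Ω)) {k : ℕ → Pt d → ℝ} {η : ℕ → ℝ}
    (hk : ∀ n, IsMollifier (k n) (η n)) (hη : Tendsto η atTop (𝓝 0)) :
    Tendsto (fun n => eLpNorm (fun x => mollify Ω (k n) f x - Ω.indicator f x) q volume) atTop
      (𝓝 0) := by
  refine ENNReal.tendsto_nhds_zero.2 fun ε hε => ?_
  obtain ⟨η0, hη0, h⟩ := exists_eLpNorm_mollify_sub_le hq hqt hΩ hf hε
  filter_upwards [hη.eventually (ge_mem_nhds hη0)] with n hn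
  exact h _ ((hk n).mono hn)

theorem eLpNorm_mollify_sub_restrict_le {F : Type*} [NormedAddCommGroup F] [NormedSpace ℝ F]
    {f : Pt d → F} {q : ℝ≥0∞} {k : Pt d → ℝ} {V : Set (Pt d)} (hV : MeasurableSet V)
    (hVΩ : V ⊆ Ω) :
    eLpNorm (fun x => mollify Ω k f x - f x) q (volume.restrict V) ≤
      eLpNorm (fun x => mollify Ω k f x - Ω.indicator f x) q volume := by
  refine le_trans (le_of_eq (eLpNorm_congr_ae ?_)) (eLpNorm_restrict_le _ _ _ V)
  filter_upwards [ae_restrict_mem hV] with x hx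
  rw [indicator_of_mem (hVΩ hx)]

/-- A mollified function is a mean value. -/
theorem abs_mollify_sub_le {f : Pt d → ℝ} {k : Pt d → ℝ} {η : ℝ} (hk : IsMollifier k η)
    (hΩ : MeasurableSet Ω) (hf : IntegrableOn f Ω) {x : Pt d} {c ε : ℝ}
    (h : ∀ z ∈ tsupport k, x - z ∈ Ω ∧ |f (x - z) - c| ≤ ε) : |mollify Ω k f x - c| ≤ ε := by
  have hkc := hk.isTestFunction.1.continuous
  have hki : Integrable k := hkc.integrable_of_hasCompactSupport hk.isTestFunction.2
  have hloc := ((integrable_indicator_iff hΩ).2 hf).locallyIntegrable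
  have hex : Integrable fun z => k z * Ω.indicator f (x - z) :=
    hk.isTestFunction.2.convolutionExists_left (ContinuousLinearMap.lsmul ℝ ℝ) hkc hloc x
  have e1 : mollify Ω k f x - c = ∫ z, k z * (Ω.indicator f (x - z) - c) := by
    rw [mollify_congr (f' := Ω.indicator f) (Eventually.of_forall fun _ => rfl)]
    simp only [smul_eq_mul, mul_sub]
    rw [integral_sub hex (hki.mul_const _), integral_mul_const, hk.integral_eq_one, one_mul]
  have e2 : ε = ∫ z, k z * ε := by rw [integral_mul_const, hk.integral_eq_one, one_mul]
  rw [e1, ← Real.norm_eq_abs, e2]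
  refine norm_integral_le_of_norm_le (hki.mul_const ε) (Eventually.of_forall fun z => ?_)
  by_cases hz : z ∈ tsupport k
  · rw [norm_mul, Real.norm_of_nonneg (hk.nonneg z), indicator_of_mem (h z hz).1]
    exact mul_le_mul_of_nonneg_left (h z hz).2 (hk.nonneg z)
  · rw [image_eq_zero_of_notMem_tsupport hz]
    simp

/-- Bounds on sets that exhaust `U` pass to `U`, by Fatou's lemma. -/
theorem eLpNorm_le_of_exhaustion {F : Type*} [NormedAddCommGroup F] {f : Pt d → F} {q : ℝ≥0∞}
    {U : Set (Pt d)} {V : ℕ → Set (Pt d)} (hU : MeasurableSet U) (hV : ∀ n, MeasurableSet (V n))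
    (hf : AEStronglyMeasurable f (volume.restrict U)) (hev : ∀ x ∈ U, ∀ᶠ n in atTop, x ∈ V n)
    {b : ℕ → ℝ≥0∞} {B : ℝ≥0∞} (hb : ∀ n, eLpNorm f q (volume.restrict (V n)) ≤ b n)
    (hB : Tendsto b atTop (𝓝 B)) : eLpNorm f q (volume.restrict U) ≤ B := by
  have h1 := Lp.eLpNorm_lim_le_liminf_eLpNorm (p := q) (μ := volume.restrict U)
    (f := fun n => (V n).indicator f) (fun n => hf.indicator (hV n)) f (by
      filter_upwards [ae_restrict_mem hU] with x hx
      refine tendsto_const_nhds.congr' ?_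
      filter_upwards [hev x hx] with n hn
      rw [indicator_of_mem hn])
  refine h1.trans ?_
  rw [← hB.liminf_eq]
  refine liminf_le_liminf (Eventually.of_forall fun n => ?_)
  rw [eLpNorm_indicator_eq_eLpNorm_restrict (hV n)]
  exact (eLpNorm_mono_measure f (Measure.restrict_mono_measure Measure.restrict_le_self _)).trans
    (hb n)

/-- Affine functions `lam i` which are the barycentric coordinates of the simplex with vertices
`N i`. -/
structure IsBarycentric {ι : Type*} [Fintype ι] (N : ι → Pt d) (lam : ι → Pt d →ᵃ[ℝ] ℝ) : Prop where
  sum_eq_one : ∀ x, ∑ i, lam i x = 1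
  sum_smul : ∀ x, ∑ i, lam i x • N i = x
  nonneg : ∀ i j, 0 ≤ lam i (N j)

/-- The open simplex with barycentric coordinates `lam i`. -/
def openCell {ι : Type*} (lam : ι → Pt d →ᵃ[ℝ] ℝ) : Set (Pt d) := {x | ∀ i, 0 < lam i x}

/-- The closed simplex with barycentric coordinates `lam i`. -/
def closedCell {ι : Type*} (lam : ι → Pt d →ᵃ[ℝ] ℝ) : Set (Pt d) := {x | ∀ i, 0 ≤ lam i x}

section Barycentric

variable {ι : Type*} {N : ι → Pt d} {lam : ι → Pt d →ᵃ[ℝ] ℝ}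

theorem isOpen_openCell [Finite ι] (lam : ι → Pt d →ᵃ[ℝ] ℝ) : IsOpen (openCell lam) := by
  simp only [openCell, ofPred_forall]
  exact isOpen_iInter_of_finite fun i => isOpen_lt continuous_const (continuous_affine _)

theorem isClosed_closedCell (lam : ι → Pt d →ᵃ[ℝ] ℝ) : IsClosed (closedCell lam) := by
  simp only [closedCell, ofPred_forall]
  exact isClosed_iInter fun i => isClosed_le continuous_const (continuous_affine _)

theorem openCell_subset_closedCell : openCell lam ⊆ closedCell lam := fun _ hx i => (hx i).le

theorem affine_segment (A : Pt d →ᵃ[ℝ] ℝ) (a y : Pt d) (τ : ℝ) :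
    A (a + τ • (y - a)) = (1 - τ) * A a + τ * A y := by
  rw [affine_eq A a (a + τ • (y - a)), affine_eq A a y, add_sub_cancel_left, inner_smul_right]
  ring

theorem segment_mem_openCell {a y : Pt d} (ha : a ∈ closedCell lam) (hy : y ∈ openCell lam) {τ : ℝ}
    (hτ : τ ∈ Ioc (0 : ℝ) 1) : a + τ • (y - a) ∈ openCell lam := by
  intro i
  rw [affine_segment]
  exact add_pos_of_nonneg_of_pos (mul_nonneg (by linarith [hτ.2]) (ha i)) (mul_pos hτ.1 (hy i))

variable [Fintype ι]

namespace IsBarycentric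

theorem mem_closedCell (h : IsBarycentric N lam) (i : ι) : N i ∈ closedCell lam :=
  fun j => h.nonneg j i

theorem sum_inner (h : IsBarycentric N lam) (z : Pt d) : ∑ i, inner ℝ (affGrad (lam i)) z = 0 := by
  have h1 := h.sum_eq_one z
  simp_rw [fun i => affine_eq (lam i) 0 z, Finset.sum_add_distrib, h.sum_eq_one, sub_zero] at h1
  linarith

theorem sum_inner_smul (h : IsBarycentric N lam) (z : Pt d) :
    ∑ i, inner ℝ (affGrad (lam i)) z • N i = z := by
  have h1 := h.sum_smul z
  simp_rw [fun i => affine_eq (lam i) 0 z, add_smul, Finset.sum_add_distrib, h.sum_smul, sub_zero,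
    zero_add] at h1
  exact h1

/-- The error of the gradient in terms of the Taylor remainders at the vertices. -/
theorem sum_taylorRem_smul (h : IsBarycentric N lam) (w : Pt d → ℝ) (G : Pt d → Pt d) (y : Pt d) :
    ∑ i, w (N i) • affGrad (lam i) - G y = ∑ i, taylorRem w G (N i) y • affGrad (lam i) := by
  refine ext_inner_right ℝ fun z => ?_
  have h1 : ∑ i, inner ℝ (affGrad (lam i)) z * inner ℝ (G y) (N i) = inner ℝ (G y) z := by
    conv_rhs => rw [← h.sum_inner_smul z, inner_sum]
    simp_rw [inner_smul_right]
  rw [inner_sub_left, _root_.sum_inner, _root_.sum_inner]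
  have h2 : ∀ i, taylorRem w G (N i) y * inner ℝ (affGrad (lam i)) z =
      w (N i) * inner ℝ (affGrad (lam i)) z - inner ℝ (affGrad (lam i)) z * inner ℝ (G y) (N i) -
        (w y - inner ℝ (G y) y) * inner ℝ (affGrad (lam i)) z := by
    intro i
    rw [taylorRem, inner_sub_right]
    ring
  simp_rw [inner_smul_left, conj_trivial, h2, Finset.sum_sub_distrib, ← Finset.mul_sum,
    h.sum_inner, h1]
  ring

/-- The error of the values in terms of Taylor remainders about an arbitrary point. -/
theorem sub_sum_eq (h : IsBarycentric N lam) (w : Pt d → ℝ) (G : Pt d → Pt d) (a y : Pt d) :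
    w a - ∑ i, lam i a * w (N i) =
      taylorRem w G a y - ∑ i, lam i a * taylorRem w G (N i) y := by
  have h1 : ∑ i, lam i a * inner ℝ (G y) (N i) = inner ℝ (G y) a := by
    conv_rhs => rw [← h.sum_smul a, inner_sum]
    simp_rw [inner_smul_right]
  simp_rw [taylorRem, inner_sub_right, mul_sub, Finset.sum_sub_distrib, ← Finset.sum_mul,
    h.sum_eq_one, h1]
  ring

/-- The homothetic smaller simplex. -/
theorem shrink (h : IsBarycentric N lam) (x₀ : Pt d) {θ : ℝ} (hθ : θ < 1) :
    IsBarycentric (fun i => x₀ + (1 - θ) • (N i - x₀))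
      (fun i => (lam i).comp (AffineMap.homothety x₀ (1 - θ)⁻¹)) := by
  have hθ' : 1 - θ ≠ 0 := by linarith
  have hc : ∀ x, AffineMap.homothety x₀ (1 - θ)⁻¹ x = x₀ + (1 - θ)⁻¹ • (x - x₀) := fun x => by
    rw [AffineMap.homothety_apply, vsub_eq_sub, vadd_eq_add, add_comm]
  refine ⟨fun x => h.sum_eq_one _, fun x => ?_, fun i j => ?_⟩
  · simp only [AffineMap.comp_apply, hc]
    simp_rw [smul_add, Finset.sum_add_distrib, smul_comm _ (1 - θ), ← Finset.smul_sum, smul_sub,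
      Finset.sum_sub_distrib, ← Finset.sum_smul, h.sum_eq_one, h.sum_smul, one_smul]
    rw [← smul_sub, add_sub_cancel_left, smul_smul, mul_inv_cancel₀ hθ', one_smul]
    abel
  · simp only [AffineMap.comp_apply, hc]
    rw [add_sub_cancel_left, smul_smul, inv_mul_cancel₀ hθ', one_smul, add_sub_cancel]
    exact h.nonneg i j

end IsBarycentric

theorem shrink_apply (A : Pt d →ᵃ[ℝ] ℝ) (x₀ : Pt d) {θ : ℝ} (hθ : θ < 1) (x : Pt d) :
    A x = θ * A x₀ + (1 - θ) * A.comp (AffineMap.homothety x₀ (1 - θ)⁻¹) x := by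
  have hθ' : 1 - θ ≠ 0 := by linarith
  rw [AffineMap.comp_apply, AffineMap.homothety_apply, vsub_eq_sub, vadd_eq_add, add_comm _ x₀,
    affine_eq A x₀ x, affine_eq A x₀ (x₀ + (1 - θ)⁻¹ • (x - x₀)), add_sub_cancel_left,
    inner_smul_right, mul_add, mul_inv_cancel_left₀ hθ']
  ring

theorem affGrad_shrink (A : Pt d →ᵃ[ℝ] ℝ) (x₀ : Pt d) (θ : ℝ) :
    affGrad (A.comp (AffineMap.homothety x₀ (1 - θ)⁻¹)) = (1 - θ)⁻¹ • affGrad A := by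
  refine ext_inner_right ℝ fun z => ?_
  rw [affGrad, affGrad, inner_smul_left, InnerProductSpace.toDual_symm_apply,
    InnerProductSpace.toDual_symm_apply]
  simp [AffineMap.homothety_def]

/-- The interpolation estimates for smooth functions. -/
theorem IsBarycentric.smooth_estimate (h : IsBarycentric N lam) {q : ℝ} (hq : 1 < q) {C : ℝ≥0}
    (hC : ∀ (B P : Set (Pt d)) (a : Pt d) (w : Pt d → ℝ) (G : Pt d → Pt d)
      (H : Pt d → Pt d →L[ℝ] Pt d) (l : ℝ), MeasurableSet B → MeasurableSet P →
      IsC2On (insert a P) w G H → (∀ y ∈ B, ∀ τ ∈ Ioc (0 : ℝ) 1, a + τ • (y - a) ∈ P) →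
      (∀ y ∈ B, dist a y ≤ l) →
      eLpNorm (taylorRem w G a) (ENNReal.ofReal q) (volume.restrict B) ≤
        C * ENNReal.ofReal (l ^ 2) * eLpNorm H (ENNReal.ofReal q) (volume.restrict P))
    {l Λ : ℝ} (hl : ∀ x ∈ closedCell lam, ∀ y ∈ closedCell lam, dist x y ≤ l)
    (hΛ : ∀ i, ‖affGrad (lam i)‖ ≤ Λ) {w : Pt d → ℝ} {G : Pt d → Pt d}
    {H : Pt d → Pt d →L[ℝ] Pt d} (hw : IsC2On (closedCell lam) w G H) (hwc : Continuous w)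
    (hGc : Continuous G) :
    eLpNorm (fun y => ∑ i, w (N i) • affGrad (lam i) - G y) (ENNReal.ofReal q)
        (volume.restrict (openCell lam)) ≤
      Fintype.card ι * ENNReal.ofReal Λ * (C * ENNReal.ofReal (l ^ 2) *
        eLpNorm H (ENNReal.ofReal q) (volume.restrict (openCell lam))) ∧
    ∀ a ∈ closedCell lam, eLpNorm (fun _ => w a - ∑ i, lam i a * w (N i)) (ENNReal.ofReal q)
        (volume.restrict (openCell lam)) ≤
      2 * (C * ENNReal.ofReal (l ^ 2) *
        eLpNorm H (ENNReal.ofReal q) (volume.restrict (openCell lam))) := by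
  have hU := (isOpen_openCell lam).measurableSet
  have hq1 : 1 ≤ ENNReal.ofReal q := by
    rw [← ENNReal.ofReal_one]
    exact ENNReal.ofReal_le_ofReal hq.le
  set M := C * ENNReal.ofReal (l ^ 2) *
        eLpNorm H (ENNReal.ofReal q) (volume.restrict (openCell lam)) with hM
  have hR : ∀ a ∈ closedCell lam,
      eLpNorm (taylorRem w G a) (ENNReal.ofReal q) (volume.restrict (openCell lam)) ≤ M :=
    fun a ha => hC _ _ a w G H l hU hU
      (hw.mono (insert_subset ha openCell_subset_closedCell))
      (fun y hy τ hτ => segment_mem_openCell ha hy hτ)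
      fun y hy => hl a ha y (openCell_subset_closedCell hy)
  have hm : ∀ a, AEStronglyMeasurable (taylorRem w G a) (volume.restrict (openCell lam)) := by
    intro a
    have : Continuous (taylorRem w G a) := by
      unfold taylorRem
      fun_prop
    exact this.aestronglyMeasurable
  constructor
  · simp_rw [h.sum_taylorRem_smul w G]
    have e1 : (fun y => ∑ i, taylorRem w G (N i) y • affGrad (lam i)) =
        ∑ i, fun y => taylorRem w G (N i) y • affGrad (lam i) := by
      funext y
      simp
    rw [e1]
    refine (eLpNorm_sum_le (fun i _ => (hm _).smul_const _) hq1).trans ?_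
    calc _ ≤ ∑ _i : ι, ENNReal.ofReal Λ * M := by
          refine Finset.sum_le_sum fun i _ => ?_
          refine (eLpNorm_le_mul_eLpNorm_of_ae_le_mul (c := Λ) (g := taylorRem w G (N i))
            (Eventually.of_forall fun y => ?_) _).trans
            (mul_le_mul' le_rfl (hR _ (h.mem_closedCell i)))
          rw [norm_smul, mul_comm]
          exact mul_le_mul_of_nonneg_right (hΛ i) (norm_nonneg _)
      _ = _ := by
          rw [Finset.sum_const, Finset.card_univ, nsmul_eq_mul, mul_assoc]
  · intro a ha
    have e1 : (fun _ => w a - ∑ i, lam i a * w (N i)) =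
        taylorRem w G a - ∑ i, fun y => lam i a * taylorRem w G (N i) y := by
      funext y
      rw [h.sub_sum_eq w G a y]
      simp
    rw [e1]
    refine (eLpNorm_sub_le (hm a) (Finset.aestronglyMeasurable_sum _
      fun i _ => (hm _).const_mul _) hq1).trans ?_
    rw [two_mul]
    refine add_le_add (hR a ha) ((eLpNorm_sum_le (fun i _ => (hm _).const_mul _) hq1).trans ?_)
    calc _ ≤ ∑ i : ι, ENNReal.ofReal (lam i a) * M := by
          refine Finset.sum_le_sum fun i _ => ?_
          refine (eLpNorm_le_mul_eLpNorm_of_ae_le_mul (c := lam i a) (g := taylorRem w G (N i))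
            (Eventually.of_forall fun y => ?_) _).trans
            (mul_le_mul' le_rfl (hR _ (h.mem_closedCell i)))
          rw [norm_mul, Real.norm_of_nonneg (ha i)]
      _ = M := by
          rw [← Finset.sum_mul, ← ENNReal.ofReal_sum_of_nonneg fun i _ => ha i, h.sum_eq_one,
            ENNReal.ofReal_one, one_mul]

end Barycentric

end

section

/-! ### Interpolation of functions with weak second derivatives -/

section Barycentric

variable {ι : Type*} {N : ι → Pt d} {lam : ι → Pt d →ᵃ[ℝ] ℝ}

theorem shrink_vertex (A : Pt d →ᵃ[ℝ] ℝ) (x₀ a : Pt d) {θ : ℝ} (hθ : θ < 1) :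
    A.comp (AffineMap.homothety x₀ (1 - θ)⁻¹) (x₀ + (1 - θ) • (a - x₀)) = A a := by
  have hθ' : 1 - θ ≠ 0 := by linarith
  rw [AffineMap.comp_apply, AffineMap.homothety_apply, vsub_eq_sub, vadd_eq_add,
    add_sub_cancel_left, smul_smul, inv_mul_cancel₀ hθ', one_smul, sub_add_cancel]

theorem closedCell_shrink_subset {x₀ : Pt d} (hx₀ : x₀ ∈ openCell lam) {θ : ℝ} (hθ : θ < 1)
    (hθ0 : 0 < θ) :
    closedCell (fun i => (lam i).comp (AffineMap.homothety x₀ (1 - θ)⁻¹)) ⊆ openCell lam := by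
  intro x hx i
  rw [shrink_apply (lam i) x₀ hθ x]
  exact add_pos_of_pos_of_nonneg (mul_pos hθ0 (hx₀ i)) (mul_nonneg (by linarith) (hx i))

theorem eventually_mem_openCell_shrink [Finite ι] {x x₀ : Pt d} (hx : x ∈ openCell lam) {θ : ℕ → ℝ}
    (hθ : Tendsto θ atTop (𝓝 0)) :
    ∀ᶠ n in atTop, x ∈ openCell (fun i => (lam i).comp (AffineMap.homothety x₀ (1 - θ n)⁻¹)) := by
  refine eventually_all.2 fun i => ?_
  have h1 : Tendsto (fun n => (lam i).comp (AffineMap.homothety x₀ (1 - θ n)⁻¹) x) atTop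
      (𝓝 (lam i x)) := by
    have h2 : Tendsto (fun n => (1 - θ n)⁻¹) atTop (𝓝 1) := by
      simpa using (tendsto_const_nhds.sub hθ).inv₀ (by norm_num : (1 - 0 : ℝ) ≠ 0)
    have h3 : Tendsto (fun n => (1 - θ n)⁻¹ • (x - x₀) + x₀) atTop (𝓝 x) := by
      simpa using (h2.smul_const (x - x₀)).add_const x₀
    exact ((continuous_affine (lam i)).tendsto x).comp h3
  exact h1.eventually (lt_mem_nhds (hx i))

theorem tendsto_eLpNorm_const {F : Type*} [NormedAddCommGroup F] {μ : Measure (Pt d)}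
    [IsFiniteMeasure μ] {q : ℝ≥0∞} (hq : q ≠ 0) (hqt : q ≠ ⊤) {c : ℕ → F} {c₀ : F}
    (hc : Tendsto c atTop (𝓝 c₀)) :
    Tendsto (fun n => eLpNorm (fun _ => c₀ - c n) q μ) atTop (𝓝 0) := by
  simp_rw [fun n => eLpNorm_const' (μ := μ) (c₀ - c n) hq hqt]
  have h1 : Tendsto (fun n => ‖c₀ - c n‖ₑ) atTop (𝓝 0) := by
    have := (continuous_enorm.tendsto (c₀ - c₀)).comp (tendsto_const_nhds.sub hc)
    rw [sub_self, enorm_zero] at this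
    exact this
  have h2 := ENNReal.Tendsto.mul_const (b := μ univ ^ (1 / q.toReal)) h1
    (Or.inr (ENNReal.rpow_ne_top_of_nonneg (by positivity) (measure_ne_top μ univ)))
  simpa using h2

/-- Linear interpolation on a simplex: the error of the gradient in `L_q`, and the pointwise error
scaled by the volume, are bounded by the second derivatives. The function is mollified on slightly
smaller homothetic simplices. -/
theorem exists_interpolation_estimate (d : ℕ) {q : ℝ} (hq : 1 < q) (hdq : (d : ℝ) < 2 * q) :
    ∃ C : ℝ≥0, ∀ {ι : Type} [Fintype ι] {N : ι → Pt d} {lam : ι → Pt d →ᵃ[ℝ] ℝ} {l Λ : ℝ}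
      {v : Pt d → ℝ} {g : Pt d → Pt d} {H : Pt d → Pt d →L[ℝ] Pt d}, IsBarycentric N lam →
      (openCell lam).Nonempty → (∀ x ∈ closedCell lam, ∀ y ∈ closedCell lam, dist x y ≤ l) →
      (∀ i, ‖affGrad (lam i)‖ ≤ Λ) → ContinuousOn v (closedCell lam) →
      HasWeakGradient (openCell lam) v g →
      (∀ z, HasWeakGradient (openCell lam) (fun x => inner ℝ (g x) z) (fun x => H x z)) →
      IntegrableOn g (openCell lam) → MemLp H (ENNReal.ofReal q) (volume.restrict (openCell lam)) →
      eLpNorm (fun y => ∑ i, v (N i) • affGrad (lam i) - g y) (ENNReal.ofReal q)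
          (volume.restrict (openCell lam)) ≤
        Fintype.card ι * ENNReal.ofReal (2 * Λ) * (C * ENNReal.ofReal (l ^ 2) *
          eLpNorm H (ENNReal.ofReal q) (volume.restrict (openCell lam))) ∧
      ∀ a ∈ closedCell lam, eLpNorm (fun _ => v a - ∑ i, lam i a * v (N i)) (ENNReal.ofReal q)
          (volume.restrict (openCell lam)) ≤
        2 * (C * ENNReal.ofReal (l ^ 2) *
          eLpNorm H (ENNReal.ofReal q) (volume.restrict (openCell lam))) := by
  obtain ⟨C, hC⟩ := exists_eLpNorm_taylorRem_le d hq hdq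
  refine ⟨C, ?_⟩
  intro ι _ N lam l Λ v g H h ⟨x₀, hx₀⟩ hl hΛ hv hg hH hgi hHq
  set U := openCell lam with hUdef
  set T := closedCell lam with hTdef
  have hUo : IsOpen U := isOpen_openCell lam
  have hU := hUo.measurableSet
  have hUT : U ⊆ T := openCell_subset_closedCell
  have hTc : IsCompact T := Metric.isCompact_of_isClosed_isBounded (isClosed_closedCell lam)
    (Metric.isBounded_iff.2 ⟨l, fun x hx y hy => hl x hx y hy⟩)
  have : IsFiniteMeasure (volume.restrict U) :=
    ⟨by rw [Measure.restrict_apply_univ]; exact (measure_mono hUT).trans_lt hTc.measure_lt_top⟩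
  have hq1 : 1 ≤ ENNReal.ofReal q := by
    rw [← ENNReal.ofReal_one]
    exact ENNReal.ofReal_le_ofReal hq.le
  have hq0 : ENNReal.ofReal q ≠ 0 := (zero_lt_one.trans_le hq1).ne'
  have hqt : ENNReal.ofReal q ≠ ⊤ := ENNReal.ofReal_ne_top
  have hvi : IntegrableOn v U := (hv.integrableOn_compact hTc).mono_set hUT
  have hHi : IntegrableOn H U := hHq.integrable hq1
  -- The simplex shrunk by the factor `1 - θ n` towards the interior point `x₀` has barycentric
  -- coordinates `lm n i`; `pt n` is the homothety.
  let θ : ℕ → ℝ := fun n => 1 / ((n : ℝ) + 2)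
  have hθ0 : ∀ n, 0 < θ n := fun n => by positivity
  have hθ2 : ∀ n, θ n ≤ 1 / 2 := fun n =>
    one_div_le_one_div_of_le (by norm_num) (by linarith [n.cast_nonneg (α := ℝ)])
  have hθ1 : ∀ n, θ n < 1 := fun n => (hθ2 n).trans_lt (by norm_num)
  have hθlim : Tendsto θ atTop (𝓝 0) := by
    have := (tendsto_one_div_add_atTop_nhds_zero_nat (𝕜 := ℝ)).comp (tendsto_add_atTop_nat 1)
    refine this.congr fun n => ?_
    simp only [Function.comp_apply, θ]
    push_cast
    ring
  let lm : ℕ → ι → Pt d →ᵃ[ℝ] ℝ := fun n i => (lam i).comp (AffineMap.homothety x₀ (1 - θ n)⁻¹)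
  let pt : ℕ → Pt d → Pt d := fun n a => x₀ + (1 - θ n) • (a - x₀)
  have hbar : ∀ n, IsBarycentric (fun i => pt n (N i)) (lm n) := fun n => h.shrink x₀ (hθ1 n)
  have hsub : ∀ n, closedCell (lm n) ⊆ U := fun n =>
    closedCell_shrink_subset hx₀ (hθ1 n) (hθ0 n)
  have hlm : ∀ n i a, lm n i (pt n a) = lam i a := fun n i a => shrink_vertex _ _ _ (hθ1 n)
  have hptT : ∀ n, ∀ a ∈ T, pt n a ∈ closedCell (lm n) := fun n a ha i => by
    rw [hlm]
    exact ha i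
  have hptlim : ∀ a, Tendsto (fun n => pt n a) atTop (𝓝 a) := fun a => by
    have h1 : Tendsto (fun n => 1 - θ n) atTop (𝓝 1) := by
      simpa using tendsto_const_nhds.sub hθlim
    simpa using (h1.smul_const (a - x₀)).const_add x₀
  have hVU : ∀ n, openCell (lm n) ⊆ U := fun n => openCell_subset_closedCell.trans (hsub n)
  have hV : ∀ n, MeasurableSet (openCell (lm n)) := fun n => (isOpen_openCell _).measurableSet
  -- mollifiers adapted to the smaller simplices
  have hker : ∀ n : ℕ, ∃ k, IsMollifier k (1 / ((n : ℝ) + 1)) ∧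
      ∀ x ∈ closedCell (lm n), ∀ z ∈ tsupport k, x - z ∈ U := by
    intro n
    have hcomp : IsCompact (closedCell (lm n)) :=
      hTc.of_isClosed_subset (isClosed_closedCell _) ((hsub n).trans hUT)
    obtain ⟨δ, hδ, hδU⟩ := hcomp.exists_cthickening_subset_open hUo (hsub n)
    obtain ⟨k, hk1, hk2⟩ := exists_isMollifier (0 : Pt d)
      (lt_min hδ (by positivity : (0 : ℝ) < 1 / ((n : ℝ) + 1)))
    refine ⟨k, hk2 _ (by rw [norm_zero, zero_add]; exact min_le_right _ _), fun x hx z hz => ?_⟩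
    rw [hk1, mem_closedBall_zero_iff] at hz
    refine hδU (Metric.mem_cthickening_of_dist_le _ x δ _ hx ?_)
    rw [dist_eq_norm, sub_sub_cancel_left, norm_neg]
    exact hz.trans (min_le_left _ _)
  choose k hk hkU using hker
  have hηlim := tendsto_one_div_add_atTop_nhds_zero_nat (𝕜 := ℝ)
  have hγ := tendsto_eLpNorm_mollify_sub le_rfl ENNReal.one_ne_top hU
    (memLp_one_iff_integrable.2 hgi) hk hηlim
  obtain ⟨ns, hns, hnsae⟩ := (tendstoInMeasure_of_tendsto_eLpNorm one_ne_zero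
    (fun n => (continuous_mollify (hk n).isTestFunction hU hgi).aestronglyMeasurable)
    ((aestronglyMeasurable_indicator_iff hU).2 hgi.1) hγ).exists_seq_tendsto_ae
  have hδ := tendsto_eLpNorm_mollify_sub hq1 hqt hU hHq hk hηlim
  set δ : ℕ → ℝ≥0∞ := fun n => eLpNorm (fun x => mollify U (k n) H x - U.indicator H x)
    (ENNReal.ofReal q) volume
  set A := eLpNorm H (ENNReal.ofReal q) (volume.restrict U) with hA
  -- The mollifications are evaluated at `pt n a`, and converge since `v` is continuous on the
  -- closed simplex.
  have hwlim : ∀ a ∈ T, Tendsto (fun n => mollify U (k n) v (pt n a)) atTop (𝓝 (v a)) := by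
    intro a ha
    refine Metric.tendsto_nhds.2 fun ε hε => ?_
    obtain ⟨r, hr, hrv⟩ := Metric.continuousWithinAt_iff.1 (hv a ha) (ε / 2) (half_pos hε)
    filter_upwards [Metric.tendsto_nhds.1 (hptlim a) (r / 2) (half_pos hr),
      hηlim.eventually (gt_mem_nhds (half_pos hr))] with n hn1 hn2
    refine lt_of_le_of_lt ?_ (half_lt_self hε)
    rw [Real.dist_eq]
    refine abs_mollify_sub_le (hk n) hU hvi fun z hz => ?_
    have hzU := hkU n _ (hptT n a ha) z hz
    refine ⟨hzU, ?_⟩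
    have hz' := (hk n).tsupport_subset hz
    rw [mem_closedBall_zero_iff] at hz'
    have := hrv (hUT hzU) (by
      calc dist (pt n a - z) a ≤ dist (pt n a - z) (pt n a) + dist (pt n a) a :=
            dist_triangle _ _ _
        _ < r := by
            rw [dist_eq_norm (pt n a - z), sub_sub_cancel_left, norm_neg]
            linarith)
    rw [Real.dist_eq] at this
    exact this.le
  have hAn : ∀ n, eLpNorm (mollify U (k n) H) (ENNReal.ofReal q)
      (volume.restrict (openCell (lm n))) ≤ A + δ n := by
    intro n
    have e1 : mollify U (k n) H = H + fun x => mollify U (k n) H x - H x := by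
      funext x
      simp
    have hm : AEStronglyMeasurable H (volume.restrict (openCell (lm n))) :=
      hHq.1.mono_measure (Measure.restrict_mono (hVU n) le_rfl)
    rw [e1]
    refine (eLpNorm_add_le hm ((continuous_mollify (hk n).isTestFunction hU
      hHi).aestronglyMeasurable.sub hm) hq1).trans ?_
    exact add_le_add (eLpNorm_mono_measure _ (Measure.restrict_mono (hVU n) le_rfl))
      (eLpNorm_mollify_sub_restrict_le (hV n) (hVU n))
  -- The gradients of `lm n i` are those of `lam i` divided by `1 - θ n ≥ 1 / 2`; hence the `2 * Λ`.
  have hest := fun n => (hbar n).smooth_estimate hq hC (l := l) (Λ := 2 * Λ)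
    (fun x hx y hy => hl x (hUT (hsub n hx)) y (hUT (hsub n hy)))
    (fun i => by
      simp only [lm]
      rw [affGrad_shrink, norm_smul, norm_inv, Real.norm_of_nonneg (by linarith [hθ1 n])]
      have h1 : (1 - θ n)⁻¹ ≤ 2 := by
        rw [inv_le_comm₀ (by linarith [hθ1 n]) (by norm_num)]
        linarith [hθ2 n]
      exact mul_le_mul h1 (hΛ i) (norm_nonneg _) (by norm_num))
    ((isC2On_mollify (hk n).isTestFunction hU hvi hgi hHi hg hH).mono
      fun x hx => hkU n x hx)
    (continuous_mollify (hk n).isTestFunction hU hvi)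
    (continuous_mollify (hk n).isTestFunction hU hgi)
  have hbdlim : ∀ c : ℝ≥0∞, c ≠ ⊤ → Tendsto (fun n => c * (C * ENNReal.ofReal (l ^ 2) * (A + δ n)))
      atTop (𝓝 (c * (C * ENNReal.ofReal (l ^ 2) * A))) := by
    intro c hc
    have h1 : Tendsto (fun n => A + δ n) atTop (𝓝 A) := by simpa using hδ.const_add A
    exact ENNReal.Tendsto.const_mul (ENNReal.Tendsto.const_mul h1
      (Or.inr (ENNReal.mul_ne_top ENNReal.coe_ne_top ENNReal.ofReal_ne_top))) (Or.inr hc)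
  constructor
  · set X := ∑ i, v (N i) • affGrad (lam i) with hX
    set Xn : ℕ → Pt d := fun n => ∑ i, mollify U (k n) v (pt n (N i)) • affGrad (lm n i) with hXn
    have hXlim : Tendsto Xn atTop (𝓝 X) := by
      refine tendsto_finsetSum _ fun i _ => (hwlim _ (h.mem_closedCell i)).smul ?_
      simp only [lm, affGrad_shrink]
      have h2 : Tendsto (fun n => (1 - θ n)⁻¹) atTop (𝓝 1) := by
        simpa using (tendsto_const_nhds.sub hθlim).inv₀ (by norm_num : (1 - 0 : ℝ) ≠ 0)
      simpa using h2.smul_const (affGrad (lam i))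
    have hB := (hbdlim (Fintype.card ι * ENNReal.ofReal (2 * Λ))
      (ENNReal.mul_ne_top (ENNReal.natCast_ne_top _) ENNReal.ofReal_ne_top)).comp hns.tendsto_atTop
    -- a subsequence of the mollified gradients converges almost everywhere, so Fatou applies
    have h1 := Lp.eLpNorm_lim_le_liminf_eLpNorm (p := ENNReal.ofReal q) (μ := volume.restrict U)
      (f := fun n => (openCell (lm (ns n))).indicator
        fun y => Xn (ns n) - mollify U (k (ns n)) g y)
      (fun n => (aestronglyMeasurable_const.sub (continuous_mollify (hk _).isTestFunction hU
        hgi).aestronglyMeasurable).indicator (hV _)) (fun y => X - g y) (by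
          filter_upwards [ae_restrict_mem hU, ae_restrict_of_ae hnsae] with x hx hxlim
          rw [indicator_of_mem hx] at hxlim
          refine ((hXlim.comp hns.tendsto_atTop).sub hxlim).congr' ?_
          filter_upwards [hns.tendsto_atTop.eventually
            (eventually_mem_openCell_shrink (lam := lam) hx hθlim)] with n hn
          rw [indicator_of_mem hn]
          rfl)
    refine h1.trans ?_
    rw [← hB.liminf_eq]
    refine liminf_le_liminf (Eventually.of_forall fun n => ?_)
    rw [eLpNorm_indicator_eq_eLpNorm_restrict (hV _)]
    refine (eLpNorm_mono_measure _
      (Measure.restrict_mono_measure Measure.restrict_le_self _)).trans ((hest (ns n)).1.trans ?_)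
    exact mul_le_mul' le_rfl (mul_le_mul' le_rfl (hAn _))
  · intro a ha
    set e := v a - ∑ i, lam i a * v (N i) with he
    set en : ℕ → ℝ := fun n => mollify U (k n) v (pt n a) -
      ∑ i, lam i a * mollify U (k n) v (pt n (N i)) with hen
    have helim : Tendsto en atTop (𝓝 e) :=
      (hwlim a ha).sub (tendsto_finsetSum _ fun i _ =>
        (hwlim _ (h.mem_closedCell i)).const_mul _)
    have hB := (tendsto_eLpNorm_const (μ := volume.restrict U) hq0 hqt helim).add
      (hbdlim 2 (by norm_num))
    rw [zero_add] at hB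
    refine eLpNorm_le_of_exhaustion hU hV aestronglyMeasurable_const
      (fun x hx => eventually_mem_openCell_shrink hx hθlim) (fun n => ?_) hB
    have e1 : (fun _ : Pt d => e) = (fun _ => e - en n) + fun _ => en n := by
      funext y
      simp
    rw [e1]
    refine (eLpNorm_add_le aestronglyMeasurable_const aestronglyMeasurable_const hq1).trans
      (add_le_add (eLpNorm_mono_measure _ (Measure.restrict_mono (hVU n) le_rfl)) ?_)
    have h1 := (hest n).2 (pt n a) (hptT n a ha)
    simp_rw [hlm] at h1
    exact h1.trans (mul_le_mul' le_rfl (mul_le_mul' le_rfl (hAn n)))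

end Barycentric

end

section

/-! ### The continuous representative -/

/-- The cone condition: short translates, in the directions of a ball, of all points of `closure Ω`
near `a` lie in `Ω`. -/
theorem IsPolygonalDomain.exists_cone (hΩ : IsPolygonalDomain Ω) {a : Pt d} (ha : a ∈ closure Ω) :
    ∃ r > 0, ∃ (y₀ : Pt d), ∃ δ > 0, ∀ x ∈ closure Ω ∩ Metric.ball a r,
      ∀ y ∈ Metric.closedBall y₀ δ, ∀ t ∈ Ioc (0 : ℝ) 1, x + t • y ∈ Ω := by
  -- Interior points admit a ball of directions. Near a boundary point, `Ω` lies below the graph of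
  -- a function with Lipschitz constant `L`, and the directions close to `-e` point downwards more
  -- steeply than the graph.
  by_cases haΩ : a ∈ Ω
  · obtain ⟨r, hr, hball⟩ := Metric.isOpen_iff.1 hΩ.isOpen a haΩ
    refine ⟨r / 2, half_pos hr, 0, r / 2, half_pos hr, fun x hx y hy t ht => hball ?_⟩
    have h1 : dist x a < r / 2 := hx.2
    rw [mem_closedBall_zero_iff] at hy
    have h2 : ‖t • y‖ ≤ r / 2 := by
      rw [norm_smul, Real.norm_of_nonneg ht.1.le]
      exact (mul_le_of_le_one_left (norm_nonneg _) ht.2).trans hy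
    rw [Metric.mem_ball, dist_eq_norm, add_sub_right_comm]
    rw [dist_eq_norm] at h1
    linarith [norm_add_le (x - a) (t • y)]
  · have haf : a ∈ frontier Ω := ⟨ha, by rwa [hΩ.isOpen.interior_eq]⟩
    obtain ⟨e, f, L, R, he, hf, hR, hball⟩ := hΩ.lipschitz a haf
    have hL : (0 : ℝ) ≤ L := L.2
    set δ : ℝ := R / 2 / (4 + 4 * L) with hδ
    have hδ0 : 0 < δ := by positivity
    have hδR : δ * (4 + 4 * L) = R / 2 := by
      rw [hδ]
      field_simp
    refine ⟨R / 2, half_pos hR, -(δ * (2 + 4 * L)) • e, δ, hδ0, fun x hx y hy t ht => ?_⟩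
    obtain ⟨b, rfl⟩ : ∃ b, y = -(δ * (2 + 4 * L)) • e + b := ⟨y - -(δ * (2 + 4 * L)) • e, by simp⟩
    have hb : ‖b‖ ≤ δ := by simpa [dist_eq_norm] using hy
    have hee : inner ℝ e e = (1 : ℝ) := by rw [real_inner_self_eq_norm_sq, he, one_pow]
    -- points of the closure lie weakly below the graph
    have hxle : inner ℝ x e ≤ f (x - inner ℝ x e • e) := by
      have hcl : x ∈ closure (Ω ∩ Metric.ball a R) := by
        rw [mem_closure_iff_nhds]
        intro U hU
        have hxR : x ∈ Metric.ball a R := Metric.ball_subset_ball (by linarith) hx.2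
        obtain ⟨z, hz1, hz2⟩ := mem_closure_iff_nhds.1 hx.1 _
          (inter_mem hU (Metric.isOpen_ball.mem_nhds hxR))
        exact ⟨z, hz1.1, hz2, hz1.2⟩
      have hfc := hf.continuous
      have hclosed : IsClosed {z : Pt d | inner ℝ z e ≤ f (z - inner ℝ z e • e)} :=
        isClosed_le (by fun_prop) (by fun_prop)
      exact closure_minimal (fun z hz => ((hball z hz.2).1 hz.1).le) hclosed hcl
    have hbe : |inner ℝ b e| ≤ δ := by
      refine (abs_real_inner_le_norm _ _).trans ?_
      rwa [he, mul_one]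
    have ht0 := ht.1
    set y := -(δ * (2 + 4 * L)) • e + b with hy
    have hye : inner ℝ y e = -(δ * (2 + 4 * L)) + inner ℝ b e := by
      rw [hy, inner_add_left, inner_smul_left, hee]
      simp
    have hynorm : ‖y‖ ≤ R / 2 := by
      refine (norm_add_le _ _).trans ?_
      rw [norm_smul, he, mul_one, norm_neg, Real.norm_of_nonneg (by positivity)]
      nlinarith
    refine (hball _ ?_).2 ?_
    · have h1 : dist x a < R / 2 := hx.2
      rw [Metric.mem_ball, dist_eq_norm, add_sub_right_comm]
      rw [dist_eq_norm] at h1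
      have h2 : ‖t • y‖ ≤ R / 2 := by
        rw [norm_smul, Real.norm_of_nonneg ht0.le]
        exact (mul_le_of_le_one_left (norm_nonneg _) ht.2).trans hynorm
      linarith [norm_add_le (x - a) (t • y)]
    · have hproj : x + t • y - inner ℝ (x + t • y) e • e - (x - inner ℝ x e • e) =
          t • (b - inner ℝ b e • e) := by
        rw [inner_add_left, inner_smul_left, hye, hy]
        simp only [conj_trivial]
        module
      have hlip := hf.dist_le_mul (x + t • y - inner ℝ (x + t • y) e • e) (x - inner ℝ x e • e)
      rw [dist_eq_norm (x + t • y - _), hproj, Real.dist_eq, norm_smul,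
        Real.norm_of_nonneg ht0.le] at hlip
      have hPb : ‖b - inner ℝ b e • e‖ ≤ 2 * δ := by
        refine (norm_sub_le _ _).trans ?_
        rw [norm_smul, he, mul_one, Real.norm_eq_abs]
        linarith
      have h3 : (L : ℝ) * (t * ‖b - inner ℝ b e • e‖) ≤ L * (t * (2 * δ)) := by gcongr
      have h4 := (abs_le.1 (hlip.trans h3)).1
      have h5 := (abs_le.1 hbe).2
      have h6 : t * inner ℝ b e ≤ t * δ := mul_le_mul_of_nonneg_left h5 ht0.le
      have h7 : 0 < t * δ := mul_pos ht0 hδ0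
      have h8 : inner ℝ (x + t • y) e = inner ℝ x e + t * (-(δ * (2 + 4 * L)) + inner ℝ b e) := by
        rw [inner_add_left, inner_smul_left, hye]
        simp
      rw [h8]
      have h9 : 0 ≤ L * (t * δ) := by positivity
      rw [h8] at h4
      nlinarith

theorem eLpNorm_mollify_sub_mollify_le {F : Type*} [NormedAddCommGroup F] [NormedSpace ℝ F]
    {f : Pt d → F} {q : ℝ≥0∞} (hq : 1 ≤ q) {k k' : Pt d → ℝ} (hk : IsTestFunction k)
    (hk' : IsTestFunction k') (hΩ : MeasurableSet Ω) (hf : IntegrableOn f Ω) (V : Set (Pt d)) :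
    eLpNorm (fun x => mollify Ω k f x - mollify Ω k' f x) q (volume.restrict V) ≤
      eLpNorm (fun x => mollify Ω k f x - Ω.indicator f x) q volume +
        eLpNorm (fun x => mollify Ω k' f x - Ω.indicator f x) q volume := by
  have hm : AEStronglyMeasurable (Ω.indicator f) volume :=
    (aestronglyMeasurable_indicator_iff hΩ).2 hf.1
  refine (eLpNorm_restrict_le _ _ _ V).trans ?_
  have e1 : (fun x => mollify Ω k f x - mollify Ω k' f x) =
      (fun x => mollify Ω k f x - Ω.indicator f x) -
        fun x => mollify Ω k' f x - Ω.indicator f x := by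
    funext x
    simp
  rw [e1]
  exact eLpNorm_sub_le ((continuous_mollify hk hΩ hf).aestronglyMeasurable.sub hm)
    ((continuous_mollify hk' hΩ hf).aestronglyMeasurable.sub hm) hq

/-- A pointwise bound by norms of the derivatives up to order two. -/
theorem exists_sup_bound (d : ℕ) {q : ℝ} (hq : 1 < q) (hdq : (d : ℝ) < 2 * q) :
    ∃ C : ℝ≥0, ∀ (B P : Set (Pt d)) (a : Pt d) (w : Pt d → ℝ) (G : Pt d → Pt d)
      (H : Pt d → Pt d →L[ℝ] Pt d) (l : ℝ), MeasurableSet B → MeasurableSet P →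
      IsC2On (insert a P) w G H → Continuous w → Continuous G →
      (∀ y ∈ B, ∀ τ ∈ Ioc (0 : ℝ) 1, a + τ • (y - a) ∈ P) → (∀ y ∈ B, dist a y ≤ l) →
      ‖w a‖ₑ * volume B ≤ eLpNorm w 1 (volume.restrict P) +
        ENNReal.ofReal l * eLpNorm G 1 (volume.restrict P) +
        C * ENNReal.ofReal (l ^ 2) * eLpNorm H (ENNReal.ofReal q) (volume.restrict P) *
          volume B ^ (1 - 1 / q) := by
  obtain ⟨C, hC⟩ := exists_eLpNorm_taylorRem_le d hq hdq
  refine ⟨C, fun B P a w G H l hB hP hw hwc hGc hseg hl => ?_⟩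
  have hBP : B ⊆ P := fun y hy => by simpa using hseg y hy 1 ⟨zero_lt_one, le_rfl⟩
  have hq1 : 1 ≤ ENNReal.ofReal q := by
    rw [← ENNReal.ofReal_one]
    exact ENNReal.ofReal_le_ofReal hq.le
  have hRc : Continuous (taylorRem w G a) := by
    unfold taylorRem
    fun_prop
  have hIc : Continuous fun y => inner ℝ (G y) (a - y) := by fun_prop
  -- Taylor expansion of the constant `w a` about each of the points of `B`.
  have e1 : (fun _ : Pt d => w a) = (w + fun y => inner ℝ (G y) (a - y)) + taylorRem w G a := by
    funext y
    simp [taylorRem]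
  have e2 : ‖w a‖ₑ * volume B = eLpNorm (fun _ : Pt d => w a) 1 (volume.restrict B) := by
    rw [eLpNorm_const' _ one_ne_zero ENNReal.one_ne_top]
    simp
  rw [e2, e1]
  refine (eLpNorm_add_le (hwc.add hIc).aestronglyMeasurable hRc.aestronglyMeasurable le_rfl).trans
    (add_le_add ((eLpNorm_add_le hwc.aestronglyMeasurable hIc.aestronglyMeasurable le_rfl).trans
      (add_le_add ?_ ?_)) ?_)
  · exact eLpNorm_mono_measure _ (Measure.restrict_mono hBP le_rfl)
  · refine (eLpNorm_le_mul_eLpNorm_of_ae_le_mul (c := l) (g := G) ?_ 1).trans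
      (mul_le_mul' le_rfl (eLpNorm_mono_measure _ (Measure.restrict_mono hBP le_rfl)))
    filter_upwards [ae_restrict_mem hB] with y hy
    refine (norm_inner_le_norm _ _).trans ?_
    rw [mul_comm]
    refine mul_le_mul_of_nonneg_right ?_ (norm_nonneg _)
    rw [← dist_eq_norm]
    exact hl y hy
  · refine (eLpNorm_le_eLpNorm_mul_rpow_measure_univ hq1 hRc.aestronglyMeasurable).trans ?_
    rw [Measure.restrict_apply_univ, ENNReal.toReal_ofReal (by linarith), ENNReal.toReal_one,
      one_div_one]
    exact mul_le_mul' (hC B P a w G H l hB hP hw hseg hl) le_rfl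

/-- Near each point of `closure Ω`, mollification with kernels averaging over points inside of `Ω`
converges uniformly up to the boundary. -/
theorem IsPolygonalDomain.exists_local_limit (hΩ : IsPolygonalDomain Ω) {q : ℝ} (hq : 1 < q)
    (hdq : (d : ℝ) < 2 * q) {v : Pt d → ℝ} {g : Pt d → Pt d} {H : Pt d → Pt d →L[ℝ] Pt d}
    (hv : IntegrableOn v Ω) (hg : IntegrableOn g Ω)
    (hH : MemLp H (ENNReal.ofReal q) (volume.restrict Ω)) (h1 : HasWeakGradient Ω v g)
    (h2 : ∀ z, HasWeakGradient Ω (fun x => inner ℝ (g x) z) (fun x => H x z)) {a : Pt d}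
    (ha : a ∈ closure Ω) :
    ∃ r > 0, ∃ (k : ℕ → Pt d → ℝ) (η : ℕ → ℝ) (vt : Pt d → ℝ), (∀ n, IsMollifier (k n) (η n)) ∧
      Tendsto η atTop (𝓝 0) ∧
      (∀ n, ∀ x ∈ closure Ω ∩ Metric.ball a r, ∀ z ∈ tsupport (k n), x - z ∈ Ω) ∧
      TendstoUniformlyOn (fun n => mollify Ω (k n) v) vt atTop (closure Ω ∩ Metric.ball a r) := by
  have hΩm := hΩ.isOpen.measurableSet
  have hq1 : 1 ≤ ENNReal.ofReal q := by
    rw [← ENNReal.ofReal_one]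
    exact ENNReal.ofReal_le_ofReal hq.le
  have : IsFiniteMeasure (volume.restrict Ω) :=
    ⟨by rw [Measure.restrict_apply_univ]; exact hΩ.isBounded.measure_lt_top⟩
  have hHi : IntegrableOn H Ω := hH.integrable hq1
  obtain ⟨r, hr, y₀, δ, hδ, hcone⟩ := hΩ.exists_cone ha
  obtain ⟨C, hC⟩ := exists_sup_bound d hq hdq
  let t : ℕ → ℝ := fun n => 1 / ((n : ℝ) + 1)
  have ht0 : ∀ n, 0 < t n := fun n => by positivity
  have ht1 : ∀ n, t n ≤ 1 := fun n => by
    rw [div_le_one (by positivity)]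
    linarith [n.cast_nonneg (α := ℝ)]
  have htlim : Tendsto t atTop (𝓝 0) := tendsto_one_div_add_atTop_nhds_zero_nat
  -- The kernels average over balls inside of the cone of admissible directions.
  have hker : ∀ n, ∃ k, tsupport k = Metric.closedBall (-(t n) • y₀) (t n * δ) ∧
      IsMollifier k (t n * (‖y₀‖ + δ)) := by
    intro n
    obtain ⟨k, hk1, hk2⟩ := exists_isMollifier (-(t n) • y₀) (mul_pos (ht0 n) hδ)
    refine ⟨k, hk1, hk2 _ (le_of_eq ?_)⟩
    rw [norm_smul, norm_neg, Real.norm_of_nonneg (ht0 n).le]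
    ring
  choose k hks hk using hker
  have hηlim : Tendsto (fun n => t n * (‖y₀‖ + δ)) atTop (𝓝 0) := by
    simpa using htlim.mul_const (‖y₀‖ + δ)
  have hkΩ : ∀ n, ∀ x ∈ closure Ω ∩ Metric.ball a r, ∀ z ∈ tsupport (k n), x - z ∈ Ω := by
    intro n x hx z hz
    rw [hks] at hz
    have h3 := hcone x hx ((-(t n)⁻¹) • z) (by
      rw [Metric.mem_closedBall, dist_eq_norm] at hz ⊢
      have e1 : (-(t n)⁻¹) • z - y₀ = (-(t n)⁻¹) • (z - -(t n) • y₀) := by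
        rw [smul_sub, smul_smul, neg_mul_neg, inv_mul_cancel₀ (ht0 n).ne', one_smul]
      rw [e1, norm_smul, norm_neg, norm_inv, Real.norm_of_nonneg (ht0 n).le]
      rwa [inv_mul_le_iff₀ (ht0 n)]) (t n) ⟨ht0 n, ht1 n⟩
    rwa [smul_smul, mul_neg, mul_inv_cancel₀ (ht0 n).ne', neg_one_smul, ← sub_eq_add_neg] at h3
  -- a ball of directions so short that the cone stays near `a`
  obtain ⟨t₀, ht₀, ht₀1, ht₀r⟩ : ∃ t₀ : ℝ, 0 < t₀ ∧ t₀ ≤ 1 ∧ t₀ * (‖y₀‖ + δ) ≤ r / 2 := by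
    have hpos : 0 < ‖y₀‖ + δ := by positivity
    refine ⟨min 1 (r / 2 / (‖y₀‖ + δ)), by positivity, min_le_left _ _, ?_⟩
    exact (mul_le_mul_of_nonneg_right (min_le_right _ _) hpos.le).trans
      (div_mul_cancel₀ _ hpos.ne').le
  set P : Set (Pt d) := Ω ∩ Metric.ball a r with hP
  have hPm : MeasurableSet P := hΩm.inter Metric.isOpen_ball.measurableSet
  set b : ℝ≥0∞ := volume (Metric.closedBall (0 : Pt d) (t₀ * δ)) with hb
  have hb0 : b ≠ 0 := (Metric.measure_closedBall_pos volume _ (mul_pos ht₀ hδ)).ne'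
  have hbt : b ≠ ⊤ := measure_closedBall_lt_top.ne
  have hα := tendsto_eLpNorm_mollify_sub le_rfl ENNReal.one_ne_top hΩm
    (memLp_one_iff_integrable.2 hv) hk hηlim
  have hγ := tendsto_eLpNorm_mollify_sub le_rfl ENNReal.one_ne_top hΩm
    (memLp_one_iff_integrable.2 hg) hk hηlim
  have hδ' := tendsto_eLpNorm_mollify_sub hq1 ENNReal.ofReal_ne_top hΩm hH hk hηlim
  set α : ℕ → ℝ≥0∞ := fun n => eLpNorm (fun x => mollify Ω (k n) v x - Ω.indicator v x) 1 volume
  set γ : ℕ → ℝ≥0∞ := fun n => eLpNorm (fun x => mollify Ω (k n) g x - Ω.indicator g x) 1 volume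
  set β : ℕ → ℝ≥0∞ := fun n => eLpNorm (fun x => mollify Ω (k n) H x - Ω.indicator H x)
    (ENNReal.ofReal q) volume
  set D : ℝ≥0∞ := C * ENNReal.ofReal (r ^ 2) with hD
  set b' : ℝ≥0∞ := b ^ (1 - 1 / q) with hb'
  have hb't : b' ≠ ⊤ := ENNReal.rpow_ne_top_of_nonneg (by
    rw [sub_nonneg, div_le_one (by linarith)]
    exact hq.le) hbt
  have hDt : D ≠ ⊤ := ENNReal.mul_ne_top ENNReal.coe_ne_top ENNReal.ofReal_ne_top
  set s : ℕ → ℝ≥0∞ := fun n => α n + ENNReal.ofReal r * γ n + D * β n * b' with hs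
  have hslim : Tendsto s atTop (𝓝 0) := by
    have h3 := (hα.add (ENNReal.Tendsto.const_mul (a := ENNReal.ofReal r) hγ
      (Or.inr ENNReal.ofReal_ne_top))).add (ENNReal.Tendsto.mul_const (b := b')
        (ENNReal.Tendsto.const_mul (a := D) hδ' (Or.inr hDt)) (Or.inr hb't))
    simpa using h3
  -- The pointwise bound is applied to the differences of mollifications, on the ball
  -- `x + t₀ • closedBall y₀ δ`, whose size does not depend on `x`.
  have hkey : ∀ n m, ∀ x ∈ closure Ω ∩ Metric.ball a (r / 2),
      ‖mollify Ω (k n) v x - mollify Ω (k m) v x‖ₑ * b ≤ s n + s m := by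
    intro n m x hx
    have hxr : x ∈ closure Ω ∩ Metric.ball a r :=
      ⟨hx.1, Metric.ball_subset_ball (by linarith) hx.2⟩
    have hins : ∀ n, insert x P ⊆ {x | ∀ z ∈ tsupport (k n), x - z ∈ Ω} := by
      intro n
      refine insert_subset (hkΩ n x hxr) fun y hy => hkΩ n y ⟨subset_closure hy.1, hy.2⟩
    have hc2 : ∀ n, IsC2On (insert x P) (mollify Ω (k n) v) (mollify Ω (k n) g)
        (mollify Ω (k n) H) := fun n =>
      (isC2On_mollify (hk n).isTestFunction hΩm hv hg hHi h1 h2).mono (hins n)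
    have hcone' : ∀ y ∈ Metric.closedBall (x + t₀ • y₀) (t₀ * δ), ∃ y' ∈ Metric.closedBall y₀ δ,
        y - x = t₀ • y' := by
      intro y hy
      refine ⟨t₀⁻¹ • (y - x), ?_, by rw [smul_smul, mul_inv_cancel₀ ht₀.ne', one_smul]⟩
      rw [Metric.mem_closedBall, dist_eq_norm] at hy ⊢
      have e1 : t₀⁻¹ • (y - x) - y₀ = t₀⁻¹ • (y - (x + t₀ • y₀)) := by
        rw [← sub_sub, smul_sub t₀⁻¹ (y - x), smul_smul, inv_mul_cancel₀ ht₀.ne', one_smul]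
      rw [e1, norm_smul, norm_inv, Real.norm_of_nonneg ht₀.le]
      rwa [inv_mul_le_iff₀ ht₀]
    have hlen : ∀ y ∈ Metric.closedBall (x + t₀ • y₀) (t₀ * δ), ‖y - x‖ ≤ r / 2 := by
      intro y hy
      obtain ⟨y', hy', hyy⟩ := hcone' y hy
      rw [hyy, norm_smul, Real.norm_of_nonneg ht₀.le]
      refine le_trans (mul_le_mul_of_nonneg_left ?_ ht₀.le) ht₀r
      rw [Metric.mem_closedBall, dist_eq_norm] at hy'
      linarith [norm_le_norm_add_norm_sub' y' y₀]
    have hB := hC (Metric.closedBall (x + t₀ • y₀) (t₀ * δ)) P x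
      (fun x => mollify Ω (k n) v x - mollify Ω (k m) v x)
      (fun x => mollify Ω (k n) g x - mollify Ω (k m) g x)
      (fun x => mollify Ω (k n) H x - mollify Ω (k m) H x) r
      Metric.isClosed_closedBall.measurableSet hPm ((hc2 n).sub (hc2 m))
      ((continuous_mollify (hk n).isTestFunction hΩm hv).sub
        (continuous_mollify (hk m).isTestFunction hΩm hv))
      ((continuous_mollify (hk n).isTestFunction hΩm hg).sub
        (continuous_mollify (hk m).isTestFunction hΩm hg))
      (fun y hy τ hτ => by
        obtain ⟨y', hy', hyy⟩ := hcone' y hy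
        have hl := hlen y hy
        refine ⟨?_, ?_⟩
        · rw [hyy, smul_smul]
          exact hcone x hxr y' hy' _ ⟨mul_pos hτ.1 ht₀, mul_le_one₀ hτ.2 ht₀.le ht₀1⟩
        · have h3 : dist x a < r / 2 := hx.2
          have h4 : ‖τ • (y - x)‖ ≤ r / 2 := by
            rw [norm_smul, Real.norm_of_nonneg hτ.1.le]
            exact (mul_le_of_le_one_left (norm_nonneg _) hτ.2).trans hl
          rw [Metric.mem_ball, dist_eq_norm, add_sub_right_comm]
          rw [dist_eq_norm] at h3
          linarith [norm_add_le (x - a) (τ • (y - x))])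
      (fun y hy => by
        rw [dist_comm, dist_eq_norm]
        linarith [hlen y hy])
    rw [Measure.addHaar_closedBall_center] at hB
    refine hB.trans ?_
    calc _ ≤ (α n + α m) + ENNReal.ofReal r * (γ n + γ m) + D * (β n + β m) * b' := by
          refine add_le_add (add_le_add ?_ (mul_le_mul' le_rfl ?_))
            (mul_le_mul' (mul_le_mul' le_rfl ?_) le_rfl)
          · exact eLpNorm_mollify_sub_mollify_le le_rfl (hk n).isTestFunction
              (hk m).isTestFunction hΩm hv P
          · exact eLpNorm_mollify_sub_mollify_le le_rfl (hk n).isTestFunction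
              (hk m).isTestFunction hΩm hg P
          · exact eLpNorm_mollify_sub_mollify_le hq1 (hk n).isTestFunction
              (hk m).isTestFunction hΩm hHi P
      _ = s n + s m := by
          simp only [hs]
          ring
  have hcauchy : UniformCauchySeqOn (fun n => mollify Ω (k n) v) atTop
      (closure Ω ∩ Metric.ball a (r / 2)) := by
    rw [Metric.uniformCauchySeqOn_iff]
    intro ε hε
    have hpos : 0 < ENNReal.ofReal ε * b / 2 :=
      ENNReal.div_pos (mul_ne_zero (by simpa using hε) hb0) (by norm_num)
    obtain ⟨M, hM⟩ := eventually_atTop.1 (hslim.eventually (gt_mem_nhds hpos))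
    refine ⟨M, fun m hm n hn x hx => ?_⟩
    have h3 := hkey m n x hx
    have h4 : s m + s n < ENNReal.ofReal ε * b := by
      have := ENNReal.add_lt_add (hM m hm) (hM n hn)
      rwa [ENNReal.add_halves] at this
    have h5 := h3.trans_lt h4
    rw [ENNReal.mul_lt_mul_iff_left hb0 hbt, ← ofReal_norm, ENNReal.ofReal_lt_ofReal_iff hε] at h5
    rwa [dist_eq_norm]
  have hex : ∀ x, ∃ y, x ∈ closure Ω ∩ Metric.ball a (r / 2) →
      Tendsto (fun n => mollify Ω (k n) v x) atTop (𝓝 y) := by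
    intro x
    by_cases hx : x ∈ closure Ω ∩ Metric.ball a (r / 2)
    · obtain ⟨y, hy⟩ := cauchySeq_tendsto_of_complete (hcauchy.cauchySeq hx)
      exact ⟨y, fun _ => hy⟩
    · exact ⟨0, fun h => absurd h hx⟩
  choose vt hvt using hex
  exact ⟨r / 2, half_pos hr, k, _, vt, hk, hηlim,
    fun n x hx => hkΩ n x ⟨hx.1, Metric.ball_subset_ball (by linarith) hx.2⟩,
    hcauchy.tendstoUniformlyOn_of_tendsto fun x hx => hvt x hx⟩

end

section

variable {n : ℕ} {Ω : Set (Pt (n + 1))}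

theorem continuousOn_mul_of_tsupport_subset {φ f : Pt d → ℝ} {A O : Set (Pt d)} (hφ : Continuous φ)
    (hO : IsOpen O) (hf : ContinuousOn f (A ∩ O)) (hsupp : tsupport φ ⊆ O) :
    ContinuousOn (fun x => φ x * f x) A := by
  intro x hx
  by_cases hxs : x ∈ tsupport φ
  · have h1 : ContinuousWithinAt f A x :=
      (hf x ⟨hx, hsupp hxs⟩).mono_of_mem_nhdsWithin
        (inter_mem self_mem_nhdsWithin (mem_nhdsWithin_of_mem_nhds (hO.mem_nhds (hsupp hxs))))
    exact hφ.continuousWithinAt.mul h1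
  · have h1 : (fun x => φ x * f x) =ᶠ[𝓝 x] fun _ => 0 := by
      filter_upwards [notMem_tsupport_iff_eventuallyEq.1 hxs] with y hy
      rw [hy]
      simp
    exact (continuousAt_const.congr h1.symm).continuousWithinAt

/-- The local uniform limit of mollifications is almost everywhere equal to the function. -/
theorem ae_eq_of_tendstoUniformlyOn {Ω : Set (Pt d)} (hΩ : MeasurableSet Ω) {v vt : Pt d → ℝ}
    (hv : IntegrableOn v Ω) {k : ℕ → Pt d → ℝ} {η : ℕ → ℝ} (hk : ∀ n, IsMollifier (k n) (η n))
    (hη : Tendsto η atTop (𝓝 0)) {B : Set (Pt d)}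
    (hlim : TendstoUniformlyOn (fun n => mollify Ω (k n) v) vt atTop B) :
    ∀ᵐ x ∂(volume : Measure (Pt d)), x ∈ Ω → x ∈ B → vt x = v x := by
  have h1 := tendsto_eLpNorm_mollify_sub le_rfl ENNReal.one_ne_top hΩ
    (memLp_one_iff_integrable.2 hv) hk hη
  have hm : AEStronglyMeasurable (Ω.indicator v) volume :=
    (aestronglyMeasurable_indicator_iff hΩ).2 hv.1
  obtain ⟨ns, hns, hae⟩ := (tendstoInMeasure_of_tendsto_eLpNorm one_ne_zero
    (fun n => (continuous_mollify (hk n).isTestFunction hΩ hv).aestronglyMeasurable) hm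
    h1).exists_seq_tendsto_ae
  filter_upwards [hae] with x hx hxΩ hxB
  rw [indicator_of_mem hxΩ] at hx
  exact tendsto_nhds_unique ((hlim.tendsto_at hxB).comp hns.tendsto_atTop) hx

/-- The local uniform limit of mollifications satisfies Green's formula, as the limit of the
divergence theorem for the mollifications. -/
theorem green_of_tendstoUniformlyOn {S : Finset (Set (Pt (n + 1)))} (hΩ : IsPolyhedralOpen Ω S)
    {v vt : Pt (n + 1) → ℝ} {g : Pt (n + 1) → Pt (n + 1)} (hv : IntegrableOn v Ω)
    (hg : IntegrableOn g Ω) (h : HasWeakGradient Ω v g) {k : ℕ → Pt (n + 1) → ℝ} {η : ℕ → ℝ}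
    (hk : ∀ n, IsMollifier (k n) (η n)) (hη : Tendsto η atTop (𝓝 0)) {O : Set (Pt (n + 1))}
    (hO : IsOpen O) (hkΩ : ∀ n, ∀ x ∈ closure Ω ∩ O, ∀ z ∈ tsupport (k n), x - z ∈ Ω)
    (hlim : TendstoUniformlyOn (fun n => mollify Ω (k n) v) vt atTop (closure Ω ∩ O))
    {φ : Pt (n + 1) → ℝ} (hφ : IsTestFunction φ) (hsupp : tsupport φ ⊆ O) :
    Integrable (fun x => (φ x * vt x) • outerNormal Ω x) (surfaceMeasure Ω) ∧
    ∫ x in Ω, (v x • gradient φ x + φ x • g x) =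
      ∫ x, (φ x * vt x) • outerNormal Ω x ∂(surfaceMeasure Ω) := by
  have hΩm := hΩ.isOpen.measurableSet
  have hfin := hΩ.isFiniteMeasure
  obtain ⟨M, hM⟩ := hφ.exists_bound
  have hM0 : 0 ≤ M := (abs_nonneg _).trans (hM 0).1
  have hwc : ∀ m, Continuous (mollify Ω (k m) v) := fun m =>
    continuous_mollify (hk m).isTestFunction hΩm hv
  have hgc : ∀ m, Continuous (mollify Ω (k m) g) := fun m =>
    continuous_mollify (hk m).isTestFunction hΩm hg
  have hφc := hφ.1.continuous
  have hφg := hφ.continuous_gradient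
  have hvt : ContinuousOn vt (closure Ω ∩ O) :=
    hlim.continuousOn (Eventually.of_forall fun m => (hwc m).continuousOn).frequently
  have hψ : ContinuousOn (fun x => φ x * vt x) (closure Ω) :=
    continuousOn_mul_of_tsupport_subset hφc hO hvt hsupp
  have hψi := hΩ.integrable_smul_outerNormal hψ
  refine ⟨hψi, ?_⟩
  have hFc : ∀ m, Continuous fun x => mollify Ω (k m) v x • gradient φ x +
      φ x • mollify Ω (k m) g x := fun m => by
    have := hwc m
    have := hgc m
    fun_prop
  have hFi : ∀ m, IntegrableOn (fun x => mollify Ω (k m) v x • gradient φ x +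
      φ x • mollify Ω (k m) g x) Ω := fun m =>
    ((hFc m).continuousOn.integrableOn_compact hΩ.isCompact_closure).mono_set subset_closure
  -- the divergence theorem for the mollifications
  have hdiv : ∀ m, ∫ x in Ω, (mollify Ω (k m) v x • gradient φ x + φ x • mollify Ω (k m) g x) =
      ∫ x, (φ x * mollify Ω (k m) v x) • outerNormal Ω x ∂(surfaceMeasure Ω) := by
    intro m
    refine hΩ.integral_gradient (g := fun x => φ x * mollify Ω (k m) v x)
      (hφc.mul (hwc m)).continuousOn (hFi m) fun x hx _ => ?_
    by_cases hxs : x ∈ tsupport φ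
    · have h1 := hasGradientAt_mollify (hk m).isTestFunction hΩm hv h
        (hkΩ m x ⟨subset_closure hx, hsupp hxs⟩)
      have h2 := hasGradientAt_mul (hφ.hasGradientAt x) h1
      rwa [add_comm (φ x • _)] at h2
    · have h1 : (fun x => φ x * mollify Ω (k m) v x) =ᶠ[𝓝 x] fun _ => 0 := by
        filter_upwards [notMem_tsupport_iff_eventuallyEq.1 hxs] with y hy
        rw [hy]
        simp
      have h2 : gradient φ x = 0 :=
        image_eq_zero_of_notMem_tsupport fun hc => hxs
          (closure_minimal (fun y hy => IsTestFunction.tsupport_gradient (subset_tsupport _ hy))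
            (isClosed_tsupport φ) hc)
      rw [h2, image_eq_zero_of_notMem_tsupport hxs, smul_zero, zero_smul, add_zero]
      exact (hasGradientAt_const x 0).congr_of_eventuallyEq h1
  -- The bulk integrals converge since the mollifications do so in `L_1`.
  have hL : Tendsto (fun m => ∫ x in Ω, (mollify Ω (k m) v x • gradient φ x +
      φ x • mollify Ω (k m) g x)) atTop (𝓝 (∫ x in Ω, (v x • gradient φ x + φ x • g x))) := by
    have hmv : AEStronglyMeasurable (fun x => v x • gradient φ x + φ x • g x)
        (volume.restrict Ω) :=
      (hv.1.smul hφg.aestronglyMeasurable).add (hφc.aestronglyMeasurable.smul hg.1)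
    refine tendsto_integral_of_L1' _ hmv (Eventually.of_forall hFi) ?_
    have hα := tendsto_eLpNorm_mollify_sub le_rfl ENNReal.one_ne_top hΩm
      (memLp_one_iff_integrable.2 hv) hk hη
    have hγ := tendsto_eLpNorm_mollify_sub le_rfl ENNReal.one_ne_top hΩm
      (memLp_one_iff_integrable.2 hg) hk hη
    have hsum := (ENNReal.Tendsto.const_mul (a := ENNReal.ofReal M) hα
      (Or.inr ENNReal.ofReal_ne_top)).add (ENNReal.Tendsto.const_mul (a := ENNReal.ofReal M) hγ
      (Or.inr ENNReal.ofReal_ne_top))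
    rw [mul_zero, add_zero] at hsum
    refine tendsto_of_tendsto_of_tendsto_of_le_of_le tendsto_const_nhds hsum
      (fun _ => zero_le) fun m => ?_
    have e1 : ((fun x => mollify Ω (k m) v x • gradient φ x + φ x • mollify Ω (k m) g x) -
        fun x => v x • gradient φ x + φ x • g x) =
        (fun x => (mollify Ω (k m) v x - v x) • gradient φ x) +
          fun x => φ x • (mollify Ω (k m) g x - g x) := by
      funext x
      simp only [Pi.sub_apply, Pi.add_apply]
      module
    rw [e1]
    have hm1 : AEStronglyMeasurable (fun x => mollify Ω (k m) v x - v x) (volume.restrict Ω) :=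
      (hwc m).aestronglyMeasurable.sub hv.1
    have hm2 : AEStronglyMeasurable (fun x => mollify Ω (k m) g x - g x) (volume.restrict Ω) :=
      (hgc m).aestronglyMeasurable.sub hg.1
    refine (eLpNorm_add_le (hm1.smul hφg.aestronglyMeasurable)
      (hφc.aestronglyMeasurable.smul hm2) le_rfl).trans (add_le_add ?_ ?_)
    · refine (eLpNorm_le_mul_eLpNorm_of_ae_le_mul (c := M)
        (g := fun x => mollify Ω (k m) v x - v x) (Eventually.of_forall fun x => ?_) 1).trans
        (mul_le_mul' le_rfl (eLpNorm_mollify_sub_restrict_le hΩm Subset.rfl))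
      rw [Pi.smul_apply', norm_smul, mul_comm]
      exact mul_le_mul_of_nonneg_right (hM x).2 (norm_nonneg _)
    · refine (eLpNorm_le_mul_eLpNorm_of_ae_le_mul (c := M)
        (g := fun x => mollify Ω (k m) g x - g x) (Eventually.of_forall fun x => ?_) 1).trans
        (mul_le_mul' le_rfl (eLpNorm_mollify_sub_restrict_le hΩm Subset.rfl))
      rw [Pi.smul_apply', norm_smul]
      exact mul_le_mul_of_nonneg_right (hM x).1 (norm_nonneg _)
  -- The boundary integrals converge by uniform convergence.
  have hR : Tendsto (fun m => ∫ x, (φ x * mollify Ω (k m) v x) • outerNormal Ω x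
      ∂(surfaceMeasure Ω)) atTop
      (𝓝 (∫ x, (φ x * vt x) • outerNormal Ω x ∂(surfaceMeasure Ω))) := by
    refine Metric.tendsto_nhds.2 fun ε hε => ?_
    set σ := (surfaceMeasure Ω).real univ with hσ
    have hσ0 : 0 ≤ σ := measureReal_nonneg
    have hpos : 0 < ε / (M * σ + 1) := by positivity
    filter_upwards [Metric.tendstoUniformlyOn_iff.1 hlim _ hpos] with m hm
    have hi := hΩ.integrable_smul_outerNormal (g := fun x => φ x * mollify Ω (k m) v x)
      (hφc.mul (hwc m)).continuousOn
    rw [dist_eq_norm, ← integral_sub hi hψi]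
    refine (norm_integral_le_of_norm_le_const (C := M * (ε / (M * σ + 1))) ?_).trans_lt ?_
    · filter_upwards [ae_restrict_mem isClosed_frontier.measurableSet] with x hx
      rw [← sub_smul, norm_smul, ← mul_sub, norm_mul]
      refine (mul_le_of_le_one_right (by positivity) (norm_outerNormal_le Ω x)).trans ?_
      by_cases hxs : x ∈ tsupport φ
      · refine mul_le_mul (hM x).1 ?_ (norm_nonneg _) hM0
        have := hm x ⟨frontier_subset_closure hx, hsupp hxs⟩
        rw [dist_comm, dist_eq_norm] at this
        exact this.le
      · rw [image_eq_zero_of_notMem_tsupport hxs, norm_zero, zero_mul]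
        positivity
    · rw [← hσ, mul_right_comm, mul_div_assoc', div_lt_iff₀ (by positivity)]
      nlinarith
  simp_rw [hdiv] at hL
  exact tendsto_nhds_unique hL hR

/-- The continuous representative near a point of the closure, and its boundary values. -/
theorem IsPolygonalDomain.exists_local_representative (hΩ : IsPolygonalDomain Ω) {q : ℝ}
    (hq : 1 < q) (hdq : ((n + 1 : ℕ) : ℝ) < 2 * q) {v w : Pt (n + 1) → ℝ}
    {g : Pt (n + 1) → Pt (n + 1)} {H : Pt (n + 1) → Pt (n + 1) →L[ℝ] Pt (n + 1)}
    (hv : IntegrableOn v Ω) (hg : IntegrableOn g Ω)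
    (hH : MemLp H (ENNReal.ofReal q) (volume.restrict Ω)) (h1 : HasWeakGradient Ω v g)
    (h2 : ∀ z, HasWeakGradient Ω (fun x => inner ℝ (g x) z) (fun x => H x z))
    (hw : Integrable w (surfaceMeasure Ω)) (htr : HasTrace Ω v g w) {a : Pt (n + 1)}
    (ha : a ∈ closure Ω) :
    ∃ r > 0, ∃ vt : Pt (n + 1) → ℝ, ContinuousOn vt (closure Ω ∩ Metric.ball a r) ∧
      (∀ᵐ x ∂(volume : Measure (Pt (n + 1))), x ∈ Ω → x ∈ Metric.ball a r → vt x = v x) ∧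
      ∀ᵐ x ∂(surfaceMeasure Ω), x ∈ Metric.ball a r → vt x = w x := by
  have hΩm := hΩ.isOpen.measurableSet
  obtain ⟨S, hS⟩ := hΩ.exists_isPolyhedralOpen
  have hfin := hS.isFiniteMeasure
  obtain ⟨r, hr, k, η, vt, hk, hη, hkΩ, hlim⟩ := hΩ.exists_local_limit hq hdq hv hg hH h1 h2 ha
  have hvt : ContinuousOn vt (closure Ω ∩ Metric.ball a r) :=
    hlim.continuousOn (Eventually.of_forall fun m =>
      (continuous_mollify (hk m).isTestFunction hΩm hv).continuousOn).frequently
  have hsub : Metric.ball a (r / 2) ⊆ Metric.ball a r := Metric.ball_subset_ball (by linarith)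
  refine ⟨r / 2, half_pos hr, vt, hvt.mono (inter_subset_inter_right _ hsub), ?_, ?_⟩
  · filter_upwards [ae_eq_of_tendstoUniformlyOn hΩm hv hk hη hlim] with x hx hxΩ hxb
    exact hx hxΩ ⟨subset_closure hxΩ, hsub hxb⟩
  · have hνm := hS.aestronglyMeasurable_outerNormal
    have hvti : IntegrableOn vt (Metric.ball a (r / 2)) (surfaceMeasure Ω) := by
      have hc : IsCompact (frontier Ω ∩ Metric.closedBall a (r / 2)) :=
        hS.isCompact_frontier.inter_right Metric.isClosed_closedBall
      have h3 : IntegrableOn vt (frontier Ω ∩ Metric.closedBall a (r / 2)) (surfaceMeasure Ω) :=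
        (hvt.mono (inter_subset_inter frontier_subset_closure
          (Metric.closedBall_subset_ball (by linarith)))).integrableOn_compact hc
      have h4 : IntegrableOn vt (Metric.closedBall a (r / 2)) (surfaceMeasure Ω) := by
        refine h3.mono_set_ae ?_
        filter_upwards [ae_restrict_mem isClosed_frontier.measurableSet] with x hx hxb
        exact ⟨hx, hxb⟩
      exact h4.mono_set Metric.ball_subset_closedBall
    have hloc : LocallyIntegrableOn (fun x => (vt x - w x) • outerNormal Ω x)
        (Metric.ball a (r / 2)) (surfaceMeasure Ω) := by
      have h3 : IntegrableOn (fun x => vt x - w x) (Metric.ball a (r / 2)) (surfaceMeasure Ω) :=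
        hvti.sub hw.integrableOn
      have h4 : IntegrableOn (fun x => (vt x - w x) • outerNormal Ω x) (Metric.ball a (r / 2))
          (surfaceMeasure Ω) :=
        Integrable.smul_bdd h3 1 hνm.restrict (Eventually.of_forall (norm_outerNormal_le Ω))
      exact h4.locallyIntegrableOn
    -- Green's formula for the limit and the definition of the trace have the same bulk integral.
    have hzero := IsOpen.ae_eq_zero_of_integral_contDiff_smul_eq_zero Metric.isOpen_ball hloc
      fun φ hφ hφc hsupp => by
        have hφt : IsTestFunction φ := ⟨hφ, hφc⟩
        obtain ⟨hi, hgreen⟩ := green_of_tendstoUniformlyOn hS hv hg h1 hk hη Metric.isOpen_ball hkΩ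
          hlim hφt (hsupp.trans hsub)
        obtain ⟨M, hM⟩ := hφt.exists_bound
        have hi2 : Integrable (fun x => (φ x * w x) • outerNormal Ω x) (surfaceMeasure Ω) := by
          have h3 : Integrable (fun x => φ x * w x) (surfaceMeasure Ω) :=
            hw.bdd_mul hφ.continuous.aestronglyMeasurable (Eventually.of_forall fun x => (hM x).1)
          exact Integrable.smul_bdd h3 1 hνm (Eventually.of_forall (norm_outerNormal_le Ω))
        have e1 : ∀ x, φ x • (vt x - w x) • outerNormal Ω x =
            (φ x * vt x) • outerNormal Ω x - (φ x * w x) • outerNormal Ω x := fun x => by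
          rw [← sub_smul, smul_smul, mul_sub]
        simp_rw [e1]
        rw [integral_sub hi hi2, ← hgreen, htr φ hφt, sub_self]
    filter_upwards [hzero, hS.ae_mem_openFaces] with x hx hν hxb
    have h3 := hx hxb
    rcases smul_eq_zero.1 h3 with h4 | h4
    · linarith
    · have := hν.1
      rw [h4, norm_zero] at this
      exact absurd this zero_ne_one

/-- Functions with second weak derivatives in `L_q`, `q > d / 2`, have a representative which is
continuous up to the boundary, where it is the trace. -/
theorem IsPolygonalDomain.exists_continuous_representative (hΩ : IsPolygonalDomain Ω) {q : ℝ}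
    (hq : 1 < q) (hdq : ((n + 1 : ℕ) : ℝ) < 2 * q) {v w : Pt (n + 1) → ℝ}
    {g : Pt (n + 1) → Pt (n + 1)} {H : Pt (n + 1) → Pt (n + 1) →L[ℝ] Pt (n + 1)}
    (hv : IntegrableOn v Ω) (hg : IntegrableOn g Ω)
    (hH : MemLp H (ENNReal.ofReal q) (volume.restrict Ω)) (h1 : HasWeakGradient Ω v g)
    (h2 : ∀ z, HasWeakGradient Ω (fun x => inner ℝ (g x) z) (fun x => H x z))
    (hw : Integrable w (surfaceMeasure Ω)) (htr : HasTrace Ω v g w) :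
    ∃ vt : Pt (n + 1) → ℝ, ContinuousOn vt (closure Ω) ∧ vt =ᵐ[bulkMeasure Ω] v ∧
      vt =ᵐ[surfaceMeasure Ω] w := by
  have hΩm := hΩ.isOpen.measurableSet
  have hex : ∀ a : Pt (n + 1), ∃ (r : ℝ) (vt : Pt (n + 1) → ℝ), a ∈ closure Ω → 0 < r ∧
      ContinuousOn vt (closure Ω ∩ Metric.ball a r) ∧
      (∀ᵐ x ∂(volume : Measure (Pt (n + 1))), x ∈ Ω → x ∈ Metric.ball a r → vt x = v x) ∧
      ∀ᵐ x ∂(surfaceMeasure Ω), x ∈ Metric.ball a r → vt x = w x := by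
    intro a
    by_cases ha : a ∈ closure Ω
    · obtain ⟨r, hr, vt, h⟩ := hΩ.exists_local_representative hq hdq hv hg hH h1 h2 hw htr ha
      exact ⟨r, vt, fun _ => ⟨hr, h⟩⟩
    · exact ⟨0, 0, fun h => absurd h ha⟩
  choose r u hu using hex
  -- Two local representatives agree almost everywhere in `Ω`, hence everywhere on the overlap by
  -- continuity.
  have hcomp : ∀ a ∈ closure Ω, ∀ b ∈ closure Ω,
      EqOn (u a) (u b) (closure Ω ∩ (Metric.ball a (r a) ∩ Metric.ball b (r b))) := by
    intro a ha b hb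
    obtain ⟨-, ca, ea, -⟩ := hu a ha
    obtain ⟨-, cb, eb, -⟩ := hu b hb
    set O := Metric.ball a (r a) ∩ Metric.ball b (r b) with hO
    have hOo : IsOpen O := Metric.isOpen_ball.inter Metric.isOpen_ball
    have ca' : ContinuousOn (u a) (closure Ω ∩ O) :=
      ca.mono (inter_subset_inter_right _ inter_subset_left)
    have cb' : ContinuousOn (u b) (closure Ω ∩ O) :=
      cb.mono (inter_subset_inter_right _ inter_subset_right)
    have hsub : Ω ∩ O ⊆ closure Ω ∩ O := inter_subset_inter_left _ subset_closure
    have h3 : EqOn (u a) (u b) (Ω ∩ O) := by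
      refine Measure.eqOn_open_of_ae_eq (μ := volume) ?_ (hΩ.isOpen.inter hOo) (ca'.mono hsub)
        (cb'.mono hsub)
      filter_upwards [ae_restrict_of_ae ea, ae_restrict_of_ae eb,
        ae_restrict_mem (hΩm.inter hOo.measurableSet)] with x hxa hxb hx
      rw [hxa hx.1 hx.2.1, hxb hx.1 hx.2.2]
    refine h3.of_subset_closure ca' cb' hsub ?_
    rintro x ⟨hx1, hx2⟩
    rw [inter_comm]
    exact hOo.inter_closure ⟨hx2, hx1⟩
  have hloc : ∀ a ∈ closure Ω, ∀ x ∈ closure Ω ∩ Metric.ball a (r a), u x x = u a x :=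
    fun a ha x hx => hcomp x hx.1 a ha
      ⟨hx.1, Metric.mem_ball_self (hu x hx.1).1, hx.2⟩
  have hnull : ∀ (μ : Measure (Pt (n + 1))) (f : Pt (n + 1) → ℝ),
      (∀ᵐ x ∂μ, x ∈ closure Ω) → (∀ a ∈ closure Ω, ∀ᵐ x ∂μ, x ∈ Metric.ball a (r a) → u a x = f x) →
      (fun x => u x x) =ᵐ[μ] f := by
    intro μ f hcl hf
    have h3 : μ {x ∈ closure Ω | u x x ≠ f x} = 0 := by
      refine measure_null_of_locally_null _ fun a ha => ?_
      refine ⟨_, inter_mem self_mem_nhdsWithin (mem_nhdsWithin_of_mem_nhds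
        (Metric.ball_mem_nhds a (hu a ha.1).1)), ?_⟩
      refine measure_mono_null ?_ (ae_iff.1 (hf a ha.1))
      rintro x ⟨⟨hx1, hx2⟩, hx3⟩ hc
      exact hx2 ((hloc a ha.1 x ⟨hx1, hx3⟩).trans (hc hx3))
    have h4 : ∀ᵐ x ∂μ, ¬(x ∈ closure Ω ∧ u x x ≠ f x) := by
      rw [ae_iff]
      simpa using h3
    filter_upwards [hcl, h4] with x hx hx'
    by_contra hne
    exact hx' ⟨hx, hne⟩
  -- The local representatives are glued on the diagonal.
  refine ⟨fun x => u x x, fun a ha => ?_, ?_, ?_⟩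
  · have h3 : ContinuousWithinAt (u a) (closure Ω) a :=
      ((hu a ha).2.1 a ⟨ha, Metric.mem_ball_self (hu a ha).1⟩).mono_of_mem_nhdsWithin
        (inter_mem self_mem_nhdsWithin (mem_nhdsWithin_of_mem_nhds
          (Metric.ball_mem_nhds a (hu a ha).1)))
    refine h3.congr_of_eventuallyEq ?_ rfl
    filter_upwards [self_mem_nhdsWithin, mem_nhdsWithin_of_mem_nhds
      (Metric.ball_mem_nhds a (hu a ha).1)] with x hx1 hx2
    exact hloc a ha x ⟨hx1, hx2⟩
  · refine hnull _ _ ?_ fun a ha => ?_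
    · filter_upwards [ae_restrict_mem hΩm] with x hx using subset_closure hx
    · filter_upwards [ae_restrict_of_ae (hu a ha).2.2.1, ae_restrict_mem hΩm] with x hx hxΩ
      exact hx hxΩ
  · refine hnull _ _ ?_ fun a ha => (hu a ha).2.2.2
    filter_upwards [ae_restrict_mem isClosed_frontier.measurableSet] with x hx
      using frontier_subset_closure hx

end

section

/-! ### Flat faces in coordinates -/

variable {n : ℕ} {Ω : Set (Pt (n + 1))} {S : Finset (Set (Pt (n + 1)))}

theorem inner_mul_inner_sub (a b e f : Pt d) :
    inner ℝ a e * inner ℝ b f - inner ℝ a f * inner ℝ b e =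
      ∑ i, ∑ j, e i * f j * (a i * b j - a j * b i) := by
  have h : ∀ x y : Pt d, inner ℝ x y = ∑ i, y i * x i := fun x y => by
    simp [PiLp.inner_apply]
  simp_rw [h, Finset.sum_mul_sum]
  rw [Finset.sum_comm (f := fun i j => f i * a i * (e j * b j)), ← Finset.sum_sub_distrib]
  refine Finset.sum_congr rfl fun i _ => ?_
  rw [← Finset.sum_sub_distrib]
  exact Finset.sum_congr rfl fun j _ => by ring

/-- The defining identity of the surface gradient, contracted with two vectors. -/
theorem HasSurfaceGradientOn.integral_eq (hΩ : IsPolyhedralOpen Ω S) {R : Set (Pt (n + 1))}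
    {w : Pt (n + 1) → ℝ} {G : Pt (n + 1) → Pt (n + 1)} (h : HasSurfaceGradientOn Ω R w G)
    (hw : Integrable w (surfaceMeasure Ω)) (hG : Integrable G (surfaceMeasure Ω))
    {φ : Pt (n + 1) → ℝ} (hφ : IsTestFunction φ) (hsupp : tsupport φ ∩ frontier Ω ⊆ R)
    (e f : Pt (n + 1)) :
    ∫ x, w x * (inner ℝ (outerNormal Ω x) e * inner ℝ (gradient φ x) f -
        inner ℝ (outerNormal Ω x) f * inner ℝ (gradient φ x) e) ∂(surfaceMeasure Ω) =
      - ∫ x, φ x * (inner ℝ (outerNormal Ω x) e * inner ℝ (G x) f -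
        inner ℝ (outerNormal Ω x) f * inner ℝ (G x) e) ∂(surfaceMeasure Ω) := by
  have hfin := hΩ.isFiniteMeasure
  have hνm := hΩ.aestronglyMeasurable_outerNormal
  have hcoord : ∀ (x : Pt (n + 1)) (i : Fin (n + 1)), ‖x i‖ ≤ ‖x‖ := PiLp.norm_apply_le
  have hνi : ∀ i, AEStronglyMeasurable (fun x => outerNormal Ω x i) (surfaceMeasure Ω) := fun i =>
    (EuclideanSpace.proj (𝕜 := ℝ) i).continuous.comp_aestronglyMeasurable hνm
  have hνb : ∀ i x, ‖outerNormal Ω x i‖ ≤ 1 := fun i x =>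
    (hcoord _ i).trans (norm_outerNormal_le Ω x)
  obtain ⟨M, hM⟩ := hφ.exists_bound
  have hgc := hφ.continuous_gradient
  have i1 : ∀ i j, Integrable (fun x => w x * (outerNormal Ω x i * gradient φ x j))
      (surfaceMeasure Ω) := fun i j => by
    have hgj : Continuous fun x => gradient φ x j := by fun_prop
    refine hw.mul_bdd (c := 1 * M) ((hνi i).mul hgj.aestronglyMeasurable)
      (Eventually.of_forall fun x => ?_)
    rw [norm_mul]
    exact mul_le_mul (hνb i x) ((hcoord _ j).trans (hM x).2) (norm_nonneg _) zero_le_one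
  have i2 : ∀ i j, Integrable (fun x => φ x * (outerNormal Ω x i * G x j))
      (surfaceMeasure Ω) := fun i j =>
    ((integrable_apply hG j).bdd_mul (hνi i) (Eventually.of_forall (hνb i))).bdd_mul
      hφ.1.continuous.aestronglyMeasurable (Eventually.of_forall fun x => (hM x).1)
  have e1 : ∀ x, w x * (inner ℝ (outerNormal Ω x) e * inner ℝ (gradient φ x) f -
      inner ℝ (outerNormal Ω x) f * inner ℝ (gradient φ x) e) = ∑ i, ∑ j, e i * f j *
        (w x * (outerNormal Ω x i * gradient φ x j) -
          w x * (outerNormal Ω x j * gradient φ x i)) := fun x => by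
    simp_rw [inner_mul_inner_sub, Finset.mul_sum]
    exact Finset.sum_congr rfl fun i _ => Finset.sum_congr rfl fun j _ => by ring
  have e2 : ∀ x, φ x * (inner ℝ (outerNormal Ω x) e * inner ℝ (G x) f -
      inner ℝ (outerNormal Ω x) f * inner ℝ (G x) e) = ∑ i, ∑ j, e i * f j *
        (φ x * (outerNormal Ω x i * G x j) - φ x * (outerNormal Ω x j * G x i)) := fun x => by
    simp_rw [inner_mul_inner_sub, Finset.mul_sum]
    exact Finset.sum_congr rfl fun i _ => Finset.sum_congr rfl fun j _ => by ring
  have j1 : ∀ i j, Integrable (fun x => e i * f j *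
      (w x * (outerNormal Ω x i * gradient φ x j) - w x * (outerNormal Ω x j * gradient φ x i)))
      (surfaceMeasure Ω) := fun i j => ((i1 i j).sub (i1 j i)).const_mul _
  have j2 : ∀ i j, Integrable (fun x => e i * f j *
      (φ x * (outerNormal Ω x i * G x j) - φ x * (outerNormal Ω x j * G x i)))
      (surfaceMeasure Ω) := fun i j => ((i2 i j).sub (i2 j i)).const_mul _
  simp_rw [e1, e2]
  rw [integral_finsetSum _ fun i _ => integrable_finsetSum _ fun j _ => j1 i j,
    integral_finsetSum _ fun i _ => integrable_finsetSum _ fun j _ => j2 i j,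
    ← Finset.sum_neg_distrib]
  refine Finset.sum_congr rfl fun i _ => ?_
  rw [integral_finsetSum _ fun j _ => j1 i j, integral_finsetSum _ fun j _ => j2 i j,
    ← Finset.sum_neg_distrib]
  refine Finset.sum_congr rfl fun j _ => ?_
  rw [integral_const_mul, integral_const_mul]
  have h1 := h.2 φ hφ hsupp i j
  simp_rw [mul_sub] at h1
  rw [h1]
  ring

/-- A flat piece `F` of the boundary with outer unit normal `ν`, in the coordinates
`y ↦ L y + c • ν` of its hyperplane. -/
structure IsFlatPiece (Ω F : Set (Pt (n + 1))) (ν : Pt (n + 1)) (c : ℝ)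
    (L : Pt n →ₗᵢ[ℝ] Pt (n + 1)) : Prop where
  norm_eq_one : ‖ν‖ = 1
  isChart : IsChart ν L
  subset_hyperplane : F ⊆ {x | inner ℝ ν x = c}
  isOuterNormal : ∀ x ∈ F, IsOuterNormal Ω x ν
  measurableSet : MeasurableSet F

namespace IsFlatPiece

variable {F : Set (Pt (n + 1))} {ν : Pt (n + 1)} {c : ℝ} {L : Pt n →ₗᵢ[ℝ] Pt (n + 1)}

theorem subset_frontier (h : IsFlatPiece Ω F ν c L) : F ⊆ frontier Ω := fun x hx =>
  (h.isOuterNormal x hx).mem_frontier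

theorem measurableEmbedding (L : Pt n →ₗᵢ[ℝ] Pt (n + 1)) (v : Pt (n + 1)) :
    MeasurableEmbedding (fun y : Pt n => L y + v) :=
  ((isometry_add_right v).comp L.isometry).isClosedEmbedding.measurableEmbedding

theorem map_volume (h : IsFlatPiece Ω F ν c L) :
    ((volume : Measure (Pt n)).restrict ((fun y => L y + c • ν) ⁻¹' F)).map
      (fun y => L y + c • ν) = (surfaceMeasure Ω).restrict F := by
  rw [← (measurableEmbedding L (c • ν)).restrict_map, h.isChart.map_volume h.norm_eq_one,
    Measure.restrict_restrict h.measurableSet, Measure.restrict_restrict h.measurableSet,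
    inter_eq_left.2 h.subset_hyperplane, inter_eq_left.2 h.subset_frontier]
  rfl

theorem setIntegral_eq (h : IsFlatPiece Ω F ν c L) (f : Pt (n + 1) → ℝ) :
    ∫ x in F, f x ∂(surfaceMeasure Ω) =
      ∫ y in (fun y => L y + c • ν) ⁻¹' F, f (L y + c • ν) := by
  rw [← h.map_volume, (measurableEmbedding L (c • ν)).integral_map]

theorem integrableOn_comp (h : IsFlatPiece Ω F ν c L) {V : Type*} [NormedAddCommGroup V]
    {f : Pt (n + 1) → V} (hf : Integrable f (surfaceMeasure Ω)) :
    IntegrableOn (fun y => f (L y + c • ν)) ((fun y => L y + c • ν) ⁻¹' F) := by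
  have h1 := hf.integrableOn (s := F)
  rw [IntegrableOn, ← h.map_volume, (measurableEmbedding L (c • ν)).integrable_map_iff] at h1
  exact h1

theorem eLpNorm_comp (h : IsFlatPiece Ω F ν c L) {V : Type*} [NormedAddCommGroup V]
    (f : Pt (n + 1) → V) (q : ℝ≥0∞) :
    eLpNorm (fun y => f (L y + c • ν)) q
        (volume.restrict ((fun y => L y + c • ν) ⁻¹' F)) =
      eLpNorm f q ((surfaceMeasure Ω).restrict F) := by
  rw [← h.map_volume, (measurableEmbedding L (c • ν)).eLpNorm_map_measure]
  rfl

theorem outerNormal_eq (h : IsFlatPiece Ω F ν c L) {x : Pt (n + 1)} (hx : x ∈ F) :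
    outerNormal Ω x = ν :=
  (h.isOuterNormal x hx).outerNormal_eq

/-- Near a flat piece, the boundary is contained in its hyperplane. -/
theorem subset_interior (h : IsFlatPiece Ω F ν c L) :
    F ⊆ interior {x | x ∈ frontier Ω → inner ℝ ν x = c} := by
  intro p hp
  obtain ⟨-, r, hr, hball⟩ := h.isOuterNormal p hp
  refine mem_interior.2 ⟨Metric.ball p r, fun y hy hyf => ?_, Metric.isOpen_ball,
    Metric.mem_ball_self hr⟩
  have hpc : inner ℝ ν p = c := h.subset_hyperplane hp
  have hcont : Continuous fun y : Pt (n + 1) => inner ℝ (y - p) ν := by fun_prop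
  have h0 : inner ℝ (y - p) ν = 0 := by
    rcases lt_trichotomy (inner ℝ (y - p) ν) 0 with h1 | h1 | h1
    · exfalso
      refine hyf.2 (mem_interior.2 ⟨Metric.ball p r ∩ {y | inner ℝ (y - p) ν < 0},
        fun z hz => (hball z hz.1).2 hz.2,
        Metric.isOpen_ball.inter (isOpen_lt hcont continuous_const), hy, h1⟩)
    · exact h1
    · exfalso
      obtain ⟨z, hz1, hz2⟩ := mem_closure_iff.1 hyf.1
        (Metric.ball p r ∩ {y | 0 < inner ℝ (y - p) ν})
        (Metric.isOpen_ball.inter (isOpen_lt continuous_const hcont)) ⟨hy, h1⟩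
      exact lt_asymm hz1.2 ((hball z hz1.1).1 hz2)
  rw [inner_sub_left, real_inner_comm, real_inner_comm ν p, hpc] at h0
  linarith

theorem adjoint_apply (h : IsFlatPiece Ω F ν c L) (y : Pt n) (s : ℝ) :
    L.toContinuousLinearMap.adjoint (L y + s • ν) = y := by
  refine ext_inner_right ℝ fun z => ?_
  rw [ContinuousLinearMap.adjoint_inner_left, inner_add_left, inner_smul_left]
  simp only [LinearIsometry.coe_toContinuousLinearMap, LinearIsometry.inner_map_map,
    h.isChart.inner_apply, mul_zero, add_zero]

/-- Test functions on the coordinate space extend to test functions whose support meets the boundary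
within the flat piece only. -/
theorem exists_extension (h : IsFlatPiece Ω F ν c L) {φ : Pt n → ℝ} (hφ : IsTestFunction φ)
    (hsupp : tsupport φ ⊆ (fun y => L y + c • ν) ⁻¹' F) :
    ∃ Φ : Pt (n + 1) → ℝ, IsTestFunction Φ ∧ tsupport Φ ∩ frontier Ω ⊆ F ∧
      ∀ y, Φ (L y + c • ν) = φ y := by
  have hι : Continuous fun y : Pt n => L y + c • ν := by fun_prop
  have hK : IsCompact ((fun y => L y + c • ν) '' tsupport φ) := hφ.2.isCompact.image hι
  obtain ⟨δ, hδ, hδO⟩ := hK.exists_cthickening_subset_open isOpen_interior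
    ((image_subset_iff.2 hsupp).trans h.subset_interior)
  -- The extension is constant in the normal direction, up to a cutoff with support so close to
  -- the hyperplane that no other part of the boundary is met.
  let χ : ContDiffBump (0 : ℝ) := ⟨δ / 2, δ, half_pos hδ, half_lt_self hδ⟩
  set A := L.toContinuousLinearMap.adjoint with hA
  have hdec : ∀ x, x = L (A x) + (inner ℝ ν x : ℝ) • ν := by
    intro x
    obtain ⟨y, hy⟩ := h.isChart.exists_eq_add h.norm_eq_one x
    have h1 : A x = y := by rw [hy, h.adjoint_apply]
    rw [h1, ← hy]
  set Z : Set (Pt (n + 1)) := (fun p : Pt n × ℝ => L p.1 + p.2 • ν) ''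
    (tsupport φ ×ˢ Metric.closedBall c δ) with hZ
  have hZc : IsCompact Z :=
    (hφ.2.isCompact.prod (isCompact_closedBall c δ)).image (by fun_prop)
  have hΦZ : Function.support (fun x => φ (A x) * χ (inner ℝ ν x - c)) ⊆ Z := by
    intro x hx
    have h1 : φ (A x) ≠ 0 := left_ne_zero_of_mul hx
    have h2 : χ (inner ℝ ν x - c) ≠ 0 := right_ne_zero_of_mul hx
    refine ⟨(A x, inner ℝ ν x), ⟨subset_tsupport _ h1, ?_⟩, (hdec x).symm⟩
    have h3 : inner ℝ ν x - c ∈ Metric.ball (0 : ℝ) δ := by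
      rw [← χ.support_eq]
      exact h2
    rw [Metric.mem_closedBall, dist_eq_norm]
    rw [mem_ball_zero_iff] at h3
    exact h3.le
  refine ⟨fun x => φ (A x) * χ (inner ℝ ν x - c), ⟨?_, ?_⟩, ?_, fun y => ?_⟩
  · have h1 := hφ.1
    have h2 : ContDiff ℝ ∞ (χ : ℝ → ℝ) := χ.contDiff
    exact (h1.comp A.contDiff).mul
      (h2.comp ((contDiff_const.inner ℝ contDiff_id).sub contDiff_const))
  · exact HasCompactSupport.of_support_subset_isCompact hZc hΦZ
  · rintro x ⟨hx, hxf⟩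
    obtain ⟨⟨y, s⟩, ⟨hy, hs⟩, rfl⟩ := closure_minimal hΦZ hZc.isClosed hx
    have hxO : L y + s • ν ∈ interior {x | x ∈ frontier Ω → inner ℝ ν x = c} := by
      refine hδO (Metric.mem_cthickening_of_dist_le _ (L y + c • ν) δ _ ⟨y, hy, rfl⟩ ?_)
      rw [dist_eq_norm, add_sub_add_left_eq_sub, ← sub_smul, norm_smul, h.norm_eq_one, mul_one,
        ← dist_eq_norm]
      exact hs
    have h1 := interior_subset hxO hxf
    rw [inner_add_right, h.isChart.inner_apply, inner_smul_right, real_inner_self_eq_norm_sq,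
      h.norm_eq_one] at h1
    have h2 : s = c := by linarith
    subst h2
    exact hsupp hy
  · have h1 : inner ℝ ν (L y + c • ν) - c = 0 := by
      rw [inner_add_right, h.isChart.inner_apply, inner_smul_right, real_inner_self_eq_norm_sq,
        h.norm_eq_one]
      ring
    simp only [hA]
    rw [h.adjoint_apply, h1, χ.one_of_mem_closedBall (by simpa [χ] using (half_pos hδ).le), mul_one]

/-- In the coordinates of a flat piece, the surface gradient is the weak gradient. -/
theorem hasWeakGradient (h : IsFlatPiece Ω F ν c L) (hΩ : IsPolyhedralOpen Ω S)
    {R : Set (Pt (n + 1))} {w : Pt (n + 1) → ℝ} {G : Pt (n + 1) → Pt (n + 1)}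
    (hwG : HasSurfaceGradientOn Ω R w G) (hw : Integrable w (surfaceMeasure Ω))
    (hG : Integrable G (surfaceMeasure Ω)) (hFR : F ⊆ R) :
    HasWeakGradient ((fun y => L y + c • ν) ⁻¹' F) (fun y => w (L y + c • ν))
      (fun y => L.toContinuousLinearMap.adjoint (G (L y + c • ν))) := by
  intro φ hφ hsupp
  obtain ⟨Φ, hΦ, hΦF, hΦφ⟩ := h.exists_extension hφ hsupp
  have hgrad : ∀ y z, inner ℝ (gradient Φ (L y + c • ν)) (L z) = inner ℝ (gradient φ y) z := by
    intro y z
    have h1 : HasFDerivAt (fun y : Pt n => L y + c • ν) L.toContinuousLinearMap y :=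
      (L.toContinuousLinearMap.hasFDerivAt).add_const _
    have h2 := (hΦ.hasGradientAt (L y + c • ν)).hasFDerivAt.comp y h1
    have h3 : (Φ ∘ fun y : Pt n => L y + c • ν) = φ := funext hΦφ
    rw [h3] at h2
    have h4 := h2.unique (hφ.hasGradientAt y).hasFDerivAt
    have h5 := congrArg (fun T : Pt n →L[ℝ] ℝ => T z) h4
    simpa using h5
  obtain ⟨M, hM⟩ := hφ.exists_bound
  have hvan : ∀ x ∈ frontier Ω, x ∉ F → Φ x = 0 ∧ gradient Φ x = 0 := by
    intro x hx hxF
    have h1 : x ∉ tsupport Φ := fun hc => hxF (hΦF ⟨hc, hx⟩)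
    exact ⟨image_eq_zero_of_notMem_tsupport h1,
      image_eq_zero_of_notMem_tsupport fun hc => h1 (IsTestFunction.tsupport_gradient hc)⟩
  have hloc : ∀ f : Pt (n + 1) → ℝ, (∀ x ∈ frontier Ω, x ∉ F → f x = 0) →
      ∫ x, f x ∂(surfaceMeasure Ω) = ∫ x in F, f x ∂(surfaceMeasure Ω) := by
    intro f hf
    refine (setIntegral_eq_integral_of_ae_compl_eq_zero ?_).symm
    filter_upwards [ae_restrict_mem isClosed_frontier.measurableSet] with x hx hxF
    exact hf x hx hxF
  have i1 : IntegrableOn (fun y => w (L y + c • ν) • gradient φ y)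
      ((fun y => L y + c • ν) ⁻¹' F) :=
    Integrable.smul_bdd (h.integrableOn_comp hw) M hφ.continuous_gradient.aestronglyMeasurable
      (Eventually.of_forall fun y => (hM y).2)
  have i2 : IntegrableOn (fun y => φ y • L.toContinuousLinearMap.adjoint (G (L y + c • ν)))
      ((fun y => L y + c • ν) ⁻¹' F) := by
    refine Integrable.bdd_smul ?_ M hφ.1.continuous.aestronglyMeasurable
      (Eventually.of_forall fun y => (hM y).1)
    exact L.toContinuousLinearMap.adjoint.integrable_comp (h.integrableOn_comp hG)
  refine ext_inner_right ℝ fun z => ?_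
  have hLz : inner ℝ ν (L z) = 0 := h.isChart.inner_apply z
  have hνν : inner ℝ ν ν = (1 : ℝ) := by rw [real_inner_self_eq_norm_sq, h.norm_eq_one, one_pow]
  -- With the normal and a tangent vector as the two directions, the defining identity reduces to
  -- the tangential derivative in the direction `L z`.
  have key := hwG.integral_eq hΩ hw hG hΦ (hΦF.trans hFR) ν (L z)
  rw [hloc _ fun x hx hxF => by rw [(hvan x hx hxF).2]; simp,
    hloc _ fun x hx hxF => by rw [(hvan x hx hxF).1]; simp, h.setIntegral_eq,
    h.setIntegral_eq] at key
  rw [inner_neg_left, real_inner_comm, ← integral_inner i1, real_inner_comm, ← integral_inner i2]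
  have hUm : MeasurableSet ((fun y => L y + c • ν) ⁻¹' F) :=
    (measurableEmbedding L (c • ν)).measurable h.measurableSet
  refine Eq.trans (setIntegral_congr_fun hUm fun y hy => ?_) (key.trans
    (congrArg Neg.neg (setIntegral_congr_fun hUm fun y hy => ?_)))
  · have hn : outerNormal Ω (L y + c • ν) = ν := h.outerNormal_eq hy
    rw [hn, hνν, hLz, hgrad, inner_smul_right, real_inner_comm z]
    ring
  · have hn : outerNormal Ω (L y + c • ν) = ν := h.outerNormal_eq hy
    rw [hn, hνν, hLz, hΦφ, inner_smul_right, real_inner_comm _ z,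
      ContinuousLinearMap.adjoint_inner_left]
    simp

end IsFlatPiece

end

section

/-! ### Interpolation on elements and boundary facets -/

theorem dist_le_meshwidth {K : Geometry.SimplicialComplex ℝ (Pt d)} (hK : (elements K).Finite)
    {s : Finset (Pt d)} (hs : s ∈ elements K) {x y : Pt d}
    (hx : x ∈ convexHull ℝ (s : Set (Pt d))) (hy : y ∈ convexHull ℝ (s : Set (Pt d))) :
    dist x y ≤ meshwidth K :=
  (Metric.dist_le_diam_of_mem
    (s.finite_toSet.isCompact_convexHull (𝕜 := ℝ)).isBounded hx hy).trans
    (le_csSup (hK.image _).bddAbove (mem_image_of_mem _ hs))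

theorem meshwidth_pos {K : Geometry.SimplicialComplex ℝ (Pt d)} (hK : (elements K).Finite)
    (hd : 0 < d) {s : Finset (Pt d)} (hs : s ∈ elements K) : 0 < meshwidth K := by
  obtain ⟨a, ha, b, hb, hab⟩ := Finset.one_lt_card.1 (by rw [hs.2]; omega : 1 < s.card)
  exact (dist_pos.2 hab).trans_le (dist_le_meshwidth hK hs (subset_convexHull ℝ _ ha)
    (subset_convexHull ℝ _ hb))

theorem IsSimplex.bary_le_one {s : Finset (Pt d)} (hs : IsSimplex s) {a : Pt d} (ha : a ∈ s)
    {x : Pt d} (hx : x ∈ convexHull ℝ (s : Set (Pt d))) : bary s a x ≤ 1 := by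
  rw [← hs.sum_bary x]
  exact Finset.single_le_sum (f := fun a => bary s a x) (hs.mem_convexHull_iff.1 hx) ha

/-- The gradients of the barycentric coordinates are at most the reciprocal of the inradius. -/
theorem IsSimplex.norm_affGrad_bary_mul_le {s : Finset (Pt d)} (hs : IsSimplex s) {a : Pt d}
    (ha : a ∈ s) {x : Pt d} {r : ℝ} (hr : 0 ≤ r)
    (h : Metric.closedBall x r ⊆ convexHull ℝ (s : Set (Pt d))) :
    ‖affGrad (bary s a)‖ * r ≤ 1 := by
  set g := affGrad (bary s a) with hg
  rcases eq_or_ne g 0 with h0 | h0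
  · rw [h0, norm_zero, zero_mul]
    exact zero_le_one
  have hg0 : ‖g‖ ≠ 0 := norm_ne_zero_iff.2 h0
  have hmem : x - (r * ‖g‖⁻¹) • g ∈ Metric.closedBall x r := by
    rw [mem_closedBall_iff_norm, sub_sub_cancel_left, norm_neg, norm_smul, Real.norm_of_nonneg
      (by positivity), mul_assoc, inv_mul_cancel₀ hg0, mul_one]
  have h1 := hs.mem_convexHull_iff.1 (h hmem) a ha
  have h2 := hs.bary_le_one ha (h (Metric.mem_closedBall_self hr))
  rw [affine_eq (bary s a) x, sub_sub_cancel_left, ← hg, inner_neg_right, inner_smul_right,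
    real_inner_self_eq_norm_sq] at h1
  have h3 : r * ‖g‖⁻¹ * ‖g‖ ^ 2 = ‖g‖ * r := by
    field_simp
  linarith

theorem HasWeakGradient.congr {v v' : Pt d → ℝ} {g g' : Pt d → Pt d} (h : HasWeakGradient Ω v g)
    (hv : v =ᵐ[bulkMeasure Ω] v') (hg : g =ᵐ[bulkMeasure Ω] g') : HasWeakGradient Ω v' g' :=
  fun φ hφ hs => by
    rw [← integral_congr_ae (hv.mono fun x hx => by simp only [hx] :
        (fun x => v x • gradient φ x) =ᵐ[bulkMeasure Ω] fun x => v' x • gradient φ x),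
      ← integral_congr_ae (hg.mono fun x hx => by simp only [hx] :
        (fun x => φ x • g x) =ᵐ[bulkMeasure Ω] fun x => φ x • g' x)]
    exact h φ hφ hs

theorem HasWeakGradient.mono {v : Pt d → ℝ} {g : Pt d → Pt d} (h : HasWeakGradient Ω v g)
    {U : Set (Pt d)} (hU : U ⊆ Ω) : HasWeakGradient U v g := fun φ hφ hs => by
  have hgs : tsupport (gradient φ) ⊆ U := IsTestFunction.tsupport_gradient.trans hs
  have e : ∀ f : Pt d → Pt d, (∀ x ∉ U, f x = 0) → ∫ x in U, f x = ∫ x in Ω, f x := fun f hf => by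
    rw [setIntegral_eq_integral_of_forall_compl_eq_zero hf,
      setIntegral_eq_integral_of_forall_compl_eq_zero fun x hx => hf x fun hxU => hx (hU hxU)]
  rw [e _ fun x hx => by rw [image_eq_zero_of_notMem_tsupport fun hx' => hx (hgs hx'), smul_zero],
    e _ fun x hx => by rw [image_eq_zero_of_notMem_tsupport fun hx' => hx (hs hx'), zero_smul]]
  exact h φ hφ (hs.trans hU)

theorem HasSurfaceGradientOn.congr {R : Set (Pt d)} {w w' : Pt d → ℝ} {G G' : Pt d → Pt d}
    (h : HasSurfaceGradientOn Ω R w G) (hw : w =ᵐ[surfaceMeasure Ω] w')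
    (hG : G =ᵐ[surfaceMeasure Ω] G') : HasSurfaceGradientOn Ω R w' G' := by
  refine ⟨?_, fun φ hφ hs i j => ?_⟩
  · filter_upwards [h.1, hG] with x h1 h2
    rwa [← h2]
  · rw [← integral_congr_ae (hw.mono fun x hx => by simp only [hx] :
        (fun x => w x * (outerNormal Ω x i * gradient φ x j - outerNormal Ω x j * gradient φ x i))
          =ᵐ[surfaceMeasure Ω] fun x =>
            w' x * (outerNormal Ω x i * gradient φ x j - outerNormal Ω x j * gradient φ x i)),
      ← integral_congr_ae (hG.mono fun x hx => by simp only [hx] :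
        (fun x => φ x * (outerNormal Ω x i * G x j - outerNormal Ω x j * G x i))
          =ᵐ[surfaceMeasure Ω] fun x =>
            φ x * (outerNormal Ω x i * G' x j - outerNormal Ω x j * G' x i))]
    exact h.2 φ hφ hs i j

theorem openCell_bary {s : Finset (Pt d)} (hs : IsSimplex s) :
    openCell (fun a : s => bary s (a : Pt d)) = interior (convexHull ℝ (s : Set (Pt d))) := by
  ext x
  rw [hs.mem_interior_iff]
  exact Subtype.forall

theorem closedCell_bary {s : Finset (Pt d)} (hs : IsSimplex s) :
    closedCell (fun a : s => bary s (a : Pt d)) = convexHull ℝ (s : Set (Pt d)) := by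
  ext x
  rw [hs.mem_convexHull_iff]
  exact Subtype.forall

theorem isBarycentric_bary {s : Finset (Pt d)} (hs : IsSimplex s) :
    IsBarycentric (fun a : s => (a : Pt d)) (fun a : s => bary s (a : Pt d)) where
  sum_eq_one x := (Finset.sum_coe_sort s fun a => bary s a x).trans (hs.sum_bary x)
  sum_smul x := (Finset.sum_coe_sort s fun a => bary s a x • a).trans (hs.sum_bary_smul x)
  nonneg a b := by
    by_cases h : (a : Pt d) = b
    · rw [h, hs.bary_self b.2]
      exact zero_le_one
    · rw [hs.bary_ne a.2 b.2 h]

/-- The interpolation estimate on an element. -/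
theorem exists_element_estimate (d : ℕ) {q : ℝ} (hq : 1 < q) (hdq : (d : ℝ) < 2 * q) :
    ∃ C : ℝ≥0, ∀ {s : Finset (Pt d)} {l Λ : ℝ}
      {v : Pt d → ℝ} {g : Pt d → Pt d} {H : Pt d → Pt d →L[ℝ] Pt d}, IsSimplex s →
      (interior (convexHull ℝ (s : Set (Pt d)))).Nonempty →
      (∀ x ∈ convexHull ℝ (s : Set (Pt d)), ∀ y ∈ convexHull ℝ (s : Set (Pt d)), dist x y ≤ l) →
      (∀ a ∈ s, ‖affGrad (bary s a)‖ ≤ Λ) → ContinuousOn v (convexHull ℝ (s : Set (Pt d))) →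
      HasWeakGradient (interior (convexHull ℝ (s : Set (Pt d)))) v g →
      (∀ z, HasWeakGradient (interior (convexHull ℝ (s : Set (Pt d))))
        (fun x => inner ℝ (g x) z) (fun x => H x z)) →
      IntegrableOn g (interior (convexHull ℝ (s : Set (Pt d)))) →
      MemLp H (ENNReal.ofReal q) (volume.restrict (interior (convexHull ℝ (s : Set (Pt d))))) →
      eLpNorm (fun y => affGrad (nodalAff s v) - g y) (ENNReal.ofReal q)
          (volume.restrict (interior (convexHull ℝ (s : Set (Pt d))))) ≤
        (d + 1 : ℕ) * ENNReal.ofReal (2 * Λ) * (C * ENNReal.ofReal (l ^ 2) *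
          eLpNorm H (ENNReal.ofReal q)
            (volume.restrict (interior (convexHull ℝ (s : Set (Pt d)))))) ∧
      ∀ a ∈ convexHull ℝ (s : Set (Pt d)),
        eLpNorm (fun _ => v a - nodalAff s v a) (ENNReal.ofReal q)
          (volume.restrict (interior (convexHull ℝ (s : Set (Pt d))))) ≤
        2 * (C * ENNReal.ofReal (l ^ 2) * eLpNorm H (ENNReal.ofReal q)
          (volume.restrict (interior (convexHull ℝ (s : Set (Pt d)))))) := by
  obtain ⟨C, hC⟩ := exists_interpolation_estimate d hq hdq
  refine ⟨C, fun {s l Λ v g H} hs hne hl hΛ hv h1 h2 hg hH => ?_⟩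
  have h := @hC s _ _ _ l Λ v g H (isBarycentric_bary hs)
  rw [openCell_bary hs, closedCell_bary hs, Fintype.card_coe, hs.2] at h
  obtain ⟨e1, e2⟩ := h hne hl (fun i => hΛ i i.2) hv h1 h2 hg hH
  refine ⟨?_, fun a ha => ?_⟩
  · rw [affGrad_nodalAff, ← Finset.sum_coe_sort s fun a => v a • affGrad (bary s a)]
    exact e1
  · rw [nodalAff_apply, ← Finset.sum_coe_sort s fun b => v b * bary s b a]
    simp_rw [mul_comm (v _)]
    exact e2 a ha

end

section

section Facet

variable {n : ℕ} {K : Geometry.SimplicialComplex ℝ (Pt (n + 1))} {Ω : Set (Pt (n + 1))}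
  {S : Finset (Set (Pt (n + 1)))} {s : Finset (Pt (n + 1))} {a : Pt (n + 1)}

theorem measurableSet_relFacet (s : Finset (Pt d)) (a : Pt d) : MeasurableSet (relFacet s a) := by
  classical
  have e : relFacet s a = {x | bary s a x = 0} ∩ ⋂ b ∈ s.erase a, {x | 0 < bary s b x} := by
    ext x
    simp only [relFacet, mem_inter_iff, mem_ofPred_eq, mem_iInter, Finset.mem_erase]
    exact and_congr_right fun _ => ⟨fun h b hb => h b hb.2 hb.1, fun h b h1 h2 => h b ⟨h2, h1⟩⟩
  rw [e]
  exact (isClosed_eq (continuous_affine _) continuous_const).measurableSet.inter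
    (Finset.measurableSet_biInter _ fun b _ =>
      (isOpen_lt continuous_const (continuous_affine _)).measurableSet)

theorem affGrad_bary_eq (hs : IsSimplex s) (ha : a ∈ s) :
    affGrad (bary s a) = -(‖affGrad (bary s a)‖ • facetNormal s a) := by
  have h0 := norm_ne_zero_iff.2 (hs.affGrad_bary_ne_zero n.succ_pos ha)
  rw [facetNormal, smul_neg, smul_smul, mul_inv_cancel₀ h0, one_smul, neg_neg]

/-- A boundary facet of the triangulation is a flat piece of the boundary. -/
theorem IsMeshed.exists_isFlatPiece (h : IsMeshed Ω K S) (hs : s ∈ elements K) (ha : a ∈ s)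
    (hbd : IsBoundaryFacet K s a) : ∃ (c : ℝ) (L : Pt n →ₗᵢ[ℝ] Pt (n + 1)),
      IsFlatPiece Ω (relFacet s a) (facetNormal s a) c L ∧
      ∀ x, bary s a x = 0 ↔ inner ℝ (facetNormal s a) x = c := by
  have hsx := isSimplex_of_mem_elements hs
  have hν := norm_facetNormal hsx n.succ_pos ha
  obtain ⟨L, hL⟩ := exists_isChart (facetNormal s a) hν
  obtain ⟨b, hb, hba⟩ := Finset.exists_mem_ne (by rw [hs.2]; omega : 1 < s.card) a
  have hiff : ∀ x, bary s a x = 0 ↔ inner ℝ (facetNormal s a) x = inner ℝ (facetNormal s a) b := by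
    intro x
    rw [affine_eq (bary s a) b x, hsx.bary_ne ha hb hba.symm, zero_add, affGrad_bary_eq hsx ha,
      inner_neg_left, neg_eq_zero, inner_smul_left, mul_eq_zero, conj_trivial, inner_sub_right,
      sub_eq_zero]
    exact or_iff_right (norm_ne_zero_iff.2 (hsx.affGrad_bary_ne_zero n.succ_pos ha))
  exact ⟨_, L, ⟨hν, hL, fun x hx => (hiff x).1 hx.1,
    fun x hx => h.isOuterNormal_facet hs ha hbd hx, measurableSet_relFacet s a⟩, hiff⟩

theorem affGrad_comp_chart (L : Pt n →ₗᵢ[ℝ] Pt (n + 1)) (v : Pt (n + 1))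
    (A : Pt (n + 1) →ᵃ[ℝ] ℝ) :
    affGrad (A.comp (L.toLinearMap.toAffineMap + AffineMap.const ℝ (Pt n) v)) =
      L.toContinuousLinearMap.adjoint (affGrad A) := by
  refine ext_inner_right ℝ fun z => ?_
  have h1 := affine_eq (A.comp (L.toLinearMap.toAffineMap + AffineMap.const ℝ (Pt n) v)) 0 z
  have e : ∀ y, A.comp (L.toLinearMap.toAffineMap + AffineMap.const ℝ (Pt n) v) y = A (L y + v) :=
    fun y => rfl
  rw [e, e, affine_eq A (L 0 + v), sub_zero, add_sub_add_right_eq_sub, map_zero, sub_zero] at h1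
  rw [ContinuousLinearMap.adjoint_inner_left, LinearIsometry.coe_toContinuousLinearMap]
  linarith

theorem IsFlatPiece.norm_adjoint {F : Set (Pt (n + 1))} {ν : Pt (n + 1)} {c : ℝ}
    {L : Pt n →ₗᵢ[ℝ] Pt (n + 1)} (h : IsFlatPiece Ω F ν c L) {w : Pt (n + 1)}
    (hw : inner ℝ ν w = 0) : ‖L.toContinuousLinearMap.adjoint w‖ = ‖w‖ := by
  obtain ⟨y, hy⟩ := h.isChart.exists_eq_add h.norm_eq_one w
  rw [hw] at hy
  rw [hy, h.adjoint_apply, zero_smul, add_zero, L.norm_map]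

theorem IsFlatPiece.adjoint_normal {F : Set (Pt (n + 1))} {ν : Pt (n + 1)} {c : ℝ}
    {L : Pt n →ₗᵢ[ℝ] Pt (n + 1)} (h : IsFlatPiece Ω F ν c L) :
    L.toContinuousLinearMap.adjoint ν = 0 := by
  have := h.adjoint_apply 0 1
  rwa [map_zero, zero_add, one_smul] at this

theorem norm_adjoint_isometry_le (L : Pt n →ₗᵢ[ℝ] Pt (n + 1)) :
    ‖L.toContinuousLinearMap.adjoint‖ ≤ 1 := by
  rw [LinearIsometryEquiv.norm_map]
  exact L.norm_toContinuousLinearMap_le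

/-- The interpolation estimate on a boundary facet: the error of the tangential gradient. -/
theorem exists_facet_estimate (n : ℕ) {q : ℝ} (hq : 1 < q) (hnq : (n : ℝ) < 2 * q) :
    ∃ C : ℝ≥0, ∀ {K : Geometry.SimplicialComplex ℝ (Pt (n + 1))} {Ω : Set (Pt (n + 1))}
      {S : Finset (Set (Pt (n + 1)))} {s : Finset (Pt (n + 1))} {a : Pt (n + 1)} {l Λ : ℝ}
      {v : Pt (n + 1) → ℝ} {G : Pt (n + 1) → Pt (n + 1)}
      {H : Pt (n + 1) → Pt (n + 1) →L[ℝ] Pt (n + 1)},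
      IsMeshed Ω K S → s ∈ elements K → a ∈ s → IsBoundaryFacet K s a →
      (∀ x ∈ convexHull ℝ (s : Set (Pt (n + 1))), ∀ y ∈ convexHull ℝ (s : Set (Pt (n + 1))),
        dist x y ≤ l) →
      (∀ a ∈ s, ‖affGrad (bary s a)‖ ≤ Λ) → ContinuousOn v (convexHull ℝ (s : Set (Pt (n + 1)))) →
      HasSurfaceGradientOn Ω univ v G →
      (∀ z, HasSurfaceGradientOn Ω (openFaces Ω) (fun x => inner ℝ (G x) z) (fun x => H x z)) →
      Integrable v (surfaceMeasure Ω) → Integrable G (surfaceMeasure Ω) →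
      MemLp H (ENNReal.ofReal q) (surfaceMeasure Ω) →
      eLpNorm (fun x => affGrad (nodalAff s v) -
            (inner ℝ (affGrad (nodalAff s v)) (facetNormal s a) : ℝ) • facetNormal s a - G x)
          (ENNReal.ofReal q) ((surfaceMeasure Ω).restrict (relFacet s a)) ≤
        (n + 1 : ℕ) * ENNReal.ofReal (2 * Λ) * (C * ENNReal.ofReal (l ^ 2) *
          eLpNorm H (ENNReal.ofReal q) ((surfaceMeasure Ω).restrict (relFacet s a))) := by
  classical
  obtain ⟨C, hC⟩ := exists_interpolation_estimate n hq hnq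
  refine ⟨C, fun {K Ω S s a l Λ v G H} h hs ha hbd hl hΛ hv h1 h2 hvi hGi hH => ?_⟩
  rcases (relFacet s a).eq_empty_or_nonempty with he | ⟨x₀, hx₀⟩
  · rw [he, Measure.restrict_empty, eLpNorm_measure_zero]
    exact zero_le
  have hfin := h.poly.isFiniteMeasure
  have hsx := isSimplex_of_mem_elements hs
  have hq1 : 1 ≤ ENNReal.ofReal q := by
    rw [← ENNReal.ofReal_one]
    exact ENNReal.ofReal_le_ofReal hq.le
  obtain ⟨c, L, hF, hiff⟩ := h.exists_isFlatPiece hs ha hbd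
  set ν := facetNormal s a with hν
  set F := relFacet s a with hFdef
  set A := L.toContinuousLinearMap.adjoint with hA
  have hA1 : ‖A‖ ≤ 1 := norm_adjoint_isometry_le L
  -- In the chart, the facet is a simplex with vertices `A b`, whose barycentric coordinates are the
  -- restrictions of those of `s`.
  let lam : ↥(s.erase a) → Pt n →ᵃ[ℝ] ℝ := fun b =>
    (bary s (b : Pt (n + 1))).comp (L.toLinearMap.toAffineMap + AffineMap.const ℝ (Pt n) (c • ν))
  have hlam : ∀ b y, lam b y = bary s (b : Pt (n + 1)) (L y + c • ν) := fun b y => rfl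
  have hzero : ∀ y, bary s a (L y + c • ν) = 0 := fun y => (hiff _).2 (by
    rw [inner_add_right, hF.isChart.inner_apply, inner_smul_right, real_inner_self_eq_norm_sq,
      hF.norm_eq_one]
    simp)
  have hvert : ∀ b ∈ s.erase a, L (A b) + c • ν = b := by
    intro b hb
    have hb' := Finset.mem_erase.1 hb
    obtain ⟨y, hy⟩ := hF.isChart.exists_eq_add hF.norm_eq_one b
    rw [(hiff b).1 (hsx.bary_ne ha hb'.2 hb'.1.symm)] at hy
    conv_rhs => rw [hy]
    rw [hA, hy, hF.adjoint_apply]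
  have hbar : IsBarycentric (fun b : ↥(s.erase a) => A b) lam := by
    refine ⟨fun y => ?_, fun y => ?_, fun b b' => ?_⟩
    · simp_rw [hlam]
      rw [Finset.sum_coe_sort (s.erase a) fun b => bary s b (L y + c • ν)]
      have := hsx.sum_bary (L y + c • ν)
      rwa [← Finset.add_sum_erase _ _ ha, hzero, zero_add] at this
    · simp_rw [hlam]
      rw [Finset.sum_coe_sort (s.erase a) fun b => bary s b (L y + c • ν) • A b]
      have := congrArg A (hsx.sum_bary_smul (L y + c • ν))
      rw [← Finset.add_sum_erase _ _ ha, hzero, zero_smul, zero_add, map_sum, hA,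
        hF.adjoint_apply] at this
      simp_rw [map_smul] at this
      exact this
    · rw [hlam, hvert b' b'.2]
      by_cases hbb : (b : Pt (n + 1)) = b'
      · rw [hbb, hsx.bary_self (Finset.mem_of_mem_erase b'.2)]
        exact zero_le_one
      · rw [hsx.bary_ne (Finset.mem_of_mem_erase b.2) (Finset.mem_of_mem_erase b'.2) hbb]
  have hopen : openCell lam = (fun y => L y + c • ν) ⁻¹' F := by
    ext y
    refine ⟨fun hy => ⟨hzero y, fun b hb hba => hy ⟨b, Finset.mem_erase.2 ⟨hba, hb⟩⟩⟩,
      fun hy b => hy.2 b (Finset.mem_of_mem_erase b.2) (Finset.ne_of_mem_erase b.2)⟩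
  have hclosed : ∀ y ∈ closedCell lam, L y + c • ν ∈ convexHull ℝ (s : Set (Pt (n + 1))) := by
    refine fun y hy => hsx.mem_convexHull_iff.2 fun b hb => ?_
    by_cases hba : b = a
    · rw [hba, hzero]
    · exact hy ⟨b, Finset.mem_erase.2 ⟨hba, hb⟩⟩
  have hmp : MeasurePreserving (fun y => L y + c • ν)
      ((volume : Measure (Pt n)).restrict ((fun y => L y + c • ν) ⁻¹' F))
      ((surfaceMeasure Ω).restrict F) :=
    ⟨(IsFlatPiece.measurableEmbedding L (c • ν)).measurable, hF.map_volume⟩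
  -- The tangential part of the second derivatives, in the chart.
  let Ψ : (Pt (n + 1) →L[ℝ] Pt (n + 1)) →L[ℝ] (Pt n →L[ℝ] Pt n) :=
    (ContinuousLinearMap.compL ℝ (Pt n) (Pt (n + 1)) (Pt n) A).comp
      ((ContinuousLinearMap.compL ℝ (Pt n) (Pt (n + 1)) (Pt (n + 1))).flip
        L.toContinuousLinearMap)
  have hΨ : ∀ T z, Ψ T z = A (T (L z)) := fun T z => rfl
  have hΨn : ∀ T, ‖Ψ T‖ ≤ ‖T‖ := by
    refine fun T => ContinuousLinearMap.opNorm_le_bound _ (norm_nonneg _) fun z => ?_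
    rw [hΨ]
    refine (A.le_of_opNorm_le hA1 _).trans ?_
    rw [one_mul]
    exact (T.le_opNorm _).trans_eq (by rw [L.norm_map])
  have hHF : MemLp (fun y => H (L y + c • ν)) (ENNReal.ofReal q)
      (volume.restrict ((fun y => L y + c • ν) ⁻¹' F)) :=
    (hH.restrict F).comp_measurePreserving hmp
  have hFo : F ⊆ openFaces Ω := fun x hx => ⟨ν, hF.isOuterNormal x hx⟩
  have key := (@hC _ _ (fun b : ↥(s.erase a) => A b) lam l Λ
    (fun y => v (L y + c • ν)) (fun y => A (G (L y + c • ν))) (fun y => Ψ (H (L y + c • ν)))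
    hbar ?_ ?_ ?_ ?_ ?_ ?_ ?_ ?_).1
  · rw [hopen, Fintype.card_coe, Finset.card_erase_of_mem ha, hs.2] at key
    -- The error is tangential, so `A` preserves its norm.
    have e1 : eLpNorm (fun x => affGrad (nodalAff s v) -
          (inner ℝ (affGrad (nodalAff s v)) ν : ℝ) • ν - G x) (ENNReal.ofReal q)
        ((surfaceMeasure Ω).restrict F) =
        eLpNorm (fun x => A (affGrad (nodalAff s v)) - A (G x)) (ENNReal.ofReal q)
        ((surfaceMeasure Ω).restrict F) := by
      refine eLpNorm_congr_norm_ae ?_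
      filter_upwards [ae_restrict_mem hF.measurableSet, ae_restrict_of_ae h1.1] with x hx hxG
      rw [hF.outerNormal_eq hx, real_inner_comm] at hxG
      have h3 : inner ℝ ν (affGrad (nodalAff s v) -
          (inner ℝ (affGrad (nodalAff s v)) ν : ℝ) • ν - G x) = 0 := by
        rw [inner_sub_right, inner_sub_right, hxG, inner_smul_right, real_inner_self_eq_norm_sq,
          hF.norm_eq_one, real_inner_comm]
        ring
      rw [← hF.norm_adjoint h3, map_sub, map_sub, map_smul, hF.adjoint_normal, smul_zero, sub_zero]
    have e2 : A (affGrad (nodalAff s v)) = ∑ b : ↥(s.erase a),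
        v (L (A b) + c • ν) • affGrad (lam b) := by
      have e3 : ∀ b : ↥(s.erase a),
          v (L (A b) + c • ν) • affGrad (lam b) = v b • A (affGrad (bary s b)) := fun b => by
        rw [hvert b b.2, affGrad_comp_chart]
      simp_rw [e3]
      rw [Finset.sum_coe_sort (s.erase a) fun b => v b • A (affGrad (bary s b)), affGrad_nodalAff,
        map_sum, ← Finset.add_sum_erase _ _ ha, map_smul, affGrad_bary_eq hsx ha, map_neg, map_smul,
        hF.adjoint_normal, smul_zero, neg_zero, smul_zero, zero_add]
      simp_rw [map_smul]
    rw [e1, ← hF.eLpNorm_comp, e2]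
    refine key.trans (mul_le_mul' (by simp) (mul_le_mul' le_rfl ?_))
    rw [← hF.eLpNorm_comp]
    exact eLpNorm_mono fun y => hΨn _
  · obtain ⟨y, hy⟩ := hF.isChart.exists_eq_add hF.norm_eq_one x₀
    rw [hF.subset_hyperplane hx₀] at hy
    rw [hopen]
    exact ⟨y, by rwa [mem_preimage, ← hy]⟩
  · intro x hx y hy
    have := hl _ (hclosed x hx) _ (hclosed y hy)
    rwa [dist_add_right, L.dist_map] at this
  · intro b
    rw [affGrad_comp_chart]
    refine (A.le_of_opNorm_le hA1 _).trans ?_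
    rw [one_mul]
    exact hΛ b (Finset.mem_of_mem_erase b.2)
  · exact hv.comp (by fun_prop) hclosed
  · rw [hopen]
    exact hF.hasWeakGradient h.poly h1 hvi hGi (subset_univ _)
  · intro z
    rw [hopen]
    have h3 := hF.hasWeakGradient h.poly (h2 (L z))
      (hGi.inner_const (L z)) ((ContinuousLinearMap.apply ℝ (Pt (n + 1)) (L z)).integrable_comp
        (hH.integrable hq1)) hFo
    refine h3.congr (Eventually.of_forall fun y => ?_) ae_eq_rfl
    exact (ContinuousLinearMap.adjoint_inner_left L.toContinuousLinearMap z _).symm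
  · rw [hopen]
    exact A.integrable_comp (hF.integrableOn_comp hGi)
  · rw [hopen]
    exact Ψ.comp_memLp' hHF

end Facet

end

section

/-! ### The interpolation error on the whole mesh -/

theorem eLpNorm_rpow_toReal {α V : Type*} [MeasurableSpace α] [NormedAddCommGroup V]
    {μ : Measure α} {f : α → V} {q : ℝ≥0∞} (hq0 : q ≠ 0) (hqt : q ≠ ⊤) :
    eLpNorm f q μ ^ q.toReal = ∫⁻ x, ‖f x‖ₑ ^ q.toReal ∂μ := by
  rw [eLpNorm_eq_lintegral_rpow_enorm_toReal hq0 hqt, ← ENNReal.rpow_mul, one_div,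
    inv_mul_cancel₀ (ENNReal.toReal_pos hq0 hqt).ne', ENNReal.rpow_one]

/-- Local estimates on the members of a cover sum up to a global one. -/
theorem eLpNorm_le_of_cover {α α' ι V V' : Type*} [MeasurableSpace α] [MeasurableSpace α']
    [NormedAddCommGroup V] [NormedAddCommGroup V'] {μ : Measure α} {m : Measure α'} {I : Finset ι}
    {U : ι → Set α} {T : ι → Set α'} {f : α → V} {g : α' → V'} {q : ℝ≥0∞} (hq0 : q ≠ 0)
    (hqt : q ≠ ⊤) {c : ℝ≥0∞} (hcov : ∀ᵐ x ∂μ, ∃ i ∈ I, x ∈ U i)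
    (hT : ∀ i ∈ I, MeasurableSet (T i)) (hdisj : (I : Set ι).PairwiseDisjoint T)
    (h : ∀ i ∈ I, eLpNorm f q (μ.restrict (U i)) ≤ c * eLpNorm g q (m.restrict (T i))) :
    eLpNorm f q μ ≤ c * eLpNorm g q m := by
  have hr : 0 < q.toReal := ENNReal.toReal_pos hq0 hqt
  rw [← ENNReal.rpow_le_rpow_iff hr, ENNReal.mul_rpow_of_nonneg _ _ hr.le,
    eLpNorm_rpow_toReal hq0 hqt, eLpNorm_rpow_toReal hq0 hqt]
  have hcov' : μ.restrict (⋃ i : I, U i) = μ := Measure.restrict_eq_self_of_ae_mem (by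
    filter_upwards [hcov] with x ⟨i, hi, hx⟩
    exact mem_iUnion.2 ⟨⟨i, hi⟩, hx⟩)
  calc ∫⁻ x, ‖f x‖ₑ ^ q.toReal ∂μ = ∫⁻ x in ⋃ i : I, U i, ‖f x‖ₑ ^ q.toReal ∂μ := by rw [hcov']
    _ ≤ ∑' i : I, ∫⁻ x in U i, ‖f x‖ₑ ^ q.toReal ∂μ := lintegral_iUnion_le _ _
    _ = ∑ i ∈ I, ∫⁻ x in U i, ‖f x‖ₑ ^ q.toReal ∂μ := by
        rw [tsum_fintype]
        exact Finset.sum_coe_sort I fun i => ∫⁻ x in U i, ‖f x‖ₑ ^ q.toReal ∂μ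
    _ ≤ ∑ i ∈ I, c ^ q.toReal * ∫⁻ x in T i, ‖g x‖ₑ ^ q.toReal ∂m := by
        refine Finset.sum_le_sum fun i hi => ?_
        rw [← eLpNorm_rpow_toReal hq0 hqt, ← eLpNorm_rpow_toReal hq0 hqt,
          ← ENNReal.mul_rpow_of_nonneg _ _ hr.le]
        exact ENNReal.rpow_le_rpow (h i hi) hr.le
    _ = c ^ q.toReal * ∫⁻ x in ⋃ i ∈ I, T i, ‖g x‖ₑ ^ q.toReal ∂m := by
        rw [lintegral_biUnion_finset hdisj hT, Finset.mul_sum]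
    _ ≤ c ^ q.toReal * ∫⁻ x, ‖g x‖ₑ ^ q.toReal ∂m :=
        mul_le_mul' le_rfl (setLIntegral_le_lintegral _ _)

/-- A pointwise bound that is scaled by the volume of a set is turned into an `L_q` bound with
respect to another measure, at the expense of the quotient of the measures. -/
theorem eLpNorm_le_of_const_le {α α' V : Type*} [MeasurableSpace α] [MeasurableSpace α']
    [NormedAddCommGroup V] {μ : Measure α} {m : Measure α'} {U : Set α} {T : Set α'} {e : α → V}
    {q : ℝ} (hq : 1 < q) {B κ : ℝ≥0∞} (hU : MeasurableSet U)
    (h : ∀ a ∈ U, eLpNorm (fun _ : α' => e a) (ENNReal.ofReal q) (m.restrict T) ≤ B)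
    (hT0 : m T ≠ 0) (hTt : m T ≠ ⊤) (hκ : 1 ≤ κ) (hUT : μ U ≤ κ * m T) :
    eLpNorm e (ENNReal.ofReal q) (μ.restrict U) ≤ κ * B := by
  have hq0 : 0 < q := zero_lt_one.trans hq
  have hqe : ENNReal.ofReal q ≠ 0 := (ENNReal.ofReal_pos.2 hq0).ne'
  set x : ℝ≥0∞ := m T ^ q⁻¹ with hx
  have hx0 : x ≠ 0 := by
    rw [hx, Ne, ENNReal.rpow_eq_zero_iff]
    rintro (⟨h1, -⟩ | ⟨h1, -⟩)
    · exact hT0 h1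
    · exact hTt h1
  have hxt : x ≠ ⊤ := ENNReal.rpow_ne_top_of_nonneg (by positivity) hTt
  have h1 : ∀ a ∈ U, ‖e a‖ₑ ≤ B / x := fun a ha => by
    rw [ENNReal.le_div_iff_mul_le (Or.inl hx0) (Or.inl hxt)]
    have := h a ha
    rwa [eLpNorm_const' _ hqe ENNReal.ofReal_ne_top, Measure.restrict_apply_univ,
      ENNReal.toReal_ofReal hq0.le, one_div] at this
  refine (eLpNorm_le_of_ae_enorm_bound (ae_restrict_of_forall_mem hU h1)).trans ?_
  rw [Measure.restrict_apply_univ, ENNReal.toReal_ofReal hq0.le, smul_eq_mul]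
  have h2 : μ U ^ q⁻¹ ≤ κ * x :=
    calc μ U ^ q⁻¹ ≤ (κ * m T) ^ q⁻¹ := ENNReal.rpow_le_rpow hUT (by positivity)
      _ = κ ^ q⁻¹ * x := ENNReal.mul_rpow_of_nonneg _ _ (by positivity)
      _ ≤ κ * x := by
        refine mul_le_mul' ?_ le_rfl
        conv_rhs => rw [← ENNReal.rpow_one κ]
        exact ENNReal.rpow_le_rpow_of_exponent_le hκ (inv_le_one_of_one_le₀ hq.le)
  calc B / x * μ U ^ q⁻¹ ≤ B / x * (κ * x) := mul_le_mul' le_rfl h2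
    _ = κ * (B / x * x) := by ring
    _ = κ * B := by rw [ENNReal.div_mul_cancel hx0 hxt]

section Mesh

variable {n : ℕ} {K : Geometry.SimplicialComplex ℝ (Pt (n + 1))} {Ω : Set (Pt (n + 1))}
  {S : Finset (Set (Pt (n + 1)))} {s : Finset (Pt (n + 1))} {a : Pt (n + 1)} {ρ : ℝ}

theorem IsMeshed.finite (h : IsMeshed Ω K S) : (elements K).Finite := finite_elements h.tri

theorem IsMeshed.meshwidth_le (h : IsMeshed Ω K S) (hs : s ∈ elements K) :
    meshwidth K ≤ Metric.diam (closure Ω) :=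
  csSup_le ⟨_, mem_image_of_mem _ hs⟩ (by
    rintro _ ⟨t, ht, rfl⟩
    exact Metric.diam_mono (h.convexHull_subset ht) h.poly.isBounded.closure)

theorem IsMeshed.norm_affGrad_bary_le (h : IsMeshed Ω K S) (hρ : 0 < ρ) (hK : IsQuasiUniform ρ K)
    (hs : s ∈ elements K) (ha : a ∈ s) : ‖affGrad (bary s a)‖ ≤ (ρ * meshwidth K)⁻¹ := by
  have hpos := mul_pos hρ (meshwidth_pos h.finite n.succ_pos hs)
  obtain ⟨x, hx⟩ := hK s hs
  rw [← one_div, le_div_iff₀ hpos]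
  exact (isSimplex_of_mem_elements hs).norm_affGrad_bary_mul_le ha hpos.le hx

theorem IsMeshed.ball_subset (hK : IsQuasiUniform ρ K) (hs : s ∈ elements K) :
    ∃ x, Metric.ball x (ρ * meshwidth K) ⊆ interior (convexHull ℝ (s : Set (Pt (n + 1)))) := by
  obtain ⟨x, hx⟩ := hK s hs
  exact ⟨x, interior_maximal (Metric.ball_subset_closedBall.trans hx) Metric.isOpen_ball⟩

/-- The facets of an element are small in comparison with the element. -/
theorem exists_measure_facets_le (n : ℕ) {ρ : ℝ} (hρ : 0 < ρ) : ∃ C : ℝ, 0 ≤ C ∧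
    ∀ {K : Geometry.SimplicialComplex ℝ (Pt (n + 1))} {Ω : Set (Pt (n + 1))}
      {S : Finset (Set (Pt (n + 1)))} {s : Finset (Pt (n + 1))}, IsMeshed Ω K S →
      IsQuasiUniform ρ K → s ∈ elements K → ∀ {I : Finset (Pt (n + 1))}, I ⊆ s →
      (∀ a ∈ I, IsBoundaryFacet K s a) →
      surfaceMeasure Ω (⋃ a ∈ I, relFacet s a) ≤ ENNReal.ofReal (C / meshwidth K) *
        volume (interior (convexHull ℝ (s : Set (Pt (n + 1))))) := by
  set A := (volume (Metric.ball (0 : Pt n) 1)).toReal with hA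
  set B := (volume (Metric.ball (0 : Pt (n + 1)) 1)).toReal with hB
  have hAe : volume (Metric.ball (0 : Pt n) 1) = ENNReal.ofReal A :=
    (ENNReal.ofReal_toReal measure_ball_lt_top.ne).symm
  have hBe : volume (Metric.ball (0 : Pt (n + 1)) 1) = ENNReal.ofReal B :=
    (ENNReal.ofReal_toReal measure_ball_lt_top.ne).symm
  have hB0 : 0 < B := ENNReal.toReal_pos (Metric.measure_ball_pos _ _ one_pos).ne'
    measure_ball_lt_top.ne
  have hA0 : 0 ≤ A := ENNReal.toReal_nonneg
  refine ⟨(n + 2 : ℕ) * A / (ρ ^ (n + 1) * B), by positivity,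
    fun {K Ω S s} h hK hs {I} hI hbd => ?_⟩
  have hh := meshwidth_pos h.finite n.succ_pos hs
  have hsx := isSimplex_of_mem_elements hs
  -- A facet lies in a ball of radius `h`, whereas the element contains a ball of radius `ρ * h`.
  have hone : ∀ a ∈ I, surfaceMeasure Ω (relFacet s a) ≤
      ENNReal.ofReal (meshwidth K ^ n * A) := by
    intro a ha
    obtain ⟨c, L, hF, -⟩ := h.exists_isFlatPiece hs (hI ha) (hbd a ha)
    have e : surfaceMeasure Ω (relFacet s a) =
        volume ((fun y => L y + c • facetNormal s a) ⁻¹' relFacet s a) := by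
      have := congrArg (fun μ => μ univ) hF.map_volume
      simp only [Measure.restrict_apply_univ] at this
      rw [← this, Measure.map_apply (IsFlatPiece.measurableEmbedding L _).measurable
        MeasurableSet.univ, preimage_univ, Measure.restrict_apply_univ]
    rw [e]
    rcases ((fun y => L y + c • facetNormal s a) ⁻¹' relFacet s a).eq_empty_or_nonempty with
      h0 | ⟨y₀, hy₀⟩
    · rw [h0, measure_empty]
      exact zero_le
    · refine (measure_mono (t := Metric.closedBall y₀ (meshwidth K)) fun y hy => ?_).trans ?_
      · have := dist_le_meshwidth h.finite hs (relFacet_subset hsx a hy)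
          (relFacet_subset hsx a hy₀)
        rwa [dist_add_right, L.dist_map] at this
      · rw [Measure.addHaar_closedBall _ _ hh.le, finrank_euclideanSpace_fin, hAe,
          ← ENNReal.ofReal_mul (by positivity)]
  obtain ⟨x, hx⟩ := IsMeshed.ball_subset hK hs
  have hvol : ENNReal.ofReal ((ρ * meshwidth K) ^ (n + 1) * B) ≤
      volume (interior (convexHull ℝ (s : Set (Pt (n + 1))))) := by
    refine le_trans (le_of_eq ?_) (measure_mono hx)
    rw [Measure.addHaar_ball _ _ (by positivity), finrank_euclideanSpace_fin, hBe,
      ← ENNReal.ofReal_mul (by positivity)]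
  calc surfaceMeasure Ω (⋃ a ∈ I, relFacet s a)
      ≤ ∑ a ∈ I, surfaceMeasure Ω (relFacet s a) := measure_biUnion_finset_le _ _
    _ ≤ ∑ a ∈ I, ENNReal.ofReal (meshwidth K ^ n * A) := Finset.sum_le_sum hone
    _ ≤ (n + 2 : ℕ) * ENNReal.ofReal (meshwidth K ^ n * A) := by
        rw [Finset.sum_const, nsmul_eq_mul]
        refine mul_le_mul' (Nat.cast_le.2 ?_) le_rfl
        exact (Finset.card_le_card hI).trans hs.2.le
    _ = ENNReal.ofReal ((n + 2 : ℕ) * A / (ρ ^ (n + 1) * B) / meshwidth K) *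
          ENNReal.ofReal ((ρ * meshwidth K) ^ (n + 1) * B) := by
        rw [← ENNReal.ofReal_natCast, ← ENNReal.ofReal_mul (by positivity),
          ← ENNReal.ofReal_mul (by positivity)]
        congr 1
        field_simp
        ring
    _ ≤ _ := mul_le_mul' le_rfl hvol

end Mesh

end

section

section Mesh

variable {n : ℕ} {K : Geometry.SimplicialComplex ℝ (Pt (n + 1))} {Ω : Set (Pt (n + 1))}
  {S : Finset (Set (Pt (n + 1)))} {s : Finset (Pt (n + 1))} {a : Pt (n + 1)} {ρ : ℝ}
  {E : Finset (Finset (Pt (n + 1)))}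

theorem IsMeshed.ae_mem_interior (h : IsMeshed Ω K S) :
    ∀ᵐ x ∂(bulkMeasure Ω), ∃ s ∈ elements K,
      x ∈ interior (convexHull ℝ (s : Set (Pt (n + 1)))) := by
  have h1 : ∀ᵐ x ∂(bulkMeasure Ω), ∀ s ∈ elements K,
      x ∉ frontier (convexHull ℝ (s : Set (Pt (n + 1)))) := by
    refine ae_restrict_of_ae ((ae_ball_iff h.finite.countable).2 fun s _ => ?_)
    exact measure_eq_zero_iff_ae_notMem.1 ((convex_convexHull ℝ _).addHaar_frontier volume)
  filter_upwards [h1, ae_restrict_mem h.poly.isOpen.measurableSet] with x hx hxΩ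
  obtain ⟨s, hs, hxs⟩ := h.exists_element (subset_closure hxΩ)
  refine ⟨s, hs, ?_⟩
  have := hx s hs
  rw [IsMeshed.isClosed_convexHull s |>.frontier_eq] at this
  by_contra hxi
  exact this ⟨hxs, hxi⟩

theorem IsMeshed.nonempty_interior (h : IsMeshed Ω K S) (hρ : 0 < ρ) (hK : IsQuasiUniform ρ K)
    (hs : s ∈ elements K) : (interior (convexHull ℝ (s : Set (Pt (n + 1))))).Nonempty := by
  obtain ⟨x, hx⟩ := IsMeshed.ball_subset hK hs
  exact ⟨x, hx (Metric.mem_ball_self (mul_pos hρ (meshwidth_pos h.finite n.succ_pos hs)))⟩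

theorem IsMeshed.pairwiseDisjoint_interior (hE : ∀ s, s ∈ E ↔ s ∈ elements K) :
    (E : Set (Finset (Pt (n + 1)))).PairwiseDisjoint
      fun s => interior (convexHull ℝ (s : Set (Pt (n + 1)))) := fun s hs t ht hst =>
  Set.disjoint_left.2 fun _ hxs hxt => hst (IsMeshed.eq_of_mem_interior ((hE s).1 hs)
    ((hE t).1 ht) hxs (_root_.interior_subset hxt)).symm

/-- The linear interpolation error of a function with second derivatives `H` in `L_q`: gradient,
function values, and function values on the boundary. -/
theorem exists_bulk_estimate (n : ℕ) {Ω : Set (Pt (n + 1))} {q : ℝ} (hq : 1 < q)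
    (hdq : ((n + 1 : ℕ) : ℝ) < 2 * q) {ρ : ℝ} (hρ : 0 < ρ) : ∃ C : ℝ≥0,
    ∀ {K : Geometry.SimplicialComplex ℝ (Pt (n + 1))} {S : Finset (Set (Pt (n + 1)))}
      {E : Finset (Finset (Pt (n + 1)))} {v : Pt (n + 1) → ℝ} {g : Pt (n + 1) → Pt (n + 1)}
      {H : Pt (n + 1) → Pt (n + 1) →L[ℝ] Pt (n + 1)}, IsMeshed Ω K S → IsQuasiUniform ρ K →
      (∀ s, s ∈ E ↔ s ∈ elements K) → ContinuousOn v (closure Ω) → HasWeakGradient Ω v g →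
      (∀ z, HasWeakGradient Ω (fun x => inner ℝ (g x) z) (fun x => H x z)) →
      IntegrableOn g Ω → MemLp H (ENNReal.ofReal q) (bulkMeasure Ω) →
      eLpNorm (fun x => nodalGrad E v x - g x) (ENNReal.ofReal q) (bulkMeasure Ω) ≤
        C * ENNReal.ofReal (meshwidth K) * eLpNorm H (ENNReal.ofReal q) (bulkMeasure Ω) ∧
      eLpNorm (fun x => nodal K v x - v x) (ENNReal.ofReal q) (bulkMeasure Ω) ≤
        C * ENNReal.ofReal (meshwidth K) * eLpNorm H (ENNReal.ofReal q) (bulkMeasure Ω) ∧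
      eLpNorm (fun x => nodal K v x - v x) (ENNReal.ofReal q) (surfaceMeasure Ω) ≤
        C * ENNReal.ofReal (meshwidth K) * eLpNorm H (ENNReal.ofReal q) (bulkMeasure Ω) := by
  classical
  obtain ⟨C₀, hC₀⟩ := exists_element_estimate (n + 1) hq hdq
  obtain ⟨C₁, hC₁0, hC₁⟩ := exists_measure_facets_le n hρ
  set D := Metric.diam (closure Ω) with hD
  have hD0 : 0 ≤ D := Metric.diam_nonneg
  have hq0 : ENNReal.ofReal q ≠ 0 := (ENNReal.ofReal_pos.2 (zero_lt_one.trans hq)).ne'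
  refine ⟨(n + 2 : ℕ) * (2 / ρ).toNNReal * C₀ + 2 * (D + C₁).toNNReal * C₀, ?_⟩
  intro K S E v g H h hK hE hv h1 h2 hg hH
  have hT : ∀ s ∈ E, MeasurableSet (interior (convexHull ℝ (s : Set (Pt (n + 1))))) :=
    fun s _ => isOpen_interior.measurableSet
  have hdisj := IsMeshed.pairwiseDisjoint_interior hE
  have hcov : ∀ᵐ x ∂(bulkMeasure Ω), ∃ s ∈ E,
      x ∈ interior (convexHull ℝ (s : Set (Pt (n + 1)))) := by
    filter_upwards [h.ae_mem_interior] with x ⟨s, hs, hx⟩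
    exact ⟨s, (hE s).2 hs, hx⟩
  have hres : ∀ s ∈ E, (bulkMeasure Ω).restrict (interior (convexHull ℝ (s : Set (Pt (n + 1))))) =
      volume.restrict (interior (convexHull ℝ (s : Set (Pt (n + 1))))) := fun s hs =>
    Measure.restrict_restrict_of_subset (h.interior_subset ((hE s).1 hs))
  have hloc : ∀ s ∈ E, _ := fun s hs => by
    have hs' := (hE s).1 hs
    have hsub := h.interior_subset hs'
    exact hC₀ (isSimplex_of_mem_elements hs') (h.nonempty_interior hρ hK hs')
      (fun x hx y hy => dist_le_meshwidth h.finite hs' hx hy)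
      (fun a ha => h.norm_affGrad_bary_le hρ hK hs' ha) (hv.mono (h.convexHull_subset hs'))
      (h1.mono hsub) (fun z => (h2 z).mono hsub) (hg.mono_set hsub)
      (hH.mono_measure (Measure.restrict_mono hsub le_rfl))
  -- The pointwise bound holds up to the boundary of the element, which gives the boundary values.
  have hval : ∀ s ∈ E, ∀ a ∈ convexHull ℝ (s : Set (Pt (n + 1))),
      eLpNorm (fun _ => nodal K v a - v a) (ENNReal.ofReal q)
        (volume.restrict (interior (convexHull ℝ (s : Set (Pt (n + 1)))))) ≤
      2 * (C₀ * ENNReal.ofReal (meshwidth K ^ 2) * eLpNorm H (ENNReal.ofReal q)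
          (volume.restrict (interior (convexHull ℝ (s : Set (Pt (n + 1))))))) := by
    intro s hs a ha
    refine le_trans (le_of_eq ?_) ((hloc s hs).2 a ha)
    rw [IsMeshed.nodal_eq ((hE s).1 hs) ha]
    exact eLpNorm_congr_norm_ae (Eventually.of_forall fun _ => norm_sub_rev _ _)
  have hvol0 : ∀ s ∈ E, volume (interior (convexHull ℝ (s : Set (Pt (n + 1))))) ≠ 0 := fun s hs =>
    (isOpen_interior.measure_pos _ (h.nonempty_interior hρ hK ((hE s).1 hs))).ne'
  have hvolt : ∀ s ∈ E, volume (interior (convexHull ℝ (s : Set (Pt (n + 1))))) ≠ ⊤ := fun s hs =>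
    ((measure_mono interior_subset).trans_lt
      (s.finite_toSet.isCompact_convexHull (𝕜 := ℝ)).measure_lt_top).ne
  have hh : ∀ s ∈ E, 0 < meshwidth K ∧ meshwidth K ≤ D := fun s hs =>
    ⟨meshwidth_pos h.finite n.succ_pos ((hE s).1 hs), h.meshwidth_le ((hE s).1 hs)⟩
  -- the powers of the mesh size are compared with the first power
  have hconst : ∀ κ : ℝ, 0 ≤ κ → κ * meshwidth K ^ 2 ≤ (D + C₁) * meshwidth K → ∀ A : ℝ≥0∞,
      ENNReal.ofReal κ * (2 * (C₀ * ENNReal.ofReal (meshwidth K ^ 2) * A)) ≤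
        ((n + 2 : ℕ) * (2 / ρ).toNNReal * C₀ + 2 * (D + C₁).toNNReal * C₀ : ℝ≥0) *
          ENNReal.ofReal (meshwidth K) * A := by
    intro κ hκ hle A
    calc ENNReal.ofReal κ * (2 * (C₀ * ENNReal.ofReal (meshwidth K ^ 2) * A))
        = 2 * C₀ * ENNReal.ofReal (κ * meshwidth K ^ 2) * A := by
          rw [ENNReal.ofReal_mul hκ]
          ring
      _ ≤ 2 * C₀ * ENNReal.ofReal ((D + C₁) * meshwidth K) * A :=
          mul_le_mul' (mul_le_mul' le_rfl (ENNReal.ofReal_le_ofReal hle)) le_rfl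
      _ = (2 * (D + C₁).toNNReal * C₀ : ℝ≥0) * ENNReal.ofReal (meshwidth K) * A := by
          rw [ENNReal.ofReal_mul (by positivity)]
          push_cast
          rw [ENNReal.ofReal]
          ring
      _ ≤ _ := by
          refine mul_le_mul' (mul_le_mul' (ENNReal.coe_le_coe.2 le_add_self) le_rfl) le_rfl
  refine ⟨eLpNorm_le_of_cover hq0 ENNReal.ofReal_ne_top hcov hT hdisj fun s hs => ?_,
    eLpNorm_le_of_cover hq0 ENNReal.ofReal_ne_top hcov hT hdisj fun s hs => ?_, ?_⟩
  · rw [hres s hs]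
    have e : eLpNorm (fun x => nodalGrad E v x - g x) (ENNReal.ofReal q)
        (volume.restrict (interior (convexHull ℝ (s : Set (Pt (n + 1)))))) =
        eLpNorm (fun x => affGrad (nodalAff s v) - g x) (ENNReal.ofReal q)
        (volume.restrict (interior (convexHull ℝ (s : Set (Pt (n + 1)))))) := by
      refine eLpNorm_congr_ae ?_
      filter_upwards [ae_restrict_mem (hT s hs)] with x hx
      rw [nodalGrad_eq hs (interior_subset hx) fun t ht hxt =>
        IsMeshed.eq_of_mem_interior ((hE s).1 hs) ((hE t).1 ht) hx hxt]
    rw [e]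
    refine (hloc s hs).1.trans ?_
    rw [← mul_assoc, ← mul_assoc]
    refine mul_le_mul' ?_ le_rfl
    have e2 : ENNReal.ofReal (2 * (ρ * meshwidth K)⁻¹) * ENNReal.ofReal (meshwidth K ^ 2) =
        ENNReal.ofReal (2 / ρ) * ENNReal.ofReal (meshwidth K) := by
      have := (hh s hs).1
      rw [← ENNReal.ofReal_mul (by positivity), ← ENNReal.ofReal_mul (by positivity)]
      congr 1
      field_simp
    calc ((n + 1 + 1 : ℕ) : ℝ≥0∞) * ENNReal.ofReal (2 * (ρ * meshwidth K)⁻¹) *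
          C₀ * ENNReal.ofReal (meshwidth K ^ 2)
        = (n + 2 : ℕ) * (ENNReal.ofReal (2 * (ρ * meshwidth K)⁻¹) *
            ENNReal.ofReal (meshwidth K ^ 2)) * C₀ := by ring
      _ = ((n + 2 : ℕ) * (2 / ρ).toNNReal * C₀ : ℝ≥0) * ENNReal.ofReal (meshwidth K) := by
          rw [e2]
          push_cast
          rw [ENNReal.ofReal, ENNReal.ofReal]
          ring
      _ ≤ _ := mul_le_mul' (ENNReal.coe_le_coe.2 le_self_add) le_rfl
  · rw [hres s hs]
    refine (eLpNorm_le_of_const_le (κ := ENNReal.ofReal 1) hq (hT s hs)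
      (fun a ha => hval s hs a (interior_subset ha)) (hvol0 s hs) (hvolt s hs) (by simp)
      (by simp)).trans (hconst 1 zero_le_one ?_ _)
    obtain ⟨h3, h4⟩ := hh s hs
    nlinarith
  · -- The boundary facets of an element carry at most `C₁ / h` times its volume, which loses one
    -- power of `h`.
    refine eLpNorm_le_of_cover (U := fun s => ⋃ a ∈ s.filter (IsBoundaryFacet K s), relFacet s a)
      hq0 ENNReal.ofReal_ne_top ?_ hT hdisj fun s hs => ?_
    · filter_upwards [h.poly.ae_isGeneric, ae_restrict_mem isClosed_frontier.measurableSet]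
        with x hx hxf
      obtain ⟨s, hs, a, ha, hbd, hxa, -⟩ := h.exists_boundaryFacet hx hxf
      exact ⟨s, (hE s).2 hs, mem_biUnion (Finset.mem_filter.2 ⟨ha, hbd⟩) hxa⟩
    · rw [hres s hs]
      obtain ⟨h3, h4⟩ := hh s hs
      have h5 : 0 ≤ C₁ / meshwidth K := by positivity
      refine (eLpNorm_le_of_const_le (κ := ENNReal.ofReal (1 + C₁ / meshwidth K)) hq
        (Finset.measurableSet_biUnion _ fun a _ => measurableSet_relFacet s a)
        (fun a ha => ?_) (hvol0 s hs) (hvolt s hs) ?_ ?_).trans (hconst _ (by positivity) ?_ _)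
      · obtain ⟨b, hb, hab⟩ := mem_iUnion₂.1 ha
        exact hval s hs a (relFacet_subset (isSimplex_of_mem_elements ((hE s).1 hs)) b hab)
      · exact ENNReal.one_le_ofReal.2 (by linarith)
      · refine (hC₁ h hK ((hE s).1 hs) (Finset.filter_subset _ _)
          fun a ha => (Finset.mem_filter.1 ha).2).trans ?_
        exact mul_le_mul' (ENNReal.ofReal_le_ofReal (by linarith)) le_rfl
      · have e : (1 + C₁ / meshwidth K) * meshwidth K ^ 2 =
            meshwidth K * meshwidth K + C₁ * meshwidth K := by field_simp
        rw [e]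
        nlinarith

/-- The linear interpolation error of the tangential gradient. -/
theorem exists_surface_estimate (n : ℕ) {Ω : Set (Pt (n + 1))} {q : ℝ} (hq : 1 < q)
    (hnq : (n : ℝ) < 2 * q) {ρ : ℝ} (hρ : 0 < ρ) : ∃ C : ℝ≥0,
    ∀ {K : Geometry.SimplicialComplex ℝ (Pt (n + 1))} {S : Finset (Set (Pt (n + 1)))}
      {E : Finset (Finset (Pt (n + 1)))} {v : Pt (n + 1) → ℝ} {G : Pt (n + 1) → Pt (n + 1)}
      {H : Pt (n + 1) → Pt (n + 1) →L[ℝ] Pt (n + 1)}, IsMeshed Ω K S → IsQuasiUniform ρ K →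
      (∀ s, s ∈ E ↔ s ∈ elements K) → ContinuousOn v (closure Ω) →
      HasSurfaceGradientOn Ω univ v G →
      (∀ z, HasSurfaceGradientOn Ω (openFaces Ω) (fun x => inner ℝ (G x) z) (fun x => H x z)) →
      Integrable v (surfaceMeasure Ω) → Integrable G (surfaceMeasure Ω) →
      MemLp H (ENNReal.ofReal q) (surfaceMeasure Ω) →
      eLpNorm (fun x => nodalSurfGrad Ω E v x - G x) (ENNReal.ofReal q) (surfaceMeasure Ω) ≤
        C * ENNReal.ofReal (meshwidth K) * eLpNorm H (ENNReal.ofReal q) (surfaceMeasure Ω) := by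
  classical
  obtain ⟨C₀, hC₀⟩ := exists_facet_estimate n hq hnq
  have hq0 : ENNReal.ofReal q ≠ 0 := (ENNReal.ofReal_pos.2 (zero_lt_one.trans hq)).ne'
  refine ⟨(n + 1 : ℕ) * (2 / ρ).toNNReal * C₀, ?_⟩
  intro K S E v G H h hK hE hv h1 h2 hvi hG hH
  -- The boundary facets, as pairs of an element and a vertex.
  let I : Finset (Σ _ : Finset (Pt (n + 1)), Pt (n + 1)) :=
    E.sigma fun s => s.filter (IsBoundaryFacet K s)
  have hI : ∀ i ∈ I, i.1 ∈ elements K ∧ i.2 ∈ i.1 ∧ IsBoundaryFacet K i.1 i.2 := fun i hi => by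
    have h3 := Finset.mem_sigma.1 hi
    have h4 := Finset.mem_filter.1 h3.2
    exact ⟨(hE _).1 h3.1, h4⟩
  have huniq : ∀ i ∈ I, ∀ x ∈ relFacet i.1 i.2, ∀ t ∈ elements K,
      x ∈ convexHull ℝ (t : Set (Pt (n + 1))) → t = i.1 := fun i hi x hx t ht hxt =>
    (hI i hi).2.2 t ht (IsMeshed.facet_subset_of_mem (hI i hi).1 ht hx hxt)
  have hm : ∀ i ∈ I, MeasurableSet (relFacet i.1 i.2) := fun i _ => measurableSet_relFacet _ _
  refine eLpNorm_le_of_cover (I := I) (U := fun i => relFacet i.1 i.2)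
    (T := fun i => relFacet i.1 i.2) hq0 ENNReal.ofReal_ne_top ?_ hm ?_ fun i hi => ?_
  · filter_upwards [h.poly.ae_isGeneric, ae_restrict_mem isClosed_frontier.measurableSet]
      with x hx hxf
    obtain ⟨s, hs, a, ha, hbd, hxa, -⟩ := h.exists_boundaryFacet hx hxf
    exact ⟨⟨s, a⟩, Finset.mem_sigma.2 ⟨(hE s).2 hs, Finset.mem_filter.2 ⟨ha, hbd⟩⟩, hxa⟩
  · rintro ⟨s, a⟩ hi ⟨t, b⟩ hj hij
    refine Set.disjoint_left.2 fun x hx hx' => hij ?_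
    have hst : t = s := huniq _ hi x hx t (hI _ hj).1
      (relFacet_subset (isSimplex_of_mem_elements (hI _ hj).1) b hx')
    subst hst
    have hab : b = a := by
      by_contra hab
      exact (hx.2 b (hI _ hj).2.1 hab).ne' hx'.1
    rw [hab]
  · obtain ⟨hs, ha, hbd⟩ := hI i hi
    have hh := meshwidth_pos h.finite n.succ_pos hs
    have key := hC₀ h hs ha hbd (fun x hx y hy => dist_le_meshwidth h.finite hs hx hy)
      (fun a ha => h.norm_affGrad_bary_le hρ hK hs ha) (hv.mono (h.convexHull_subset hs)) h1 h2
      hvi hG hH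
    refine le_trans (le_of_eq (eLpNorm_congr_ae ?_)) (key.trans ?_)
    · filter_upwards [ae_restrict_mem (hm i hi)] with x hx
      rw [nodalSurfGrad, (h.isOuterNormal_facet hs ha hbd hx).outerNormal_eq,
        nodalGrad_eq ((hE _).2 hs) (relFacet_subset (isSimplex_of_mem_elements hs) _ hx)
          fun t ht hxt => huniq i hi x hx t ((hE t).1 ht) hxt]
    · rw [← mul_assoc, ← mul_assoc]
      refine mul_le_mul' (le_of_eq ?_) le_rfl
      have e2 : ENNReal.ofReal (2 * (ρ * meshwidth K)⁻¹) * ENNReal.ofReal (meshwidth K ^ 2) =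
          ENNReal.ofReal (2 / ρ) * ENNReal.ofReal (meshwidth K) := by
        rw [← ENNReal.ofReal_mul (by positivity), ← ENNReal.ofReal_mul (by positivity)]
        congr 1
        field_simp
      calc ((n + 1 : ℕ) : ℝ≥0∞) * ENNReal.ofReal (2 * (ρ * meshwidth K)⁻¹) *
            C₀ * ENNReal.ofReal (meshwidth K ^ 2)
          = (n + 1 : ℕ) * (ENNReal.ofReal (2 * (ρ * meshwidth K)⁻¹) *
              ENNReal.ofReal (meshwidth K ^ 2)) * C₀ := by ring
        _ = ((n + 1 : ℕ) * (2 / ρ).toNNReal * C₀ : ℝ≥0) * ENNReal.ofReal (meshwidth K) := by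
            rw [e2]
            push_cast
            rw [ENNReal.ofReal, ENNReal.ofReal]
            ring

end Mesh

end

section

theorem meshwidth_nonneg (K : Geometry.SimplicialComplex ℝ (Pt d)) : 0 ≤ meshwidth K :=
  Real.sSup_nonneg (by
    rintro _ ⟨s, -, rfl⟩
    exact Metric.diam_nonneg)

/-- On spaces of finite measure, an estimate in `L_q` with `2 ≤ q ≤ p` gives one in `L_2`, in terms
of the `L_p` norm on the right. -/
theorem exists_norm_sub_le {α α' V V' : Type*} [MeasurableSpace α] [MeasurableSpace α']
    [NormedAddCommGroup V] [NormedAddCommGroup V'] (μ : Measure α) (m : Measure α')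
    [IsFiniteMeasure μ] [IsFiniteMeasure m] {p q : ℝ≥0∞} (hq : 2 ≤ q) (hqp : q ≤ p) (hqt : q ≠ ⊤)
    (C : ℝ≥0) : ∃ c : ℝ, 0 ≤ c ∧ ∀ (X Y : Lp V 2 μ) (f : α → V) (H : Lp V' p m) (h : ℝ),
      X =ᵐ[μ] f → 0 ≤ h →
      eLpNorm (fun x => f x - Y x) q μ ≤ C * ENNReal.ofReal h * eLpNorm H q m →
      ‖X - Y‖ ≤ c * h * ‖H‖ := by
  have hq0 : 0 < q.toReal := ENNReal.toReal_pos (by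
    rintro rfl
    simp at hq) hqt
  have hq2 : (2 : ℝ) ≤ q.toReal := by
    have := ENNReal.toReal_mono hqt hq
    simpa using this
  set a := μ univ ^ (1 / (2 : ℝ≥0∞).toReal - 1 / q.toReal) with ha
  set b := m univ ^ (1 / q.toReal - 1 / p.toReal) with hb
  have hat : a ≠ ⊤ := ENNReal.rpow_ne_top_of_nonneg (by
    rw [ENNReal.toReal_ofNat, sub_nonneg]
    exact one_div_le_one_div_of_le two_pos hq2) (measure_ne_top μ univ)
  have hbt : b ≠ ⊤ := ENNReal.rpow_ne_top_of_nonneg (by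
    rw [sub_nonneg]
    rcases eq_or_ne p ⊤ with rfl | hp
    · simp
    · exact one_div_le_one_div_of_le hq0 (ENNReal.toReal_mono hp hqp)) (measure_ne_top m univ)
  refine ⟨C * a.toReal * b.toReal, by positivity, fun X Y f H h hX hh hle => ?_⟩
  have hm : AEStronglyMeasurable (fun x => f x - Y x) μ :=
    ((Lp.aestronglyMeasurable X).congr hX).sub (Lp.aestronglyMeasurable Y)
  have h1 : eLpNorm (X - Y : Lp V 2 μ) 2 μ ≤ C * ENNReal.ofReal h * (‖H‖ₑ * b) * a := by
    calc eLpNorm (X - Y : Lp V 2 μ) 2 μ = eLpNorm (fun x => f x - Y x) 2 μ := by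
          refine eLpNorm_congr_ae ?_
          filter_upwards [Lp.coeFn_sub X Y, hX] with x h2 h3
          rw [h2, Pi.sub_apply, h3]
      _ ≤ eLpNorm (fun x => f x - Y x) q μ * a := eLpNorm_le_eLpNorm_mul_rpow_measure_univ hq hm
      _ ≤ C * ENNReal.ofReal h * eLpNorm H q m * a := mul_le_mul' hle le_rfl
      _ ≤ _ := by
          refine mul_le_mul' (mul_le_mul' le_rfl ?_) le_rfl
          rw [Lp.enorm_def]
          exact eLpNorm_le_eLpNorm_mul_rpow_measure_univ hqp (Lp.aestronglyMeasurable H)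
  rw [Lp.norm_def]
  refine (ENNReal.toReal_mono ?_ h1).trans (le_of_eq ?_)
  · exact ENNReal.mul_ne_top (ENNReal.mul_ne_top (ENNReal.mul_ne_top ENNReal.coe_ne_top
      ENNReal.ofReal_ne_top) (ENNReal.mul_ne_top enorm_ne_top hbt)) hat
  · rw [Lp.enorm_def, Lp.norm_def]
    simp only [ENNReal.toReal_mul, ENNReal.coe_toReal, ENNReal.toReal_ofReal hh]
    ring

/-- Since `p` may be infinite, the estimates are made in `L_q` with a finite exponent. -/
theorem exists_real_exponent (d : ℕ) {p : ℝ≥0∞} (hp : 2 ≤ p) (hpd : (d : ℝ≥0∞) < 2 * p) :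
    ∃ q : ℝ, 2 ≤ q ∧ (d : ℝ) < 2 * q ∧ ENNReal.ofReal q ≤ p := by
  rcases eq_or_ne p ⊤ with rfl | hpt
  · exact ⟨d + 2, by linarith [d.cast_nonneg (α := ℝ)], by linarith [d.cast_nonneg (α := ℝ)],
      le_top⟩
  · refine ⟨p.toReal, ?_, ?_, (ENNReal.ofReal_toReal hpt).le⟩
    · simpa using ENNReal.toReal_mono hpt hp
    · have := (ENNReal.toReal_lt_toReal (ENNReal.natCast_ne_top d)
        (ENNReal.mul_ne_top (by norm_num) hpt)).2 hpd
      simpa using this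

/-- Functions with second derivatives in `L_p` are approximated by finite element functions in the
norm of `V`, to first order in the mesh size. -/
theorem exists_feSpace_approximation {n : ℕ} {Ω : Set (Pt (n + 1))} (hΩ : IsPolygonalDomain Ω)
    (β : ℝ) {p : ℝ≥0∞} [Fact (1 ≤ p)] (hp : 2 ≤ p) (hpd : ((n + 1 : ℕ) : ℝ≥0∞) < 2 * p) {ρ : ℝ}
    (hρ : 0 < ρ) : ∃ C : ℝ, 0 ≤ C ∧ ∀ K : Geometry.SimplicialComplex ℝ (Pt (n + 1)),
      IsTriangulation Ω K → IsQuasiUniform ρ K → ∀ U ∈ regularSpace Ω β p,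
        ∃ W ∈ feSpace Ω β K, ‖W - U.1‖ ≤ C * meshwidth K * ‖U‖ := by
  obtain ⟨q, hq2, hdq, hqp⟩ := exists_real_exponent (n + 1) hp hpd
  have hq1 : 1 < q := by linarith
  have hnq : (n : ℝ) < 2 * q := by
    push_cast at hdq
    linarith
  obtain ⟨S₀, hS₀⟩ := hΩ.exists_isPolyhedralOpen
  have := hS₀.isFiniteMeasure
  have : IsFiniteMeasure (bulkMeasure Ω) :=
    ⟨by rw [Measure.restrict_apply_univ]; exact hΩ.isBounded.measure_lt_top⟩
  have hq2' : 2 ≤ ENNReal.ofReal q := by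
    simpa using ENNReal.ofReal_le_ofReal hq2
  obtain ⟨C₁, hC₁⟩ := exists_bulk_estimate n (Ω := Ω) hq1 hdq hρ
  obtain ⟨C₂, hC₂⟩ := exists_surface_estimate n (Ω := Ω) hq1 hnq hρ
  obtain ⟨c₁, hc₁, h₁⟩ := exists_norm_sub_le (V := ℝ) (V' := Pt (n + 1) →L[ℝ] Pt (n + 1))
    (bulkMeasure Ω) (bulkMeasure Ω) hq2' hqp ENNReal.ofReal_ne_top C₁
  obtain ⟨c₂, hc₂, h₂⟩ := exists_norm_sub_le (V := Pt (n + 1))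
    (V' := Pt (n + 1) →L[ℝ] Pt (n + 1))
    (bulkMeasure Ω) (bulkMeasure Ω) hq2' hqp ENNReal.ofReal_ne_top C₁
  obtain ⟨c₃, hc₃, h₃⟩ := exists_norm_sub_le (V := ℝ) (V' := Pt (n + 1) →L[ℝ] Pt (n + 1))
    (surfaceMeasure Ω) (bulkMeasure Ω) hq2' hqp ENNReal.ofReal_ne_top C₁
  obtain ⟨c₄, hc₄, h₄⟩ := exists_norm_sub_le (V := Pt (n + 1))
    (V' := Pt (n + 1) →L[ℝ] Pt (n + 1))
    (surfaceMeasure Ω) (surfaceMeasure Ω) hq2' hqp ENNReal.ofReal_ne_top C₂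
  refine ⟨c₁ + c₂ + c₃ + c₄, by positivity, fun K hK hKq U hU => ?_⟩
  obtain ⟨S, hS⟩ := hS₀.exists_isMeshed hK
  set E := (finite_elements hK).toFinset with hEdef
  have hE : ∀ s, s ∈ E ↔ s ∈ elements K := fun s => Set.Finite.mem_toFinset _
  have hh := meshwidth_nonneg K
  obtain ⟨⟨hw1, hw2, hw3, hw4⟩, h5, h6⟩ := hU
  have hgi : IntegrableOn (grad U.1) Ω := (Lp.memLp (grad U.1)).integrable (by norm_num)
  have hvi : IntegrableOn (val U.1) Ω := (Lp.memLp (val U.1)).integrable (by norm_num)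
  have hti : Integrable (tr U.1) (surfaceMeasure Ω) := (Lp.memLp (tr U.1)).integrable (by norm_num)
  have hsi : Integrable (surfGrad U.1) (surfaceMeasure Ω) :=
    (Lp.memLp (surfGrad U.1)).integrable (by norm_num)
  have hH : MemLp U.2.1 (ENNReal.ofReal q) (bulkMeasure Ω) := (Lp.memLp U.2.1).mono_exponent hqp
  have hHs : MemLp U.2.2 (ENNReal.ofReal q) (surfaceMeasure Ω) :=
    (Lp.memLp U.2.2).mono_exponent hqp
  obtain ⟨v, hv, hvv, hvt⟩ := hΩ.exists_continuous_representative hq1 hdq hvi hgi hH hw1 h5 hti hw2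
  -- the approximation is the nodal interpolant of the continuous representative
  obtain ⟨W, hW, e1, e2, e3, e4, e5⟩ := hS.exists_mem_feSpace hE v β
  obtain ⟨b1, b2, b3⟩ := hC₁ hS hKq hE hv (hw1.congr hvv.symm ae_eq_rfl) h5 hgi hH
  have hU1 : ‖U.2.1‖ ≤ ‖U‖ := (norm_fst_le _).trans (norm_snd_le _)
  have hU2 : ‖U.2.2‖ ≤ ‖U‖ := (norm_snd_le _).trans (norm_snd_le _)
  have hfin : ∀ {c N A : ℝ}, 0 ≤ c → c ≤ c₁ + c₂ + c₃ + c₄ → A ≤ ‖U‖ → N ≤ c * meshwidth K * A →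
      N ≤ (c₁ + c₂ + c₃ + c₄) * meshwidth K * ‖U‖ := fun hc hle hA hN =>
    hN.trans ((mul_le_mul_of_nonneg_left hA (mul_nonneg hc hh)).trans (by gcongr))
  refine ⟨W, hW, norm_prod_le_iff.2 ⟨?_, norm_prod_le_iff.2 ⟨?_, norm_prod_le_iff.2 ⟨?_, ?_⟩⟩⟩⟩
  · refine hfin hc₁ (by linarith) hU1 (h₁ (val W) (val U.1) _ _ _ e1 hh (le_trans (le_of_eq ?_) b2))
    exact eLpNorm_congr_ae (hvv.mono fun x hx => by simp only [hx])
  · exact hfin hc₂ (by linarith) hU1 (h₂ (grad W) (grad U.1) _ _ _ e2 hh b1)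
  · refine hfin hc₃ (by linarith) hU1 (h₃ (tr W) (tr U.1) _ _ _ e3 hh (le_trans (le_of_eq ?_) b3))
    exact eLpNorm_congr_ae (hvt.mono fun x hx => by simp only [hx])
  · by_cases hβ : β = 0
    · have e : (W - U.1).2.2.2 = surfGrad W - surfGrad U.1 := rfl
      rw [e, e5 hβ, hw4 hβ, sub_zero, norm_zero]
      positivity
    · exact hfin hc₄ (by linarith) hU2 (h₄ (surfGrad W) (surfGrad U.1) _ _ _ (e4 hβ) hh
        (hC₂ hS hKq hE hv ((hw3 hβ).congr hvt.symm ae_eq_rfl) (h6 hβ) (hti.congr hvt.symm) hsi hHs))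

end

section

/-! ### Linearity of the function spaces -/

theorem IsTestFunction.integrable_smul {φ : Pt d → ℝ} (hφ : IsTestFunction φ) {V : Type*}
    [NormedAddCommGroup V] [NormedSpace ℝ V] {μ : Measure (Pt d)} {g : Pt d → V}
    (hg : Integrable g μ) : Integrable (fun x => φ x • g x) μ := by
  obtain ⟨M, hM⟩ := hφ.exists_bound
  exact hg.bdd_smul M hφ.1.continuous.aestronglyMeasurable (Eventually.of_forall fun x => (hM x).1)

theorem IsTestFunction.integrable_smul_gradient {φ : Pt d → ℝ} (hφ : IsTestFunction φ)
    {μ : Measure (Pt d)} {v : Pt d → ℝ} (hv : Integrable v μ) :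
    Integrable (fun x => v x • gradient φ x) μ := by
  obtain ⟨M, hM⟩ := hφ.exists_bound
  exact hv.smul_bdd M hφ.continuous_gradient.aestronglyMeasurable
    (Eventually.of_forall fun x => (hM x).2)

theorem HasTrace.congr {v v' : Pt d → ℝ} {g g' : Pt d → Pt d} {w w' : Pt d → ℝ}
    (h : HasTrace Ω v g w) (hv : v =ᵐ[bulkMeasure Ω] v') (hg : g =ᵐ[bulkMeasure Ω] g')
    (hw : w =ᵐ[surfaceMeasure Ω] w') : HasTrace Ω v' g' w' := fun φ hφ => by
  rw [← integral_congr_ae (by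
      filter_upwards [hv, hg] with x h1 h2
      rw [h1, h2] : (fun x => v x • gradient φ x + φ x • g x) =ᵐ[bulkMeasure Ω]
        fun x => v' x • gradient φ x + φ x • g' x),
    ← integral_congr_ae (hw.mono fun x hx => by simp only [hx] :
      (fun x => (φ x * w x) • outerNormal Ω x) =ᵐ[surfaceMeasure Ω]
        fun x => (φ x * w' x) • outerNormal Ω x)]
  exact h φ hφ

theorem HasWeakGradient.smul_add {v v' : Pt d → ℝ} {g g' : Pt d → Pt d}
    (h : HasWeakGradient Ω v g) (h' : HasWeakGradient Ω v' g') (c : ℝ) (hv : IntegrableOn v Ω)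
    (hv' : IntegrableOn v' Ω) (hg : IntegrableOn g Ω) (hg' : IntegrableOn g' Ω) :
    HasWeakGradient Ω (fun x => c * v x + v' x) (fun x => c • g x + g' x) := fun φ hφ hs => by
  have e1 : ∀ x, (c * v x + v' x) • gradient φ x = c • (v x • gradient φ x) + v' x • gradient φ x :=
    fun x => by rw [_root_.add_smul, mul_smul]
  have e2 : ∀ x, φ x • (c • g x + g' x) = c • (φ x • g x) + φ x • g' x := fun x => by
    rw [_root_.smul_add, smul_comm]
  simp_rw [e1, e2]
  have i1 : Integrable (fun x => c • (v x • gradient φ x)) (bulkMeasure Ω) :=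
    (hφ.integrable_smul_gradient hv).smul c
  have i2 : Integrable (fun x => c • (φ x • g x)) (bulkMeasure Ω) := (hφ.integrable_smul hg).smul c
  rw [integral_add i1 (hφ.integrable_smul_gradient hv'), integral_add i2 (hφ.integrable_smul hg'),
    integral_smul, integral_smul, h φ hφ hs, h' φ hφ hs, smul_neg, neg_add]

section Poly

variable {n : ℕ} {Ω : Set (Pt (n + 1))} {S : Finset (Set (Pt (n + 1)))}

theorem HasTrace.smul_add (hΩ : IsPolyhedralOpen Ω S) {v v' w w' : Pt (n + 1) → ℝ}
    {g g' : Pt (n + 1) → Pt (n + 1)} (h : HasTrace Ω v g w) (h' : HasTrace Ω v' g' w') (c : ℝ)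
    (hv : IntegrableOn v Ω) (hv' : IntegrableOn v' Ω) (hg : IntegrableOn g Ω)
    (hg' : IntegrableOn g' Ω) (hw : Integrable w (surfaceMeasure Ω))
    (hw' : Integrable w' (surfaceMeasure Ω)) :
    HasTrace Ω (fun x => c * v x + v' x) (fun x => c • g x + g' x)
      (fun x => c * w x + w' x) := fun φ hφ => by
  have e1 : ∀ x, (c * v x + v' x) • gradient φ x + φ x • (c • g x + g' x) =
      c • (v x • gradient φ x + φ x • g x) + (v' x • gradient φ x + φ x • g' x) := fun x => by
    rw [_root_.add_smul, mul_smul, _root_.smul_add, _root_.smul_add, smul_comm (φ x)]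
    abel
  have e2 : ∀ x, (φ x * (c * w x + w' x)) • outerNormal Ω x =
      c • ((φ x * w x) • outerNormal Ω x) + (φ x * w' x) • outerNormal Ω x := fun x => by
    rw [smul_smul, ← _root_.add_smul]
    ring_nf
  have hb : ∀ {v : Pt (n + 1) → ℝ} {g : Pt (n + 1) → Pt (n + 1)}, IntegrableOn v Ω →
      IntegrableOn g Ω →
      Integrable (fun x => v x • gradient φ x + φ x • g x) (bulkMeasure Ω) := fun h1 h2 =>
    (hφ.integrable_smul_gradient h1).add (hφ.integrable_smul h2)
  have hs : ∀ {w : Pt (n + 1) → ℝ}, Integrable w (surfaceMeasure Ω) →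
      Integrable (fun x => (φ x * w x) • outerNormal Ω x) (surfaceMeasure Ω) := fun h1 =>
    (hφ.integrable_smul h1).smul_bdd 1 hΩ.aestronglyMeasurable_outerNormal
      (Eventually.of_forall fun x => norm_outerNormal_le Ω x)
  simp_rw [e1, e2]
  have i1 : Integrable (fun x => c • (v x • gradient φ x + φ x • g x)) (bulkMeasure Ω) :=
    (hb hv hg).smul c
  have i2 : Integrable (fun x => c • ((φ x * w x) • outerNormal Ω x)) (surfaceMeasure Ω) :=
    (hs hw).smul c
  rw [integral_add i1 (hb hv' hg'), integral_add i2 (hs hw'), integral_smul, integral_smul,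
    h φ hφ, h' φ hφ]

theorem HasSurfaceGradientOn.smul_add (hΩ : IsPolyhedralOpen Ω S) {R : Set (Pt (n + 1))}
    {w w' : Pt (n + 1) → ℝ} {G G' : Pt (n + 1) → Pt (n + 1)} (h : HasSurfaceGradientOn Ω R w G)
    (h' : HasSurfaceGradientOn Ω R w' G') (c : ℝ) (hw : Integrable w (surfaceMeasure Ω))
    (hw' : Integrable w' (surfaceMeasure Ω)) (hG : Integrable G (surfaceMeasure Ω))
    (hG' : Integrable G' (surfaceMeasure Ω)) :
    HasSurfaceGradientOn Ω R (fun x => c * w x + w' x) (fun x => c • G x + G' x) := by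
  refine ⟨?_, fun φ hφ hs i j => ?_⟩
  · filter_upwards [h.1, h'.1] with x h1 h2
    rw [inner_add_left, inner_smul_left, h1, h2]
    simp
  obtain ⟨M, hM⟩ := hφ.exists_bound
  have hM0 : 0 ≤ M := (abs_nonneg _).trans (hM 0).1
  have hνm : ∀ i, AEStronglyMeasurable (fun x => outerNormal Ω x i) (surfaceMeasure Ω) := fun i =>
    (EuclideanSpace.proj i : Pt (n + 1) →L[ℝ] ℝ).continuous.comp_aestronglyMeasurable
      hΩ.aestronglyMeasurable_outerNormal
  have hν : ∀ x i, |outerNormal Ω x i| ≤ 1 := fun x i =>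
    (PiLp.norm_apply_le _ i).trans (norm_outerNormal_le Ω x)
  have hgm : ∀ i, Continuous fun x => gradient φ x i := fun i =>
    (EuclideanSpace.proj i : Pt (n + 1) →L[ℝ] ℝ).continuous.comp hφ.continuous_gradient
  have hg : ∀ x i, |gradient φ x i| ≤ M := fun x i => (PiLp.norm_apply_le _ i).trans (hM x).2
  have i1 : ∀ {w : Pt (n + 1) → ℝ}, Integrable w (surfaceMeasure Ω) → Integrable (fun x =>
      w x * (outerNormal Ω x i * gradient φ x j - outerNormal Ω x j * gradient φ x i))
      (surfaceMeasure Ω) := fun {w} hw => by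
    refine hw.mul_bdd (c := M + M) (((hνm i).mul (hgm j).aestronglyMeasurable).sub
      ((hνm j).mul (hgm i).aestronglyMeasurable)) (Eventually.of_forall fun x => ?_)
    have h1 : ∀ i j, |outerNormal Ω x i * gradient φ x j| ≤ M := fun i j => by
      rw [abs_mul]
      calc |outerNormal Ω x i| * |gradient φ x j| ≤ 1 * M :=
            mul_le_mul (hν x i) (hg x j) (abs_nonneg _) zero_le_one
        _ = M := one_mul M
    exact (abs_sub _ _).trans (add_le_add (h1 i j) (h1 j i))
  have i2 : ∀ {G : Pt (n + 1) → Pt (n + 1)}, Integrable G (surfaceMeasure Ω) → Integrable (fun x =>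
      φ x * (outerNormal Ω x i * G x j - outerNormal Ω x j * G x i)) (surfaceMeasure Ω) :=
    fun {G} hG => by
      have h1 : ∀ i j, Integrable (fun x => outerNormal Ω x i * G x j) (surfaceMeasure Ω) :=
        fun i j => (integrable_apply hG j).bdd_mul (c := 1) (hνm i)
          (Eventually.of_forall fun x => hν x i)
      exact hφ.integrable_smul ((h1 i j).sub (h1 j i))
  have e1 : ∀ x, (c * w x + w' x) *
      (outerNormal Ω x i * gradient φ x j - outerNormal Ω x j * gradient φ x i) =
      c * (w x * (outerNormal Ω x i * gradient φ x j - outerNormal Ω x j * gradient φ x i)) +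
      w' x * (outerNormal Ω x i * gradient φ x j - outerNormal Ω x j * gradient φ x i) :=
    fun x => by ring
  have e2 : ∀ x, φ x * (outerNormal Ω x i * (c • G x + G' x) j -
        outerNormal Ω x j * (c • G x + G' x) i) =
      c * (φ x * (outerNormal Ω x i * G x j - outerNormal Ω x j * G x i)) +
      φ x * (outerNormal Ω x i * G' x j - outerNormal Ω x j * G' x i) := fun x => by
    simp only [PiLp.add_apply, PiLp.smul_apply, smul_eq_mul]
    ring
  simp_rw [e1, e2]
  rw [integral_add ((i1 hw).const_mul c) (i1 hw'), integral_add ((i2 hG).const_mul c) (i2 hG'),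
    integral_const_mul, integral_const_mul, h.2 φ hφ hs, h'.2 φ hφ hs]
  ring

theorem coeFn_smul_add {α V : Type*} [MeasurableSpace α] {μ : Measure α} [NormedAddCommGroup V]
    [NormedSpace ℝ V] {p : ℝ≥0∞} (c : ℝ) (f g : Lp V p μ) :
    (c • f + g : Lp V p μ) =ᵐ[μ] fun x => c • f x + g x := by
  filter_upwards [Lp.coeFn_add (c • f) g, Lp.coeFn_smul c f] with x h1 h2
  rw [h1, Pi.add_apply, h2, Pi.smul_apply]

theorem smul_add_mem_energySpace (hΩ : IsPolyhedralOpen Ω S) {β : ℝ} {v v' : BulkSurface Ω}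
    (hv : v ∈ energySpace Ω β) (hv' : v' ∈ energySpace Ω β) (c : ℝ) :
    c • v + v' ∈ energySpace Ω β := by
  have := hΩ.isFiniteMeasure
  have : IsFiniteMeasure (bulkMeasure Ω) :=
    ⟨by rw [Measure.restrict_apply_univ]; exact hΩ.isBounded.measure_lt_top⟩
  obtain ⟨h1, h2, h3, h4⟩ := hv
  obtain ⟨h1', h2', h3', h4'⟩ := hv'
  have hi : ∀ {V : Type} [NormedAddCommGroup V] (f : Lp V 2 (bulkMeasure Ω)),
      IntegrableOn f Ω := fun f => (Lp.memLp f).integrable (by norm_num)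
  have hi' : ∀ {V : Type} [NormedAddCommGroup V] (f : Lp V 2 (surfaceMeasure Ω)),
      Integrable f (surfaceMeasure Ω) := fun f => (Lp.memLp f).integrable (by norm_num)
  have e1 := (coeFn_smul_add c (val v) (val v')).symm
  have e2 := (coeFn_smul_add c (grad v) (grad v')).symm
  have e3 := (coeFn_smul_add c (tr v) (tr v')).symm
  have e4 := (coeFn_smul_add c (surfGrad v) (surfGrad v')).symm
  refine ⟨(h1.smul_add h1' c (hi _) (hi _) (hi _) (hi _)).congr e1 e2,
    (h2.smul_add hΩ h2' c (hi _) (hi _) (hi _) (hi _) (hi' _) (hi' _)).congr e1 e2 e3,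
    fun hβ => ((h3 hβ).smul_add hΩ (h3' hβ) c (hi' _) (hi' _) (hi' _) (hi' _)).congr e3 e4,
    fun hβ => ?_⟩
  have : surfGrad (c • v + v') = c • surfGrad v + surfGrad v' := rfl
  rw [this, h4 hβ, h4' hβ, smul_zero, zero_add]

theorem zero_mem_energySpace (β : ℝ) : (0 : BulkSurface Ω) ∈ energySpace Ω β := by
  have e1 : (val (0 : BulkSurface Ω) : Pt (n + 1) → ℝ) =ᵐ[bulkMeasure Ω] fun _ => 0 :=
    Lp.coeFn_zero _ _ _
  have e2 : (grad (0 : BulkSurface Ω) : Pt (n + 1) → Pt (n + 1)) =ᵐ[bulkMeasure Ω] fun _ => 0 :=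
    Lp.coeFn_zero _ _ _
  have e3 : (tr (0 : BulkSurface Ω) : Pt (n + 1) → ℝ) =ᵐ[surfaceMeasure Ω] fun _ => 0 :=
    Lp.coeFn_zero _ _ _
  have e4 : (surfGrad (0 : BulkSurface Ω) : Pt (n + 1) → Pt (n + 1)) =ᵐ[surfaceMeasure Ω]
      fun _ => 0 := Lp.coeFn_zero _ _ _
  refine ⟨HasWeakGradient.congr (v := fun _ => 0) (g := fun _ => 0) ?_ e1.symm e2.symm,
    HasTrace.congr (v := fun _ => 0) (g := fun _ => 0) (w := fun _ => 0) ?_ e1.symm e2.symm e3.symm,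
    fun _ => HasSurfaceGradientOn.congr (w := fun _ => 0) (G := fun _ => 0) ?_ e3.symm e4.symm,
    fun _ => rfl⟩
  · intro φ _ _
    simp
  · intro φ _
    simp
  · refine ⟨by simp, fun φ _ _ i j => by simp⟩

theorem smul_add_mem_feSpace (hΩ : IsPolyhedralOpen Ω S) {β : ℝ}
    {K : Geometry.SimplicialComplex ℝ (Pt (n + 1))} {v v' : BulkSurface Ω}
    (hv : v ∈ feSpace Ω β K) (hv' : v' ∈ feSpace Ω β K) (c : ℝ) : c • v + v' ∈ feSpace Ω β K := by
  obtain ⟨h1, φ, ⟨h2, h3⟩, h4⟩ := hv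
  obtain ⟨h1', φ', ⟨h2', h3'⟩, h4'⟩ := hv'
  refine ⟨smul_add_mem_energySpace hΩ h1 h1' c, fun x => c * φ x + φ' x,
    ⟨(h2.const_smul c).add h2', fun s hs => ?_⟩, ?_⟩
  · obtain ⟨A, hA⟩ := h3 s hs
    obtain ⟨A', hA'⟩ := h3' s hs
    exact ⟨c • A + A', fun x hx => by simp [hA hx, hA' hx]⟩
  · filter_upwards [coeFn_smul_add c (val v) (val v'), h4, h4'] with x e1 e2 e3
    exact e1.trans (by rw [e2, e3, smul_eq_mul])

theorem zero_mem_feSpace (β : ℝ) (K : Geometry.SimplicialComplex ℝ (Pt (n + 1))) :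
    (0 : BulkSurface Ω) ∈ feSpace Ω β K :=
  ⟨zero_mem_energySpace β, fun _ => 0, ⟨continuousOn_const, fun _ _ => ⟨0, fun _ _ => rfl⟩⟩,
    Lp.coeFn_zero _ _ _⟩

theorem smul_add_mem_regularSpace (hΩ : IsPolyhedralOpen Ω S) {β : ℝ} {p : ℝ≥0∞} [Fact (1 ≤ p)]
    {U U' : BulkSurface Ω × Lp (Pt (n + 1) →L[ℝ] Pt (n + 1)) p (bulkMeasure Ω) ×
      Lp (Pt (n + 1) →L[ℝ] Pt (n + 1)) p (surfaceMeasure Ω)}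
    (hU : U ∈ regularSpace Ω β p) (hU' : U' ∈ regularSpace Ω β p) (c : ℝ) :
    c • U + U' ∈ regularSpace Ω β p := by
  have := hΩ.isFiniteMeasure
  have : IsFiniteMeasure (bulkMeasure Ω) :=
    ⟨by rw [Measure.restrict_apply_univ]; exact hΩ.isBounded.measure_lt_top⟩
  obtain ⟨h1, h2, h3⟩ := hU
  obtain ⟨h1', h2', h3'⟩ := hU'
  have hp : 1 ≤ p := Fact.out
  refine ⟨smul_add_mem_energySpace hΩ h1 h1' c, fun z => ?_, fun hβ z => ?_⟩
  · have hi : ∀ f : Lp (Pt (n + 1)) 2 (bulkMeasure Ω), IntegrableOn (fun x => inner ℝ (f x) z) Ω :=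
      fun f => ((Lp.memLp f).integrable (by norm_num)).inner_const z
    have hj : ∀ f : Lp (Pt (n + 1) →L[ℝ] Pt (n + 1)) p (bulkMeasure Ω),
        IntegrableOn (fun x => f x z) Ω := fun f =>
      (ContinuousLinearMap.apply ℝ (Pt (n + 1)) z).integrable_comp ((Lp.memLp f).integrable hp)
    refine ((h2 z).smul_add (h2' z) c (hi _) (hi _) (hj _) (hj _)).congr ?_ ?_
    · filter_upwards [coeFn_smul_add c (grad U.1) (grad U'.1)] with x hx
      have e : grad (c • U + U').1 x = c • grad U.1 x + grad U'.1 x := hx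
      rw [e, inner_add_left, inner_smul_left, conj_trivial]
    · filter_upwards [coeFn_smul_add c U.2.1 U'.2.1] with x hx
      have e : (c • U + U').2.1 x = c • U.2.1 x + U'.2.1 x := hx
      rw [e]
      rfl
  · have hi : ∀ f : Lp (Pt (n + 1)) 2 (surfaceMeasure Ω),
        Integrable (fun x => inner ℝ (f x) z) (surfaceMeasure Ω) :=
      fun f => ((Lp.memLp f).integrable (by norm_num)).inner_const z
    have hj : ∀ f : Lp (Pt (n + 1) →L[ℝ] Pt (n + 1)) p (surfaceMeasure Ω),
        Integrable (fun x => f x z) (surfaceMeasure Ω) := fun f =>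
      (ContinuousLinearMap.apply ℝ (Pt (n + 1)) z).integrable_comp ((Lp.memLp f).integrable hp)
    refine ((h3 hβ z).smul_add hΩ (h3' hβ z) c (hi _) (hi _) (hj _) (hj _)).congr ?_ ?_
    · filter_upwards [coeFn_smul_add c (surfGrad U.1) (surfGrad U'.1)] with x hx
      have e : surfGrad (c • U + U').1 x = c • surfGrad U.1 x + surfGrad U'.1 x := hx
      rw [e, inner_add_left, inner_smul_left, conj_trivial]
    · filter_upwards [coeFn_smul_add c U.2.2 U'.2.2] with x hx
      have e : (c • U + U').2.2 x = c • U.2.2 x + U'.2.2 x := hx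
      rw [e]
      rfl

end Poly

end

section

/-! ### The energy argument -/

section Energy

variable {X : Type*} [NormedAddCommGroup X] [InnerProductSpace ℝ X]

/-- The orthogonal projection is the best approximation. -/
theorem norm_starProjection_sub_le (N : Submodule ℝ X) [N.HasOrthogonalProjection] {w x : X}
    (hw : w ∈ N) : ‖N.starProjection x - x‖ ≤ ‖w - x‖ := by
  have h1 : inner ℝ (w - N.starProjection x) (N.starProjection x - x) = 0 := by
    have := N.starProjection_inner_eq_zero x (w - N.starProjection x)
      (N.sub_mem hw (N.starProjection_apply_mem x))
    rw [real_inner_comm, ← neg_sub, inner_neg_left, this, neg_zero]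
  have h2 := norm_add_sq_eq_norm_sq_add_norm_sq_of_inner_eq_zero _ _ h1
  rw [sub_add_sub_cancel] at h2
  nlinarith [norm_nonneg (w - x), norm_nonneg (N.starProjection x - x),
    norm_nonneg (w - N.starProjection x)]

theorem continuousOn_bilin (a : X →L[ℝ] X →L[ℝ] ℝ) {θ : ℝ → X} {s : Set ℝ}
    (hθ : ContinuousOn θ s) : ContinuousOn (fun t => a (θ t) (θ t)) s :=
  (a.continuous.comp_continuousOn hθ).clm_apply hθ

theorem bilin_add_self_le {a : X →L[ℝ] X →L[ℝ] ℝ} (ha : ∀ v, 0 ≤ a v v) (v w : X) :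
    a (v + w) (v + w) ≤ 2 * a v v + 2 * a w w := by
  have h := ha (v - w)
  simp only [map_add, map_sub, _root_.add_apply, _root_.sub_apply] at h ⊢
  linarith

theorem bilin_self_le (a : X →L[ℝ] X →L[ℝ] ℝ) {w : X} {δ : ℝ} (hw : ‖w‖ ≤ δ) :
    a w w ≤ ‖a‖ * δ ^ 2 := by
  calc a w w ≤ ‖a w w‖ := Real.le_norm_self _
    _ ≤ ‖a‖ * ‖w‖ * ‖w‖ := a.le_opNorm₂ w w
    _ = ‖a‖ * ‖w‖ ^ 2 := by ring
    _ ≤ ‖a‖ * δ ^ 2 := by gcongr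

/-- The differential inequality `Ė ≤ -a(θ, θ) + E + K` for the energy `E = b(θ, θ)` bounds the
energy and the dissipation. -/
theorem energy_le {b a : X →L[ℝ] X →L[ℝ] ℝ} (hbs : ∀ v w, b v w = b w v) (hb : ∀ v, 0 ≤ b v v)
    (ha : ∀ v, 0 ≤ a v v) {T K : ℝ} {θ : ℝ → X} (hθ : ContinuousOn θ (Icc 0 T)) (hK0 : 0 ≤ K)
    (hK : ∀ t ∈ Ioo 0 T, ∃ θ', HasDerivAt θ θ' t ∧
      2 * b θ' (θ t) ≤ -a (θ t) (θ t) + b (θ t) (θ t) + K)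
    {t : ℝ} (ht : t ∈ Icc 0 T) :
    b (θ t) (θ t) + ∫ s in (0 : ℝ)..t, a (θ s) (θ s) ≤
      Real.exp T * (b (θ 0) (θ 0) + K * T) := by
  have hT : 0 ≤ T := ht.1.trans ht.2
  have hac := continuousOn_bilin a hθ
  have hexp : Continuous fun s : ℝ => Real.exp (-s) := by fun_prop
  have hfc : ContinuousOn (fun s => Real.exp (-s) * a (θ s) (θ s)) (Icc 0 T) :=
    hexp.continuousOn.mul hac
  -- the weight `exp (-t)` absorbs the term `b (θ t) (θ t)`, so that `Φ` is nonincreasing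
  set Φ : ℝ → ℝ := fun t => Real.exp (-t) * b (θ t) (θ t) +
    (∫ s in (0 : ℝ)..t, Real.exp (-s) * a (θ s) (θ s)) - K * t with hΦ
  have hii : ∀ {f : ℝ → ℝ}, ContinuousOn f (Icc 0 T) → ∀ t ∈ Icc 0 T,
      IntervalIntegrable f volume 0 t := fun {f} hf t ht =>
    (hf.mono (by rw [uIcc_of_le ht.1]; exact Icc_subset_Icc_right ht.2)).intervalIntegrable
  have hderiv : ∀ t ∈ Ioo 0 T, ∃ D ≤ 0, HasDerivAt Φ D t := by
    intro t ht
    obtain ⟨θ', hd, hle⟩ := hK t ht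
    have h1 : HasDerivAt (fun t => b (θ t) (θ t)) (b θ' (θ t) + b (θ t) θ') t :=
      (b.hasFDerivAt.comp_hasDerivAt t hd).clm_apply hd
    have h2 : HasDerivAt (fun s : ℝ => Real.exp (-s)) (-Real.exp (-t)) t := by
      simpa using (hasDerivAt_neg t).exp
    have h3 : HasDerivAt (fun t => ∫ s in (0 : ℝ)..t, Real.exp (-s) * a (θ s) (θ s))
        (Real.exp (-t) * a (θ t) (θ t)) t :=
      intervalIntegral.integral_hasDerivAt_right (hii hfc t ⟨ht.1.le, ht.2.le⟩)
        ((hfc.mono Ioo_subset_Icc_self).stronglyMeasurableAtFilter isOpen_Ioo t ht)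
        (hfc.continuousAt (Icc_mem_nhds ht.1 ht.2))
    refine ⟨_, ?_, ((h2.mul h1).add h3).sub ((hasDerivAt_id t).const_mul K)⟩
    rw [hbs (θ t) θ']
    have he0 := Real.exp_pos (-t)
    have he1 : Real.exp (-t) ≤ 1 := Real.exp_le_one_iff.2 (by linarith [ht.1])
    have h4 : Real.exp (-t) * (2 * b θ' (θ t) - b (θ t) (θ t) + a (θ t) (θ t)) ≤
        Real.exp (-t) * K := mul_le_mul_of_nonneg_left (by linarith) he0.le
    have h5 : Real.exp (-t) * K ≤ 1 * K := mul_le_mul_of_nonneg_right he1 hK0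
    linarith
  have hanti : AntitoneOn Φ (Icc 0 T) := by
    refine antitoneOn_of_deriv_nonpos (convex_Icc 0 T) ?_ ?_ ?_
    · have hp : ContinuousOn (fun t => ∫ s in (0 : ℝ)..t, Real.exp (-s) * a (θ s) (θ s))
          (Icc 0 T) := by
        rw [← uIcc_of_le hT] at hfc ⊢
        exact intervalIntegral.continuousOn_primitive_interval
          (hfc.integrableOn_compact isCompact_uIcc)
      exact ((hexp.continuousOn.mul (continuousOn_bilin b hθ)).add hp).sub
        (continuous_const.mul continuous_id).continuousOn
    · rw [interior_Icc]
      intro t ht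
      obtain ⟨D, -, hD⟩ := hderiv t ht
      exact hD.differentiableAt.differentiableWithinAt
    · rw [interior_Icc]
      intro t ht
      obtain ⟨D, hD0, hD⟩ := hderiv t ht
      rwa [hD.deriv]
  have h0 : Φ t ≤ Φ 0 := hanti ⟨le_rfl, hT⟩ ht ht.1
  simp only [hΦ, neg_zero, Real.exp_zero, one_mul, intervalIntegral.integral_same, mul_zero,
    add_zero, sub_zero] at h0
  have h1 : Real.exp (-T) * ∫ s in (0 : ℝ)..t, a (θ s) (θ s) ≤
      ∫ s in (0 : ℝ)..t, Real.exp (-s) * a (θ s) (θ s) := by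
    rw [← intervalIntegral.integral_const_mul]
    refine intervalIntegral.integral_mono_on ht.1 ((hii hac t ht).const_mul _) (hii hfc t ht)
      fun s hs => mul_le_mul_of_nonneg_right ?_ (ha _)
    exact Real.exp_le_exp.2 (neg_le_neg (hs.2.trans ht.2))
  have h2 : Real.exp (-T) * b (θ t) (θ t) ≤ Real.exp (-t) * b (θ t) (θ t) :=
    mul_le_mul_of_nonneg_right (Real.exp_le_exp.2 (neg_le_neg ht.2)) (hb _)
  have h3 : K * t ≤ K * T := mul_le_mul_of_nonneg_left ht.2 hK0
  have h4 : Real.exp (-T) * (b (θ t) (θ t) + ∫ s in (0 : ℝ)..t, a (θ s) (θ s)) ≤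
      b (θ 0) (θ 0) + K * T := by
    rw [mul_add]
    linarith
  rwa [Real.exp_neg, inv_mul_le_iff₀ (Real.exp_pos T)] at h4

/-- The semi-discrete error is controlled by the errors of best approximation of `u` and of its
difference quotients. -/
theorem exists_error_le [CompleteSpace X] {b a : X →L[ℝ] X →L[ℝ] ℝ}
    (hbs : ∀ v w, b v w = b w v) (hb : ∀ v, 0 ≤ b v v) (ha : ∀ v, 0 ≤ a v v) {c T : ℝ} (hc : 0 < c)
    (hT : 0 < T) : ∃ C : ℝ, ∀ (M : Submodule ℝ X) (u uh : ℝ → X) (δ : ℝ), 0 ≤ δ →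
      (∀ v ∈ M, c * ‖v‖ ^ 2 ≤ b v v + a v v) →
      ContinuousOn u (Icc 0 T) → ContinuousOn uh (Icc 0 T) →
      (∀ t ∈ Ioc 0 T, ∃ u', HasDerivWithinAt u u' (Icc 0 T) t ∧
        ∀ v ∈ M, b u' v + a (u t) v = 0) →
      (∀ t ∈ Ioc 0 T, ∃ u', HasDerivWithinAt uh u' (Icc 0 T) t ∧
        ∀ v ∈ M, b u' v + a (uh t) v = 0) →
      (∀ t ∈ Icc 0 T, uh t ∈ M) → (∀ v ∈ M, b (uh 0) v = b (u 0) v) →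
      (∀ t ∈ Icc 0 T, ∃ w ∈ M, ‖w - u t‖ ≤ δ) →
      (∀ s ∈ Icc 0 T, ∀ t ∈ Icc 0 T, ∃ w ∈ M, ‖w - (u t - u s)‖ ≤ δ * |t - s|) →
      ∀ t ∈ Ioc 0 T, b (uh t - u t) (uh t - u t) +
        ∫ s in (0 : ℝ)..t, a (uh s - u s) (uh s - u s) ≤ C * δ ^ 2 := by
  set A := ‖a‖ + ‖b‖ with hA
  refine ⟨2 * (Real.exp T * (‖b‖ + A ^ 2 / c * T)) + 2 * ‖b‖ + 2 * ‖a‖ * T, ?_⟩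
  intro M u uh δ hδ hcoer hu huh heq heqh hmem hinit happ happ'
  -- `R` is the orthogonal projection onto the closure of `M`, `D = R - id`, and `θ = uh - R u`.
  set N := M.topologicalClosure with hN
  have hNmem : ∀ {p : X → Prop}, IsClosed {v | p v} → (∀ v ∈ M, p v) → ∀ v ∈ N, p v :=
    fun hp h v hv => closure_minimal (s := (M : Set X)) h hp hv
  have : CompleteSpace N := M.isClosed_topologicalClosure.completeSpace_coe
  set R := N.starProjection with hR
  obtain ⟨D, hDapp⟩ : ∃ D : X →L[ℝ] X, ∀ x, D x = R x - x :=
    ⟨R - ContinuousLinearMap.id ℝ X, fun x => rfl⟩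
  have hDle : ∀ {x w : X}, w ∈ M → ‖D x‖ ≤ ‖w - x‖ := fun {x w} hw => by
    rw [hDapp]
    exact norm_starProjection_sub_le N (M.le_topologicalClosure hw)
  have hη : ∀ t ∈ Icc 0 T, ‖D (u t)‖ ≤ δ := fun t ht => by
    obtain ⟨w, hw, hle⟩ := happ t ht
    exact (hDle hw).trans hle
  have hcoerN : ∀ v ∈ N, c * ‖v‖ ^ 2 ≤ b v v + a v v :=
    hNmem (isClosed_le (by fun_prop) (by fun_prop)) hcoer
  have hinitN : ∀ v ∈ N, b (uh 0) v = b (u 0) v :=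
    hNmem (isClosed_eq (by fun_prop) (by fun_prop)) hinit
  obtain ⟨θ, hθdef⟩ : ∃ θ : ℝ → X, θ = fun t => uh t - R (u t) := ⟨_, rfl⟩
  have hθ : ContinuousOn θ (Icc 0 T) := by
    rw [hθdef]
    exact huh.sub (R.continuous.comp_continuousOn hu)
  have hsplit : ∀ t, uh t - u t = θ t + D (u t) := fun t => by
    rw [hDapp, hθdef]
    exact (sub_add_sub_cancel _ _ _).symm
  have hθN : ∀ t ∈ Icc 0 T, θ t ∈ N := fun t ht => by
    rw [hθdef]
    exact N.sub_mem (M.le_topologicalClosure (hmem t ht)) (N.starProjection_apply_mem _)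
  have h0mem : (0 : ℝ) ∈ Icc 0 T := ⟨le_rfl, hT.le⟩
  -- The initial value `uh 0` is the `b`-orthogonal projection of `u 0`.
  have hE0 : b (θ 0) (θ 0) ≤ ‖b‖ * δ ^ 2 := by
    have h1 : b (θ 0 + D (u 0)) (θ 0) = 0 := by
      rw [← hsplit, map_sub, _root_.sub_apply, hinitN _ (hθN 0 h0mem), sub_self]
    have h2 := hb (θ 0 + D (u 0))
    have h3 := bilin_self_le b (hη 0 h0mem)
    have h4 := hbs (θ 0) (D (u 0))
    simp only [map_add, _root_.add_apply] at h1 h2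
    linarith
  have hK : ∀ t ∈ Ioo 0 T, ∃ θ', HasDerivAt θ θ' t ∧
      2 * b θ' (θ t) ≤ -a (θ t) (θ t) + b (θ t) (θ t) + A ^ 2 / c * δ ^ 2 := by
    intro t ht
    have htc : t ∈ Icc 0 T := ⟨ht.1.le, ht.2.le⟩
    obtain ⟨u', hu', he⟩ := heq t ⟨ht.1, ht.2.le⟩
    obtain ⟨uh', huh', heh⟩ := heqh t ⟨ht.1, ht.2.le⟩
    have hnhds := Icc_mem_nhds ht.1 ht.2
    -- the derivative of `R u - u` is a limit of difference quotients, to which `happ'` applies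
    have hη' : ‖D u'‖ ≤ δ := by
      have h1 : HasDerivWithinAt (fun t => D (u t)) (D u') (Icc 0 T) t :=
        D.hasFDerivAt.comp_hasDerivWithinAt t hu'
      have h2 := hasDerivWithinAt_iff_tendsto_slope.1 h1
      have hne : (𝓝[Icc 0 T \ {t}] t).NeBot :=
        accPt_principal_iff_nhdsWithin.1
          (uniqueDiffWithinAt_iff_accPt.1 (uniqueDiffOn_Icc hT t htc))
      refine le_of_tendsto h2.norm (eventually_nhdsWithin_of_forall fun s hs => ?_)
      obtain ⟨w, hw, hle⟩ := happ' t htc s hs.1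
      have hst : 0 < |s - t| := abs_pos.2 (sub_ne_zero.2 hs.2)
      rw [slope_def_module, norm_smul, norm_inv, Real.norm_eq_abs, ← map_sub,
        inv_mul_le_iff₀ hst, mul_comm]
      exact (hDle hw).trans hle
    have hθ' : HasDerivAt θ (uh' - R u') t := by
      rw [hθdef]
      exact (huh'.hasDerivAt hnhds).sub
        (R.hasFDerivAt.comp_hasDerivAt t (hu'.hasDerivAt hnhds))
    refine ⟨uh' - R u', hθ', ?_⟩
    have hv := hθN t htc
    have e1 := hNmem (p := fun v => b u' v + a (u t) v = 0)
      (isClosed_eq (by fun_prop) (by fun_prop)) he _ hv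
    have e2 := hNmem (p := fun v => b uh' v + a (uh t) v = 0)
      (isClosed_eq (by fun_prop) (by fun_prop)) heh _ hv
    -- The error equation, tested with `θ t`.
    have e3 : b (uh' - R u') (θ t) = -a (θ t) (θ t) - a (D (u t)) (θ t) - b (D u') (θ t) := by
      have h1 : uh' - R u' = uh' - u' - D u' := by
        rw [hDapp]
        abel
      have h2 : a (θ t) (θ t) = a (uh t) (θ t) - a (u t) (θ t) - a (D (u t)) (θ t) := by
        have h3 : θ t = uh t - u t - D (u t) := by
          rw [hsplit, add_sub_cancel_right]
        have h4 := congrArg (fun x => a x (θ t)) h3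
        simpa only [map_sub, _root_.sub_apply] using h4
      rw [h1, h2, map_sub, map_sub, _root_.sub_apply, _root_.sub_apply]
      linarith
    have h3 : |a (D (u t)) (θ t)| ≤ ‖a‖ * δ * ‖θ t‖ :=
      (a.le_opNorm₂ _ _).trans (by gcongr; exact hη t htc)
    have h4 : |b (D u') (θ t)| ≤ ‖b‖ * δ * ‖θ t‖ := (b.le_opNorm₂ _ _).trans (by gcongr)
    have h5 : 2 * (A * δ * ‖θ t‖) ≤ A ^ 2 / c * δ ^ 2 + c * ‖θ t‖ ^ 2 := by
      have h6 : A ^ 2 / c * δ ^ 2 + c * ‖θ t‖ ^ 2 - 2 * (A * δ * ‖θ t‖) =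
          (A * δ - c * ‖θ t‖) ^ 2 / c := by
        field_simp
        ring
      have h7 : 0 ≤ (A * δ - c * ‖θ t‖) ^ 2 / c := by positivity
      linarith
    have h6 := hcoerN _ hv
    have h7 : A * δ * ‖θ t‖ = ‖a‖ * δ * ‖θ t‖ + ‖b‖ * δ * ‖θ t‖ := by
      rw [hA]
      ring
    rw [e3]
    linarith [neg_abs_le (a (D (u t)) (θ t)), neg_abs_le (b (D u') (θ t))]
  intro t ht
  have htc : t ∈ Icc 0 T := ⟨ht.1.le, ht.2⟩
  have hmain := energy_le hbs hb ha hθ (K := A ^ 2 / c * δ ^ 2) (by positivity) hK htc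
  have hi : ∀ {f : ℝ → ℝ}, ContinuousOn f (Icc 0 T) → IntervalIntegrable f volume 0 t := fun hf =>
    (hf.mono (by rw [uIcc_of_le ht.1.le]; exact Icc_subset_Icc_right ht.2)).intervalIntegrable
  have hiθ := hi (continuousOn_bilin a hθ)
  have hint : ∫ s in (0 : ℝ)..t, a (uh s - u s) (uh s - u s) ≤
      2 * (∫ s in (0 : ℝ)..t, a (θ s) (θ s)) + t * (2 * (‖a‖ * δ ^ 2)) := by
    have h1 : ∫ s in (0 : ℝ)..t, (2 * a (θ s) (θ s) + 2 * (‖a‖ * δ ^ 2)) =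
        2 * (∫ s in (0 : ℝ)..t, a (θ s) (θ s)) + t * (2 * (‖a‖ * δ ^ 2)) := by
      rw [intervalIntegral.integral_add (hiθ.const_mul 2) intervalIntegrable_const,
        intervalIntegral.integral_const_mul, intervalIntegral.integral_const, sub_zero,
        smul_eq_mul]
    rw [← h1]
    refine intervalIntegral.integral_mono_on ht.1.le (hi (continuousOn_bilin a (huh.sub hu)))
      ((hiθ.const_mul 2).add intervalIntegrable_const) fun s hs => ?_
    rw [hsplit]
    have h2 := bilin_self_le a (hη s ⟨hs.1, hs.2.trans ht.2⟩)
    linarith [bilin_add_self_le ha (θ s) (D (u s))]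
  have hbt : b (uh t - u t) (uh t - u t) ≤ 2 * b (θ t) (θ t) + 2 * (‖b‖ * δ ^ 2) := by
    rw [hsplit]
    linarith [bilin_add_self_le hb (θ t) (D (u t)), bilin_self_le b (hη t htc)]
  have h1 : Real.exp T * (b (θ 0) (θ 0) + A ^ 2 / c * δ ^ 2 * T) ≤
      Real.exp T * (‖b‖ * δ ^ 2 + A ^ 2 / c * δ ^ 2 * T) := by gcongr
  have h2 : t * (2 * (‖a‖ * δ ^ 2)) ≤ T * (2 * (‖a‖ * δ ^ 2)) :=
    mul_le_mul_of_nonneg_right ht.2 (by positivity)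
  calc _ ≤ 2 * (Real.exp T * (‖b‖ * δ ^ 2 + A ^ 2 / c * δ ^ 2 * T)) + 2 * (‖b‖ * δ ^ 2) +
        T * (2 * (‖a‖ * δ ^ 2)) := by linarith
    _ = _ := by ring

end Energy

end

section

/-! ### The Hilbert space of the problem -/

/-- The space of quadruples `(v, ∇v, γv, ∇_Γ γv)` with its Hilbert space norm. -/
def HilbertSurface (Ω : Set (Pt d)) :=
  WithLp 2 (Lp ℝ 2 (bulkMeasure Ω) × WithLp 2 (Lp (Pt d) 2 (bulkMeasure Ω) ×
    WithLp 2 (Lp ℝ 2 (surfaceMeasure Ω) × Lp (Pt d) 2 (surfaceMeasure Ω))))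

instance : NormedAddCommGroup (HilbertSurface Ω) :=
  inferInstanceAs (NormedAddCommGroup (WithLp 2 (Lp ℝ 2 (bulkMeasure Ω) × WithLp 2
    (Lp (Pt d) 2 (bulkMeasure Ω) × WithLp 2 (Lp ℝ 2 (surfaceMeasure Ω) ×
      Lp (Pt d) 2 (surfaceMeasure Ω))))))

instance : InnerProductSpace ℝ (HilbertSurface Ω) :=
  inferInstanceAs (InnerProductSpace ℝ (WithLp 2 (Lp ℝ 2 (bulkMeasure Ω) × WithLp 2
    (Lp (Pt d) 2 (bulkMeasure Ω) × WithLp 2 (Lp ℝ 2 (surfaceMeasure Ω) ×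
      Lp (Pt d) 2 (surfaceMeasure Ω))))))

instance : CompleteSpace (HilbertSurface Ω) :=
  inferInstanceAs (CompleteSpace (WithLp 2 (Lp ℝ 2 (bulkMeasure Ω) × WithLp 2
    (Lp (Pt d) 2 (bulkMeasure Ω) × WithLp 2 (Lp ℝ 2 (surfaceMeasure Ω) ×
      Lp (Pt d) 2 (surfaceMeasure Ω))))))

/-- The identification of the quadruples with the Hilbert space; the sup norm on the product is
replaced by an equivalent one. -/
def toHilbert (Ω : Set (Pt d)) : BulkSurface Ω ≃L[ℝ] HilbertSurface Ω :=
  ((ContinuousLinearEquiv.refl ℝ _).prodCongr (((ContinuousLinearEquiv.refl ℝ _).prodCongr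
    (WithLp.prodContinuousLinearEquiv 2 ℝ _ _).symm).trans
      (WithLp.prodContinuousLinearEquiv 2 ℝ _ _).symm)).trans
        (WithLp.prodContinuousLinearEquiv 2 ℝ _ _).symm

theorem norm_toHilbert_sq (v : BulkSurface Ω) :
    ‖toHilbert Ω v‖ ^ 2 = ‖val v‖ ^ 2 + ‖grad v‖ ^ 2 + ‖tr v‖ ^ 2 + ‖surfGrad v‖ ^ 2 := by
  refine (WithLp.prod_norm_sq_eq_of_L2 _).trans ?_
  rw [WithLp.prod_norm_sq_eq_of_L2, WithLp.prod_norm_sq_eq_of_L2]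
  simp only [← add_assoc]
  rfl

theorem norm_toHilbert_le (v : BulkSurface Ω) : ‖toHilbert Ω v‖ ≤ 2 * ‖v‖ := by
  have h1 : ‖val v‖ ≤ ‖v‖ := norm_fst_le v
  have h2 : ‖grad v‖ ≤ ‖v‖ := (norm_fst_le _).trans (norm_snd_le v)
  have h3 : ‖tr v‖ ≤ ‖v‖ := (norm_fst_le _).trans ((norm_snd_le _).trans (norm_snd_le v))
  have h4 : ‖surfGrad v‖ ≤ ‖v‖ := (norm_snd_le _).trans ((norm_snd_le _).trans (norm_snd_le v))
  refine le_of_sq_le_sq ?_ (by positivity)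
  rw [norm_toHilbert_sq]
  have h5 : ‖val v‖ ^ 2 ≤ ‖v‖ ^ 2 := by gcongr
  have h6 : ‖grad v‖ ^ 2 ≤ ‖v‖ ^ 2 := by gcongr
  have h7 : ‖tr v‖ ^ 2 ≤ ‖v‖ ^ 2 := by gcongr
  have h8 : ‖surfGrad v‖ ^ 2 ≤ ‖v‖ ^ 2 := by gcongr
  linarith

/-- The product `(v, w)`, weighted by `μ` on the boundary, as a bounded bilinear form. -/
def innerForm (Ω : Set (Pt d)) (μ : ℝ) : HilbertSurface Ω →L[ℝ] HilbertSurface Ω →L[ℝ] ℝ :=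
  let P := (toHilbert Ω).symm.toContinuousLinearMap
  let p := (ContinuousLinearMap.fst ℝ _ _).comp P
  let q := ((ContinuousLinearMap.fst ℝ _ _).comp ((ContinuousLinearMap.snd ℝ _ _).comp
    (ContinuousLinearMap.snd ℝ _ _))).comp P
  (innerSL ℝ).bilinearComp p p + μ • (innerSL ℝ).bilinearComp q q

/-- The form `a` as a bounded bilinear form. -/
def energyForm (Ω : Set (Pt d)) (κ β : ℝ) : HilbertSurface Ω →L[ℝ] HilbertSurface Ω →L[ℝ] ℝ :=
  let P := (toHilbert Ω).symm.toContinuousLinearMap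
  let p := ((ContinuousLinearMap.fst ℝ _ _).comp (ContinuousLinearMap.snd ℝ _ _)).comp P
  let q := ((ContinuousLinearMap.fst ℝ _ _).comp ((ContinuousLinearMap.snd ℝ _ _).comp
    (ContinuousLinearMap.snd ℝ _ _))).comp P
  let r := ((ContinuousLinearMap.snd ℝ _ _).comp ((ContinuousLinearMap.snd ℝ _ _).comp
    (ContinuousLinearMap.snd ℝ _ _))).comp P
  (innerSL ℝ).bilinearComp p p + κ • (innerSL ℝ).bilinearComp q q +
    β • (innerSL ℝ).bilinearComp r r

theorem innerForm_apply (μ : ℝ) (u v : BulkSurface Ω) :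
    innerForm Ω μ (toHilbert Ω u) (toHilbert Ω v) =
      inner ℝ (val u) (val v) + μ * inner ℝ (tr u) (tr v) := rfl

theorem energyForm_apply (κ β : ℝ) (u v : BulkSurface Ω) :
    energyForm Ω κ β (toHilbert Ω u) (toHilbert Ω v) =
      inner ℝ (grad u) (grad v) + κ * inner ℝ (tr u) (tr v) +
        β * inner ℝ (surfGrad u) (surfGrad v) := rfl

theorem inner_Lp_real {α : Type*} [MeasurableSpace α] {μ : Measure α} (f g : Lp ℝ 2 μ) :
    inner ℝ f g = ∫ x, f x * g x ∂μ := by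
  rw [L2.inner_def]
  exact integral_congr_ae (Eventually.of_forall fun x => mul_comm _ _)

theorem innerForm_eq (μ : ℝ) (u v : BulkSurface Ω) :
    innerForm Ω μ (toHilbert Ω u) (toHilbert Ω v) = innerH μ u v := by
  rw [innerForm_apply, innerH, inner_Lp_real, inner_Lp_real]

theorem energyForm_eq (κ β : ℝ) (u v : BulkSurface Ω) :
    energyForm Ω κ β (toHilbert Ω u) (toHilbert Ω v) = formA κ β u v := by
  rw [energyForm_apply, formA, inner_Lp_real, L2.inner_def, L2.inner_def]

theorem innerForm_self (μ : ℝ) (v : BulkSurface Ω) :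
    innerForm Ω μ (toHilbert Ω v) (toHilbert Ω v) = ‖val v‖ ^ 2 + μ * ‖tr v‖ ^ 2 := by
  rw [innerForm_apply, real_inner_self_eq_norm_sq, real_inner_self_eq_norm_sq]

theorem energyForm_self (κ β : ℝ) (v : BulkSurface Ω) :
    energyForm Ω κ β (toHilbert Ω v) (toHilbert Ω v) =
      ‖grad v‖ ^ 2 + β * ‖surfGrad v‖ ^ 2 + κ * ‖tr v‖ ^ 2 := by
  rw [energyForm_apply, real_inner_self_eq_norm_sq, real_inner_self_eq_norm_sq,
    real_inner_self_eq_norm_sq]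
  ring

attribute [irreducible] toHilbert innerForm energyForm

/-- The two forms together control the norm of `V`. -/
theorem exists_coercive (Ω : Set (Pt d)) {μ κ β : ℝ} (hμ : 0 < μ) (hκ : 0 < κ) (hβ : 0 ≤ β) :
    ∃ c > 0, ∀ v ∈ energySpace Ω β, c * ‖toHilbert Ω v‖ ^ 2 ≤
      innerForm Ω μ (toHilbert Ω v) (toHilbert Ω v) +
        energyForm Ω κ β (toHilbert Ω v) (toHilbert Ω v) := by
  have key : ∀ c : ℝ, c ≤ 1 → c ≤ μ → ∀ v : BulkSurface Ω,
      c * ‖surfGrad v‖ ^ 2 ≤ β * ‖surfGrad v‖ ^ 2 → c * ‖toHilbert Ω v‖ ^ 2 ≤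
      innerForm Ω μ (toHilbert Ω v) (toHilbert Ω v) +
        energyForm Ω κ β (toHilbert Ω v) (toHilbert Ω v) := by
    intro c h1 h2 v h3
    rw [norm_toHilbert_sq, innerForm_self, energyForm_self]
    have h4 : c * ‖val v‖ ^ 2 ≤ 1 * ‖val v‖ ^ 2 := by gcongr
    have h5 : c * ‖grad v‖ ^ 2 ≤ 1 * ‖grad v‖ ^ 2 := by gcongr
    have h6 : c * ‖tr v‖ ^ 2 ≤ μ * ‖tr v‖ ^ 2 := by gcongr
    have h7 : 0 ≤ κ * ‖tr v‖ ^ 2 := by positivity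
    linarith
  rcases hβ.eq_or_lt with h0 | h0
  · refine ⟨min 1 μ, lt_min one_pos hμ, fun v hv => key _ (min_le_left _ _) (min_le_right _ _) v ?_⟩
    rw [hv.2.2.2 h0.symm, norm_zero]
    simp
  · refine ⟨min (min 1 μ) β, lt_min (lt_min one_pos hμ) h0, fun v hv => key _
      ((min_le_left _ _).trans (min_le_left _ _)) ((min_le_left _ _).trans (min_le_right _ _)) v ?_⟩
    exact mul_le_mul_of_nonneg_right (min_le_right _ _) (by positivity)

/-- The finite element space as a subspace of the Hilbert space. -/
def feSubmodule {n : ℕ} {Ω : Set (Pt (n + 1))} {S : Finset (Set (Pt (n + 1)))}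
    (hΩ : IsPolyhedralOpen Ω S) (β : ℝ) (K : Geometry.SimplicialComplex ℝ (Pt (n + 1))) :
    Submodule ℝ (HilbertSurface Ω) where
  carrier := {x | (toHilbert Ω).symm x ∈ feSpace Ω β K}
  add_mem' {x y} hx hy := by
    have := smul_add_mem_feSpace hΩ hx hy 1
    rwa [one_smul, ← map_add] at this
  zero_mem' := by
    rw [mem_ofPred_eq, map_zero]
    exact zero_mem_feSpace β K
  smul_mem' c x hx := by
    have := smul_add_mem_feSpace hΩ hx (zero_mem_feSpace β K) c
    rwa [add_zero, ← map_smul] at this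

theorem toHilbert_mem_feSubmodule {n : ℕ} {Ω : Set (Pt (n + 1))} {S : Finset (Set (Pt (n + 1)))}
    (hΩ : IsPolyhedralOpen Ω S) {β : ℝ} {K : Geometry.SimplicialComplex ℝ (Pt (n + 1))}
    {v : BulkSurface Ω} (hv : v ∈ feSpace Ω β K) : toHilbert Ω v ∈ feSubmodule hΩ β K := by
  change (toHilbert Ω).symm (toHilbert Ω v) ∈ feSpace Ω β K
  rwa [ContinuousLinearEquiv.symm_apply_apply]

theorem exists_eq_toHilbert {n : ℕ} {Ω : Set (Pt (n + 1))} {S : Finset (Set (Pt (n + 1)))}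
    (hΩ : IsPolyhedralOpen Ω S) {β : ℝ} {K : Geometry.SimplicialComplex ℝ (Pt (n + 1))}
    {x : HilbertSurface Ω} (hx : x ∈ feSubmodule hΩ β K) :
    ∃ v ∈ feSpace Ω β K, toHilbert Ω v = x :=
  ⟨_, hx, ContinuousLinearEquiv.apply_symm_apply _ _⟩

theorem toHilbert_equation {n : ℕ} {Ω : Set (Pt (n + 1))} {S : Finset (Set (Pt (n + 1)))}
    (hΩ : IsPolyhedralOpen Ω S) {μ κ β : ℝ} {K : Geometry.SimplicialComplex ℝ (Pt (n + 1))}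
    {w w' : BulkSurface Ω} (h : ∀ v ∈ feSpace Ω β K, innerH μ w' v + formA κ β w v = 0)
    {x : HilbertSurface Ω} (hx : x ∈ feSubmodule hΩ β K) :
    innerForm Ω μ (toHilbert Ω w') x + energyForm Ω κ β (toHilbert Ω w) x = 0 := by
  obtain ⟨v, hv, rfl⟩ := exists_eq_toHilbert hΩ hx
  exact (congrArg₂ (· + ·) (innerForm_eq μ w' v) (energyForm_eq κ β w v)).trans (h v hv)

/-- The error estimate in dimension `n + 1`. -/
theorem exists_semidiscrete_error_le {n : ℕ} {Ω : Set (Pt (n + 1))} (hΩ : IsPolygonalDomain Ω)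
    {μ κ β T : ℝ} (hμ : 0 < μ) (hκ : 0 < κ) (hβ : 0 ≤ β) (hT : 0 < T) {p : ℝ≥0∞} [Fact (1 ≤ p)]
    (hp : 2 ≤ p) (hpd : ((n + 1 : ℕ) : ℝ≥0∞) < 2 * p) {u : ℝ → BulkSurface Ω}
    (hu : IsWeakSolution μ κ β T u) (hreg : IsRegular β p T u) {ρ : ℝ} (hρ : 0 < ρ) :
    ∃ C : ℝ, ∀ K : Geometry.SimplicialComplex ℝ (Pt (n + 1)),
      IsTriangulation Ω K → IsQuasiUniform ρ K →
      ∀ uh : ℝ → BulkSurface Ω, IsSemidiscreteSolution μ κ β T K (u 0) uh → ∀ t ∈ Ioc 0 T,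
        ‖val (uh t - u t)‖ ^ 2 + μ * ‖tr (uh t - u t)‖ ^ 2 +
          (∫ s in (0 : ℝ)..t, (‖grad (uh s - u s)‖ ^ 2 +
            β * ‖surfGrad (uh s - u s)‖ ^ 2 + κ * ‖tr (uh s - u s)‖ ^ 2))
        ≤ C * meshwidth K ^ 2 := by
  obtain ⟨S, hS⟩ := hΩ.exists_isPolyhedralOpen
  obtain ⟨c, hc, hcoer⟩ := exists_coercive Ω hμ hκ hβ
  have hsurj : ∀ {q : HilbertSurface Ω → Prop}, (∀ v, q (toHilbert Ω v)) → ∀ x, q x := fun h x => by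
    have := h ((toHilbert Ω).symm x)
    rwa [ContinuousLinearEquiv.apply_symm_apply] at this
  have hbs : ∀ v w, innerForm Ω μ v w = innerForm Ω μ w v :=
    hsurj fun v => hsurj fun w => by
      rw [innerForm_apply, innerForm_apply, real_inner_comm, real_inner_comm (tr v)]
  have hb : ∀ v, 0 ≤ innerForm Ω μ v v := hsurj fun v => by
    rw [innerForm_self]
    positivity
  have ha : ∀ v, 0 ≤ energyForm Ω κ β v v := hsurj fun v => by
    rw [energyForm_self]
    positivity
  obtain ⟨C₁, hC₁⟩ := exists_error_le hbs hb ha hc hT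
  obtain ⟨C₂, hC₂0, hC₂⟩ := exists_feSpace_approximation hΩ β hp hpd hρ
  obtain ⟨U, hU, hUmem⟩ := hreg
  -- `B` bounds `u` in `X_p`, and `Λ` bounds the difference quotients of `u`.
  obtain ⟨B, hB⟩ := isCompact_Icc.exists_bound_of_continuousOn hU.continuousOn
  obtain ⟨Λ, hΛ⟩ := hU.exists_lipschitzOnWith one_ne_zero (convex_Icc 0 T) isCompact_Icc
  have h0mem : (0 : ℝ) ∈ Icc 0 T := ⟨le_rfl, hT.le⟩
  have hB0 : 0 ≤ B := (norm_nonneg _).trans (hB 0 h0mem)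
  refine ⟨C₁ * (2 * (C₂ * (B + Λ))) ^ 2, fun K hK hKq uh huh t ht => ?_⟩
  have hh := meshwidth_nonneg K
  have happ : ∀ V ∈ regularSpace Ω β p, ∀ r, ‖V‖ ≤ r → ∃ w ∈ feSubmodule hS β K,
      ‖w - toHilbert Ω V.1‖ ≤ 2 * (C₂ * meshwidth K * r) := by
    intro V hV r hr
    obtain ⟨W, hW, hle⟩ := hC₂ K hK hKq V hV
    refine ⟨toHilbert Ω W, toHilbert_mem_feSubmodule hS hW, ?_⟩
    rw [← map_sub]
    refine (norm_toHilbert_le _).trans (mul_le_mul_of_nonneg_left (hle.trans ?_) zero_le_two)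
    gcongr
  have heq : ∀ w : ℝ → BulkSurface Ω, (∀ t ∈ Ioc 0 T, ∃ w' : BulkSurface Ω,
      HasDerivWithinAt w w' (Icc 0 T) t ∧
        ∀ v ∈ feSpace Ω β K, innerH μ w' v + formA κ β (w t) v = 0) →
      ∀ t ∈ Ioc 0 T, ∃ w', HasDerivWithinAt (fun t => toHilbert Ω (w t)) w' (Icc 0 T) t ∧
        ∀ v ∈ feSubmodule hS β K,
          innerForm Ω μ w' v + energyForm Ω κ β (toHilbert Ω (w t)) v = 0 := by
    intro w hw t ht
    obtain ⟨w', hw', he⟩ := hw t ht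
    exact ⟨toHilbert Ω w', (toHilbert Ω).toContinuousLinearMap.hasFDerivAt.comp_hasDerivWithinAt t
      hw', fun x hx => toHilbert_equation hS he hx⟩
  have key := hC₁ (feSubmodule hS β K) (fun t => toHilbert Ω (u t)) (fun t => toHilbert Ω (uh t))
    (2 * (C₂ * meshwidth K * (B + Λ))) (by positivity)
    (fun x hx => by
      obtain ⟨v, hv, rfl⟩ := exists_eq_toHilbert hS hx
      exact hcoer v hv.1)
    ((toHilbert Ω).continuous.comp_continuousOn hu.continuousOn)
    ((toHilbert Ω).continuous.comp_continuousOn huh.continuousOn)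
    (heq u fun t ht => by
      obtain ⟨u', hu', he⟩ := hu.equation t ht
      exact ⟨u', hu', fun v hv => he v hv.1⟩)
    (heq uh huh.equation)
    (fun t ht => toHilbert_mem_feSubmodule hS (huh.mem t ht))
    (fun x hx => by
      obtain ⟨v, hv, rfl⟩ := exists_eq_toHilbert hS hx
      exact (innerForm_eq μ (uh 0) v).trans
        ((huh.initial v hv).trans (innerForm_eq μ (u 0) v).symm))
    (fun t ht => by
      obtain ⟨w, hw, hle⟩ := happ _ (hUmem t ht).1 (B + Λ)
        ((hB t ht).trans (le_add_of_nonneg_right Λ.2))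
      rw [(hUmem t ht).2] at hle
      exact ⟨w, hw, hle⟩)
    (fun s hs t ht => by
      have h1 := smul_add_mem_regularSpace hS (hUmem s hs).1 (hUmem t ht).1 (-1)
      rw [neg_one_smul, neg_add_eq_sub] at h1
      obtain ⟨w, hw, hle⟩ := happ _ h1 ((B + Λ) * |t - s|) (by
        refine (hΛ.norm_sub_le ht hs).trans ?_
        rw [Real.norm_eq_abs]
        gcongr
        exact le_add_of_nonneg_left hB0)
      refine ⟨w, hw, ?_⟩
      have e : toHilbert Ω (U t - U s).1 = toHilbert Ω (u t) - toHilbert Ω (u s) := by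
        rw [Prod.fst_sub, (hUmem t ht).2, (hUmem s hs).2, map_sub]
      rw [e] at hle
      exact hle.trans (le_of_eq (by ring)))
    t ht
  simp only [← map_sub, innerForm_self, energyForm_self] at key
  refine key.trans (le_of_eq ?_)
  ring

end

end DynBC

end

theorem mainTheorem1 (d : ℕ) (hd : 2 ≤ d) (Ω : Set (DynBC.Pt d))
    (hΩ : DynBC.IsPolygonalDomain Ω)
    (μ κ β T : ℝ) (hμ : 0 < μ) (hκ : 0 < κ) (hβ : 0 ≤ β) (hT : 0 < T)
    (p : ℝ≥0∞) [Fact (1 ≤ p)] (hp : 2 ≤ p) (hpd : (d : ℝ≥0∞) < 2 * p)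
    (u : ℝ → DynBC.BulkSurface Ω) (hu : DynBC.IsWeakSolution μ κ β T u)
    (hreg : DynBC.IsRegular β p T u)
    (ρ : ℝ) (hρ : 0 < ρ) :
    ∃ C : ℝ, ∀ K : Geometry.SimplicialComplex ℝ (DynBC.Pt d),
      DynBC.IsTriangulation Ω K → DynBC.IsQuasiUniform ρ K →
      ∀ uh : ℝ → DynBC.BulkSurface Ω, DynBC.IsSemidiscreteSolution μ κ β T K (u 0) uh →
      ∀ t ∈ Ioc 0 T,
        ‖DynBC.val (uh t - u t)‖ ^ 2 + μ * ‖DynBC.tr (uh t - u t)‖ ^ 2 +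
          (∫ s in (0 : ℝ)..t, (‖DynBC.grad (uh s - u s)‖ ^ 2 +
            β * ‖DynBC.surfGrad (uh s - u s)‖ ^ 2 + κ * ‖DynBC.tr (uh s - u s)‖ ^ 2))
        ≤ C * DynBC.meshwidth K ^ 2 := by
  obtain ⟨n, rfl⟩ : ∃ n, d = n + 1 := ⟨d - 1, by omega⟩
  exact DynBC.exists_semidiscrete_error_le hΩ hμ hκ hβ hT hp hpd hu hreg hρ
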